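/- Let $r,n\ge 1$, let $\zeta=e^{2\pi i/r}$, and let $W=G(r,1,n)$ be the group of $n\times n$ monomial matrices whose non-zero entries are $r$-th roots of unity; let $\zeta_i\in W$ be the diagonal matrix with $\zeta$ in position $i$ and $1$ elsewhere on the diagonal, and let $s_{ij}$, $s_i=s_{i,i+1}$ be transpositions. Fix $c_0\in\mathbb{C}$ with $c_0\neq 0$ and complex numbers $d_j$ ($j\in\mathbb{Z}/r$) with $\sum_j d_j=0$. Let $\mathbb{H}$ be the rational Cherednik algebra of $W$ (with $\kappa=1$): the $\mathbb{C}$-algebra generated by $\mathbb{C}[x_1,\dots,x_n]$, $\mathbb{C}[y_1,\dots,y_n]$ and $\mathbb{C}W=\mathrm{span}\{t_w\}$, where $y_1,\dots,y_n$ is the standard basis of $\mathbb{C}^n$ and $x_1,\dots,x_n$ the dual basis, with relations $t_wx=(wx)t_w$, $t_wy=(wy)t_w$, $$y_ix_j=x_jy_i+c_0\sum_{l=0}^{r-1}\zeta^{-l}t_{\zeta_i^ls_{ij}\zeta_i^{-l}}\quad(i\ne j),$$ $$y_ix_i=x_iy_i+1-\sum_{j=0}^{r-1}(d_j-d_{j-1})e_{ij}-c_0\sum_{j\ne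 i}\sum_{l=0}^{r-1}t_{\zeta_i^ls_{ij}\zeta_i^{-l}},\qquad e_{ij}=\frac1r\sum_{l=0}^{r-1}\zeta^{-lj}t_{\zeta_i^l}.$$ Let $\mathfrak{t}\subseteq\mathbb{H}$ be the commutative subalgebra generated by $t_{\zeta_1},\dots,t_{\zeta_n}$ and $z_i=y_ix_i+c_0\sum_{j<i}\sum_{l=0}^{r-1}t_{\zeta_i^ls_{ij}\zeta_i^{-l}}$, $1\le i\le n$. Let $\lambda=(\lambda^0,\dots,\lambda^{r-1})$ be an $r$-partition of $n$ and $\mathrm{SYT}(\lambda)$ the set of standard tableaux $T$ on $\lambda$, where $T(i)$ is the box containing $i$. For a box $b$ in row $i$ and column $j$ of $\lambda^l$ put $\beta(b)=l$ and $\mathrm{ct}(b)=j-i$. Let $s_i.T$ be $T$ with the entries $i,i+1$ exchanged. Let $S^\lambda$ be the irreducible $\mathbb{C}W$-module with basis $v_T$, $T\in\mathrm{SYT}(\lambda)$, in Young's orthonormal form: $t_{\zeta_i}v_T=\zeta^{\beta(T(i))}v_T$; $t_{s_i}v_T=v_{s_i.T}$ if $\beta(T(i))\ne\beta(T(i+1))$;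 and $t_{s_i}v_T=\frac1k v_T+\sqrt{1-\frac1{k^2}}\,v_{s_i.T}$ with $k=\mathrm{ct}(T(i+1))-\mathrm{ct}(T(i))$ if $\beta(T(i))=\beta(T(i+1))$ (where $v_{s_i.T}=0$ if $s_i.T$ is not standard). Let $M(\lambda)$ be the $\mathbb{H}$-module induced from $S^\lambda$, on which each $y_i$ acts by $0$. Suppose that the $\mathfrak{t}$-spectrum of $M(\lambda)$ is simple, i.e. that every non-zero weight space (generalized simultaneous eigenspace) $M(\lambda)_\alpha$, $\alpha:\mathfrak{t}\to\mathbb{C}$, is one-dimensional. For $\mu\in\mathbb{Z}_{\ge0}^n$ and $w\in S_n$ put $(w.\mu)_i=\mu_{w^{-1}(i)}$, let $w_\mu$ be the longest element of $S_n$ such that $w_\mu.\mu$ is non-decreasing, and let $\mu^+$ be the non-increasing rearrangement of $\mu$. Write $\nu<\mu$ if $\nu^+$ is strictly below $\mu^+$ in dominance order, or $\nu^+=\mu^+$ and $w_\nu<w_\mu$ in Bruhat order. Then for every $\mu\in\mathbb{Z}_{\ge0}^n$ and $T\in\mathrm{SYT}(\lambda)$ there is exactly one $\mathfrak{t}$-eigenvector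 $f_{\mu,T}\in M(\lambda)$ such that $f_{\mu,T}-x^\mu\, t_{w_\mu}^{-1}v_T$ is a linear combination of elements $x^\nu\, t_{w_\nu}^{-1}v_S$ with $\nu<\mu$ and $S\in\mathrm{SYT}(\lambda)$. The calibration graph is the directed graph with vertex set $\Gamma=\mathbb{Z}_{\ge0}^n\times\mathrm{SYT}(\lambda)$ and the following edges, where $\sigma_i=t_{s_i}+\frac{c_0}{z_i-z_{i+1}}\sum_{l=0}^{r-1}(t_{\zeta_i\zeta_{i+1}^{-1}})^l$ and $\Psi=y_1t_{s_1\cdots s_{n-1}}$: * $(\mu,T)\to(s_i.\mu,T)$ if $1\le i\le n-1$, $\mu_i\ne\mu_{i+1}$ and $\sigma_i f_{\mu,T}\ne0$; * $(\mu,T)\to(\mu,s_{j-1}.T)$ if $1\le i\le n-1$, $\mu_i=\mu_{i+1}$, $j=w_\mu(i)$ and $s_{j-1}.T$ is standard; * $(\mu,T)\to((\mu_2,\dots,\mu_n,\mu_1+1),T)$ always; * $(\mu,T)\to((\mu_n-1,\mu_1,\dots,\mu_{n-1}),T)$ if $\mu_n>0$ and $\Psi f_{\mu,T}\ne0$. A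 subset $X\subseteq\Gamma$ is closed if $(\mu,T)\in X$ and $(\mu,T)\to(\nu,S)$ imply $(\nu,S)\in X$. Then the map $N\mapsto\{(\mu,T)\in\Gamma : f_{\mu,T}\in N\}$ is a bijection from the set of $\mathbb{H}$-submodules of $M(\lambda)$ onto the set of closed subsets of $\Gamma$. -/

import Mathlib

open scoped BigOperators TensorProduct

namespace RCA

open Equiv (Perm swap)

/-! ## The group `G(r,1,n)` -/

noncomputable section

/-- The left action of the symmetric group on `Gⁿ` by permuting coordinates:
`(w.a)_i = a_{w⁻¹(i)}`. -/
def permAct (n : ℕ) (G : Type) [Group G] : Perm (Fin n) →* MulAut (Fin n → G) where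
  toFun w := MulEquiv.arrowCongr w (MulEquiv.refl G)
  map_one' := rfl
  map_mul' _ _ := rfl

/-- The group `G(r,1,n)` of `n × n` monomial matrices whose non-zero entries are `r`-th roots of
unity, written as a wreath product: the pair `⟨a, w⟩` is the monomial matrix
`diag(a₁,…,aₙ) · P_w`, which sends the basis vector `e_j` of `ℂⁿ` to `a_{w(j)} e_{w(j)}`. -/
abbrev W (r n : ℕ) : Type :=
  (Fin n → rootsOfUnity r ℂ) ⋊[permAct n (rootsOfUnity r ℂ)] Perm (Fin n)

variable {r n : ℕ}

/-- `ζ = exp(2πi/r)`. -/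
def zeta (r : ℕ) : ℂ := Complex.exp (2 * Real.pi * Complex.I / r)

lemma zeta_pow (r : ℕ) [NeZero r] : zeta r ^ r = 1 :=
  (Complex.isPrimitiveRoot_exp r (NeZero.ne r)).pow_eq_one

/-- The diagonal matrix `ζ_i` with `ζ` in position `i` and `1` elsewhere on the diagonal. -/
def zetaAt [NeZero r] (i : Fin n) : W r n :=
  SemidirectProduct.inl (Pi.mulSingle i (rootsOfUnity.mkOfPowEq (zeta r) (zeta_pow r)))

/-- The permutation matrix of `w`. -/
def perm (w : Perm (Fin n)) : W r n := SemidirectProduct.inr w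

/-- The reflection `ζ_i^l s_{ij} ζ_i^{-l}`. -/
def reflect [NeZero r] (i j : Fin n) (l : ℕ) : W r n :=
  zetaAt i ^ l * perm (swap i j) * (zetaAt i ^ l)⁻¹

/-! ## The rational Cherednik algebra -/

/-- Generators of the rational Cherednik algebra: `x_i ∈ 𝔥*`, `y_i ∈ 𝔥` and `t_w` for
`w ∈ G(r,1,n)`. -/
inductive Gen (r n : ℕ) : Type
  | x (i : Fin n)
  | y (i : Fin n)
  | t (w : W r n)

/-- `x_i`, `y_i`, `t_w` and `e_{ij}` in the free algebra. -/
abbrev FX (i : Fin n) : FreeAlgebra ℂ (Gen r n) := FreeAlgebra.ι ℂ (Gen.x i)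
abbrev FY (i : Fin n) : FreeAlgebra ℂ (Gen r n) := FreeAlgebra.ι ℂ (Gen.y i)
abbrev FT (w : W r n) : FreeAlgebra ℂ (Gen r n) := FreeAlgebra.ι ℂ (Gen.t w)
def FE [NeZero r] (i : Fin n) (j : ZMod r) : FreeAlgebra ℂ (Gen r n) :=
  ((r : ℂ)⁻¹) • ∑ l ∈ Finset.range r, ((zeta r)⁻¹ ^ (l * j.val)) • FT (zetaAt i ^ l)

/-- The defining relations of the rational Cherednik algebra of `G(r,1,n)` with parameters `κ`,
`c₀` and `d_j` (`j ∈ ℤ/r`). The group acts on `y_1,…,y_n` as on the standard basis of `ℂⁿ` and on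
`x_1,…,x_n` as on the dual basis. -/
inductive Rel [NeZero r] (κ c₀ : ℂ) (d : ZMod r → ℂ) :
    FreeAlgebra ℂ (Gen r n) → FreeAlgebra ℂ (Gen r n) → Prop
  | x_comm (i j : Fin n) : Rel κ c₀ d (FX i * FX j) (FX j * FX i)
  | y_comm (i j : Fin n) : Rel κ c₀ d (FY i * FY j) (FY j * FY i)
  | t_one : Rel κ c₀ d (FT 1) 1
  | t_mul (v w : W r n) : Rel κ c₀ d (FT v * FT w) (FT (v * w))
  | t_x (w : W r n) (j : Fin n) : Rel κ c₀ d (FT w * FX j)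
      ((((w.left (w.right j) : ℂˣ) : ℂ)⁻¹) • (FX (w.right j) * FT w))
  | t_y (w : W r n) (j : Fin n) : Rel κ c₀ d (FT w * FY j)
      (((w.left (w.right j) : ℂˣ) : ℂ) • (FY (w.right j) * FT w))
  | y_x_ne (i j : Fin n) (hij : i ≠ j) : Rel κ c₀ d (FY i * FX j)
      (FX j * FY i + c₀ • ∑ l ∈ Finset.range r, ((zeta r)⁻¹ ^ l) • FT (reflect i j l))
  | y_x_self (i : Fin n) : Rel κ c₀ d (FY i * FX i)
      (FX i * FY i + algebraMap ℂ _ κ - ∑ j : ZMod r, (d j - d (j - 1)) • FE i j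
        - c₀ • ∑ j ∈ Finset.univ.erase i, ∑ l ∈ Finset.range r, FT (reflect i j l))

/-- The rational Cherednik algebra `ℍ` of `G(r,1,n)` over `ℂ`. -/
def Cherednik (r n : ℕ) [NeZero r] (κ c₀ : ℂ) (d : ZMod r → ℂ) : Type :=
  RingQuot (Rel (r := r) (n := n) κ c₀ d)

instance [NeZero r] (κ c₀ : ℂ) (d : ZMod r → ℂ) : Ring (Cherednik r n κ c₀ d) :=
  inferInstanceAs (Ring (RingQuot (Rel (r := r) (n := n) κ c₀ d)))

instance [NeZero r] (κ c₀ : ℂ) (d : ZMod r → ℂ) : Algebra ℂ (Cherednik r n κ c₀ d) :=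
  inferInstanceAs (Algebra ℂ (RingQuot (Rel (r := r) (n := n) κ c₀ d)))

section Elements

variable [NeZero r] (κ c₀ : ℂ) (d : ZMod r → ℂ)

/-- The image in `ℍ` of an element of the free algebra. -/
def toH : FreeAlgebra ℂ (Gen r n) →ₐ[ℂ] Cherednik r n κ c₀ d :=
  RingQuot.mkAlgHom ℂ (Rel (r := r) (n := n) κ c₀ d)

/-- The element `x_i` of `ℍ`. -/
def X (i : Fin n) : Cherednik r n κ c₀ d := toH κ c₀ d (FX i)

/-- The element `y_i` of `ℍ`. -/
def Y (i : Fin n) : Cherednik r n κ c₀ d := toH κ c₀ d (FY i)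

/-- The element `t_w` of `ℍ`. -/
def t (w : W r n) : Cherednik r n κ c₀ d := toH κ c₀ d (FT w)

/-- The monomial `x^μ = x_1^{μ_1} ⋯ x_n^{μ_n}`. -/
def xPow (μ : Fin n → ℕ) : Cherednik r n κ c₀ d := (List.ofFn fun i => X κ c₀ d i ^ μ i).prod

/-- The Jucys-Murphy element `φ_i = ∑_{j < i} ∑_{l < r} t_{ζ_i^l s_{ij} ζ_i^{-l}}`. -/
def jucysMurphy (i : Fin n) : Cherednik r n κ c₀ d :=
  ∑ j ∈ Finset.Iio i, ∑ l ∈ Finset.range r, t κ c₀ d (reflect i j l)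

/-- The Dunkl-Opdam element `z_i = y_i x_i + c₀ φ_i`. -/
def z (i : Fin n) : Cherednik r n κ c₀ d :=
  Y κ c₀ d i * X κ c₀ d i + c₀ • jucysMurphy κ c₀ d i

/-- The subalgebra `𝔱` of `ℍ` generated by `z_1,…,z_n` and `t_{ζ_1},…,t_{ζ_n}`. -/
def tAlg : Subalgebra ℂ (Cherednik r n κ c₀ d) :=
  Algebra.adjoin ℂ (Set.range (z κ c₀ d) ∪ Set.range fun i : Fin n => t κ c₀ d (zetaAt i))

/-- `∑_{l < r} (t_{ζ_i ζ_j⁻¹})^l`; for `j = i + 1` this is the element `π_i`. -/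
def piElt (i j : Fin n) : Cherednik r n κ c₀ d :=
  ∑ l ∈ Finset.range r, t κ c₀ d (zetaAt i * (zetaAt j)⁻¹) ^ l

/-- `Ψ = y_1 t_{s_1 s_2 ⋯ s_{n-1}}`; the permutation `s_1 s_2 ⋯ s_{n-1}` is the long cycle
`1 ↦ 2 ↦ ⋯ ↦ n ↦ 1`. -/
def Psi [NeZero n] : Cherednik r n κ c₀ d := Y κ c₀ d 0 * t κ c₀ d (perm (finRotate n))

end Elements

/-! ## Multipartitions and standard tableaux -/

/-- An `r`-partition of `n`: partitions `λ^l`, `l ∈ ℤ/r = {0,…,r-1}`, with `n` boxes in total. -/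
structure MultiPartition (r n : ℕ) [NeZero r] where
  part : ZMod r → YoungDiagram
  card_eq : ∑ l, (part l).card = n

variable [NeZero r]

/-- The boxes of an `r`-partition. -/
abbrev Box (lam : MultiPartition r n) : Type :=
  Σ l : ZMod r, {c : ℕ × ℕ // c ∈ lam.part l}

/-- `β(b) = l` if the box `b` is in `λ^l`. -/
def Box.beta {lam : MultiPartition r n} (b : Box lam) : ZMod r := b.1

/-- The content of a box: column minus row. -/
def Box.ct {lam : MultiPartition r n} (b : Box lam) : ℤ := (b.2.1.2 : ℤ) - (b.2.1.1 : ℤ)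

/-- A filling of the boxes of `λ` by `1,…,n`, given as `T(i) =` the box containing `i`, is standard
if within each `λ^l` the entries increase strictly from left to right along each row and from top
to bottom along each column. -/
def IsStandard {lam : MultiPartition r n} (T : Fin n ≃ Box lam) : Prop :=
  ∀ (l : ZMod r) (c c' : {c : ℕ × ℕ // c ∈ lam.part l}),
    ((c.1.1 = c'.1.1 ∧ c.1.2 < c'.1.2) ∨ (c.1.2 = c'.1.2 ∧ c.1.1 < c'.1.1)) →
      T.symm ⟨l, c⟩ < T.symm ⟨l, c'⟩

/-- Standard Young tableaux on `λ`. -/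
abbrev SYT (lam : MultiPartition r n) : Type := {T : Fin n ≃ Box lam // IsStandard T}

/-- The tableau obtained from `T` by exchanging the entries `i` and `j`. -/
def swapT {lam : MultiPartition r n} (i j : Fin n) (T : Fin n ≃ Box lam) : Fin n ≃ Box lam :=
  (swap i j).trans T

/-! ## The irreducible representation `S^λ` (Young's orthonormal form) -/

/-- The group algebra of `G(r,1,n)`. -/
abbrev CW (r n : ℕ) : Type := MonoidAlgebra ℂ (W r n)

open Classical in
/-- `v_T` for a filling `T`, read as `0` if `T` is not standard (in the free `ℂW`-module on the
standard tableaux). -/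
def freeV {lam : MultiPartition r n} (T : Fin n ≃ Box lam) : SYT lam →₀ CW r n :=
  if h : IsStandard T then Finsupp.single ⟨T, h⟩ 1 else 0

/-- The prescribed value of `t_{s_i} v_T`, where `j = i + 1`. Let
`k = ct(T(i+1)) - ct(T(i))`. It is `v_{s_i T}` if `T(i)` and `T(i+1)` are in different components
of `λ`, and `(1/k) v_T + (1 - 1/k²)^{1/2} v_{s_i T}` if they are in the same component (then
`k ≠ 0`). -/
def youngS {lam : MultiPartition r n} (i j : Fin n) (T : SYT lam) : SYT lam →₀ CW r n :=
  if (T.1 i).beta = (T.1 j).beta then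
    ((1 : ℂ) / (((T.1 j).ct - (T.1 i).ct : ℤ) : ℂ)) • freeV T.1
      + ((Real.sqrt (1 - (1 / (((T.1 j).ct - (T.1 i).ct : ℤ) : ℝ)) ^ 2) : ℝ) : ℂ) •
          freeV (swapT i j T.1)
  else freeV (swapT i j T.1)

/-- The relations of Young's orthonormal form: `t_{ζ_i} v_T = ζ^{β(T(i))} v_T`, and
`t_{s_i} v_T` is given by `youngS`. -/
inductive YoungRel (lam : MultiPartition r n) : (SYT lam →₀ CW r n) → Prop
  | zeta (i : Fin n) (T : SYT lam) : YoungRel lam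
      (MonoidAlgebra.of ℂ (W r n) (zetaAt i) • freeV T.1
        - (zeta r ^ (T.1 i).beta.val) • freeV T.1)
  | simple (i j : Fin n) (hij : (i : ℕ) + 1 = j) (T : SYT lam) : YoungRel lam
      (MonoidAlgebra.of ℂ (W r n) (perm (swap i j)) • freeV T.1 - youngS i j T)

/-- The irreducible `ℂW`-module `S^λ`: the `ℂW`-module with generators `v_T`, `T ∈ SYT(λ)`, on
which the `ζ_i` and the `s_i` act by Young's orthonormal form. (These elements generate the group,
so this module is spanned over `ℂ` by the `v_T`; they are in fact a basis.) -/
abbrev SMod (lam : MultiPartition r n) : Type :=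
  (SYT lam →₀ CW r n) ⧸ Submodule.span (CW r n) {u | YoungRel lam u}

/-- The vector `v_T` of `S^λ`. -/
def vec {lam : MultiPartition r n} (T : SYT lam) : SMod lam :=
  Submodule.Quotient.mk (freeV T.1)

/-! ## The standard module `M(λ)` -/

section Verma

variable (κ c₀ : ℂ) (d : ZMod r → ℂ) (lam : MultiPartition r n)

/-- The relations defining `ℍ ⊗_{ℂW ⋉ ℂ[y_1,…,y_n]} S^λ` as a quotient of `ℍ ⊗_ℂ S^λ`, where the
`y_i` act on `S^λ` by `0`. -/
inductive IndRel : (Cherednik r n κ c₀ d ⊗[ℂ] SMod lam) → Prop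
  | group (w : W r n) (h : Cherednik r n κ c₀ d) (v : SMod lam) :
      IndRel ((h * t κ c₀ d w) ⊗ₜ[ℂ] v - h ⊗ₜ[ℂ] (MonoidAlgebra.of ℂ (W r n) w • v))
  | y (i : Fin n) (h : Cherednik r n κ c₀ d) (v : SMod lam) :
      IndRel ((h * Y κ c₀ d i) ⊗ₜ[ℂ] v)

/-- The standard module `M(λ) = Ind_{ℂW ⋉ ℂ[y_1,…,y_n]}^ℍ S^λ`. -/
abbrev Verma : Type :=
  (Cherednik r n κ c₀ d ⊗[ℂ] SMod lam) ⧸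
    Submodule.span (Cherednik r n κ c₀ d) {u | IndRel κ c₀ d lam u}

/-- The weight space `M_α` of `𝔱` on `M(λ)` (generalized simultaneous eigenspace) for an algebra
homomorphism `α : 𝔱 → ℂ`. -/
def weightSpace (α : tAlg (n := n) κ c₀ d →ₐ[ℂ] ℂ) : Submodule ℂ (Verma κ c₀ d lam) where
  carrier := {m | ∃ q : ℕ, 0 < q ∧ ∀ f : tAlg (n := n) κ c₀ d,
    ((f : Cherednik r n κ c₀ d) - algebraMap ℂ _ (α f)) ^ q • m = 0}
  zero_mem' := ⟨1, one_pos, fun _ => smul_zero _⟩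
  add_mem' := by
    rintro a b ⟨p, hp, ha⟩ ⟨q, hq, hb⟩
    refine ⟨p + q, by omega, fun f => ?_⟩
    rw [smul_add, pow_add, mul_smul _ _ b, hb f, smul_zero, add_zero, ← pow_add, add_comm p q,
      pow_add, mul_smul, ha f, smul_zero]
  smul_mem' := by
    rintro c a ⟨p, hp, ha⟩
    exact ⟨p, hp, fun f => by rw [smul_comm, ha f, smul_zero]⟩

/-- The `𝔱`-spectrum of `M(λ)` is simple: all (non-zero) weight spaces are one-dimensional. -/
def SimpleSpectrum : Prop :=
  ∀ α : tAlg (n := n) κ c₀ d →ₐ[ℂ] ℂ, weightSpace κ c₀ d lam α ≠ ⊥ →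
    Module.finrank ℂ (weightSpace κ c₀ d lam α) = 1

/-- `m` is a (genuine, non-zero) simultaneous eigenvector of `𝔱`. -/
def IsEigenvector (m : Verma κ c₀ d lam) : Prop :=
  m ≠ 0 ∧ ∀ a ∈ tAlg (n := n) κ c₀ d, ∃ e : ℂ, a • m = e • m

end Verma

/-! ## The order on compositions -/

/-- The number of inversions (the length) of a permutation. -/
def invCount (w : Perm (Fin n)) : ℕ :=
  (Finset.univ.filter fun p : Fin n × Fin n => p.1 < p.2 ∧ w p.2 < w p.1).card

/-- Strict Bruhat order on the symmetric group: the transitive closure of `u < u s_{ij}` when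
`l(u) < l(u s_{ij})`. -/
def BruhatLT : Perm (Fin n) → Perm (Fin n) → Prop :=
  Relation.TransGen fun u v => (∃ i j : Fin n, i ≠ j ∧ v = u * swap i j) ∧ invCount u < invCount v

/-- The (zero-based) value `w_μ(i) = |{j < i : μ_j < μ_i}| + |{j > i : μ_j ≤ μ_i}|`. -/
def wVal (μ : Fin n → ℕ) (i : Fin n) : ℕ :=
  (Finset.univ.filter fun j => j < i ∧ μ j < μ i).card
    + (Finset.univ.filter fun j => i < j ∧ μ j ≤ μ i).card

lemma wVal_eq (μ : Fin n → ℕ) (i : Fin n) :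
    wVal μ i = (Finset.univ.filter fun j => (j < i ∧ μ j < μ i) ∨ (i < j ∧ μ j ≤ μ i)).card := by
  rw [wVal, Finset.filter_or, Finset.card_union_of_disjoint]
  rw [Finset.disjoint_filter]
  rintro j - h1 h2
  exact absurd h1.1 (not_lt.mpr h2.1.le)

lemma wVal_lt_of (μ : Fin n → ℕ) {i k : Fin n}
    (h : (i < k ∧ μ i < μ k) ∨ (k < i ∧ μ i ≤ μ k)) : wVal μ i < wVal μ k := by
  rw [wVal_eq, wVal_eq]
  refine Finset.card_lt_card (Finset.ssubset_iff_of_subset ?_ |>.mpr ⟨i, ?_, ?_⟩)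
  · intro j
    simp only [Finset.mem_filter, Finset.mem_univ, true_and]
    rcases eq_or_ne j k with rfl | hjk
    · omega
    · have := Fin.val_ne_of_ne hjk
      omega
  · simpa using h
  · simp

lemma wVal_lt (μ : Fin n → ℕ) (i : Fin n) : wVal μ i < n := by
  rw [wVal_eq]
  refine lt_of_lt_of_eq (Finset.card_lt_card (Finset.ssubset_iff_of_subset
    (Finset.subset_univ _) |>.mpr ⟨i, Finset.mem_univ _, ?_⟩)) (Finset.card_fin n)
  simp

lemma wVal_injective (μ : Fin n → ℕ) :
    Function.Injective fun i => (⟨wVal μ i, wVal_lt μ i⟩ : Fin n) := by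
  intro i k h
  by_contra hne
  have h' : wVal μ i = wVal μ k := congrArg Fin.val h
  have key : ((i < k ∧ μ i < μ k) ∨ (k < i ∧ μ i ≤ μ k)) ∨
      ((k < i ∧ μ k < μ i) ∨ (i < k ∧ μ k ≤ μ i)) := by omega
  rcases key with h1 | h1 <;> have := wVal_lt_of μ h1 <;> omega

/-- The longest permutation `w_μ` such that `w_μ.μ` is non-decreasing. -/
def wPerm (μ : Fin n → ℕ) : Perm (Fin n) :=
  Equiv.ofBijective _ (Finite.injective_iff_bijective.mp (wVal_injective μ))

/-- The action `(w.μ)_i = μ_{w⁻¹(i)}`. -/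
def permComp (w : Perm (Fin n)) (μ : Fin n → ℕ) : Fin n → ℕ := fun i => μ (w⁻¹ i)

/-- The non-increasing rearrangement `μ⁺` (the non-decreasing one is `w_μ.μ`). -/
def plus (μ : Fin n → ℕ) : Fin n → ℕ := fun i => permComp (wPerm μ) μ i.rev

/-- Strict dominance order `ν <_d μ`. -/
def DomLT (ν μ : Fin n → ℕ) : Prop :=
  ν ≠ μ ∧ ∑ i, ν i = ∑ i, μ i ∧ ∀ k : Fin n, ∑ i ∈ Finset.Iic k, ν i ≤ ∑ i ∈ Finset.Iic k, μ i

/-- The partial order on `ℤ_{≥0}^n`: `ν < μ` iff `ν⁺ <_d μ⁺`, or `ν⁺ = μ⁺` and `w_ν < w_μ` in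
Bruhat order. -/
def CompLT (ν μ : Fin n → ℕ) : Prop :=
  DomLT (plus ν) (plus μ) ∨ (plus ν = plus μ ∧ BruhatLT (wPerm ν) (wPerm μ))

/-! ## The eigenfunctions and the calibration graph -/

section Graph

variable (κ c₀ : ℂ) (d : ZMod r → ℂ) (lam : MultiPartition r n)

/-- The element `x^μ v_T^μ` of `M(λ)`, with `v_T^μ = t_{w_μ}⁻¹ v_T`. -/
def leading (μ : Fin n → ℕ) (T : SYT lam) : Verma κ c₀ d lam :=
  Submodule.Quotient.mk
    (xPow κ c₀ d μ ⊗ₜ[ℂ] (MonoidAlgebra.of ℂ (W r n) (perm (wPerm μ))⁻¹ • vec T))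

/-- `f` is a `𝔱`-eigenvector of the form `x^μ v_T^μ + lower terms`, a lower term being a multiple
of some `x^ν v_S^ν` with `ν < μ`. -/
def IsF (μ : Fin n → ℕ) (T : SYT lam) (f : Verma κ c₀ d lam) : Prop :=
  IsEigenvector κ c₀ d lam f ∧
    f - leading κ c₀ d lam μ T ∈
      Submodule.span ℂ {m | ∃ (ν : Fin n → ℕ) (S : SYT lam), CompLT ν μ ∧
        m = leading κ c₀ d lam ν S}

/-- The eigenfunction `f_{μ,T}`: the element with the property `IsF` (meaningful when there is
exactly one). -/
def fElt (p : (Fin n → ℕ) × SYT lam) : Verma κ c₀ d lam :=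
  Classical.epsilon (IsF κ c₀ d lam p.1 p.2)

/-- The eigenvalue of `a` on a non-zero eigenvector `m`. -/
def eigenvalue (a : Cherednik r n κ c₀ d) (m : Verma κ c₀ d lam) : ℂ :=
  Classical.epsilon fun e : ℂ => a • m = e • m

/-- The intertwiner `σ_i = t_{s_i} + c₀ (z_i - z_{i+1})⁻¹ π_i` applied to a `𝔱`-eigenvector `m`
(here `j = i + 1`). If `z_i - z_{i+1}` acts on `m` by `0`, then `σ_i m` is defined only when
`π_i m = 0`, and is `t_{s_i} m`. -/
def sigma (i j : Fin n) (m : Verma κ c₀ d lam) : Verma κ c₀ d lam :=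
  t κ c₀ d (perm (swap i j)) • m
    + (c₀ / eigenvalue κ c₀ d lam (z κ c₀ d i - z κ c₀ d j) m) • (piElt κ c₀ d i j • m)

variable [NeZero n]

/-- The last index. -/
def lastIdx (n : ℕ) [NeZero n] : Fin n := ⟨n - 1, Nat.sub_lt (NeZero.pos n) one_pos⟩

/-- `φ.μ = (μ_2,…,μ_n,μ_1+1)`. -/
def phi (μ : Fin n → ℕ) : Fin n → ℕ := fun i =>
  permComp (finRotate n)⁻¹ μ i + if i = lastIdx n then 1 else 0

/-- `ψ.μ = (μ_n-1,μ_1,…,μ_{n-1})`, used only if `μ_n > 0`. -/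
def psi (μ : Fin n → ℕ) : Fin n → ℕ := fun i =>
  permComp (finRotate n) μ i - if i = 0 then 1 else 0

/-- The directed edges of the calibration graph, whose vertex set is
`Γ = ℤ_{≥0}^n × SYT(λ)`. -/
inductive Edge : (Fin n → ℕ) × SYT lam → (Fin n → ℕ) × SYT lam → Prop
  | swap (μ : Fin n → ℕ) (T : SYT lam) (i j : Fin n) (hij : (i : ℕ) + 1 = j) (hμ : μ i ≠ μ j)
      (hσ : sigma κ c₀ d lam i j (fElt κ c₀ d lam (μ, T)) ≠ 0) :
      Edge (μ, T) (permComp (Equiv.swap i j) μ, T)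
  | tableau (μ : Fin n → ℕ) (T : SYT lam) (i j k : Fin n) (hij : (i : ℕ) + 1 = j) (hμ : μ i = μ j)
      (hk : (k : ℕ) + 1 = wPerm μ i) (hT : IsStandard (swapT k (wPerm μ i) T.1)) :
      Edge (μ, T) (μ, ⟨swapT k (wPerm μ i) T.1, hT⟩)
  | phi (μ : Fin n → ℕ) (T : SYT lam) : Edge (μ, T) (phi μ, T)
  | psi (μ : Fin n → ℕ) (T : SYT lam) (hμ : 0 < μ (lastIdx n))
      (hΨ : (Psi κ c₀ d : Cherednik r n κ c₀ d) • fElt κ c₀ d lam (μ, T) ≠ 0) : Edge (μ, T) (psi μ, T)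

/-- A set of vertices of the calibration graph is closed if it contains the target of every edge
whose source it contains. -/
def IsClosedSet (A : Set ((Fin n → ℕ) × SYT lam)) : Prop :=
  ∀ p q, p ∈ A → Edge κ c₀ d lam p q → q ∈ A

end Graph

end

end RCA

set_option linter.unusedSectionVars false

namespace RCA

open Equiv (Perm swap)

section

variable {r n : ℕ}

/-! ## Inversions, Bruhat order and the permutations `w_μ` -/

/-! The eigenvectors f_{μ,T} form a basis of M(λ) with pairwise distinct weights, so a submodule is
spanned by the f_{μ,T} that it contains, and the question is how a generating set of ℍ acts on this
basis. Such a set consists of the t_{ζ_i}, the t_{s_i}, Ψ and Φ = x_n t_{s_{n-1}⋯s_1}. The t_{ζ_i}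
act by scalars. The others are governed by intertwiners, which permute weights and therefore send
each f_{μ,T} to a multiple of another basis vector; the edges of the graph record the non-zero
multiples.

Basis and triangularity. Dunkl-Opdam operators make ℂ[x] ⊗ S^λ an ℍ-module, so M(λ) is no smaller
than this space (`polyToVerma`). As the v_T are linearly independent (`linearIndependent_vec`), the
x^μ t_{w_μ}⁻¹ v_T form a basis. Each z_i is triangular in it: the reflections on its diagonal at x^μ
are those exchanging i with some j such that w_μ(j) < w_μ(i) (`divDiff_term_mem`). Conjugated by w_μ
they add up to a Jucys-Murphy element, which is diagonal in Young's form (`sum_reflSum_vec`,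
`zDiag_vec`). The z_i commute on M(λ) (`zComm_eq_top`), so each basis element can be corrected by
lower terms to a generalized weight vector; simplicity of the spectrum makes it a genuine
eigenvector and makes it unique (`existsUnique_isF`). Of two vertices with equal weights each would
lie strictly below the other (`compLT_of_weight_eq`), so the weights are distinct.

Intertwiners. If t_{ζ_i} and t_{ζ_{i+1}} act on f = f_{μ,T} by the same scalars, then z_i and
z_{i+1} have different eigenvalues (`wtz_ne_of_sameChar`, where c₀ ≠ 0 enters), so σ_i f is
meaningful. Comparing weights and leading coefficients, σ_i f is a multiple of f_{s_i.μ,T} if μ_i ≠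
μ_{i+1}, and a non-zero multiple of f_{μ,s_{j-1}.T} if μ_i = μ_{i+1} and s_{j-1}.T is standard. Φ is
injective on M(λ), and ΨΦ = z_1 together with the formula for ΦΨ controls Ψ.

The delicate case is μ_i = μ_{i+1} with s_{j-1}.T not standard. There is no edge then, and t_{s_i}
f_{μ,T} = ± f_{μ,T} has to be proved (`swapActs_of_isStuck`). This goes by induction on the degree
and on the order of compositions. For μ = 0 it is Young's form; a positive last part is removed by
Φ; otherwise μ has a descent, and undoing it costs an intertwiner that either commutes with s_i or
is tied to it by the braid relation (`swap_smul_braid`). -/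

theorem invCount_mul_swap_lt (w : Perm (Fin n)) {a b : Fin n} (hab : a < b) (h : w b < w a) :
    invCount (w * swap a b) < invCount w := by
  classical
  set s : Perm (Fin n) := swap a b with hs
  -- `F` injects the inversions of `w * swap a b` into those of `w`: a pair is moved by the
  -- transposition when its order survives and stays in place otherwise. The inversion `(a, b)` of
  -- `w` is not hit, whence strictness.
  let F : Fin n × Fin n → Fin n × Fin n := fun p => if s p.1 < s p.2 then (s p.1, s p.2) else p
  have key : ∀ p q : Fin n, p < q → w (s q) < w (s p) → ¬ s p < s q → w q < w p ∧ ¬ (p = a ∧ q = b) := by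
    intro p q hpq hw hnot
    rcases eq_or_ne p a with rfl | hpa
    · rcases eq_or_ne q b with rfl | hqb
      · simp [hs] at hw; exact absurd hw (not_lt.mpr h.le)
      · have hq : s q = q := Equiv.swap_apply_of_ne_of_ne hpq.ne' hqb
        have hp : s p = b := Equiv.swap_apply_left _ _
        rw [hq, hp] at hw
        exact ⟨hw.trans h, fun hh => hqb hh.2⟩
    · rcases eq_or_ne q b with rfl | hqb
      · have hp : s p = p := Equiv.swap_apply_of_ne_of_ne hpa hpq.ne
        have hq : s q = a := Equiv.swap_apply_right _ _
        rw [hq, hp] at hw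
        exact ⟨h.trans hw, fun hh => hpa hh.1⟩
      · exfalso
        apply hnot
        rcases eq_or_ne p b with rfl | hpb
        · rcases eq_or_ne q a with rfl | hqa
          · exact absurd hab (not_lt.mpr hpq.le)
          · rw [hs, Equiv.swap_apply_right, Equiv.swap_apply_of_ne_of_ne hqa hqb]
            exact hab.trans hpq
        · rcases eq_or_ne q a with rfl | hqa
          · rw [hs, Equiv.swap_apply_left, Equiv.swap_apply_of_ne_of_ne hpa hpb]
            exact hpq.trans hab
          · rwa [hs, Equiv.swap_apply_of_ne_of_ne hpa hpb, Equiv.swap_apply_of_ne_of_ne hqa hqb]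
  have hss : ∀ x, s (s x) = x := fun x => by rw [hs, Equiv.swap_apply_self]
  unfold invCount
  refine lt_of_eq_of_lt (Finset.card_image_of_injOn (f := F) ?_).symm
    (Finset.card_lt_card (Finset.ssubset_iff_of_subset ?_ |>.mpr ⟨(a, b), ?_, ?_⟩))
  · rintro ⟨p, q⟩ hp ⟨p', q'⟩ hp' hE
    simp only [Finset.coe_filter, Finset.mem_univ, true_and, Set.mem_ofPred_eq] at hp hp'
    simp only [F] at hE
    split_ifs at hE with h1 h2 h2
    · simpa using hE
    · simp only [Prod.mk.injEq] at hE
      rw [← hE.1, ← hE.2, hss, hss] at h2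
      exact absurd hp.1 h2
    · simp only [Prod.mk.injEq] at hE
      rw [hE.1, hE.2, hss, hss] at h1
      exact absurd hp'.1 h1
    · exact hE
  · intro x hx
    obtain ⟨⟨p, q⟩, hp, rfl⟩ := Finset.mem_image.mp hx
    have hp := (Finset.mem_filter.mp hp).2
    simp only [Finset.mem_filter, Finset.mem_univ, true_and, Perm.mul_apply] at hp ⊢
    simp only [F]
    split_ifs with h1
    · exact ⟨h1, hp.2⟩
    · exact ⟨hp.1, (key p q hp.1 hp.2 h1).1⟩
  · simp [hab, h]
  · intro hx
    obtain ⟨⟨p, q⟩, hp, hF⟩ := Finset.mem_image.mp hx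
    have hp := (Finset.mem_filter.mp hp).2
    simp only [Perm.mul_apply] at hp
    simp only [F] at hF
    split_ifs at hF with h1
    · simp only [Prod.mk.injEq] at hF
      have e1 : p = b := by rw [← hss p, hF.1, hs, Equiv.swap_apply_left]
      have e2 : q = a := by rw [← hss q, hF.2, hs, Equiv.swap_apply_right]
      rw [e1, e2] at hp
      exact absurd hab (not_lt.mpr hp.1.le)
    · simp only [Prod.mk.injEq] at hF
      exact (key p q hp.1 hp.2 h1).2 hF

theorem BruhatLT.invCount_lt {u v : Perm (Fin n)} (h : BruhatLT u v) : invCount u < invCount v := by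
  induction h with
  | single h => exact h.2
  | tail _ h ih => exact ih.trans h.2

theorem bruhatLT_mul_swap (w : Perm (Fin n)) {a b : Fin n} (hab : a < b) (h : w b < w a) :
    BruhatLT (w * swap a b) w :=
  .single ⟨⟨a, b, hab.ne, by rw [mul_assoc, Equiv.swap_mul_self, mul_one]⟩,
    invCount_mul_swap_lt w hab h⟩

/-- The total order on positions that `w_μ` straightens. -/
def PosLT (μ : Fin n → ℕ) (i k : Fin n) : Prop := (i < k ∧ μ i < μ k) ∨ (k < i ∧ μ i ≤ μ k)

theorem PosLT.total (μ : Fin n → ℕ) {i k : Fin n} (h : i ≠ k) : PosLT μ i k ∨ PosLT μ k i := by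
  have := Fin.val_ne_of_ne h
  unfold PosLT
  simp only [Fin.lt_def]
  omega

theorem PosLT.wPerm_lt {μ : Fin n → ℕ} {i k : Fin n} (h : PosLT μ i k) : wPerm μ i < wPerm μ k :=
  wVal_lt_of μ h

theorem PosLT.asymm {μ : Fin n → ℕ} {i k : Fin n} (h : PosLT μ i k) : ¬ PosLT μ k i := by
  unfold PosLT at *; simp only [Fin.lt_def] at *; omega

theorem wPerm_lt_iff (μ : Fin n → ℕ) (i k : Fin n) : wPerm μ i < wPerm μ k ↔ PosLT μ i k := by
  refine ⟨fun h => ?_, PosLT.wPerm_lt⟩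
  rcases eq_or_ne i k with rfl | hne
  · exact absurd h (lt_irrefl _)
  · exact (PosLT.total μ hne).resolve_right fun h' => absurd h'.wPerm_lt (not_lt.mpr h.le)

/-- A strictly monotone permutation of `Fin n` is the identity; this is applied to `wPerm μ * w⁻¹`.
The criterion gives the formulas for w_{s.μ} and w_{φ.μ} without counting. -/
theorem eq_wPerm_of {μ : Fin n → ℕ} {w : Perm (Fin n)} (h : ∀ i k, PosLT μ i k → w i < w k) :
    w = wPerm μ := by
  have hm : StrictMono (wPerm μ * w⁻¹ : Perm (Fin n)) := by
    intro a b hab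
    rw [Perm.mul_apply, Perm.mul_apply, wPerm_lt_iff]
    refine (PosLT.total μ (fun e => hab.ne (w⁻¹.injective e))).resolve_right fun h' => ?_
    have := h _ _ h'
    have e : ∀ x, w (w⁻¹ x) = x := w.apply_symm_apply
    rw [e, e] at this
    exact absurd this (not_lt.mpr hab.le)
  have : (hm.orderIsoOfSurjective _ (wPerm μ * w⁻¹ : Perm (Fin n)).surjective) = OrderIso.refl _ :=
    Subsingleton.elim _ _
  have e : (wPerm μ * w⁻¹ : Perm (Fin n)) = 1 := by
    ext x
    have := congrArg (fun e => e x) this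
    simpa using congrArg Fin.val this
  exact (mul_inv_eq_one.mp e).symm

theorem permComp_apply (w : Perm (Fin n)) (μ : Fin n → ℕ) (i : Fin n) :
    permComp w μ i = μ (w⁻¹ i) := rfl

theorem permComp_mul (v w : Perm (Fin n)) (μ : Fin n → ℕ) :
    permComp (v * w) μ = permComp v (permComp w μ) := by
  ext i; simp [permComp, mul_inv_rev]

theorem permComp_swap_apply (a b : Fin n) (μ : Fin n → ℕ) (i : Fin n) :
    permComp (swap a b) μ i = μ (swap a b i) := by
  rw [permComp, Equiv.swap_inv]

theorem permComp_swap_swap (a b : Fin n) (μ : Fin n → ℕ) :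
    permComp (swap a b) (permComp (swap a b) μ) = μ := by
  rw [← permComp_mul, Equiv.swap_mul_self]; rfl

theorem permComp_swap_eq (a b : Fin n) (μ : Fin n → ℕ) (h : μ a = μ b) :
    permComp (swap a b) μ = μ := by
  ext i
  rw [permComp_swap_apply]
  rcases eq_or_ne i a with rfl | ha
  · rw [Equiv.swap_apply_left, h]
  · rcases eq_or_ne i b with rfl | hb
    · rw [Equiv.swap_apply_right, h]
    · rw [Equiv.swap_apply_of_ne_of_ne ha hb]

/-- `PosLT` breaks ties by position, so carrying a value past an equal one would change the
comparison. `hbet` excludes this. -/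
theorem wPerm_permComp_swap {μ : Fin n → ℕ} {a b : Fin n} (hab : a < b) (hμ : μ a ≠ μ b)
    (hbet : ∀ m, a < m → m < b → μ m ≠ μ a ∧ μ m ≠ μ b) :
    wPerm (permComp (swap a b) μ) = wPerm μ * swap a b := by
  symm
  apply eq_wPerm_of
  intro i k h
  rw [Perm.mul_apply, Perm.mul_apply, wPerm_lt_iff]
  unfold PosLT at h ⊢
  rw [permComp_swap_apply, permComp_swap_apply] at h
  have ha := hbet i
  have hb := hbet k
  simp only [Equiv.swap_apply_def] at h ⊢
  split_ifs at h ⊢ with h1 h2 h3 h4 h5 h6 h7 h8 <;> subst_vars <;>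
    simp only [Fin.lt_def, Fin.ext_iff] at * <;> omega

/-- With no equal part in between, the swap multiplies w_μ by a transposition that shortens it.
Otherwise let m be the first intermediate position with value μ_a or μ_b: since two of the three
values coincide, the swap at (a, b) has the same effect as two successive swaps at (a, m) and (m,
b), taken in a suitable order. The first of these pairs is free of ties and the second is shorter.
-/
theorem bruhatLT_wPerm_swap (μ : Fin n → ℕ) {a b : Fin n} (hab : a < b) (hμ : μ b < μ a) :
    BruhatLT (wPerm (permComp (swap a b) μ)) (wPerm μ) := by
  induction hN : (b : ℕ) - a using Nat.strong_induction_on generalizing a b μ with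
  | _ N ih =>
  have elem : ∀ (ν : Fin n → ℕ) (a b : Fin n), a < b → ν b < ν a →
      (∀ m, a < m → m < b → ν m ≠ ν a ∧ ν m ≠ ν b) →
      BruhatLT (wPerm (permComp (swap a b) ν)) (wPerm ν) := by
    intro ν a b hab hν hbet
    rw [wPerm_permComp_swap hab hν.ne' hbet]
    apply bruhatLT_mul_swap _ hab
    rw [wPerm_lt_iff]
    exact Or.inr ⟨hab, hν.le⟩
  by_cases hex : ∃ m, a < m ∧ m < b ∧ (μ m = μ a ∨ μ m = μ b)
  · classical
    obtain ⟨m, ⟨ham, hmb, hm⟩, hmin⟩ : ∃ m : Fin n, (a < m ∧ m < b ∧ (μ m = μ a ∨ μ m = μ b)) ∧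
        ∀ m', a < m' → m' < m → ¬ (μ m' = μ a ∨ μ m' = μ b) := by
      have hw := WellFounded.has_min (wellFounded_lt (α := Fin n))
        {m | a < m ∧ m < b ∧ (μ m = μ a ∨ μ m = μ b)} hex
      obtain ⟨m, hm, hmin⟩ := hw
      exact ⟨m, hm, fun m' h1 h2 h3 => hmin m' ⟨h1, h2.trans hm.2.1, h3⟩ h2⟩
    have na : swap m b a = a := Equiv.swap_apply_of_ne_of_ne ham.ne hab.ne
    have nb : swap a m b = b := Equiv.swap_apply_of_ne_of_ne hab.ne' hmb.ne'
    have lt1 : (b : ℕ) - m < N := by simp only [Fin.lt_def] at *; omega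
    rcases hm with hm | hm
    · have h1 := ih _ lt1 μ hmb (by rwa [hm]) rfl
      have h2 := elem (permComp (swap m b) μ) a m ham
        (by rw [permComp_swap_apply, permComp_swap_apply, na, Equiv.swap_apply_left]; exact hμ)
        (by
          intro m' h1 h2
          have e : swap m b m' = m' := Equiv.swap_apply_of_ne_of_ne h2.ne (h2.trans hmb).ne
          rw [permComp_swap_apply, permComp_swap_apply, permComp_swap_apply, na,
            Equiv.swap_apply_left, e]
          have := hmin m' h1 h2
          tauto)
      have e : permComp (swap a m) (permComp (swap m b) μ) = permComp (swap a b) μ := by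
        ext x
        simp only [permComp_swap_apply]
        rcases eq_or_ne x a with rfl | hxa
        · simp
        rcases eq_or_ne x b with rfl | hxb
        · simp [nb, hm]
        rcases eq_or_ne x m with rfl | hxm
        · simp [na, hm, Equiv.swap_apply_of_ne_of_ne ham.ne' hmb.ne]
        · rw [Equiv.swap_apply_of_ne_of_ne hxa hxm, Equiv.swap_apply_of_ne_of_ne hxm hxb,
            Equiv.swap_apply_of_ne_of_ne hxa hxb]
      rw [e] at h2
      exact h2.trans h1
    · have h1 := elem μ a m ham (by rwa [hm]) (by
          intro m' h1 h2
          have := hmin m' h1 h2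
          rw [hm]
          tauto)
      have h2 := ih _ lt1 (permComp (swap a m) μ) hmb
        (by rw [permComp_swap_apply, permComp_swap_apply, nb, Equiv.swap_apply_right]; exact hμ) rfl
      have e : permComp (swap m b) (permComp (swap a m) μ) = permComp (swap a b) μ := by
        ext x
        simp only [permComp_swap_apply]
        rcases eq_or_ne x a with rfl | hxa
        · simp [na, hm]
        rcases eq_or_ne x b with rfl | hxb
        · simp
        rcases eq_or_ne x m with rfl | hxm
        · simp [nb, hm, Equiv.swap_apply_of_ne_of_ne ham.ne' hmb.ne]
        · rw [Equiv.swap_apply_of_ne_of_ne hxm hxb, Equiv.swap_apply_of_ne_of_ne hxa hxm,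
            Equiv.swap_apply_of_ne_of_ne hxa hxb]
      rw [e] at h2
      exact h2.trans h1
  · refine elem μ a b hab hμ fun m h1 h2 => ?_
    constructor <;> intro h <;> exact hex ⟨m, h1, h2, by tauto⟩

/-- The first part v lost every tie-free comparison with u > v and won the ones with u ≤ v. Moved to
the end as v + 1 it wins exactly when u < v + 1, which is the same condition. -/
theorem wPerm_phi [NeZero n] (μ : Fin n → ℕ) : wPerm (phi μ) = wPerm μ * finRotate n := by
  symm
  apply eq_wPerm_of
  obtain ⟨m, rfl⟩ : ∃ m, n = m + 1 := ⟨n - 1, (Nat.succ_pred (NeZero.ne n)).symm⟩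
  have hphi : ∀ i : Fin (m+1), phi μ i = μ (finRotate _ i) + if i = Fin.last m then 1 else 0 := by
    intro i
    simp only [phi, permComp, inv_inv]
    rfl
  intro i k h
  rw [Perm.mul_apply, Perm.mul_apply, wPerm_lt_iff]
  unfold PosLT at h ⊢
  rw [hphi, hphi] at h
  have hi : (i : ℕ) < m + 1 := i.2
  have hk : (k : ℕ) < m + 1 := k.2
  have rot : ∀ j : Fin (m+1), (finRotate (m+1) j : ℕ) = if j = Fin.last m then 0 else (j : ℕ) + 1 :=
    fun j => coe_finRotate j
  have ri := rot i
  have rk := rot k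
  split_ifs at h ri rk with h1 h2 h2 <;>
    simp only [Fin.lt_def, Fin.ext_iff, Fin.val_last] at * <;> omega

/-! ## Dominance and the order on compositions -/

theorem permComp_wPerm_monotone (μ : Fin n → ℕ) : Monotone (permComp (wPerm μ) μ) := by
  intro a b hab
  rcases hab.eq_or_lt with rfl | hab
  · exact le_rfl
  have h : wPerm μ ((wPerm μ)⁻¹ a) < wPerm μ ((wPerm μ)⁻¹ b) := by
    have e : ∀ x, wPerm μ ((wPerm μ)⁻¹ x) = x := (wPerm μ).apply_symm_apply
    rwa [e, e]
  rw [wPerm_lt_iff] at h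
  rcases h with h | h
  · exact h.2.le
  · exact h.2

theorem plus_antitone (μ : Fin n → ℕ) : Antitone (plus μ) := fun _ _ h =>
  permComp_wPerm_monotone μ (Fin.rev_le_rev.mpr h)

theorem plus_permComp (w : Perm (Fin n)) (μ : Fin n → ℕ) : plus (permComp w μ) = plus μ := by
  have h := Tuple.unique_monotone (f := μ) (σ := w⁻¹ * (wPerm (permComp w μ))⁻¹)
    (τ := (wPerm μ)⁻¹) (permComp_wPerm_monotone (permComp w μ)) (permComp_wPerm_monotone μ)
  ext i
  exact congrFun h i.rev

/-- The permutation `i ↦ w_μ⁻¹(n - i)` that rearranges `μ` into `μ⁺`. -/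
theorem exists_plus_eq (μ : Fin n → ℕ) : ∃ σ : Perm (Fin n), plus μ = μ ∘ σ :=
  ⟨(wPerm μ)⁻¹ * Fin.revPerm, rfl⟩

/-- Exchange argument: `B \ Iic k` and `Iic k \ B` have the same size, and `g k` separates the
values on them. -/
theorem sum_le_sum_Iic_of_antitone {g : Fin n → ℕ} (hg : Antitone g) (k : Fin n)
    (B : Finset (Fin n)) (hB : B.card = k + 1) : ∑ i ∈ B, g i ≤ ∑ i ∈ Finset.Iic k, g i := by
  classical
  rw [← Finset.sum_inter_add_sum_sdiff B (Finset.Iic k),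
    ← Finset.sum_inter_add_sum_sdiff (Finset.Iic k) B, Finset.inter_comm]
  refine add_le_add le_rfl ?_
  have hc : (B \ Finset.Iic k).card = (Finset.Iic k \ B).card := by
    have h1 := Finset.card_sdiff_add_card_inter B (Finset.Iic k)
    have h2 := Finset.card_sdiff_add_card_inter (Finset.Iic k) B
    rw [Finset.inter_comm] at h2
    rw [Fin.card_Iic] at h2
    omega
  calc ∑ i ∈ B \ Finset.Iic k, g i ≤ (B \ Finset.Iic k).card • g k :=
        Finset.sum_le_card_nsmul _ _ _ fun x hx => hg (by
          simp only [Finset.mem_sdiff, Finset.mem_Iic, not_le] at hx; exact hx.2.le)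
    _ = (Finset.Iic k \ B).card • g k := by rw [hc]
    _ ≤ ∑ i ∈ Finset.Iic k \ B, g i := Finset.card_nsmul_le_sum _ _ _ fun x hx => hg (by
          simp only [Finset.mem_sdiff, Finset.mem_Iic] at hx; exact hx.1)

/-- Together with `exists_sum_Iic_plus_eq` this describes the partial sums of μ⁺ as maxima over sets
of k + 1 positions, so that dominance can be tested without sorting. -/
theorem sum_le_sum_Iic_plus (μ : Fin n → ℕ) (k : Fin n) (A : Finset (Fin n))
    (hA : A.card = k + 1) : ∑ i ∈ A, μ i ≤ ∑ i ∈ Finset.Iic k, plus μ i := by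
  obtain ⟨σ, hσ⟩ := exists_plus_eq μ
  have h := sum_le_sum_Iic_of_antitone (plus_antitone μ) k (A.map σ.symm.toEmbedding)
    (by rw [Finset.card_map, hA])
  simpa [Finset.sum_map, hσ] using h

theorem exists_sum_Iic_plus_eq (μ : Fin n → ℕ) (k : Fin n) :
    ∃ A : Finset (Fin n), A.card = k + 1 ∧ ∑ i ∈ Finset.Iic k, plus μ i = ∑ i ∈ A, μ i := by
  obtain ⟨σ, hσ⟩ := exists_plus_eq μ
  exact ⟨(Finset.Iic k).map σ.toEmbedding, by rw [Finset.card_map, Fin.card_Iic],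
    by simp [Finset.sum_map, hσ]⟩

theorem sum_plus (μ : Fin n → ℕ) (F : ℕ → ℤ) : ∑ i, F (plus μ i) = ∑ i, F (μ i) := by
  obtain ⟨σ, hσ⟩ := exists_plus_eq μ
  rw [hσ]
  exact Equiv.sum_comp σ fun i => F (μ i)

theorem sum_plus' (μ : Fin n → ℕ) : ∑ i, plus μ i = ∑ i, μ i := by
  obtain ⟨σ, hσ⟩ := exists_plus_eq μ
  rw [hσ]
  exact Equiv.sum_comp σ μ

/-- Here ν arises from μ by moving an amount c > 0 from part i to part j. A set A of positions can
gain only if it contains j and not i, and then exchanging i and j in A compensates because ν_j <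
μ_i. The rearrangements differ because the sum of squares drops. -/
theorem domLT_plus_of_between {ν μ : Fin n → ℕ} {i j : Fin n} (h1 : μ j < ν i) (h2 : ν i < μ i)
    (hs : ν i + ν j = μ i + μ j) (ho : ∀ x, x ≠ i → x ≠ j → ν x = μ x) :
    DomLT (plus ν) (plus μ) := by
  classical
  have hij : i ≠ j := by rintro rfl; omega
  set c : ℤ := μ i - ν i with hc
  have hν : ∀ x, (ν x : ℤ) = μ x + (if x = j then c else 0) - (if x = i then c else 0) := by
    intro x
    by_cases hxi : x = i
    · subst hxi; rw [if_neg hij, if_pos rfl]; omega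
    · by_cases hxj : x = j
      · subst hxj; rw [if_pos rfl, if_neg hxi]; omega
      · rw [if_neg hxi, if_neg hxj, ho x hxi hxj]; ring
  have hsum : ∀ A : Finset (Fin n), (∑ x ∈ A, (ν x : ℤ)) =
      ∑ x ∈ A, (μ x : ℤ) + (if j ∈ A then c else 0) - (if i ∈ A then c else 0) := by
    intro A
    rw [Finset.sum_congr rfl fun x _ => hν x, Finset.sum_sub_distrib, Finset.sum_add_distrib,
      Finset.sum_ite_eq', Finset.sum_ite_eq']
  have hcpos : 0 < c := by omega
  refine ⟨fun h => ?_, ?_, fun k => ?_⟩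
  · have e := sum_plus ν fun x => (x : ℤ) ^ 2
    rw [h, sum_plus μ fun x => (x : ℤ) ^ 2, ← sub_eq_zero, ← Finset.sum_sub_distrib,
      Fintype.sum_eq_add i j hij (fun x hx => by rw [ho x hx.1 hx.2, sub_self])] at e
    have hj : (ν j : ℤ) = μ i + μ j - ν i := by omega
    rw [hj] at e
    have h1' : (μ j : ℤ) < ν i := by exact_mod_cast h1
    have h2' : (ν i : ℤ) < μ i := by exact_mod_cast h2
    nlinarith
  · rw [sum_plus', sum_plus']
    have := hsum Finset.univ
    simp only [Finset.mem_univ, if_true] at this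
    have h' : (∑ x, (ν x : ℤ)) = ∑ x, (μ x : ℤ) := by omega
    exact_mod_cast h'
  · obtain ⟨A, hA, e⟩ := exists_sum_Iic_plus_eq ν k
    rw [e]
    by_cases hcase : j ∈ A ∧ i ∉ A
    · have h := sum_le_sum_Iic_plus μ k (A.map (swap i j).toEmbedding) (by rw [Finset.card_map, hA])
      refine le_trans ?_ h
      rw [Finset.sum_map]
      refine Finset.sum_le_sum fun x hx => ?_
      simp only [Equiv.coe_toEmbedding]
      by_cases hxj : x = j
      · subst hxj; rw [Equiv.swap_apply_right]; omega
      · have hxi : x ≠ i := fun h => hcase.2 (h ▸ hx)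
        rw [Equiv.swap_apply_of_ne_of_ne hxi hxj, ho x hxi hxj]
    · refine le_trans ?_ (sum_le_sum_Iic_plus μ k A hA)
      have := hsum A
      have h' : (∑ x ∈ A, (ν x : ℤ)) ≤ ∑ x ∈ A, (μ x : ℤ) := by
        split_ifs at this with h3 h4 h4
        · omega
        · exact absurd ⟨h3, h4⟩ hcase
        · omega
        · omega
      exact_mod_cast h'

theorem DomLT.sum_lt {a b : Fin n → ℕ} (h : DomLT a b) :
    ∑ k, ∑ i ∈ Finset.Iic k, a i < ∑ k, ∑ i ∈ Finset.Iic k, b i := by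
  classical
  refine Finset.sum_lt_sum (fun k _ => h.2.2 k) ?_
  by_contra hcon
  push Not at hcon
  have heq : ∀ k, ∑ i ∈ Finset.Iic k, a i = ∑ i ∈ Finset.Iic k, b i :=
    fun k => le_antisymm (h.2.2 k) (hcon k (Finset.mem_univ k))
  apply h.1
  ext k
  induction k using WellFoundedLT.induction with
  | _ k ih =>
    have h1 := heq k
    rw [← Finset.Iio_insert, Finset.sum_insert (by simp), Finset.sum_insert (by simp),
      Finset.sum_congr rfl fun x hx => ih x (Finset.mem_Iio.mp hx)] at h1
    exact Nat.add_right_cancel h1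

/-- A rank function that is strictly monotone for the order on compositions. -/
noncomputable def compRank (μ : Fin n → ℕ) : ℕ :=
  (∑ k, ∑ i ∈ Finset.Iic k, plus μ i) * (n * n + 1) + invCount (wPerm μ)

theorem invCount_le (w : Perm (Fin n)) : invCount w ≤ n * n := by
  refine (Finset.card_filter_le _ _).trans ?_
  simp

/-- The factor `n * n + 1` exceeds every inversion number, so a gain in dominance outweighs any
change in length. -/
theorem CompLT.compRank_lt {ν μ : Fin n → ℕ} (h : CompLT ν μ) : compRank ν < compRank μ := by
  unfold compRank
  rcases h with h | ⟨h, h'⟩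
  · have h1 := h.sum_lt
    have h2 := invCount_le (wPerm ν)
    have h3 : (∑ k, ∑ i ∈ Finset.Iic k, plus ν i + 1) * (n * n + 1) ≤
      (∑ k, ∑ i ∈ Finset.Iic k, plus μ i) * (n * n + 1) := Nat.mul_le_mul_right _ h1
    rw [add_mul, one_mul] at h3
    omega
  · rw [h]
    exact Nat.add_lt_add_left h'.invCount_lt _

theorem CompLT.sum_eq {ν μ : Fin n → ℕ} (h : CompLT ν μ) : ∑ i, ν i = ∑ i, μ i := by
  rw [← sum_plus' ν, ← sum_plus' μ]
  rcases h with h | ⟨h, -⟩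
  · exact h.2.1
  · rw [h]

theorem CompLT.trans {a b c : Fin n → ℕ} (h1 : CompLT a b) (h2 : CompLT b c) : CompLT a c := by
  rcases h1 with h1 | ⟨h1, h1'⟩
  · rcases h2 with h2 | ⟨h2, -⟩
    · refine Or.inl ⟨fun e => ?_, h1.2.1.trans h2.2.1, fun k => (h1.2.2 k).trans (h2.2.2 k)⟩
      have := h1.sum_lt.trans h2.sum_lt
      rw [e] at this
      exact lt_irrefl _ this
    · exact Or.inl (h2 ▸ h1)
  · rcases h2 with h2 | ⟨h2, h2'⟩
    · exact Or.inl (h1 ▸ h2)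
    · exact Or.inr ⟨h1.trans h2, Relation.TransGen.trans h1' h2'⟩

theorem CompLT.ne {ν μ : Fin n → ℕ} (h : CompLT ν μ) : ν ≠ μ := fun e =>
  absurd h.compRank_lt (by rw [e]; exact lt_irrefl _)

theorem CompLT.asymm {ν μ : Fin n → ℕ} (h : CompLT ν μ) : ¬ CompLT μ ν :=
  fun h' => (h.trans h').ne rfl

theorem compLT_swap {μ : Fin n → ℕ} {a b : Fin n} (hab : a < b) (hμ : μ b < μ a) :
    CompLT (permComp (swap a b) μ) μ :=
  Or.inr ⟨plus_permComp _ _, bruhatLT_wPerm_swap μ hab hμ⟩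

theorem not_compLT_zero (ν : Fin n → ℕ) : ¬ CompLT ν 0 := by
  intro h
  have hs := h.sum_eq
  simp only [Pi.zero_apply, Finset.sum_const_zero, Finset.sum_eq_zero_iff, Finset.mem_univ,
    true_imp_iff] at hs
  exact h.ne (funext hs)

theorem finite_compLT (μ : Fin n → ℕ) : {ν | CompLT ν μ}.Finite := by
  refine (Set.finite_Icc (0 : Fin n → ℕ) fun _ => ∑ i, μ i).subset fun ν hν => ⟨fun i => zero_le, fun i => ?_⟩
  rw [← CompLT.sum_eq hν]
  exact Finset.single_le_sum (fun _ _ => Nat.zero_le _) (Finset.mem_univ i)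

/-! ## Extending a map on adjacent transpositions to the symmetric group -/

/-- The adjacent transposition of the positions `i` and `i + 1` (counted from zero). -/
def adj (n i : ℕ) : Perm (Fin n) :=
  if h : i + 1 < n then swap ⟨i, Nat.lt_of_succ_lt h⟩ ⟨i + 1, h⟩ else 1

theorem adj_eq {i : ℕ} (h : i + 1 < n) : adj n i = swap ⟨i, Nat.lt_of_succ_lt h⟩ ⟨i + 1, h⟩ :=
  dif_pos h

theorem adj_left {i : ℕ} (h : i + 1 < n) : adj n i ⟨i, Nat.lt_of_succ_lt h⟩ = ⟨i + 1, h⟩ := by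
  rw [adj_eq h, Equiv.swap_apply_left]

theorem adj_right {i : ℕ} (h : i + 1 < n) : adj n i ⟨i + 1, h⟩ = ⟨i, Nat.lt_of_succ_lt h⟩ := by
  rw [adj_eq h, Equiv.swap_apply_right]

theorem adj_of_ne {i : ℕ} {k : Fin n} (h1 : (k : ℕ) ≠ i) (h2 : (k : ℕ) ≠ i + 1) :
    adj n i k = k := by
  unfold adj
  split_ifs with h
  · exact Equiv.swap_apply_of_ne_of_ne (by simpa [Fin.ext_iff] using h1)
      (by simpa [Fin.ext_iff] using h2)
  · rfl

theorem adj_mul_self (i : ℕ) : adj n i * adj n i = 1 := by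
  unfold adj
  split_ifs
  · exact Equiv.swap_mul_self _ _
  · rfl

theorem adj_comm {i j : ℕ} (h : i + 1 < j) : adj n i * adj n j = adj n j * adj n i := by
  by_cases hj : j + 1 < n
  · ext k
    have hi : i + 1 < n := by omega
    simp only [Perm.mul_apply]
    rcases eq_or_ne (k : ℕ) i with h1 | h1
    · obtain rfl : k = ⟨i, Nat.lt_of_succ_lt hi⟩ := Fin.ext h1
      rw [adj_left hi, adj_of_ne (i := j) (by simp; omega) (by simp; omega),
        adj_left hi, adj_of_ne (by simp; omega) (by simp; omega)]
    rcases eq_or_ne (k : ℕ) (i + 1) with h2 | h2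
    · obtain rfl : k = ⟨i + 1, by omega⟩ := Fin.ext h2
      rw [adj_right hi, adj_of_ne (i := j) (by simp; omega) (by simp; omega),
        adj_right hi, adj_of_ne (by simp; omega) (by simp; omega)]
    rw [adj_of_ne (i := i) h1 h2]
    rcases eq_or_ne (k : ℕ) j with h3 | h3
    · obtain rfl : k = ⟨j, Nat.lt_of_succ_lt hj⟩ := Fin.ext h3
      rw [adj_left hj, adj_of_ne (by simp; omega) (by simp; omega)]
    rcases eq_or_ne (k : ℕ) (j + 1) with h4 | h4
    · obtain rfl : k = ⟨j + 1, by omega⟩ := Fin.ext h4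
      rw [adj_right hj, adj_of_ne (by simp; omega) (by simp; omega)]
    rw [adj_of_ne (i := j) h3 h4, adj_of_ne (i := i) h1 h2]
  · have : adj n j = 1 := dif_neg hj
    rw [this, one_mul, mul_one]

theorem adj_braid {i : ℕ} (h : i + 2 < n) :
    adj n i * adj n (i + 1) * adj n i = adj n (i + 1) * adj n i * adj n (i + 1) := by
  ext k
  have h1 : i + 1 < n := by omega
  have h2 : i + 1 + 1 < n := by omega
  simp only [Perm.mul_apply]
  rcases eq_or_ne (k : ℕ) i with e | e
  · obtain rfl : k = ⟨i, Nat.lt_of_succ_lt h1⟩ := Fin.ext e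
    rw [adj_left h1, adj_left h2, adj_of_ne (i := i) (by simp; omega) (by simp),
      adj_of_ne (i := i + 1) (k := ⟨i, by omega⟩) (by simp) (by simp; omega), adj_left h1, adj_left h2]
  rcases eq_or_ne (k : ℕ) (i + 1) with e' | e'
  · obtain rfl : k = ⟨i + 1, by omega⟩ := Fin.ext e'
    rw [adj_right h1, adj_left h2, adj_of_ne (i := i) (k := ⟨i + 1 + 1, by omega⟩)
      (by simp; omega) (by simp), adj_of_ne (i := i + 1) (k := ⟨i, by omega⟩) (by simp)
      (by simp; omega), adj_left h1, adj_right h2]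
  rcases eq_or_ne (k : ℕ) (i + 2) with e'' | e''
  · obtain rfl : k = ⟨i + 1 + 1, by omega⟩ := Fin.ext e''
    rw [adj_right h2, adj_right h1, adj_of_ne (i := i) (k := ⟨i + 1 + 1, by omega⟩)
      (by simp; omega) (by simp), adj_right h2, adj_right h1, adj_of_ne (i := i + 1) (by simp)
      (by simp; omega)]
  rw [adj_of_ne (i := i) e e', adj_of_ne (i := i + 1) e' (by omega), adj_of_ne (i := i) e e',
    adj_of_ne (i := i + 1) e' (by omega)]

theorem adj_induction {p : Perm (Fin n) → Prop} (one : p 1)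
    (mul : ∀ w i, i + 1 < n → p w → p (w * adj n i)) (w : Perm (Fin n)) : p w := by
  cases n with
  | zero => rwa [Subsingleton.elim w 1]
  | succ m =>
    have hw : w ∈ Submonoid.closure (Set.range fun i : Fin m => swap i.castSucc i.succ) := by
      rw [Perm.mclosure_swap_castSucc_succ]; trivial
    induction hw using Submonoid.closure_induction_right with
    | one => exact one
    | mul_right x hx y hy ih =>
      obtain ⟨i, rfl⟩ := hy
      have hi : (i : ℕ) + 1 < m + 1 := by omega
      have := mul x i hi ih
      rwa [adj_eq hi] at this

/-- `i` is a right descent of `w`. -/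
def IsDesc (w : Perm (Fin n)) (i : ℕ) : Prop :=
  ∃ h : i + 1 < n, w ⟨i + 1, h⟩ < w ⟨i, Nat.lt_of_succ_lt h⟩

theorem IsDesc.invCount_lt {w : Perm (Fin n)} {i : ℕ} (h : IsDesc w i) :
    invCount (w * adj n i) < invCount w := by
  obtain ⟨h, h'⟩ := h
  rw [adj_eq h]
  exact invCount_mul_swap_lt w (by simp [Fin.lt_def]) h'

section Extend

variable {R : Type*} [Monoid R] (g : ℕ → R)

open Classical in
/-- The product of the `g i` along a reduced word of `w`. -/
noncomputable def wordProd (w : Perm (Fin n)) : R :=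
  if h : ∃ i, IsDesc w i then wordProd (w * adj n h.choose) * g h.choose else 1
termination_by invCount w
decreasing_by exact h.choose_spec.invCount_lt

variable {g}

/-- `wordProd` strips an arbitrary descent, and this compares two choices. Distant descents can both
be stripped and the two letters commute; for adjacent descents all three letters of a braid can be
stripped, in either spelling. `ih` allows this on the shorter permutations met on the way. -/
theorem wordProd_diamond
    (hc : ∀ i j, i + 1 < j → j + 1 < n → g i * g j = g j * g i)
    (hb : ∀ i, i + 2 < n → g i * g (i + 1) * g i = g (i + 1) * g i * g (i + 1))
    (w : Perm (Fin n))
    (ih : ∀ v : Perm (Fin n), invCount v < invCount w → ∀ i, IsDesc v i →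
      wordProd g v = wordProd g (v * adj n i) * g i)
    {i j : ℕ} (hij : i < j) (hi : IsDesc w i) (hj : IsDesc w j) :
    wordProd g (w * adj n i) * g i = wordProd g (w * adj n j) * g j := by
  obtain ⟨hi1, hi2⟩ := id hi
  obtain ⟨hj1, hj2⟩ := id hj
  rcases Nat.lt_or_ge (i + 1) j with hfar | hnear
  · have d1 : IsDesc (w * adj n i) j := ⟨hj1, by
      rw [Perm.mul_apply, Perm.mul_apply, adj_of_ne (by simp; omega) (by simp; omega),
        adj_of_ne (by simp; omega) (by simp; omega)]; exact hj2⟩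
    have d2 : IsDesc (w * adj n j) i := ⟨hi1, by
      rw [Perm.mul_apply, Perm.mul_apply, adj_of_ne (by simp; omega) (by simp; omega),
        adj_of_ne (by simp; omega) (by simp; omega)]; exact hi2⟩
    rw [ih _ hi.invCount_lt _ d1, ih _ hj.invCount_lt _ d2, mul_assoc, mul_assoc, mul_assoc,
      mul_assoc, adj_comm hfar, hc i j hfar hj1]
  · obtain rfl : j = i + 1 := by omega
    have e1 : adj n i ⟨i + 1 + 1, hj1⟩ = ⟨i + 1 + 1, hj1⟩ :=
      adj_of_ne (by simp; omega) (by simp)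
    have e2 : adj n (i + 1) ⟨i, by omega⟩ = ⟨i, by omega⟩ := adj_of_ne (by simp) (by simp; omega)
    have d1 : IsDesc (w * adj n i) (i + 1) := ⟨hj1, by
      rw [Perm.mul_apply, Perm.mul_apply, e1, adj_right hi1]; exact hj2.trans hi2⟩
    have d1' : IsDesc (w * adj n i * adj n (i + 1)) i := ⟨hi1, by
      rw [Perm.mul_apply, Perm.mul_apply, Perm.mul_apply, Perm.mul_apply, adj_left hj1, e1, e2,
        adj_left hi1]; exact hj2⟩
    have d2 : IsDesc (w * adj n (i + 1)) i := ⟨hi1, by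
      rw [Perm.mul_apply, Perm.mul_apply, adj_left hj1, e2]; exact hj2.trans hi2⟩
    have d2' : IsDesc (w * adj n (i + 1) * adj n i) (i + 1) := ⟨hj1, by
      rw [Perm.mul_apply, Perm.mul_apply, Perm.mul_apply, Perm.mul_apply, adj_right hi1, e1, e2,
        adj_right hj1]; exact hi2⟩
    rw [ih _ hi.invCount_lt _ d1, ih _ (d1.invCount_lt.trans hi.invCount_lt) _ d1',
      ih _ hj.invCount_lt _ d2, ih _ (d2.invCount_lt.trans hj.invCount_lt) _ d2']
    have a := adj_braid (n := n) (i := i) (by omega)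
    have b := hb i (by omega)
    simp only [mul_assoc] at a b ⊢
    rw [a, b]

/-- By induction on the length the choice made in the definition of `wordProd` is immaterial. -/
theorem wordProd_of_isDesc
    (hc : ∀ i j, i + 1 < j → j + 1 < n → g i * g j = g j * g i)
    (hb : ∀ i, i + 2 < n → g i * g (i + 1) * g i = g (i + 1) * g i * g (i + 1))
    (w : Perm (Fin n)) (i : ℕ) (hi : IsDesc w i) :
    wordProd g w = wordProd g (w * adj n i) * g i := by
  induction hN : invCount w using Nat.strong_induction_on generalizing w i with
  | _ N ih =>
    subst hN
    have hex : ∃ i, IsDesc w i := ⟨i, hi⟩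
    have h0 : wordProd g w = wordProd g (w * adj n hex.choose) * g hex.choose := by
      rw [wordProd, dif_pos hex]
    rw [h0]
    have ih' : ∀ v : Perm (Fin n), invCount v < invCount w → ∀ i, IsDesc v i →
      wordProd g v = wordProd g (v * adj n i) * g i := fun v hv i hi => ih _ hv v i hi rfl
    rcases lt_trichotomy hex.choose i with h | h | h
    · exact wordProd_diamond hc hb w ih' h hex.choose_spec hi
    · rw [h]
    · exact (wordProd_diamond hc hb w ih' h hi hex.choose_spec).symm

/-- This is the half of the Coxeter presentation of the symmetric group that produces homomorphisms.
It is what turns Young's operators into a representation. -/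
theorem exists_monoidHom_of_adj
    (h2 : ∀ i, i + 1 < n → g i * g i = 1)
    (hc : ∀ i j, i + 1 < j → j + 1 < n → g i * g j = g j * g i)
    (hb : ∀ i, i + 2 < n → g i * g (i + 1) * g i = g (i + 1) * g i * g (i + 1)) :
    ∃ ρ : Perm (Fin n) →* R, ∀ i, i + 1 < n → ρ (adj n i) = g i := by
  have h1 : wordProd (n := n) g 1 = 1 := by
    rw [wordProd, dif_neg]
    rintro ⟨i, h, h'⟩
    simp [Fin.lt_def] at h'
  have hmul : ∀ (w : Perm (Fin n)) i, i + 1 < n → wordProd g (w * adj n i) = wordProd g w * g i := by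
    intro w i hi
    have hne : w ⟨i + 1, hi⟩ ≠ w ⟨i, by omega⟩ := fun h => by simpa using w.injective h
    rcases lt_or_gt_of_ne hne with h | h
    · rw [wordProd_of_isDesc hc hb w i ⟨hi, h⟩, mul_assoc, h2 i hi, mul_one]
    · rw [wordProd_of_isDesc hc hb (w * adj n i) i ⟨hi, by
        rwa [Perm.mul_apply, Perm.mul_apply, adj_right hi, adj_left hi]⟩, mul_assoc w,
        adj_mul_self, mul_one]
  refine ⟨⟨⟨wordProd g, h1⟩, fun v w => ?_⟩, fun i hi => ?_⟩
  · induction w using adj_induction with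
    | one => simp [h1]
    | mul w i hi ih =>
      simp only at ih ⊢
      rw [← mul_assoc, hmul _ _ hi, ih, hmul _ _ hi, mul_assoc]
  · have := hmul 1 i hi
    rwa [one_mul, h1, one_mul] at this

end Extend

/-! ## Elements of `G(r,1,n)` -/

/-- The generator `ζ` of the group of `r`-th roots of unity. -/
noncomputable def zu (r : ℕ) [NeZero r] : rootsOfUnity r ℂ :=
  rootsOfUnity.mkOfPowEq (zeta r) (zeta_pow r)

/-- The underlying complex number of a root of unity. -/
def uval (η : rootsOfUnity r ℂ) : ℂ := ((η : ℂˣ) : ℂ)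

@[simp] theorem uval_one : uval (1 : rootsOfUnity r ℂ) = 1 := rfl
@[simp] theorem uval_mul (a b : rootsOfUnity r ℂ) : uval (a * b) = uval a * uval b := rfl
@[simp] theorem uval_inv (a : rootsOfUnity r ℂ) : uval a⁻¹ = (uval a)⁻¹ := by
  simp [uval]
@[simp] theorem uval_pow (a : rootsOfUnity r ℂ) (k : ℕ) : uval (a ^ k) = uval a ^ k := by
  simp [uval]
theorem uval_ne_zero (a : rootsOfUnity r ℂ) : uval a ≠ 0 := Units.ne_zero _
theorem uval_injective : Function.Injective (uval (r := r)) := fun _ _ h =>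
  Subtype.ext (Units.ext h)
theorem uval_pow_eq_one (a : rootsOfUnity r ℂ) : uval a ^ r = 1 := by
  have := a.2
  rw [mem_rootsOfUnity] at this
  rw [uval, ← Units.val_pow_eq_pow_val, this, Units.val_one]

@[simp] theorem uval_zu [NeZero r] : uval (zu r) = zeta r := rfl

theorem zeta_ne_zero [NeZero r] : zeta r ≠ 0 := uval_zu (r := r) ▸ uval_ne_zero _

theorem zeta_primitive [NeZero r] : IsPrimitiveRoot (zeta r) r :=
  Complex.isPrimitiveRoot_exp r (NeZero.ne r)

theorem exists_zu_pow [NeZero r] (η : rootsOfUnity r ℂ) : ∃ l, l < r ∧ zu r ^ l = η := by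
  obtain ⟨l, hl, h⟩ := (zeta_primitive (r := r)).eq_pow_of_pow_eq_one (uval_pow_eq_one η)
  exact ⟨l, hl, uval_injective (by rw [uval_pow, uval_zu, h])⟩

noncomputable instance [NeZero r] : Fintype (rootsOfUnity r ℂ) := Fintype.ofFinite _

/-- A sum over exponents becomes a sum over the group of roots of unity, which can be reindexed by
translation and inversion. -/
theorem sum_range_zu [NeZero r] {M : Type*} [AddCommMonoid M] (F : rootsOfUnity r ℂ → M) :
    ∑ l ∈ Finset.range r, F (zu r ^ l) = ∑ η, F η := by
  refine Finset.sum_bij (fun l _ => zu r ^ l) (fun _ _ => Finset.mem_univ _) ?_ ?_ (fun _ _ => rfl)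
  · intro a ha b hb h
    have := congrArg uval h
    simp only [uval_pow, uval_zu] at this
    exact (zeta_primitive (r := r)).pow_inj (Finset.mem_range.mp ha) (Finset.mem_range.mp hb) this
  · intro η _
    obtain ⟨l, hl, h⟩ := exists_zu_pow η
    exact ⟨l, Finset.mem_range.mpr hl, h⟩

/-- The diagonal matrix with `η` in position `i`. -/
def dg (i : Fin n) (η : rootsOfUnity r ℂ) : W r n := SemidirectProduct.inl (Pi.mulSingle i η)

/-- The reflection `ζ_i^l s_{ij} ζ_i^{-l}` for `η = ζ^l`. -/
def refl (i j : Fin n) (η : rootsOfUnity r ℂ) : W r n :=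
  SemidirectProduct.inl (Pi.mulSingle i η * (Pi.mulSingle j η)⁻¹) * perm (swap i j)

@[simp] theorem permAct_apply (w : Perm (Fin n)) (a : Fin n → rootsOfUnity r ℂ) (i : Fin n) :
    permAct n (rootsOfUnity r ℂ) w a i = a (w⁻¹ i) := rfl

theorem permAct_mulSingle (w : Perm (Fin n)) (i : Fin n) (η : rootsOfUnity r ℂ) :
    permAct n (rootsOfUnity r ℂ) w (Pi.mulSingle i η) = Pi.mulSingle (w i) η := by
  funext k
  rw [permAct_apply]
  rcases eq_or_ne k (w i) with rfl | h
  · have : w⁻¹ (w i) = i := w.symm_apply_apply i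
    rw [this, Pi.mulSingle_eq_same, Pi.mulSingle_eq_same]
  · rw [Pi.mulSingle_eq_of_ne h, Pi.mulSingle_eq_of_ne]
    rintro rfl
    exact h (w.apply_symm_apply k).symm

theorem perm_mul_inl (w : Perm (Fin n)) (a : Fin n → rootsOfUnity r ℂ) :
    (perm w : W r n) * SemidirectProduct.inl a =
      SemidirectProduct.inl (permAct n _ w a) * perm w := by
  rw [SemidirectProduct.inl_aut, perm, map_inv, inv_mul_cancel_right]

theorem perm_mul (v w : Perm (Fin n)) : (perm (v * w) : W r n) = perm v * perm w :=
  map_mul SemidirectProduct.inr v w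

@[simp] theorem perm_one : (perm 1 : W r n) = 1 := map_one SemidirectProduct.inr

theorem perm_inv (w : Perm (Fin n)) : (perm w⁻¹ : W r n) = (perm w)⁻¹ :=
  map_inv SemidirectProduct.inr w

@[simp] theorem perm_left (w : Perm (Fin n)) (i : Fin n) : (perm w : W r n).left i = 1 := rfl
@[simp] theorem perm_right (w : Perm (Fin n)) : (perm w : W r n).right = w := rfl

theorem eq_inl_mul_perm (w : W r n) : w = SemidirectProduct.inl w.left * perm w.right :=
  (SemidirectProduct.inl_left_mul_inr_right w).symm

theorem dg_one (i : Fin n) : (dg i 1 : W r n) = 1 := by rw [dg, Pi.mulSingle_one, map_one]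

theorem dg_mul (i : Fin n) (η θ : rootsOfUnity r ℂ) : dg i (η * θ) = dg i η * dg i θ := by
  rw [dg, Pi.mulSingle_mul, map_mul]; rfl

theorem dg_pow (i : Fin n) (η : rootsOfUnity r ℂ) (k : ℕ) : dg i (η ^ k) = dg i η ^ k := by
  induction k with
  | zero => rw [pow_zero, pow_zero, dg_one]
  | succ k ih => rw [pow_succ, pow_succ, dg_mul, ih]

theorem dg_inv (i : Fin n) (η : rootsOfUnity r ℂ) : dg i η⁻¹ = (dg i η)⁻¹ := by
  rw [eq_comm, inv_eq_iff_mul_eq_one, ← dg_mul, mul_inv_cancel, dg_one]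

theorem inl_mul_dg (a : Fin n → rootsOfUnity r ℂ) (i : Fin n) (η : rootsOfUnity r ℂ) :
    SemidirectProduct.inl a * dg i η = dg i η * SemidirectProduct.inl a := by
  rw [dg, ← map_mul, ← map_mul, mul_comm]

theorem dg_comm (i j : Fin n) (η θ : rootsOfUnity r ℂ) : dg i η * dg j θ = dg j θ * dg i η :=
  inl_mul_dg _ _ _

theorem mul_dg (w : W r n) (i : Fin n) (η : rootsOfUnity r ℂ) :
    w * dg i η = dg (w.right i) η * w := by
  conv_lhs => rw [eq_inl_mul_perm w]
  conv_rhs => rw [eq_inl_mul_perm w]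
  rw [mul_assoc, dg, perm_mul_inl, permAct_mulSingle, ← mul_assoc, ← dg, inl_mul_dg, mul_assoc]
  rfl

theorem zetaAt_eq [NeZero r] (i : Fin n) : zetaAt i = dg i (zu r) := rfl

theorem reflect_eq [NeZero r] (i j : Fin n) (l : ℕ) : reflect i j l = refl i j (zu r ^ l) := by
  rw [reflect, zetaAt_eq, ← dg_pow, dg, ← map_inv, mul_assoc, perm_mul_inl, map_inv,
    permAct_mulSingle, Equiv.swap_apply_left, ← mul_assoc, ← map_mul]
  rfl

theorem sum_reflect [NeZero r] {M : Type*} [AddCommMonoid M] (F : W r n → M) (i j : Fin n) :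
    ∑ l ∈ Finset.range r, F (reflect i j l) = ∑ η, F (refl i j η) := by
  rw [← sum_range_zu fun η => F (refl i j η)]
  simp only [reflect_eq]

theorem refl_symm (i j : Fin n) (η : rootsOfUnity r ℂ) : refl i j η = refl j i η⁻¹ := by
  rw [refl, refl, Equiv.swap_comm, Pi.mulSingle_inv, Pi.mulSingle_inv, inv_inv, mul_comm]

theorem perm_mul_refl (w : Perm (Fin n)) (i j : Fin n) (η : rootsOfUnity r ℂ) :
    perm w * refl i j η = refl (w i) (w j) η * perm w := by
  rw [refl, ← mul_assoc, perm_mul_inl, map_mul, map_inv, permAct_mulSingle, permAct_mulSingle,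
    mul_assoc, ← perm_mul, Equiv.mul_swap_eq_swap_mul, perm_mul, ← mul_assoc, refl]

theorem inl_mul_refl (a : Fin n → rootsOfUnity r ℂ) {i j : Fin n} (hij : i ≠ j)
    (η : rootsOfUnity r ℂ) : SemidirectProduct.inl a * refl i j η =
      refl i j (η * a i * (a j)⁻¹) * SemidirectProduct.inl a := by
  rw [refl, refl, mul_assoc, perm_mul_inl, ← mul_assoc, ← mul_assoc, ← map_mul, ← map_mul]
  congr 2
  funext k
  simp only [Pi.mul_apply, Pi.inv_apply, permAct_apply, Equiv.swap_inv]
  rcases eq_or_ne k i with rfl | hk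
  · rw [Pi.mulSingle_eq_same, Pi.mulSingle_eq_of_ne hij, Pi.mulSingle_eq_same,
      Pi.mulSingle_eq_of_ne hij, Equiv.swap_apply_left]
    simp [mul_comm]
  · rcases eq_or_ne k j with rfl | hk'
    · rw [Pi.mulSingle_eq_same, Pi.mulSingle_eq_of_ne hk, Pi.mulSingle_eq_same,
        Pi.mulSingle_eq_of_ne hk, Equiv.swap_apply_right, one_mul, one_mul, mul_inv_rev, inv_inv,
        mul_inv_rev, mul_comm (a i)⁻¹, ← mul_assoc, inv_mul_cancel_right]
    · rw [Pi.mulSingle_eq_of_ne hk, Pi.mulSingle_eq_of_ne hk', Pi.mulSingle_eq_of_ne hk,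
        Pi.mulSingle_eq_of_ne hk', Equiv.swap_apply_of_ne_of_ne hk hk']
      simp

theorem mul_refl (w : W r n) {i j : Fin n} (hij : i ≠ j) (η : rootsOfUnity r ℂ) :
    w * refl i j η =
      refl (w.right i) (w.right j) (η * w.left (w.right i) * (w.left (w.right j))⁻¹) * w := by
  conv_lhs => rw [eq_inl_mul_perm w]
  rw [mul_assoc, perm_mul_refl, ← mul_assoc, inl_mul_refl _ (fun h => hij (w.right.injective h)),
    mul_assoc, ← eq_inl_mul_perm w]

theorem refl_right (i j : Fin n) (η : rootsOfUnity r ℂ) : (refl i j η).right = swap i j := by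
  simp [refl, perm]

theorem refl_left {i j : Fin n} (k : Fin n) (η : rootsOfUnity r ℂ) :
    (refl i j η).left k =
      (Pi.mulSingle i η : Fin n → _) k * ((Pi.mulSingle j η : Fin n → rootsOfUnity r ℂ) k)⁻¹ := by
  simp [refl, perm]

theorem refl_mul_perm_swap (i j : Fin n) (η : rootsOfUnity r ℂ) :
    refl i j η * perm (swap i j) = dg i η * (dg j η)⁻¹ := by
  rw [refl, mul_assoc, ← perm_mul, Equiv.swap_mul_self, perm_one, mul_one, map_mul, map_inv]
  rfl

end

section

variable {r n : ℕ} [NeZero r]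

/-! ## Standard tableaux -/

section Tableaux

variable {lam : MultiPartition r n}

theorem IsStandard.lt_of_le {T : Fin n ≃ Box lam} (hT : IsStandard T) {l : ZMod r}
    {c c' : {c : ℕ × ℕ // c ∈ lam.part l}} (h1 : c.1.1 ≤ c'.1.1) (h2 : c.1.2 ≤ c'.1.2)
    (hne : c ≠ c') : T.symm ⟨l, c⟩ < T.symm ⟨l, c'⟩ := by
  rcases h1.eq_or_lt with e1 | h1
  · rcases h2.eq_or_lt with e2 | h2
    · exact absurd (Subtype.ext (Prod.ext e1 e2)) hne
    · exact hT l c c' (Or.inl ⟨e1, h2⟩)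
  · rcases h2.eq_or_lt with e2 | h2
    · exact hT l c c' (Or.inr ⟨e2, h1⟩)
    · let m : {c : ℕ × ℕ // c ∈ lam.part l} :=
        ⟨(c.1.1, c'.1.2), (lam.part l).up_left_mem h1.le le_rfl c'.2⟩
      exact (hT l c m (Or.inl ⟨rfl, h2⟩)).trans (hT l m c' (Or.inr ⟨rfl, h1⟩))

theorem exists_cells {T : Fin n ≃ Box lam} {i j : Fin n} (h : (T i).beta = (T j).beta) :
    ∃ (l : ZMod r) (c c' : {c : ℕ × ℕ // c ∈ lam.part l}), T i = ⟨l, c⟩ ∧ T j = ⟨l, c'⟩ := by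
  rcases hi : T i with ⟨l, c⟩
  rcases hj : T j with ⟨l', c'⟩
  rw [hi, hj] at h
  obtain rfl : l = l' := h
  exact ⟨l, c, c', rfl, rfl⟩

/-- No cell lies strictly between the cells of consecutive entries in the north-west order. -/
theorem IsStandard.no_between {T : Fin n ≃ Box lam} (hT : IsStandard T) {i j : Fin n}
    (hij : (i : ℕ) + 1 = j) {l : ZMod r} {c c' : {c : ℕ × ℕ // c ∈ lam.part l}}
    (hi : T i = ⟨l, c⟩) (hj : T j = ⟨l, c'⟩) :
    ¬ (c'.1.1 ≤ c.1.1 ∧ c'.1.2 ≤ c.1.2) ∧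
      ∀ m : ℕ × ℕ, c.1.1 ≤ m.1 → c.1.2 ≤ m.2 → m.1 ≤ c'.1.1 → m.2 ≤ c'.1.2 → m = c.1 ∨ m = c'.1 := by
  have si : T.symm ⟨l, c⟩ = i := by rw [← hi, T.symm_apply_apply]
  have sj : T.symm ⟨l, c'⟩ = j := by rw [← hj, T.symm_apply_apply]
  refine ⟨fun h => ?_, fun m h1 h2 h3 h4 => ?_⟩
  · have hne : c' ≠ c := by
      rintro rfl
      rw [si] at sj
      subst sj
      omega
    have := hT.lt_of_le h.1 h.2 hne
    rw [si, sj, Fin.lt_def] at this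
    omega
  · by_contra hcon
    push Not at hcon
    let m' : {c : ℕ × ℕ // c ∈ lam.part l} := ⟨m, (lam.part l).up_left_mem h3 h4 c'.2⟩
    have a := hT.lt_of_le (c := c) (c' := m') h1 h2 (fun e => hcon.1 (congrArg Subtype.val e).symm)
    have b := hT.lt_of_le (c := m') (c' := c') h3 h4 (fun e => hcon.2 (congrArg Subtype.val e))
    rw [si, Fin.lt_def] at a
    rw [sj, Fin.lt_def] at b
    omega

/-- Two cells on one diagonal span a rectangle with a further corner strictly between them in the
north-west order, which is impossible for consecutive entries. -/
theorem IsStandard.ct_ne {T : Fin n ≃ Box lam} (hT : IsStandard T) {i j : Fin n}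
    (hij : (i : ℕ) + 1 = j) (hβ : (T i).beta = (T j).beta) : (T j).ct - (T i).ct ≠ 0 := by
  obtain ⟨l, c, c', hi, hj⟩ := exists_cells hβ
  obtain ⟨h1, h2⟩ := hT.no_between hij hi hj
  have h3 := h2 (c.1.1, c'.1.2) le_rfl
  rw [hi, hj]
  simp only [Box.ct, Prod.ext_iff] at *
  omega

/-- Two cells on one diagonal span a rectangle with two further corners, both strictly in between,
but only one entry lies between i and i + 2. This allows the division in the braid relation. -/
theorem IsStandard.ct_ne_two {T : Fin n ≃ Box lam} (hT : IsStandard T) {i k : Fin n}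
    (hik : (i : ℕ) + 2 = k) (hβ : (T i).beta = (T k).beta) : (T k).ct - (T i).ct ≠ 0 := by
  obtain ⟨l, c, c', hi, hk⟩ := exists_cells hβ
  have si : T.symm ⟨l, c⟩ = i := by rw [← hi, T.symm_apply_apply]
  have sk : T.symm ⟨l, c'⟩ = k := by rw [← hk, T.symm_apply_apply]
  intro h
  rw [hi, hk] at h
  simp only [Box.ct] at h
  have hne : c ≠ c' := by
    rintro rfl
    rw [si] at sk
    subst sk
    omega
  have hne1 : ¬ (c.1.1 = c'.1.1 ∧ c.1.2 = c'.1.2) := fun h => hne (Subtype.ext (Prod.ext h.1 h.2))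
  rcases lt_or_ge c.1.1 c'.1.1 with h1 | h1
  · have h2 : c.1.2 < c'.1.2 := by omega
    let m : {c : ℕ × ℕ // c ∈ lam.part l} :=
      ⟨(c.1.1, c'.1.2), (lam.part l).up_left_mem h1.le le_rfl c'.2⟩
    let m' : {c : ℕ × ℕ // c ∈ lam.part l} :=
      ⟨(c'.1.1, c.1.2), (lam.part l).up_left_mem le_rfl h2.le c'.2⟩
    have a1 := hT l c m (Or.inl ⟨rfl, h2⟩)
    have a2 := hT l m c' (Or.inr ⟨rfl, h1⟩)
    have b1 := hT l c m' (Or.inr ⟨rfl, h1⟩)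
    have b2 := hT l m' c' (Or.inl ⟨rfl, h2⟩)
    rw [si, Fin.lt_def] at a1 b1
    rw [sk, Fin.lt_def] at a2 b2
    have e : T.symm ⟨l, m⟩ = T.symm ⟨l, m'⟩ := Fin.ext (by omega)
    have e' := T.symm.injective e
    simp only [Sigma.mk.injEq, heq_eq_eq, true_and] at e'
    have := congrArg (fun c => c.1.1) e'
    simp only [m, m'] at this
    omega
  · have := hT.lt_of_le (c := c') (c' := c) h1 (by omega) hne.symm
    rw [si, sk, Fin.lt_def] at this
    omega

theorem IsStandard.ct_zero {T : Fin n ≃ Box lam} (hT : IsStandard T) {i : Fin n}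
    (hi : (i : ℕ) = 0) : (T i).ct = 0 := by
  rcases hc : T i with ⟨l, c⟩
  have si : T.symm ⟨l, c⟩ = i := by rw [← hc, T.symm_apply_apply]
  let m : {c : ℕ × ℕ // c ∈ lam.part l} := ⟨(0, 0), (lam.part l).up_left_mem (Nat.zero_le _) (Nat.zero_le _) c.2⟩
  by_cases h : m = c
  · rw [← h]; simp [Box.ct, m]
  · have := hT.lt_of_le (c := m) (c' := c) (Nat.zero_le _) (Nat.zero_le _) h
    rw [si, Fin.lt_def] at this
    omega

theorem swapT_apply (i j : Fin n) (T : Fin n ≃ Box lam) (k : Fin n) :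
    swapT i j T k = T (swap i j k) := rfl

theorem swapT_symm_apply (i j : Fin n) (T : Fin n ≃ Box lam) (b : Box lam) :
    (swapT i j T).symm b = swap i j (T.symm b) := by
  simp [swapT]

theorem swapT_swapT (i j : Fin n) (T : Fin n ≃ Box lam) : swapT i j (swapT i j T) = T := by
  ext k : 1
  rw [swapT_apply, swapT_apply, Equiv.swap_apply_self]

/-- Exchanging consecutive entries can spoil only the comparison of these two. Their cells are then
in one row or column with nothing in between, hence neighbours. -/
theorem IsStandard.of_not_swap {T : Fin n ≃ Box lam} (hT : IsStandard T) {i j : Fin n}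
    (hij : (i : ℕ) + 1 = j) (hs : ¬ IsStandard (swapT i j T)) :
    (T i).beta = (T j).beta ∧ ((T j).ct - (T i).ct = 1 ∨ (T j).ct - (T i).ct = -1) := by
  unfold IsStandard at hs
  push Not at hs
  obtain ⟨l, c, c', hcc, hle⟩ := hs
  have hlt := hT l c c' hcc
  rw [swapT_symm_apply, swapT_symm_apply] at hle
  obtain ⟨hi, hj⟩ : T.symm ⟨l, c⟩ = i ∧ T.symm ⟨l, c'⟩ = j := by
    simp only [Equiv.swap_apply_def] at hle
    split_ifs at hle with h1 h2 h3 h4 h5 h6 h7 h8 <;>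
      simp only [Fin.lt_def, Fin.le_def, Fin.ext_iff] at * <;> omega
  have hi' : T i = ⟨l, c⟩ := by rw [← hi, T.apply_symm_apply]
  have hj' : T j = ⟨l, c'⟩ := by rw [← hj, T.apply_symm_apply]
  obtain ⟨h1, h2⟩ := hT.no_between hij hi' hj'
  refine ⟨by rw [hi', hj']; rfl, ?_⟩
  rw [hi', hj']
  simp only [Box.ct]
  have h3 := h2 (c.1.1, c.1.2 + 1) le_rfl (by simp)
  have h4 := h2 (c.1.1 + 1, c.1.2) (by simp) le_rfl
  simp only [Prod.ext_iff] at h3 h4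
  omega

theorem IsStandard.not_swap {T : Fin n ≃ Box lam} (hT : IsStandard T) {i j : Fin n}
    (hij : (i : ℕ) + 1 = j) (hβ : (T i).beta = (T j).beta)
    (hct : (T j).ct - (T i).ct = 1 ∨ (T j).ct - (T i).ct = -1) : ¬ IsStandard (swapT i j T) := by
  obtain ⟨l, c, c', hi, hj⟩ := exists_cells hβ
  obtain ⟨h1, h2⟩ := hT.no_between hij hi hj
  have si : T.symm ⟨l, c⟩ = i := by rw [← hi, T.symm_apply_apply]
  have sj : T.symm ⟨l, c'⟩ = j := by rw [← hj, T.symm_apply_apply]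
  intro hs
  have key : (c.1.1 = c'.1.1 ∧ c.1.2 < c'.1.2) ∨ (c.1.2 = c'.1.2 ∧ c.1.1 < c'.1.1) := by
    rw [hi, hj] at hct
    simp only [Box.ct] at hct
    have h3 := h2 (c.1.1, c'.1.2) le_rfl
    simp only [Prod.ext_iff] at h3
    omega
  have := hs l c c' key
  rw [swapT_symm_apply, swapT_symm_apply, si, sj, Equiv.swap_apply_left, Equiv.swap_apply_right,
    Fin.lt_def] at this
  omega

/-- The diagonal coefficient of Young's orthonormal form. -/
noncomputable def yA (b b' : Box lam) : ℂ :=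
  if b.beta = b'.beta then (1 : ℂ) / ((b'.ct - b.ct : ℤ) : ℂ) else 0

/-- The off-diagonal coefficient of Young's orthonormal form. -/
noncomputable def yB (b b' : Box lam) : ℂ :=
  if b.beta = b'.beta then
    ((Real.sqrt (1 - (1 / ((b'.ct - b.ct : ℤ) : ℝ)) ^ 2) : ℝ) : ℂ) else 1

theorem yA_swap (b b' : Box lam) : yA b' b = - yA b b' := by
  unfold yA
  by_cases h : b.beta = b'.beta
  · rw [if_pos h, if_pos h.symm, ← neg_sub, Int.cast_neg, div_neg]
  · rw [if_neg h, if_neg (Ne.symm h), neg_zero]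

theorem yB_swap (b b' : Box lam) : yB b' b = yB b b' := by
  unfold yB
  by_cases h : b.beta = b'.beta
  · rw [if_pos h, if_pos h.symm, ← neg_sub b'.ct, Int.cast_neg, div_neg, neg_sq]
  · rw [if_neg h, if_neg (Ne.symm h)]

theorem yA_sq_add_yB_sq {b b' : Box lam} (h : b.beta = b'.beta → b'.ct - b.ct ≠ 0) :
    yA b b' ^ 2 + yB b b' ^ 2 = 1 := by
  unfold yA yB
  by_cases hb : b.beta = b'.beta
  · rw [if_pos hb, if_pos hb, ← Complex.ofReal_pow, Real.sq_sqrt]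
    · push_cast; ring
    · have hk := h hb
      -- A non-zero integer has square at least 1, so the radicand is non-negative and `Real.sqrt`
      -- takes no default value.
      have h1 : (1 : ℝ) ≤ ((b'.ct - b.ct : ℤ) : ℝ) ^ 2 := by
        have : 1 ≤ (b'.ct - b.ct) ^ 2 := by
          have := sq_pos_of_ne_zero hk
          omega
        exact_mod_cast this
      rw [one_div, inv_pow, sub_nonneg]
      exact inv_le_one_of_one_le₀ h1
  · rw [if_neg hb, if_neg hb]; ring

theorem yB_eq_zero {T : Fin n ≃ Box lam} (hT : IsStandard T) {i j : Fin n}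
    (hij : (i : ℕ) + 1 = j) (hs : ¬ IsStandard (swapT i j T)) : yB (T i) (T j) = 0 := by
  obtain ⟨h1, h2⟩ := hT.of_not_swap hij hs
  rw [yB, if_pos h1]
  rcases h2 with h2 | h2 <;> rw [h2] <;> norm_num

theorem yA_sq_eq_one {T : Fin n ≃ Box lam} (hT : IsStandard T) {i j : Fin n}
    (hij : (i : ℕ) + 1 = j) (hs : ¬ IsStandard (swapT i j T)) :
    yA (T i) (T j) * yA (T i) (T j) = 1 := by
  obtain ⟨h1, h2⟩ := hT.of_not_swap hij hs
  rw [yA, if_pos h1]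
  rcases h2 with h2 | h2 <;> rw [h2] <;> norm_num

theorem yB_ne_zero {T : Fin n ≃ Box lam} (hT : IsStandard T) {i j : Fin n}
    (hij : (i : ℕ) + 1 = j) (hs : IsStandard (swapT i j T)) : yB (T i) (T j) ≠ 0 := by
  intro h0
  have h := yA_sq_add_yB_sq (hT.ct_ne hij)
  rw [h0] at h
  unfold yB at h0
  split_ifs at h0 with hb
  · rw [yA, if_pos hb] at h
    have hk : (((T j).ct - (T i).ct : ℤ) : ℂ) ≠ 0 := by exact_mod_cast hT.ct_ne hij hb
    field_simp at h
    have h' : ((T j).ct - (T i).ct) ^ 2 = 1 := by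
      have : (1 : ℂ) = (((T j).ct - (T i).ct : ℤ) : ℂ) ^ 2 := by simpa using h
      exact_mod_cast this.symm
    exact hT.not_swap hij hb (by simpa using h') hs
  · exact one_ne_zero h0

/-- Within one component this is the partial fraction identity (1/(x+y))(1/x + 1/y) = 1/(xy) for
content differences x, y; in the other cases both sides vanish. It is the core of the braid
relation. -/
theorem yA_braid {b1 b2 b3 : Box lam} (h12 : b1.beta = b2.beta → b2.ct - b1.ct ≠ 0)
    (h23 : b2.beta = b3.beta → b3.ct - b2.ct ≠ 0) (h13 : b1.beta = b3.beta → b3.ct - b1.ct ≠ 0) :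
    yA b1 b3 * (yA b1 b2 + yA b2 b3) = yA b1 b2 * yA b2 b3 := by
  unfold yA
  by_cases e12 : b1.beta = b2.beta
  · by_cases e23 : b2.beta = b3.beta
    · rw [if_pos e12, if_pos e23, if_pos (e12.trans e23)]
      have a : ((b2.ct - b1.ct : ℤ) : ℂ) ≠ 0 := by exact_mod_cast h12 e12
      have b : ((b3.ct - b2.ct : ℤ) : ℂ) ≠ 0 := by exact_mod_cast h23 e23
      have c : ((b3.ct - b1.ct : ℤ) : ℂ) ≠ 0 := by exact_mod_cast h13 (e12.trans e23)
      field_simp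
      push_cast
      ring
    · rw [if_neg e23, if_neg (fun h => e23 (e12.symm.trans h))]; ring
  · by_cases e23 : b2.beta = b3.beta
    · rw [if_neg e12, if_neg (fun h => e12 (h.trans e23.symm))]; ring
    · rw [if_neg e12, if_neg e23]; ring

end Tableaux

/-! ## Young's orthonormal form -/

section Young

variable {lam : MultiPartition r n}

/-- Young's operator on the space of all fillings. -/
noncomputable def fillOp (i j : Fin n) : ((Fin n ≃ Box lam) →₀ ℂ) →ₗ[ℂ] ((Fin n ≃ Box lam) →₀ ℂ) :=
  Finsupp.linearCombination ℂ fun T => yA (T i) (T j) • Finsupp.single T 1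
    + yB (T i) (T j) • Finsupp.single (swapT i j T) 1

theorem fillOp_single (i j : Fin n) (T : Fin n ≃ Box lam) :
    fillOp i j (Finsupp.single T 1) = yA (T i) (T j) • Finsupp.single T 1
      + yB (T i) (T j) • Finsupp.single (swapT i j T) 1 := by
  rw [fillOp, Finsupp.linearCombination_single, one_smul]

theorem fillOp_fillOp {i j : Fin n} {T : Fin n ≃ Box lam}
    (h : (T i).beta = (T j).beta → (T j).ct - (T i).ct ≠ 0) :
    fillOp i j (fillOp i j (Finsupp.single T 1)) = Finsupp.single T 1 := by
  simp only [fillOp_single, map_add, map_smul, swapT_apply, Equiv.swap_apply_left,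
    Equiv.swap_apply_right, swapT_swapT, yA_swap (T i) (T j), yB_swap (T i) (T j)]
  have := yA_sq_add_yB_sq h
  linear_combination (norm := module) this • (Finsupp.single T (1 : ℂ))

theorem swapT_comm {i j k l : Fin n} (hik : i ≠ k) (hil : i ≠ l) (hjk : j ≠ k) (hjl : j ≠ l)
    (T : Fin n ≃ Box lam) : swapT i j (swapT k l T) = swapT k l (swapT i j T) := by
  ext x : 1
  simp only [swapT_apply]
  congr 1
  simp only [Equiv.swap_apply_def]
  split_ifs <;> simp_all

theorem fillOp_comm {i j k l : Fin n} (hik : i ≠ k) (hil : i ≠ l) (hjk : j ≠ k) (hjl : j ≠ l)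
    (T : Fin n ≃ Box lam) : fillOp i j (fillOp k l (Finsupp.single T 1)) =
      fillOp k l (fillOp i j (Finsupp.single T 1)) := by
  simp only [fillOp_single, map_add, map_smul, swapT_apply, Equiv.swap_apply_of_ne_of_ne hik hil,
    Equiv.swap_apply_of_ne_of_ne hjk hjl, Equiv.swap_apply_of_ne_of_ne hik.symm hjk.symm,
    Equiv.swap_apply_of_ne_of_ne hil.symm hjl.symm, swapT_comm hik hil hjk hjl]
  module

theorem fillOp_braid {i j k : Fin n} (hij : i ≠ j) (hjk : j ≠ k) (hik : i ≠ k)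
    {T : Fin n ≃ Box lam} (h12 : (T i).beta = (T j).beta → (T j).ct - (T i).ct ≠ 0)
    (h23 : (T j).beta = (T k).beta → (T k).ct - (T j).ct ≠ 0)
    (h13 : (T i).beta = (T k).beta → (T k).ct - (T i).ct ≠ 0) :
    fillOp i j (fillOp j k (fillOp i j (Finsupp.single T 1))) =
      fillOp j k (fillOp i j (fillOp j k (Finsupp.single T 1))) := by
  have e : swapT i j (swapT j k (swapT i j T)) = swapT j k (swapT i j (swapT j k T)) := by
    ext x : 1
    simp only [swapT_apply]
    congr 1
    simp only [Equiv.swap_apply_def]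
    split_ifs <;> simp_all
  simp only [fillOp_single, map_add, map_smul, swapT_apply, Equiv.swap_apply_left,
    Equiv.swap_apply_right, swapT_swapT, Equiv.swap_apply_of_ne_of_ne hik.symm hjk.symm,
    Equiv.swap_apply_of_ne_of_ne hij hik, yA_swap (T i) (T j), yB_swap (T i) (T j),
    yA_swap (T j) (T k), yB_swap (T j) (T k), e]
  have hb := yA_braid h12 h23 h13
  have s1 := yA_sq_add_yB_sq h12
  have s2 := yA_sq_add_yB_sq h23
  generalize yA (T i) (T j) = p at *
  generalize yA (T j) (T k) = q at *
  generalize yA (T i) (T k) = m at *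
  generalize yB (T i) (T j) = P at *
  generalize yB (T j) (T k) = Q at *
  generalize yB (T i) (T k) = M at *
  -- Among the six fillings that occur, only the coefficients of T and of its images under the two
  -- adjacent transpositions need an identity; the other three agree on the nose.
  have c1 : p * q * p + m * P ^ 2 = q * p * q + m * Q ^ 2 := by
    linear_combination m * s1 - m * s2 - (p - q) * hb
  have c2 : p * q * P - p * m * P = q * m * P := by linear_combination -P * hb
  have c3 : p * m * Q = p * q * Q - q * m * Q := by linear_combination Q * hb
  linear_combination (norm := module) c1 • (Finsupp.single T (1 : ℂ)) +
    c2 • (Finsupp.single (swapT i j T) (1 : ℂ)) + c3 • (Finsupp.single (swapT j k T) (1 : ℂ))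

/-- The inclusion of the space with basis `SYT(λ)` into the space of all fillings. -/
noncomputable def sytIncl : (SYT lam →₀ ℂ) →ₗ[ℂ] ((Fin n ≃ Box lam) →₀ ℂ) :=
  Finsupp.lmapDomain ℂ ℂ Subtype.val

theorem sytIncl_single (T : SYT lam) (c : ℂ) :
    sytIncl (Finsupp.single T c) = Finsupp.single T.1 c := Finsupp.mapDomain_single

theorem sytIncl_injective : Function.Injective (sytIncl (lam := lam)) :=
  Finsupp.mapDomain_injective Subtype.val_injective

open Classical in
/-- The basis vector of a filling, read as `0` if the filling is not standard. -/
noncomputable def sytVec (T : Fin n ≃ Box lam) : SYT lam →₀ ℂ :=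
  if h : IsStandard T then Finsupp.single ⟨T, h⟩ 1 else 0

theorem sytVec_of {T : Fin n ≃ Box lam} (h : IsStandard T) :
    sytVec T = Finsupp.single (⟨T, h⟩ : SYT lam) 1 := dif_pos h

/-- Young's operator on the space with basis `SYT(λ)`. -/
noncomputable def sytOp (i j : Fin n) : (SYT lam →₀ ℂ) →ₗ[ℂ] (SYT lam →₀ ℂ) :=
  Finsupp.linearCombination ℂ fun T => yA (T.1 i) (T.1 j) • Finsupp.single T 1
    + yB (T.1 i) (T.1 j) • sytVec (swapT i j T.1)

theorem sytOp_single (i j : Fin n) (T : SYT lam) :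
    sytOp i j (Finsupp.single T 1) = yA (T.1 i) (T.1 j) • Finsupp.single T 1
      + yB (T.1 i) (T.1 j) • sytVec (swapT i j T.1) := by
  rw [sytOp, Finsupp.linearCombination_single, one_smul]

/-- The off-diagonal coefficient vanishes when the exchange leaves the standard tableaux. Their span
is therefore stable, and the Coxeter relations can be checked among all fillings without
distinguishing cases. -/
theorem sytIncl_sytOp {i j : Fin n} (hij : (i : ℕ) + 1 = j) (v : SYT lam →₀ ℂ) :
    sytIncl (sytOp i j v) = fillOp i j (sytIncl v) := by
  suffices sytIncl ∘ₗ sytOp i j = fillOp i j ∘ₗ sytIncl (lam := lam) from LinearMap.congr_fun this v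
  ext1 T
  apply LinearMap.ext_ring
  simp only [LinearMap.comp_apply, Finsupp.lsingle_apply, sytOp_single, sytIncl_single,
    fillOp_single, map_add, map_smul]
  by_cases hs : IsStandard (swapT i j T.1)
  · rw [sytVec_of hs, sytIncl_single]
  · rw [yB_eq_zero T.2 hij hs, zero_smul, zero_smul]

theorem syt_ext {f g : (SYT lam →₀ ℂ) →ₗ[ℂ] (SYT lam →₀ ℂ)}
    (h : ∀ T, sytIncl (f (Finsupp.single T 1)) = sytIncl (g (Finsupp.single T 1))) : f = g := by
  ext1 T
  exact LinearMap.ext_ring (sytIncl_injective (h T))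

/-- The scalar by which a diagonal matrix acts on the basis vector of a filling. -/
noncomputable def torusChar (a : Fin n → rootsOfUnity r ℂ) (T : Fin n ≃ Box lam) : ℂ :=
  ∏ k, uval (a k) ^ (T k).beta.val

theorem torusChar_mul (a b : Fin n → rootsOfUnity r ℂ) (T : Fin n ≃ Box lam) :
    torusChar (a * b) T = torusChar a T * torusChar b T := by
  simp [torusChar, mul_pow, Finset.prod_mul_distrib]

theorem torusChar_one (T : Fin n ≃ Box lam) : torusChar 1 T = 1 := by simp [torusChar]

theorem torusChar_mulSingle (i : Fin n) (η : rootsOfUnity r ℂ) (T : Fin n ≃ Box lam) :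
    torusChar (Pi.mulSingle i η) T = uval η ^ (T i).beta.val := by
  rw [torusChar, Finset.prod_eq_single i]
  · rw [Pi.mulSingle_eq_same]
  · intro k _ hk
    rw [Pi.mulSingle_eq_of_ne hk, uval_one, one_pow]
  · simp

theorem torusChar_swapT (i j : Fin n) (a : Fin n → rootsOfUnity r ℂ) (T : Fin n ≃ Box lam) :
    torusChar (permAct n _ (swap i j) a) (swapT i j T) = torusChar a T := by
  simp only [torusChar, permAct_apply, swapT_apply, Equiv.swap_inv]
  exact Equiv.prod_comp (swap i j) fun k => uval (a k) ^ (T k).beta.val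

theorem torusChar_of_beta_eq (i j : Fin n) (a : Fin n → rootsOfUnity r ℂ) {T : Fin n ≃ Box lam}
    (h : (T i).beta = (T j).beta) :
    torusChar (permAct n _ (swap i j) a) T = torusChar a T := by
  rw [← torusChar_swapT i j a T]
  simp only [torusChar]
  refine Finset.prod_congr rfl fun k _ => ?_
  rw [swapT_apply]
  congr 2
  rw [Equiv.swap_apply_def]
  split_ifs with h1 h2
  · rw [h1, h]
  · rw [h2, h]
  · rfl

/-- The action of a diagonal matrix on the space with basis `SYT(λ)`. -/
noncomputable def sytTorus (a : Fin n → rootsOfUnity r ℂ) : (SYT lam →₀ ℂ) →ₗ[ℂ] (SYT lam →₀ ℂ) :=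
  Finsupp.linearCombination ℂ fun T => torusChar a T.1 • Finsupp.single T 1

theorem sytTorus_single (a : Fin n → rootsOfUnity r ℂ) (T : SYT lam) :
    sytTorus a (Finsupp.single T 1) = torusChar a T.1 • Finsupp.single T 1 := by
  rw [sytTorus, Finsupp.linearCombination_single, one_smul]

theorem sytOp_sytTorus (i j : Fin n) (a : Fin n → rootsOfUnity r ℂ) :
    sytOp (lam := lam) i j * sytTorus a = sytTorus (permAct n _ (swap i j) a) * sytOp i j := by
  ext1 T
  apply LinearMap.ext_ring
  simp only [LinearMap.comp_apply, Finsupp.lsingle_apply, Module.End.mul_apply, sytOp_single,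
    sytTorus_single, map_add, map_smul]
  -- The diagonal coefficient is non-zero only if both entries lie in the same component, and then
  -- permuting the two diagonal entries does not change the character.
  have h1 : yA (T.1 i) (T.1 j) * torusChar (permAct n _ (swap i j) a) T.1 =
      yA (T.1 i) (T.1 j) * torusChar a T.1 := by
    by_cases h : (T.1 i).beta = (T.1 j).beta
    · rw [torusChar_of_beta_eq i j a h]
    · rw [yA, if_neg h, zero_mul, zero_mul]
  have h2 : sytTorus (permAct n _ (swap i j) a) (sytVec (swapT i j T.1)) =
      torusChar a T.1 • sytVec (swapT i j T.1) := by
    by_cases hs : IsStandard (swapT i j T.1)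
    · rw [sytVec_of hs, sytTorus_single, torusChar_swapT]
    · rw [sytVec, dif_neg hs, map_zero, smul_zero]
  rw [h2, smul_smul _ (torusChar _ T.1), h1]
  module

/-- `SMod` is given by generators and relations and might collapse. This concrete model, built from
the Coxeter presentation and the diagonal matrices, is what keeps the v_T apart. -/
theorem exists_youngRep (lam : MultiPartition r n) :
    ∃ ρ : W r n →* Module.End ℂ (SYT lam →₀ ℂ),
      (∀ a, ρ (SemidirectProduct.inl a) = sytTorus a) ∧
      ∀ i j : Fin n, (i : ℕ) + 1 = j → ρ (perm (swap i j)) = sytOp i j := by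
  let g : ℕ → Module.End ℂ (SYT lam →₀ ℂ) := fun i =>
    if h : i + 1 < n then sytOp ⟨i, Nat.lt_of_succ_lt h⟩ ⟨i + 1, h⟩ else 1
  have hg : ∀ {i} (h : i + 1 < n), g i = sytOp ⟨i, Nat.lt_of_succ_lt h⟩ ⟨i + 1, h⟩ :=
    fun h => dif_pos h
  obtain ⟨σ, hσ⟩ := exists_monoidHom_of_adj (n := n) (g := g)
    (by
      intro i hi
      rw [hg hi]
      refine syt_ext fun T => ?_
      rw [Module.End.mul_apply, sytIncl_sytOp rfl, sytIncl_sytOp rfl, sytIncl_single,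
        fillOp_fillOp (T.2.ct_ne rfl), Module.End.one_apply, sytIncl_single])
    (by
      intro i j hij hj
      rw [hg hj, hg (by omega : i + 1 < n)]
      refine syt_ext fun T => ?_
      rw [Module.End.mul_apply, Module.End.mul_apply, sytIncl_sytOp rfl, sytIncl_sytOp rfl,
        sytIncl_sytOp rfl, sytIncl_sytOp rfl, sytIncl_single, fillOp_comm] <;>
      · rw [Ne, Fin.ext_iff]
        simp
        omega)
    (by
      intro i hi
      rw [hg (by omega : i + 1 < n), hg (by omega : i + 1 + 1 < n)]
      refine syt_ext fun T => ?_
      simp only [Module.End.mul_apply]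
      rw [sytIncl_sytOp rfl, sytIncl_sytOp rfl, sytIncl_sytOp rfl, sytIncl_sytOp rfl,
        sytIncl_sytOp rfl, sytIncl_sytOp rfl, sytIncl_single, fillOp_braid]
      · simp
      · simp
      · simp; omega
      · exact T.2.ct_ne rfl
      · exact T.2.ct_ne rfl
      · exact T.2.ct_ne_two rfl)
  have hσ' : ∀ i j : Fin n, (i : ℕ) + 1 = j → σ (swap i j) = sytOp i j := by
    rintro ⟨i, hi⟩ ⟨j, hj⟩ hij
    simp only at hij
    subst hij
    rw [← adj_eq hj, hσ i hj, hg hj]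
  have hcomm : ∀ (w : Perm (Fin n)) a, σ w * sytTorus a = sytTorus (permAct n _ w a) * σ w := by
    intro w
    induction w using adj_induction with
    | one => intro a; rw [map_one, map_one, one_mul, mul_one]; rfl
    | mul w i hi ih =>
      intro a
      rw [map_mul, hσ i hi, hg hi, mul_assoc, sytOp_sytTorus, ← mul_assoc, ih, mul_assoc, map_mul,
        adj_eq hi]
      rfl
  have hone : sytTorus (lam := lam) 1 = 1 := by
    refine syt_ext fun T => ?_
    rw [sytTorus_single, torusChar_one, one_smul, Module.End.one_apply]
  have hmul : ∀ a b, sytTorus (lam := lam) (a * b) = sytTorus a * sytTorus b := by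
    intro a b
    refine syt_ext fun T => ?_
    simp only [Module.End.mul_apply, sytTorus_single, map_smul, torusChar_mul, smul_smul, mul_comm]
  refine ⟨⟨⟨fun w => sytTorus w.left * σ w.right, ?_⟩, fun v w => ?_⟩, fun a => ?_, fun i j hij => ?_⟩
  · rw [SemidirectProduct.one_left, SemidirectProduct.one_right, hone, map_one, one_mul]
  · simp only
    rw [SemidirectProduct.mul_left, SemidirectProduct.mul_right, hmul, map_mul, mul_assoc,
      ← mul_assoc (sytTorus _) (σ _), ← hcomm, mul_assoc, mul_assoc]
  · change sytTorus a * σ 1 = _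
    rw [map_one, mul_one]
  · change sytTorus 1 * σ (swap i j) = _
    rw [hone, one_mul, hσ' i j hij]

end Young

/-! ## The irreducible module `S^λ` -/

section SMod

variable {lam : MultiPartition r n}

/-- The action of `G(r,1,n)` on `S^λ`. -/
noncomputable def sRep (lam : MultiPartition r n) : W r n →* Module.End ℂ (SMod lam) :=
  ((Algebra.lsmul ℂ ℂ (SMod lam) : CW r n →ₐ[ℂ] _) : CW r n →* _).comp (MonoidAlgebra.of ℂ (W r n))

/-- The vector `v_T` of a filling, read as `0` if the filling is not standard. -/
noncomputable def vecF (T : Fin n ≃ Box lam) : SMod lam := Submodule.Quotient.mk (freeV T)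

theorem vecF_eq (T : SYT lam) : vecF T.1 = vec T := rfl

theorem vecF_of_not {T : Fin n ≃ Box lam} (h : ¬ IsStandard T) : vecF T = 0 := by
  rw [vecF, freeV, dif_neg h, Submodule.Quotient.mk_zero]

theorem freeV_eq (T : SYT lam) : freeV T.1 = Finsupp.single T 1 := dif_pos T.2

theorem youngS_eq (i j : Fin n) (T : SYT lam) :
    youngS i j T = yA (T.1 i) (T.1 j) • freeV T.1 + yB (T.1 i) (T.1 j) • freeV (swapT i j T.1) := by
  unfold youngS yA yB
  split_ifs with h
  · rfl
  · rw [zero_smul, zero_add, one_smul]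

theorem mk_eq_of_youngRel {x y : SYT lam →₀ CW r n} (h : YoungRel lam (x - y)) :
    (Submodule.Quotient.mk x : SMod lam) = Submodule.Quotient.mk y :=
  (Submodule.Quotient.eq _).mpr (Submodule.subset_span h)

theorem sRep_zetaAt_vec (i : Fin n) (T : SYT lam) :
    sRep lam (zetaAt i) (vec T) = (zeta r ^ (T.1 i).beta.val) • vec T :=
  mk_eq_of_youngRel (YoungRel.zeta i T)

theorem sRep_swap_vec {i j : Fin n} (hij : (i : ℕ) + 1 = j) (T : SYT lam) :
    sRep lam (perm (swap i j)) (vec T) =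
      yA (T.1 i) (T.1 j) • vec T + yB (T.1 i) (T.1 j) • vecF (swapT i j T.1) := by
  have h := mk_eq_of_youngRel (YoungRel.simple i j hij T)
  rw [youngS_eq] at h
  exact h

theorem sRep_dg_vec (i : Fin n) (η : rootsOfUnity r ℂ) (T : SYT lam) :
    sRep lam (dg i η) (vec T) = (uval η ^ (T.1 i).beta.val) • vec T := by
  obtain ⟨l, -, rfl⟩ := exists_zu_pow η
  rw [dg_pow, uval_pow, uval_zu, pow_right_comm]
  induction l with
  | zero => rw [pow_zero, pow_zero, map_one, one_smul, Module.End.one_apply]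
  | succ l ih =>
    rw [pow_succ, map_mul, Module.End.mul_apply, ← zetaAt_eq, sRep_zetaAt_vec, map_smul, zetaAt_eq,
      ih, smul_smul, pow_succ, mul_comm]

theorem sRep_inl_vec (a : Fin n → rootsOfUnity r ℂ) (T : SYT lam) :
    sRep lam (SemidirectProduct.inl a) (vec T) = torusChar a T.1 • vec T := by
  let H : Submonoid (Fin n → rootsOfUnity r ℂ) :=
    { carrier := {a | sRep lam (SemidirectProduct.inl a) (vec T) = torusChar a T.1 • vec T}
      one_mem' := by
        change sRep lam (SemidirectProduct.inl 1) (vec T) = _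
        rw [map_one, map_one, torusChar_one, one_smul, Module.End.one_apply]
      mul_mem' := by
        intro a b ha hb
        change sRep lam (SemidirectProduct.inl (a * b)) (vec T) = _
        change sRep lam (SemidirectProduct.inl a) (vec T) = _ at ha
        change sRep lam (SemidirectProduct.inl b) (vec T) = _ at hb
        rw [map_mul, map_mul, Module.End.mul_apply, hb, map_smul, ha, smul_smul, torusChar_mul,
          mul_comm] }
  exact Submonoid.pi_mem_of_mulSingle_mem (H := H) a fun i => by
    change sRep lam (dg i (a i)) (vec T) = _
    rw [sRep_dg_vec, torusChar_mulSingle]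

theorem span_range_vec : Submodule.span ℂ (Set.range (vec (lam := lam))) = ⊤ := by
  set N := Submodule.span ℂ (Set.range (vec (lam := lam))) with hN
  have hvF : ∀ T : Fin n ≃ Box lam, vecF T ∈ N := by
    intro T
    by_cases h : IsStandard T
    · exact Submodule.subset_span ⟨⟨T, h⟩, rfl⟩
    · rw [vecF_of_not h]; exact N.zero_mem
  have hstab : ∀ w : W r n, (∀ T : SYT lam, sRep lam w (vec T) ∈ N) → ∀ v ∈ N, sRep lam w v ∈ N := by
    intro w hw v hv
    have : N ≤ N.comap (sRep lam w) := Submodule.span_le.mpr (by rintro _ ⟨T, rfl⟩; exact hw T)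
    exact this hv
  have hperm : ∀ w : Perm (Fin n), ∀ v ∈ N, sRep lam (perm w) v ∈ N := by
    intro w
    induction w using adj_induction with
    | one => intro v hv; rwa [perm_one, map_one, Module.End.one_apply]
    | mul w i hi ih =>
      intro v hv
      rw [perm_mul, map_mul, Module.End.mul_apply]
      refine ih _ (hstab _ (fun T => ?_) v hv)
      rw [adj_eq hi, sRep_swap_vec rfl]
      exact N.add_mem (N.smul_mem _ (Submodule.subset_span ⟨T, rfl⟩)) (N.smul_mem _ (hvF _))
  have hW : ∀ w : W r n, ∀ v ∈ N, sRep lam w v ∈ N := by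
    intro w v hv
    rw [eq_inl_mul_perm w, map_mul, Module.End.mul_apply]
    refine hstab _ (fun T => ?_) _ (hperm _ v hv)
    rw [sRep_inl_vec]
    exact N.smul_mem _ (Submodule.subset_span ⟨T, rfl⟩)
  have hCW : ∀ c : CW r n, ∀ v ∈ N, c • v ∈ N := by
    intro c v hv
    induction c using MonoidAlgebra.induction_on with
    | of w => exact hW w v hv
    | add f g hf hg => rw [add_smul]; exact N.add_mem hf hg
    | smul k f hf => rw [smul_assoc]; exact N.smul_mem _ hf
  rw [eq_top_iff]
  intro x _
  obtain ⟨x, rfl⟩ := Submodule.Quotient.mk_surjective _ x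
  induction x using Finsupp.induction_linear with
  | zero => exact N.zero_mem
  | add f g hf hg =>
    rw [Submodule.Quotient.mk_add]
    exact N.add_mem (hf trivial) (hg trivial)
  | single T c =>
    have : Finsupp.single T c = c • freeV T.1 := by
      rw [freeV_eq, Finsupp.smul_single, smul_eq_mul, mul_one]
    rw [this, Submodule.Quotient.mk_smul]
    exact hCW c _ (hvF T.1)

/-- The relations hold in the concrete Young representation, so `SMod` maps to it, and the v_T go to
basis vectors. -/
theorem linearIndependent_vec : LinearIndependent ℂ (vec (lam := lam)) := by
  obtain ⟨ρ, hρ1, hρ2⟩ := exists_youngRep lam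
  let _ : Module (CW r n) (SYT lam →₀ ℂ) :=
    Module.compHom _ (MonoidAlgebra.lift ℂ (Module.End ℂ (SYT lam →₀ ℂ)) (W r n) ρ).toRingHom
  have hsm : ∀ (c : CW r n) (v : SYT lam →₀ ℂ),
      c • v = MonoidAlgebra.lift ℂ (Module.End ℂ (SYT lam →₀ ℂ)) (W r n) ρ c v := fun _ _ => rfl
  have hof : ∀ (w : W r n) (v : SYT lam →₀ ℂ), MonoidAlgebra.of ℂ (W r n) w • v = ρ w v := by
    intro w v
    rw [hsm, MonoidAlgebra.lift_of]
  have : IsScalarTower ℂ (CW r n) (SYT lam →₀ ℂ) := ⟨fun a c v => by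
    rw [hsm, hsm, map_smul]; rfl⟩
  let F : (SYT lam →₀ CW r n) →ₗ[CW r n] (SYT lam →₀ ℂ) :=
    Finsupp.linearCombination (CW r n) fun T => Finsupp.single T (1 : ℂ)
  have hF : ∀ T : Fin n ≃ Box lam, F (freeV T) = sytVec T := by
    intro T
    by_cases h : IsStandard T
    · rw [freeV_eq ⟨T, h⟩, Finsupp.linearCombination_single, one_smul, sytVec_of h]
    · rw [freeV, dif_neg h, sytVec, dif_neg h, map_zero]
  have hFs : ∀ (a : ℂ) x, F (a • x) = a • F x := fun a x => map_smul (F.restrictScalars ℂ) a x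
  have hker : Submodule.span (CW r n) {u | YoungRel lam u} ≤ LinearMap.ker F := by
    rw [Submodule.span_le]
    rintro _ (⟨i, T⟩ | ⟨i, j, hij, T⟩)
    · rw [SetLike.mem_coe, LinearMap.mem_ker, map_sub, map_smul, hF, sytVec_of T.2, hof, hFs, hF,
        sytVec_of T.2, zetaAt_eq, dg, hρ1, sytTorus_single, torusChar_mulSingle, uval_zu, sub_self]
    · rw [SetLike.mem_coe, LinearMap.mem_ker, map_sub, map_smul, hF, sytVec_of T.2, hof,
        hρ2 i j hij, sytOp_single, youngS_eq, map_add, hFs, hFs, hF, hF, sytVec_of T.2, sub_self]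
  let G : SMod lam →ₗ[ℂ] (SYT lam →₀ ℂ) :=
    (Submodule.liftQ _ F hker).restrictScalars ℂ
  have hG : ∀ T, G (vec T) = Finsupp.single T 1 := by
    intro T
    change F (freeV T.1) = _
    rw [hF, sytVec_of T.2]
  refine LinearIndependent.of_comp G ?_
  have : (G ∘ vec) = fun T => Finsupp.single T (1 : ℂ) := funext hG
  rw [this]
  exact Finsupp.linearIndependent_single_one ℂ (SYT lam)

/-- The basis `v_T` of `S^λ`. -/
noncomputable def vecBasis (lam : MultiPartition r n) : Module.Basis (SYT lam) ℂ (SMod lam) :=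
  Module.Basis.mk linearIndependent_vec (by rw [span_range_vec])

theorem vecBasis_apply (T : SYT lam) : vecBasis lam T = vec T := Module.Basis.mk_apply _ _ T

theorem sum_uval_pow (a b : ZMod r) :
    ∑ η : rootsOfUnity r ℂ, uval η ^ a.val * (uval η ^ b.val)⁻¹ = if a = b then (r : ℂ) else 0 := by
  rw [← sum_range_zu fun η : rootsOfUnity r ℂ => uval η ^ a.val * (uval η ^ b.val)⁻¹]
  simp only [uval_pow, uval_zu]
  split_ifs with h
  · subst h
    rw [Finset.sum_congr rfl fun l _ => mul_inv_cancel₀ (pow_ne_zero _ (pow_ne_zero _ zeta_ne_zero))]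
    simp
  · set χ : ℂ := zeta r ^ a.val * (zeta r ^ b.val)⁻¹ with hχ
    have e : ∀ l, (zeta r ^ l) ^ a.val * ((zeta r ^ l) ^ b.val)⁻¹ = χ ^ l := by
      intro l
      rw [hχ, mul_pow, inv_pow, pow_right_comm, pow_right_comm (zeta r) b.val l]
    rw [Finset.sum_congr rfl fun l _ => e l]
    have h1 : χ ≠ 1 := by
      intro h1
      rw [hχ, mul_inv_eq_one₀ (pow_ne_zero _ zeta_ne_zero)] at h1
      exact h (ZMod.val_injective r
        ((zeta_primitive (r := r)).pow_inj (ZMod.val_lt a) (ZMod.val_lt b) h1))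
    have h2 : χ ^ r = 1 := by
      rw [hχ, mul_pow, inv_pow, pow_right_comm, pow_right_comm (zeta r) b.val, zeta_pow, one_pow,
        one_pow, inv_one, mul_one]
    rw [geom_sum_eq h1, h2, sub_self, zero_div]

/-- The sum of the `t_w` over the reflections `w` interchanging the lines of `e_i` and `e_j`. -/
noncomputable def reflSum (lam : MultiPartition r n) (i j : Fin n) : Module.End ℂ (SMod lam) :=
  ∑ η, sRep lam (refl i j η)

theorem perm_mul_reflSum (w : Perm (Fin n)) (i j : Fin n) :
    sRep lam (perm w) * reflSum lam i j = reflSum lam (w i) (w j) * sRep lam (perm w) := by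
  simp only [reflSum, Finset.mul_sum, Finset.sum_mul, ← map_mul, perm_mul_refl]

/-- A reflection times the transposition is diagonal, so the sum is a sum of characters, which by
orthogonality detects equality of components. -/
theorem reflSum_swap_vecF (i j : Fin n) (T : Fin n ≃ Box lam) :
    (reflSum lam j i * sRep lam (perm (swap i j))) (vecF T) =
      (if (T j).beta = (T i).beta then (r : ℂ) else 0) • vecF T := by
  by_cases h : IsStandard T
  · rw [← sum_uval_pow, Finset.sum_smul, reflSum, Finset.sum_mul, LinearMap.sum_apply]
    refine Finset.sum_congr rfl fun η _ => ?_
    rw [← map_mul, Equiv.swap_comm, refl_mul_perm_swap, map_mul, Module.End.mul_apply, ← dg_inv,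
      vecF_eq ⟨T, h⟩, sRep_dg_vec, map_smul, sRep_dg_vec, smul_smul, mul_comm, uval_inv, inv_pow]
  · rw [vecF_of_not h, map_zero, smul_zero]

theorem sRep_perm_swap_sq (i j : Fin n) :
    sRep lam (perm (swap i j)) * sRep lam (perm (swap i j)) = 1 := by
  rw [← map_mul, ← perm_mul, Equiv.swap_mul_self, perm_one, map_one]

/-- The Jucys-Murphy elements act diagonally in Young's orthonormal form. -/
theorem sum_reflSum_vec (k : Fin n) (T : SYT lam) :
    (∑ j ∈ Finset.Iio k, reflSum lam k j) (vec T) = ((r : ℂ) * ((T.1 k).ct : ℂ)) • vec T := by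
  obtain ⟨k, hk⟩ := k
  induction k generalizing T with
  | zero =>
    rw [T.2.ct_zero rfl]
    have : Finset.Iio (⟨0, hk⟩ : Fin n) = ∅ := by
      ext x; simp [Fin.lt_def]
    rw [this]
    simp
  | succ k ih =>
    have hk' : k < n := Nat.lt_of_succ_lt hk
    obtain ⟨i, hi⟩ : ∃ i : Fin n, i = ⟨k, hk'⟩ := ⟨_, rfl⟩
    obtain ⟨j, hj⟩ : ∃ j : Fin n, j = ⟨k + 1, hk⟩ := ⟨_, rfl⟩
    have hij : (i : ℕ) + 1 = j := by rw [hi, hj]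
    rw [← hj]
    have ih' : ∀ T : Fin n ≃ Box lam, (∑ m ∈ Finset.Iio i, reflSum lam i m) (vecF T) =
        ((r : ℂ) * ((T i).ct : ℂ)) • vecF T := by
      intro T
      by_cases h : IsStandard T
      · rw [hi]; exact ih ⟨T, h⟩ hk'
      · rw [vecF_of_not h, map_zero, smul_zero]
    have hIio : Finset.Iio j = insert i (Finset.Iio i) := by
      ext x; simp only [Finset.mem_Iio, Finset.mem_insert, Fin.lt_def, Fin.ext_iff]; omega
    set S := sRep lam (perm (swap i j)) with hS
    have hSS : S * S = 1 := sRep_perm_swap_sq i j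
    -- The recursion of Jucys-Murphy elements: conjugation by s turns the reflections (i, m), m < i,
    -- into the reflections (j, m), and the only one left over is (j, i).
    have hsum : ∑ m ∈ Finset.Iio j, reflSum lam j m =
        (reflSum lam j i * S) * S + S * (∑ m ∈ Finset.Iio i, reflSum lam i m) * S := by
      rw [hIio, Finset.sum_insert (by simp), mul_assoc, hSS, mul_one, Finset.mul_sum,
        Finset.sum_mul]
      congr 1
      refine Finset.sum_congr rfl fun m hm => ?_
      have hm' : m < i := Finset.mem_Iio.mp hm
      have e1 : swap i j m = m := Equiv.swap_apply_of_ne_of_ne hm'.ne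
        (by rw [Fin.lt_def] at hm'; rw [Ne, Fin.ext_iff]; omega)
      rw [hS, perm_mul_reflSum, Equiv.swap_apply_left, e1, mul_assoc, ← hS, hSS, mul_one]
    have hA := T.2.ct_ne hij
    have hsq := yA_sq_add_yB_sq hA
    have hv : S (vecF T.1) = yA (T.1 i) (T.1 j) • vecF T.1 +
        yB (T.1 i) (T.1 j) • vecF (swapT i j T.1) := sRep_swap_vec hij T
    have hv' : S (yB (T.1 i) (T.1 j) • vecF (swapT i j T.1)) =
        yB (T.1 i) (T.1 j) • (- yA (T.1 i) (T.1 j) • vecF (swapT i j T.1) +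
          yB (T.1 i) (T.1 j) • vecF T.1) := by
      by_cases h : IsStandard (swapT i j T.1)
      · rw [map_smul, hS, vecF_eq ⟨swapT i j T.1, h⟩, sRep_swap_vec hij]
        simp only [swapT_apply, Equiv.swap_apply_left, Equiv.swap_apply_right, swapT_swapT]
        rw [yA_swap (T.1 i), yB_swap (T.1 i)]
      · rw [yB_eq_zero T.2 hij h, zero_smul, zero_smul, map_zero]
    have h1 := ih' T.1
    have h2 := ih' (swapT i j T.1)
    have h3 := reflSum_swap_vecF i j T.1
    have h4 := reflSum_swap_vecF i j (swapT i j T.1)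
    rw [← hS] at h3 h4
    rw [swapT_apply, Equiv.swap_apply_left] at h2
    rw [swapT_apply, swapT_apply, Equiv.swap_apply_left, Equiv.swap_apply_right] at h4
    rw [hsum, ← vecF_eq]
    clear_value S
    generalize reflSum lam j i * S = P at *
    generalize ∑ m ∈ Finset.Iio i, reflSum lam i m = J at *
    generalize vecF T.1 = v at *
    generalize vecF (swapT i j T.1) = v' at *
    clear ih ih' hsum
    have e : (P * S + S * J * S) v = P (S v) + S (J (S v)) := rfl
    rw [e, hv, map_add, map_add, map_smul, map_smul, map_smul, map_smul, h1, h2, h3, h4, map_add,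
      map_smul, map_smul, hv,
      smul_comm (yB (T.1 i) (T.1 j)) ((r : ℂ) * ((T.1 j).ct : ℂ)) v', map_smul, hv']
    by_cases hb : (T.1 i).beta = (T.1 j).beta
    · rw [if_pos hb, if_pos hb.symm]
      have hk : (((T.1 j).ct - (T.1 i).ct : ℤ) : ℂ) ≠ 0 := by exact_mod_cast hA hb
      -- With a = 1/k this says that a times the content difference is 1, which makes the v' terms
      -- cancel and turns the content of T(i) into that of T(j) on v.
      have h1 : yA (T.1 i) (T.1 j) * (((T.1 j).ct : ℂ) - ((T.1 i).ct : ℂ)) = 1 := by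
        rw [yA, if_pos hb]
        push_cast at hk ⊢
        field_simp
      generalize yA (T.1 i) (T.1 j) = p at *
      generalize yB (T.1 i) (T.1 j) = q at *
      have c1 : p * r + p * (r * (T.1 i).ct * p) + r * (T.1 j).ct * (q * q) =
          r * (T.1 j).ct := by
        linear_combination (r : ℂ) * (T.1 j).ct * hsq - p * r * h1
      have c2 : q * r + p * (r * (T.1 i).ct * q) - r * (T.1 j).ct * q * p = 0 := by
        linear_combination - q * r * h1
      linear_combination (norm := module) c1 • v + c2 • v'
    · rw [if_neg hb, if_neg (Ne.symm hb), yA, if_neg hb]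
      have : yB (T.1 i) (T.1 j) = 1 := by rw [yB, if_neg hb]
      rw [this]
      module

end SMod

/-! ## The commutators `[y_i, x_j]` in the group algebra -/

section Commutators

variable {R : Type*} [Ring R] [Algebra ℂ R] (τ : W r n →* R) (c₀ : ℂ) (h : rootsOfUnity r ℂ → ℂ)

/-- The value of `[y_i, x_j]`, for a representation `τ` of `G(r,1,n)`. -/
noncomputable def commC (i j : Fin n) : R :=
  if i = j then ∑ η, h η • τ (dg i η) - c₀ • ∑ m ∈ Finset.univ.erase i, ∑ η, τ (refl i m η)
  else c₀ • ∑ η, (uval η)⁻¹ • τ (refl i j η)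

theorem commC_self (i : Fin n) : commC τ c₀ h i i =
    ∑ η, h η • τ (dg i η) - c₀ • ∑ m ∈ Finset.univ.erase i, ∑ η, τ (refl i m η) := if_pos rfl

theorem commC_ne {i j : Fin n} (hij : i ≠ j) :
    commC τ c₀ h i j = c₀ • ∑ η, (uval η)⁻¹ • τ (refl i j η) := if_neg hij

/-- Conjugation by w permutes the indices and translates η by a fixed root of unity, which the sum
over all η does not see. -/
theorem mul_sum_refl (w : W r n) {i j : Fin n} (hij : i ≠ j) :
    τ w * ∑ η, τ (refl i j η) = (∑ η, τ (refl (w.right i) (w.right j) η)) * τ w := by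
  rw [← Equiv.sum_comp (Equiv.mulRight (w.left (w.right i) * (w.left (w.right j))⁻¹))
    (fun η => τ (refl (w.right i) (w.right j) η)), Finset.mul_sum, Finset.sum_mul]
  refine Finset.sum_congr rfl fun η _ => ?_
  rw [← map_mul, mul_refl w hij, map_mul, Equiv.coe_mulRight, mul_assoc η]

theorem mul_commC (w : W r n) (i j : Fin n) : τ w * commC τ c₀ h i j =
    (uval (w.left (w.right i)) * (uval (w.left (w.right j)))⁻¹) •
      (commC τ c₀ h (w.right i) (w.right j) * τ w) := by
  rcases eq_or_ne i j with rfl | hij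
  · rw [mul_inv_cancel₀ (uval_ne_zero _), one_smul, commC_self, commC_self, mul_sub, sub_mul,
      Finset.mul_sum, Finset.sum_mul, mul_smul_comm, smul_mul_assoc, Finset.mul_sum, Finset.sum_mul]
    congr 1
    · refine Finset.sum_congr rfl fun η _ => ?_
      rw [mul_smul_comm, smul_mul_assoc, ← map_mul, ← map_mul, mul_dg]
    · congr 1
      refine Finset.sum_bij (fun m _ => w.right m) (fun m hm => ?_) (fun a _ b _ e => w.right.injective e)
        (fun m hm => ⟨w.right.symm m, ?_, w.right.apply_symm_apply m⟩) (fun m hm => ?_)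
      · simpa using hm
      · rw [Finset.mem_erase] at hm ⊢
        refine ⟨fun e => hm.1 ?_, Finset.mem_univ _⟩
        rw [← e, Equiv.apply_symm_apply]
      · exact mul_sum_refl τ w (Finset.ne_of_mem_erase hm).symm
  · have hij' : w.right i ≠ w.right j := fun e => hij (w.right.injective e)
    rw [commC_ne τ c₀ h hij, commC_ne τ c₀ h hij',
      ← Equiv.sum_comp (Equiv.mulRight (w.left (w.right i) * (w.left (w.right j))⁻¹))
      (fun η => (uval η)⁻¹ • τ (refl (w.right i) (w.right j) η)), mul_smul_comm, smul_mul_assoc]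
    refine (congrArg (c₀ • ·) ?_).trans (smul_comm _ _ _)
    rw [Finset.mul_sum, Finset.sum_mul, Finset.smul_sum]
    refine Finset.sum_congr rfl fun η _ => ?_
    rw [mul_smul_comm, ← map_mul, mul_refl w hij, map_mul, Equiv.coe_mulRight, smul_mul_assoc,
      smul_smul, mul_assoc η]
    congr 1
    have h1 := uval_ne_zero (w.left (w.right i))
    have h2 := uval_ne_zero (w.left (w.right j))
    have h3 := uval_ne_zero η
    rw [uval_mul, uval_mul, uval_inv]
    field_simp

/-- The elements `D_i` are permuted by `τ` like the standard basis of `ℂⁿ`. -/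
def IsEquivariant (D : Fin n → R) : Prop :=
  ∀ (w : W r n) i, τ w * D i = uval (w.left (w.right i)) • (D (w.right i) * τ w)

variable {τ} {D : Fin n → R}

theorem dg_mul_D (hD : IsEquivariant τ D) {i j : Fin n} (hij : i ≠ j) (η : rootsOfUnity r ℂ) :
    τ (dg i η) * D j = D j * τ (dg i η) := by
  rw [hD]
  have h1 : (dg i η : W r n).right j = j := rfl
  have h2 : (dg i η : W r n).left j = 1 := Pi.mulSingle_eq_of_ne hij.symm _
  rw [h1, h2, uval_one, one_smul]

theorem refl_mul_D_of_ne (hD : IsEquivariant τ D) {i j k : Fin n} (hi : k ≠ i) (hj : k ≠ j) (η : rootsOfUnity r ℂ) :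
    τ (refl i j η) * D k = D k * τ (refl i j η) := by
  rw [hD, refl_right, Equiv.swap_apply_of_ne_of_ne hi hj, refl_left, Pi.mulSingle_eq_of_ne hi,
    Pi.mulSingle_eq_of_ne hj, inv_one, mul_one, uval_one, one_smul]

theorem refl_mul_D_left (hD : IsEquivariant τ D) {i j : Fin n} (hij : i ≠ j) (η : rootsOfUnity r ℂ) :
    τ (refl i j η) * D i = (uval η)⁻¹ • (D j * τ (refl i j η)) := by
  rw [hD, refl_right, Equiv.swap_apply_left, refl_left, Pi.mulSingle_eq_of_ne hij.symm,
    Pi.mulSingle_eq_same, one_mul, uval_inv]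

theorem refl_mul_D_right (hD : IsEquivariant τ D) {i j : Fin n} (hij : i ≠ j) (η : rootsOfUnity r ℂ) :
    τ (refl i j η) * D j = uval η • (D i * τ (refl i j η)) := by
  rw [hD, refl_right, Equiv.swap_apply_right, refl_left, Pi.mulSingle_eq_of_ne hij,
    Pi.mulSingle_eq_same, inv_one, mul_one]

/-- The only summands of [y_j, x_j] that fail to commute with D_i are the reflections in i and j.
These carry D_i to D_j and D_j to D_i up to η, and so produce the commutator of D_j with [y_i, x_j].
-/
theorem commC_sub_aux (hD : IsEquivariant τ D) {i j : Fin n} (hij : i ≠ j) :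
    D i * commC τ c₀ h j j - commC τ c₀ h j j * D i =
      D j * commC τ c₀ h i j - commC τ c₀ h i j * D j := by
  have hmem : i ∈ Finset.univ.erase j := by simp [hij]
  have hre : ∑ η, τ (refl j i η) = ∑ η, τ (refl i j η) := by
    rw [← Equiv.sum_comp (Equiv.inv (rootsOfUnity r ℂ))]
    refine Finset.sum_congr rfl fun η _ => ?_
    rw [refl_symm, Equiv.inv_apply, inv_inv]
  have h1 : D i * ∑ η, h η • τ (dg j η) = (∑ η, h η • τ (dg j η)) * D i := by
    rw [Finset.mul_sum, Finset.sum_mul]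
    refine Finset.sum_congr rfl fun η _ => ?_
    rw [mul_smul_comm, smul_mul_assoc, dg_mul_D hD hij.symm]
  have h2 : D i * ∑ m ∈ (Finset.univ.erase j).erase i, ∑ η, τ (refl j m η) =
      (∑ m ∈ (Finset.univ.erase j).erase i, ∑ η, τ (refl j m η)) * D i := by
    rw [Finset.mul_sum, Finset.sum_mul]
    refine Finset.sum_congr rfl fun m hm => ?_
    rw [Finset.mul_sum, Finset.sum_mul]
    refine Finset.sum_congr rfl fun η _ => ?_
    rw [refl_mul_D_of_ne hD hij (Finset.ne_of_mem_erase hm).symm]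
  have h3 : (∑ η, τ (refl i j η)) * D i = ∑ η, (uval η)⁻¹ • (D j * τ (refl i j η)) := by
    rw [Finset.sum_mul]
    exact Finset.sum_congr rfl fun η _ => refl_mul_D_left hD hij η
  have h4 : (∑ η, (uval η)⁻¹ • τ (refl i j η)) * D j = D i * ∑ η, τ (refl i j η) := by
    rw [Finset.sum_mul, Finset.mul_sum]
    refine Finset.sum_congr rfl fun η _ => ?_
    rw [smul_mul_assoc, refl_mul_D_right hD hij, smul_smul, inv_mul_cancel₀ (uval_ne_zero _),
      one_smul]
  have h5 : D j * (∑ η, (uval η)⁻¹ • τ (refl i j η)) = ∑ η, (uval η)⁻¹ • (D j * τ (refl i j η)) := by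
    rw [Finset.mul_sum]
    exact Finset.sum_congr rfl fun η _ => mul_smul_comm _ _ _
  rw [commC_self, commC_ne τ c₀ h hij, ← Finset.add_sum_erase _ _ hmem, hre, mul_sub, sub_mul, h1,
    mul_smul_comm, mul_smul_comm, smul_mul_assoc, smul_mul_assoc, mul_add, add_mul, h2, h3, h4, h5]
  module

/-- This is the Jacobi identity for y_i, y_j, x_k under the assumption that the y's commute. It uses
only equivariance of the D_i, and commutativity of the Dunkl operators is deduced from it. -/
theorem commC_sub (hD : IsEquivariant τ D) (i j k : Fin n) :
    D i * commC τ c₀ h j k - commC τ c₀ h j k * D i =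
      D j * commC τ c₀ h i k - commC τ c₀ h i k * D j := by
  rcases eq_or_ne i j with rfl | hij
  · rfl
  rcases eq_or_ne k j with rfl | hkj
  · exact commC_sub_aux c₀ h hD hij
  rcases eq_or_ne k i with rfl | hki
  · exact (commC_sub_aux c₀ h hD hij.symm).symm
  have key : ∀ {i j : Fin n}, i ≠ j → k ≠ i → k ≠ j →
      D i * commC τ c₀ h j k - commC τ c₀ h j k * D i = 0 := by
    intro i j hij hki hkj
    rw [commC_ne τ c₀ h hkj.symm, mul_smul_comm, smul_mul_assoc, Finset.mul_sum, Finset.sum_mul,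
      sub_eq_zero]
    congr 1
    refine Finset.sum_congr rfl fun η _ => ?_
    rw [mul_smul_comm, smul_mul_assoc, refl_mul_D_of_ne hD hij hki.symm]
  rw [key hij hki hkj, key hij.symm hkj hki]

end Commutators

/-! ## Monomials -/

section Monomials

/-- The monomial `x^μ`. -/
noncomputable def xmon (μ : Fin n → ℕ) : MvPolynomial (Fin n) ℂ := ∏ i, MvPolynomial.X i ^ μ i

theorem xmon_eq (μ : Fin n → ℕ) :
    xmon μ = MvPolynomial.monomial (Finsupp.equivFunOnFinite.symm μ) 1 := by
  rw [MvPolynomial.monomial_eq, Finsupp.prod_fintype _ _ (fun i => pow_zero _), map_one, one_mul]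
  rfl

/-- The basis of monomials. -/
noncomputable def xmonBasis (n : ℕ) : Module.Basis (Fin n → ℕ) ℂ (MvPolynomial (Fin n) ℂ) :=
  (MvPolynomial.basisMonomials (Fin n) ℂ).reindex Finsupp.equivFunOnFinite

theorem xmonBasis_apply (μ : Fin n → ℕ) : xmonBasis n μ = xmon μ := by
  rw [xmonBasis, Module.Basis.reindex_apply, MvPolynomial.coe_basisMonomials, xmon_eq]

@[simp] theorem xmon_zero : xmon (0 : Fin n → ℕ) = 1 := by simp [xmon]

theorem xmon_add (μ ν : Fin n → ℕ) : xmon (μ + ν) = xmon μ * xmon ν := by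
  simp [xmon, pow_add, Finset.prod_mul_distrib]

theorem xmon_single (k : Fin n) (m : ℕ) : xmon (Pi.single k m) = MvPolynomial.X k ^ m := by
  rw [xmon, Finset.prod_eq_single k]
  · rw [Pi.single_eq_same]
  · intro j _ hj
    rw [Pi.single_eq_of_ne hj, pow_zero]
  · simp

theorem X_mul_xmon (k : Fin n) (μ : Fin n → ℕ) :
    MvPolynomial.X k * xmon μ = xmon (μ + Pi.single k 1) := by
  rw [xmon_add, xmon_single, pow_one, mul_comm]

/-- The action of `G(r,1,n)` on polynomials in `x_1,…,x_n`. -/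
noncomputable def polyAct (w : W r n) : MvPolynomial (Fin n) ℂ →ₐ[ℂ] MvPolynomial (Fin n) ℂ :=
  MvPolynomial.aeval fun j => (uval (w.left (w.right j)))⁻¹ • MvPolynomial.X (w.right j)

theorem polyAct_X (w : W r n) (j : Fin n) : polyAct w (MvPolynomial.X j) =
    (uval (w.left (w.right j)))⁻¹ • MvPolynomial.X (w.right j) := MvPolynomial.aeval_X _ _

theorem polyAct_one : polyAct (1 : W r n) = AlgHom.id ℂ _ := by
  refine MvPolynomial.algHom_ext fun j => ?_
  rw [polyAct_X, SemidirectProduct.one_right, SemidirectProduct.one_left]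
  simp

theorem polyAct_mul (v w : W r n) : polyAct (v * w) = (polyAct v).comp (polyAct w) := by
  refine MvPolynomial.algHom_ext fun j => ?_
  rw [AlgHom.comp_apply, polyAct_X, polyAct_X, map_smul, polyAct_X, smul_smul,
    SemidirectProduct.mul_left, SemidirectProduct.mul_right]
  congr 1
  rw [Perm.mul_apply, Pi.mul_apply, permAct_apply, uval_mul, mul_inv, mul_comm]
  congr 3
  rw [show v.right⁻¹ (v.right (w.right j)) = w.right j from v.right.symm_apply_apply _]

theorem polyAct_xmon (w : W r n) (μ : Fin n → ℕ) : polyAct w (xmon μ) =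
    (∏ j, (uval (w.left (w.right j)))⁻¹ ^ μ j) • xmon (permComp w.right μ) := by
  rw [xmon, map_prod]
  simp only [map_pow, polyAct_X, smul_pow, xmon]
  rw [Finset.prod_smul]
  congr 1
  refine (Finset.prod_congr rfl fun j _ => ?_).trans
    (Equiv.prod_comp w.right fun j => MvPolynomial.X j ^ permComp w.right μ j)
  rw [permComp_apply, show w.right⁻¹ (w.right j) = j from w.right.symm_apply_apply _]

theorem polyAct_perm_xmon (w : Perm (Fin n)) (μ : Fin n → ℕ) :
    polyAct (perm w : W r n) (xmon μ) = xmon (permComp w μ) := by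
  rw [polyAct_xmon]; simp

theorem polyAct_dg_xmon (i : Fin n) (η : rootsOfUnity r ℂ) (μ : Fin n → ℕ) :
    polyAct (dg i η) (xmon μ) = ((uval η)⁻¹ ^ μ i) • xmon μ := by
  rw [polyAct_xmon, Finset.prod_eq_single i]
  · change ((uval ((Pi.mulSingle i η : Fin n → _) i))⁻¹ ^ μ i) • xmon μ = _
    rw [Pi.mulSingle_eq_same]
  · intro j _ hj
    change (uval ((Pi.mulSingle i η : Fin n → _) j))⁻¹ ^ μ j = _
    rw [Pi.mulSingle_eq_of_ne hj, uval_one, inv_one, one_pow]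
  · simp

end Monomials

/-! ## Dunkl operators -/

section Dunkl

/-- The polynomial ring `ℂ[x_1,…,x_n]`. -/
abbrev PolyX (n : ℕ) : Type := MvPolynomial (Fin n) ℂ

/-- The linear form vanishing on the reflecting hyperplane. -/
noncomputable def rootForm (i j : Fin n) (η : rootsOfUnity r ℂ) : PolyX n :=
  MvPolynomial.X i - uval η • MvPolynomial.X j

theorem rootForm_ne_zero {i j : Fin n} (hij : i ≠ j) (η : rootsOfUnity r ℂ) :
    rootForm i j η ≠ 0 := by
  intro h
  have := congrArg (MvPolynomial.eval (Pi.single i (1 : ℂ))) h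
  simp [rootForm, hij.symm, MvPolynomial.smul_eval] at this

/-- The coefficients `d` with `x_k - s x_k = d_k α_s`. -/
noncomputable def rootCoeff (i j : Fin n) (η : rootsOfUnity r ℂ) (k : Fin n) : ℂ :=
  if k = i then 1 else if k = j then -(uval η)⁻¹ else 0

theorem X_sub_polyAct_refl {i j : Fin n} (hij : i ≠ j) (η : rootsOfUnity r ℂ) (k : Fin n) :
    MvPolynomial.X k - polyAct (refl i j η) (MvPolynomial.X k) =
      rootCoeff i j η k • rootForm i j η := by
  have h := uval_ne_zero η
  rw [polyAct_X, refl_right, refl_left, rootCoeff, rootForm]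
  split_ifs with h1 h2
  · subst h1
    rw [Equiv.swap_apply_left, Pi.mulSingle_eq_of_ne hij.symm, Pi.mulSingle_eq_same]
    simp
  · subst h2
    rw [Equiv.swap_apply_right, Pi.mulSingle_eq_of_ne hij, Pi.mulSingle_eq_same, smul_sub,
      smul_smul, neg_mul, inv_mul_cancel₀ h]
    simp only [inv_one, mul_one]
    module
  · rw [Equiv.swap_apply_of_ne_of_ne h1 h2, Pi.mulSingle_eq_of_ne h1, Pi.mulSingle_eq_of_ne h2]
    simp

theorem rootForm_dvd {i j : Fin n} (hij : i ≠ j) (η : rootsOfUnity r ℂ) (f : PolyX n) :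
    ∃ g, rootForm i j η * g = f - polyAct (refl i j η) f := by
  induction f using MvPolynomial.induction_on with
  | C a => exact ⟨0, by rw [MvPolynomial.algHom_C, MvPolynomial.algebraMap_eq, sub_self, mul_zero]⟩
  | add f g hf hg =>
    obtain ⟨u, hu⟩ := hf
    obtain ⟨v, hv⟩ := hg
    exact ⟨u + v, by rw [mul_add, hu, hv, map_add]; ring⟩
  | mul_X f k hf =>
    obtain ⟨u, hu⟩ := hf
    -- The quotient comes from the twisted Leibniz rule x_k f − s(x_k f) = x_k (f − s f) + (x_k − s
    -- x_k) s f.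
    refine ⟨MvPolynomial.X k * u + rootCoeff i j η k • polyAct (refl i j η) f, ?_⟩
    rw [mul_add, mul_smul_comm, ← smul_mul_assoc, ← X_sub_polyAct_refl hij, mul_left_comm, hu,
      map_mul]
    ring

/-- The divided difference operator `f ↦ (f - s f) / α_s`. -/
noncomputable def divDiff (i j : Fin n) (η : rootsOfUnity r ℂ) : (PolyX n) →ₗ[ℂ] (PolyX n) :=
  if hij : i ≠ j then
    { toFun := fun f => (rootForm_dvd hij η f).choose
      map_add' := fun f g => mul_left_cancel₀ (rootForm_ne_zero hij η) (by
        rw [mul_add, (rootForm_dvd hij η _).choose_spec, (rootForm_dvd hij η _).choose_spec,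
          (rootForm_dvd hij η _).choose_spec, map_add]; ring)
      map_smul' := fun a f => mul_left_cancel₀ (rootForm_ne_zero hij η) (by
        rw [RingHom.id_apply, mul_smul_comm, (rootForm_dvd hij η _).choose_spec,
          (rootForm_dvd hij η _).choose_spec, map_smul, smul_sub]) }
  else 0

theorem rootForm_mul_divDiff {i j : Fin n} (hij : i ≠ j) (η : rootsOfUnity r ℂ) (f : PolyX n) :
    rootForm i j η * divDiff i j η f = f - polyAct (refl i j η) f := by
  rw [divDiff, dif_pos hij]
  exact (rootForm_dvd hij η f).choose_spec

theorem divDiff_eq {i j : Fin n} (hij : i ≠ j) {η : rootsOfUnity r ℂ} {f g : PolyX n}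
    (h : rootForm i j η * g = f - polyAct (refl i j η) f) : divDiff i j η f = g :=
  mul_left_cancel₀ (rootForm_ne_zero hij η) ((rootForm_mul_divDiff hij η f).trans h.symm)

theorem divDiff_one {i j : Fin n} (hij : i ≠ j) (η : rootsOfUnity r ℂ) : divDiff i j η 1 = 0 :=
  divDiff_eq hij (by rw [map_one, sub_self, mul_zero])

theorem divDiff_X_mul {i j : Fin n} (hij : i ≠ j) (η : rootsOfUnity r ℂ) (k : Fin n) (f : PolyX n) :
    divDiff i j η (MvPolynomial.X k * f) = MvPolynomial.X k * divDiff i j η f +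
      rootCoeff i j η k • polyAct (refl i j η) f := by
  apply divDiff_eq hij
  rw [mul_add, mul_smul_comm, ← smul_mul_assoc, ← X_sub_polyAct_refl hij, mul_left_comm,
    rootForm_mul_divDiff hij, map_mul]
  ring

/-- The `η⁻¹`-difference operator in the variable `x_i`. -/
noncomputable def qDiff (i : Fin n) (η : rootsOfUnity r ℂ) : (PolyX n) →ₗ[ℂ] (PolyX n) :=
  (xmonBasis n).constr ℂ fun μ =>
    (∑ m ∈ Finset.range (μ i), (uval η)⁻¹ ^ m) • xmon (Function.update μ i (μ i - 1))

/-- For η = 1 the coefficient is μ_i and the operator is ∂/∂x_i. For η ≠ 1 the geometric sum makes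
it a difference quotient. The term κ and the idempotents e_{ij} are thus treated uniformly. -/
theorem qDiff_xmon (i : Fin n) (η : rootsOfUnity r ℂ) (μ : Fin n → ℕ) : qDiff i η (xmon μ) =
    (∑ m ∈ Finset.range (μ i), (uval η)⁻¹ ^ m) • xmon (Function.update μ i (μ i - 1)) := by
  rw [qDiff, ← xmonBasis_apply, Module.Basis.constr_basis]

theorem qDiff_one (i : Fin n) (η : rootsOfUnity r ℂ) : qDiff i η (1 : PolyX n) = 0 := by
  rw [← xmon_zero, qDiff_xmon]; simp

theorem X_mul_qDiff_xmon (i : Fin n) (η : rootsOfUnity r ℂ) (μ : Fin n → ℕ) :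
    MvPolynomial.X i * qDiff i η (xmon μ) = (∑ m ∈ Finset.range (μ i), (uval η)⁻¹ ^ m) • xmon μ := by
  rw [qDiff_xmon, mul_smul_comm, X_mul_xmon]
  rcases Nat.eq_zero_or_pos (μ i) with h | h
  · rw [h]; simp
  · congr 2
    ext j
    rcases eq_or_ne j i with rfl | hj
    · simp; omega
    · simp [hj]

theorem qDiff_X_mul (i : Fin n) (η : rootsOfUnity r ℂ) (k : Fin n) (f : PolyX n) :
    qDiff i η (MvPolynomial.X k * f) = MvPolynomial.X k * qDiff i η f +
      if k = i then polyAct (dg i η) f else 0 := by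
  suffices h : qDiff i η ∘ₗ LinearMap.mulLeft ℂ (MvPolynomial.X k) =
      LinearMap.mulLeft ℂ (MvPolynomial.X k) ∘ₗ qDiff i η +
        if k = i then (polyAct (dg i η) : (PolyX n) →ₐ[ℂ] _).toLinearMap else 0 by
    have := LinearMap.congr_fun h f
    split_ifs at this ⊢ with hk <;> exact this
  refine (xmonBasis n).ext fun μ => ?_
  rw [xmonBasis_apply, LinearMap.comp_apply, LinearMap.mulLeft_apply, LinearMap.add_apply,
    LinearMap.comp_apply, LinearMap.mulLeft_apply, X_mul_xmon, qDiff_xmon]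
  split_ifs with hk
  · subst hk
    rw [X_mul_qDiff_xmon, AlgHom.toLinearMap_apply, polyAct_dg_xmon, ← add_smul]
    have e : (μ + Pi.single k 1 : Fin n → ℕ) k = μ k + 1 := by simp
    rw [e, Finset.sum_range_succ]
    congr 2
    ext j
    rcases eq_or_ne j k with rfl | hj
    · simp
    · simp [hj]
  · rw [qDiff_xmon, mul_smul_comm, X_mul_xmon, LinearMap.zero_apply, add_zero]
    have e : (μ + Pi.single k 1 : Fin n → ℕ) i = μ i := by simp [Ne.symm hk]
    rw [e]
    congr 2
    ext j
    rcases eq_or_ne j i with rfl | hj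
    · simp [Ne.symm hk]
    · simp [hj]

variable {S : Type*} [AddCommGroup S] [Module ℂ S] (τ : W r n →* Module.End ℂ S)
  (c₀ : ℂ) (h : rootsOfUnity r ℂ → ℂ)

/-- The vector space `ℂ[x] ⊗ S`. -/
def PolyMod (n : ℕ) (S : Type*) [AddCommGroup S] [Module ℂ S] := PolyX n ⊗[ℂ] S

noncomputable instance : AddCommGroup (PolyMod n S) :=
  inferInstanceAs (AddCommGroup (PolyX n ⊗[ℂ] S))

noncomputable instance : Module ℂ (PolyMod n S) := inferInstanceAs (Module ℂ (PolyX n ⊗[ℂ] S))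

/-- The element `f ⊗ v` of `ℂ[x] ⊗ S`. -/
noncomputable def pt : PolyX n →ₗ[ℂ] S →ₗ[ℂ] PolyMod n S := TensorProduct.mk ℂ (PolyX n) S

/-- The tensor product of two operators. -/
noncomputable def pmap (A : PolyX n →ₗ[ℂ] PolyX n) (B : Module.End ℂ S) :
    Module.End ℂ (PolyMod n S) := TensorProduct.map A B

@[simp] theorem pmap_pt (A : PolyX n →ₗ[ℂ] PolyX n) (B : Module.End ℂ S) (f : PolyX n) (v : S) :
    pmap A B (pt f v) = pt (A f) (B v) := rfl

theorem polyMod_ext {M : Type*} [AddCommGroup M] [Module ℂ M] {A B : PolyMod n S →ₗ[ℂ] M}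
    (h : ∀ f v, A (pt f v) = B (pt f v)) : A = B :=
  TensorProduct.ext' h

theorem smul_pt (a : ℂ) (f : PolyX n) (v : S) : pt (a • f) v = a • pt f v := by
  rw [map_smul, LinearMap.smul_apply]

theorem add_pt (f g : PolyX n) (v : S) : pt (f + g) v = pt f v + pt g v := by
  rw [map_add, LinearMap.add_apply]

theorem zero_pt (v : S) : pt (0 : PolyX n) v = 0 := by rw [map_zero, LinearMap.zero_apply]

/-- Multiplication by `x_k` on `ℂ[x] ⊗ S`. -/
noncomputable def mulX (S : Type*) [AddCommGroup S] [Module ℂ S] (k : Fin n) :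
    Module.End ℂ (PolyMod n S) :=
  pmap (LinearMap.mulLeft ℂ (MvPolynomial.X k)) LinearMap.id

@[simp] theorem mulX_pt (k : Fin n) (f : PolyX n) (v : S) :
    mulX S k (pt f v) = pt (MvPolynomial.X k * f) v := rfl

/-- The diagonal action of `G(r,1,n)` on `ℂ[x] ⊗ S`. -/
noncomputable def diagAct : W r n →* Module.End ℂ (PolyMod n S) where
  toFun w := pmap (polyAct w).toLinearMap (τ w)
  map_one' := by
    refine polyMod_ext fun f v => ?_
    rw [pmap_pt, polyAct_one, map_one]
    rfl
  map_mul' v w := by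
    refine polyMod_ext fun f v => ?_
    rw [Module.End.mul_apply, pmap_pt, pmap_pt, pmap_pt,
      polyAct_mul, map_mul]
    rfl

@[simp] theorem diagAct_pt (w : W r n) (f : PolyX n) (v : S) :
    diagAct τ w (pt f v) = pt (polyAct w f) (τ w v) := rfl

/-- The Dunkl-Opdam operator `D_i` on `ℂ[x] ⊗ S`. -/
noncomputable def dunkl (i : Fin n) : Module.End ℂ (PolyMod n S) :=
  ∑ η, h η • pmap (qDiff i η) (τ (dg i η))
    - c₀ • ∑ j ∈ Finset.univ.erase i, ∑ η, pmap (divDiff i j η) (τ (refl i j η))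

theorem dunkl_pt (i : Fin n) (f : PolyX n) (v : S) : dunkl τ c₀ h i (pt f v) =
    ∑ η, h η • (pt (qDiff i η f) (τ (dg i η) v))
      - c₀ • ∑ j ∈ Finset.univ.erase i, ∑ η, pt (divDiff i j η f) (τ (refl i j η) v) := by
  simp [dunkl, LinearMap.sum_apply]

theorem dunkl_one_pt (i : Fin n) (v : S) : dunkl τ c₀ h i (pt 1 v) = 0 := by
  rw [dunkl_pt, Finset.sum_eq_zero, Finset.sum_eq_zero, smul_zero, sub_zero]
  · intro j hj
    refine Finset.sum_eq_zero fun η _ => ?_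
    rw [divDiff_one (Finset.ne_of_mem_erase hj).symm, zero_pt]
  · intro η _
    rw [qDiff_one, zero_pt, smul_zero]

theorem commC_diagAct_pt_self (i : Fin n) (f : PolyX n) (v : S) :
    commC (diagAct τ) c₀ h i i (pt f v) = ∑ η, h η • (pt (polyAct (dg i η) f) (τ (dg i η) v))
      - c₀ • ∑ m ∈ Finset.univ.erase i, ∑ η, pt (polyAct (refl i m η) f) (τ (refl i m η) v) := by
  rw [commC_self]; simp [LinearMap.sum_apply]

theorem commC_diagAct_pt_ne {i k : Fin n} (hik : i ≠ k) (f : PolyX n) (v : S) :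
    commC (diagAct τ) c₀ h i k (pt f v) =
      c₀ • ∑ η, (uval η)⁻¹ • (pt (polyAct (refl i k η) f) (τ (refl i k η) v)) := by
  rw [commC_ne _ _ _ hik]; simp [LinearMap.sum_apply]

/-- Every summand of the Dunkl operator obeys a twisted Leibniz rule, and the twist terms assemble
to the prescribed commutator. -/
theorem dunkl_mul_mulX (i k : Fin n) : dunkl τ c₀ h i * mulX S k =
    mulX S k * dunkl τ c₀ h i + commC (diagAct τ) c₀ h i k := by
  refine polyMod_ext fun f v => ?_
  rw [Module.End.mul_apply, mulX_pt, dunkl_pt, LinearMap.add_apply, Module.End.mul_apply,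
    dunkl_pt, map_sub, map_smul, map_sum, map_sum]
  have e1 : ∀ η, h η • (pt (qDiff i η (MvPolynomial.X k * f)) (τ (dg i η) v)) =
      mulX S k (h η • (pt (qDiff i η f) (τ (dg i η) v))) +
        if k = i then h η • (pt (polyAct (dg i η) f) (τ (dg i η) v)) else 0 := by
    intro η
    rw [qDiff_X_mul, add_pt, smul_add, map_smul, mulX_pt]
    split_ifs
    · rfl
    · rw [zero_pt, smul_zero]
  have e2 : ∀ j ∈ Finset.univ.erase i,
      ∑ η, pt (divDiff i j η (MvPolynomial.X k * f)) (τ (refl i j η) v) =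
      mulX S k (∑ η, pt (divDiff i j η f) (τ (refl i j η) v)) +
        ∑ η, rootCoeff i j η k • (pt (polyAct (refl i j η) f) (τ (refl i j η) v)) := by
    intro j hj
    rw [map_sum, ← Finset.sum_add_distrib]
    refine Finset.sum_congr rfl fun η _ => ?_
    rw [divDiff_X_mul (Finset.ne_of_mem_erase hj).symm, add_pt, mulX_pt,
      smul_pt]
  rw [Finset.sum_congr rfl fun η _ => e1 η, Finset.sum_congr rfl e2, Finset.sum_add_distrib,
    Finset.sum_add_distrib, smul_add]
  rcases eq_or_ne i k with rfl | hik
  · rw [commC_diagAct_pt_self, Finset.sum_congr rfl fun η _ => if_pos rfl]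
    have : ∀ j η, rootCoeff (r := r) i j η i = 1 := fun j η => if_pos rfl
    simp only [this, one_smul]
    abel
  · rw [commC_diagAct_pt_ne _ _ _ hik, Finset.sum_congr rfl fun η _ => if_neg hik.symm,
      Finset.sum_const_zero, add_zero]
    rw [Finset.sum_eq_single (a := k) (f := fun j => ∑ η, rootCoeff i j η k •
      (pt (polyAct (refl i j η) f) (τ (refl i j η) v)))]
    · have : ∀ η, rootCoeff (r := r) i k η k = -(uval η)⁻¹ := fun η => by
        rw [rootCoeff, if_neg hik.symm, if_pos rfl]
      simp only [this, neg_smul, Finset.sum_neg_distrib, smul_neg]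
      abel
    · intro j _ hj
      refine Finset.sum_eq_zero fun η _ => ?_
      rw [rootCoeff, if_neg hik.symm, if_neg hj.symm, zero_smul]
    · intro hk
      simp [hik.symm] at hk

theorem diagAct_mul_mulX (w : W r n) (k : Fin n) : diagAct τ w * mulX S k =
    (uval (w.left (w.right k)))⁻¹ • (mulX S (w.right k) * diagAct τ w) := by
  refine polyMod_ext fun f v => ?_
  rw [Module.End.mul_apply, mulX_pt, diagAct_pt, map_mul, polyAct_X, LinearMap.smul_apply,
    Module.End.mul_apply, diagAct_pt, mulX_pt, smul_mul_assoc, smul_pt]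

/-- An operator on `ℂ[x] ⊗ S` that kills `1 ⊗ S` and commutes with the `x_k` up to a left factor is
zero. -/
theorem eq_zero_of_mulX (O : Module.End ℂ (PolyMod n S)) (h0 : ∀ v, O (pt 1 v) = 0)
    (hX : ∀ k, ∃ A : Module.End ℂ (PolyMod n S), O * mulX S k = A * O) : O = 0 := by
  refine polyMod_ext fun f v => ?_
  rw [LinearMap.zero_apply]
  induction f using MvPolynomial.induction_on with
  | C a =>
    have : (MvPolynomial.C a : PolyX n) = a • 1 := by
      rw [MvPolynomial.smul_eq_C_mul, mul_one]
    rw [this, smul_pt, map_smul, h0, smul_zero]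
  | add f g hf hg => rw [add_pt, map_add, hf, hg, add_zero]
  | mul_X f k hf =>
    obtain ⟨A, hA⟩ := hX k
    rw [mul_comm, ← mulX_pt, ← Module.End.mul_apply, hA, Module.End.mul_apply, hf, map_zero]

/-- The difference of both sides kills 1 ⊗ S and passes through every x_k up to a factor, hence is
zero. Only the commutators with the x_k enter, not the formula for the operators. -/
theorem dunkl_isEquivariant : IsEquivariant (diagAct τ) (dunkl τ c₀ h) := by
  intro w i
  rw [← sub_eq_zero]
  refine eq_zero_of_mulX _ (fun v => ?_) fun k =>
    ⟨(uval (w.left (w.right k)))⁻¹ • mulX S (w.right k), ?_⟩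
  · rw [LinearMap.sub_apply, LinearMap.smul_apply, Module.End.mul_apply, Module.End.mul_apply,
      diagAct_pt, map_one (polyAct w), dunkl_one_pt, dunkl_one_pt, map_zero, smul_zero, sub_zero]
  · have e1 : diagAct τ w * dunkl τ c₀ h i * mulX S k =
        (uval (w.left (w.right k)))⁻¹ • (mulX S (w.right k) * (diagAct τ w * dunkl τ c₀ h i)) +
        (uval (w.left (w.right i)) * (uval (w.left (w.right k)))⁻¹) •
          (commC (diagAct τ) c₀ h (w.right i) (w.right k) * diagAct τ w) := by
      rw [mul_assoc, dunkl_mul_mulX, mul_add, ← mul_assoc, diagAct_mul_mulX, mul_commC,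
        smul_mul_assoc, mul_assoc]
    have e2 : dunkl τ c₀ h (w.right i) * diagAct τ w * mulX S k = (uval (w.left (w.right k)))⁻¹ •
        (mulX S (w.right k) * (dunkl τ c₀ h (w.right i) * diagAct τ w) +
          commC (diagAct τ) c₀ h (w.right i) (w.right k) * diagAct τ w) := by
      rw [mul_assoc, diagAct_mul_mulX, mul_smul_comm, ← mul_assoc, dunkl_mul_mulX, add_mul,
        mul_assoc]
    rw [sub_mul, e1, smul_mul_assoc, e2, smul_mul_assoc, mul_sub, mul_smul_comm]
    module

/-- The same principle applied to the commutator of D_i and D_j: that it commutes with each x_k is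
the Jacobi identity `commC_sub`. -/
theorem dunkl_comm (i j : Fin n) : dunkl τ c₀ h i * dunkl τ c₀ h j = dunkl τ c₀ h j * dunkl τ c₀ h i := by
  rw [← sub_eq_zero]
  refine eq_zero_of_mulX _ (fun v => ?_) fun k => ⟨mulX S k, ?_⟩
  · rw [LinearMap.sub_apply, Module.End.mul_apply, Module.End.mul_apply, dunkl_one_pt,
      dunkl_one_pt, map_zero, map_zero, sub_zero]
  · have key := commC_sub c₀ h (dunkl_isEquivariant τ c₀ h) i j k
    rw [sub_mul, mul_assoc, mul_assoc, dunkl_mul_mulX, dunkl_mul_mulX, mul_add, mul_add, ← mul_assoc,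
      ← mul_assoc, dunkl_mul_mulX, dunkl_mul_mulX, add_mul, add_mul, mul_sub, mul_assoc, mul_assoc]
    rw [sub_eq_sub_iff_add_eq_add] at key
    rw [sub_eq_iff_eq_add]
    have := congrArg (fun x => mulX S k * (dunkl τ c₀ h i * dunkl τ c₀ h j) + x) key
    rw [show ∀ a b c d : Module.End ℂ (PolyMod n S), a - b + (b + c + d) = a + (d + c) by
      intros; abel, ← this]
    abel

end Dunkl

/-! ## The Cherednik algebra -/

section Relations

/-- The coefficients of `κ - ∑ (d_j - d_{j-1}) e_{ij}` in the elements `t_{η_i}`. -/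
noncomputable def hcoef (κ : ℂ) (d : ZMod r → ℂ) (η : rootsOfUnity r ℂ) : ℂ :=
  (if η = 1 then κ else 0) - ∑ j, (d j - d (j - 1)) * ((r : ℂ)⁻¹ * (uval η)⁻¹ ^ j.val)

variable {A : Type*} [Ring A] [Algebra ℂ A] (φ : FreeAlgebra ℂ (Gen r n) →ₐ[ℂ] A) (τ : W r n →* A)
  (κ c₀ : ℂ) (d : ZMod r → ℂ)

theorem map_FE (hφ : ∀ w, φ (FT w) = τ w) (i : Fin n) (j : ZMod r) :
    φ (FE i j) = ∑ η, ((r : ℂ)⁻¹ * (uval η)⁻¹ ^ j.val) • τ (dg i η) := by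
  rw [FE, map_smul, map_sum, ← sum_range_zu, Finset.smul_sum]
  refine Finset.sum_congr rfl fun l _ => ?_
  rw [map_smul, hφ, smul_smul, uval_pow, uval_zu, zetaAt_eq, dg_pow, pow_mul, inv_pow]

theorem map_rel_self (hφ : ∀ w, φ (FT w) = τ w) (i : Fin n) :
    φ (FX i * FY i + algebraMap ℂ _ κ - ∑ j : ZMod r, (d j - d (j - 1)) • FE i j
        - c₀ • ∑ j ∈ Finset.univ.erase i, ∑ l ∈ Finset.range r, FT (reflect i j l)) =
      φ (FX i) * φ (FY i) + commC τ c₀ (hcoef κ d) i i := by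
  rw [commC_self, map_sub, map_sub, map_add, map_mul, map_smul, map_sum, map_sum, AlgHom.commutes]
  have e1 : ∑ j ∈ Finset.univ.erase i, φ (∑ l ∈ Finset.range r, FT (reflect i j l)) =
      ∑ j ∈ Finset.univ.erase i, ∑ η, τ (refl i j η) := by
    refine Finset.sum_congr rfl fun j _ => ?_
    rw [map_sum, ← sum_range_zu]
    refine Finset.sum_congr rfl fun l _ => ?_
    rw [hφ, reflect_eq]
  have e2 : ∑ η, hcoef κ d η • τ (dg i η) =
      algebraMap ℂ A κ - ∑ j : ZMod r, φ ((d j - d (j - 1)) • FE i j) := by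
    simp only [hcoef]
    rw [Finset.sum_congr rfl fun η _ => sub_smul _ _ (τ (dg i η))]
    simp only [Finset.sum_sub_distrib, ite_smul, zero_smul, Finset.sum_ite_eq',
      Finset.mem_univ, if_true, dg_one, map_one, Algebra.algebraMap_eq_smul_one]
    congr 1
    simp only [Finset.sum_smul]
    rw [Finset.sum_comm]
    refine Finset.sum_congr rfl fun j _ => ?_
    rw [map_smul, map_FE φ τ hφ, Finset.smul_sum]
    refine Finset.sum_congr rfl fun η _ => ?_
    rw [smul_smul]
  rw [e1, e2]
  abel

theorem map_rel_ne (hφ : ∀ w, φ (FT w) = τ w) {i j : Fin n} (hij : i ≠ j) :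
    φ (FX j * FY i + c₀ • ∑ l ∈ Finset.range r, ((zeta r)⁻¹ ^ l) • FT (reflect i j l)) =
      φ (FX j) * φ (FY i) + commC τ c₀ (hcoef κ d) i j := by
  rw [commC_ne _ _ _ hij, map_add, map_mul, map_smul, map_sum, ← sum_range_zu]
  congr 2
  refine Finset.sum_congr rfl fun l _ => ?_
  rw [map_smul, hφ, reflect_eq, uval_pow, uval_zu, inv_pow]

theorem toH_eq_of_rel {a b : FreeAlgebra ℂ (Gen r n)} (h : Rel κ c₀ d a b) :
    toH κ c₀ d a = toH κ c₀ d b :=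
  RingQuot.mkAlgHom_rel ℂ h

/-- The homomorphism `w ↦ t_w`. -/
noncomputable def tH (κ c₀ : ℂ) (d : ZMod r → ℂ) : W r n →* Cherednik r n κ c₀ d where
  toFun := t κ c₀ d
  map_one' := (toH_eq_of_rel κ c₀ d Rel.t_one).trans (map_one _)
  map_mul' v w := by
    rw [t, t, t, ← map_mul, toH_eq_of_rel κ c₀ d (Rel.t_mul v w)]

theorem tH_apply (w : W r n) : tH κ c₀ d w = t κ c₀ d w := rfl

theorem X_comm (i j : Fin n) : X κ c₀ d i * X κ c₀ d j = X κ c₀ d j * X κ c₀ d i := by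
  rw [X, X, ← map_mul, ← map_mul, toH_eq_of_rel κ c₀ d (Rel.x_comm i j)]

theorem tH_mul_X (w : W r n) (j : Fin n) : tH κ c₀ d w * X κ c₀ d j =
    (uval (w.left (w.right j)))⁻¹ • (X κ c₀ d (w.right j) * tH κ c₀ d w) := by
  rw [tH_apply, t, X, X, ← map_mul, toH_eq_of_rel κ c₀ d (Rel.t_x w j), map_smul, map_mul]
  rfl

theorem Y_isEquivariant : IsEquivariant (n := n) (tH κ c₀ d) (Y κ c₀ d) := by
  intro w j
  rw [tH_apply, t, Y, Y, ← map_mul, toH_eq_of_rel κ c₀ d (Rel.t_y w j), map_smul, map_mul]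
  rfl

theorem Y_mul_X (i j : Fin n) : Y κ c₀ d i * X κ c₀ d j =
    X κ c₀ d j * Y κ c₀ d i + commC (tH κ c₀ d) c₀ (hcoef κ d) i j := by
  rw [X, Y, ← map_mul]
  rcases eq_or_ne i j with rfl | hij
  · rw [toH_eq_of_rel κ c₀ d (Rel.y_x_self i)]
    exact map_rel_self (toH κ c₀ d) (tH κ c₀ d) κ c₀ d (fun _ => rfl) i
  · rw [toH_eq_of_rel κ c₀ d (Rel.y_x_ne i j hij)]
    exact map_rel_ne (toH κ c₀ d) (tH κ c₀ d) κ c₀ d (fun _ => rfl) hij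

variable {κ c₀ d}

theorem cherednik_induction {p : Cherednik r n κ c₀ d → Prop} (hc : ∀ a, p (algebraMap ℂ _ a))
    (hX : ∀ i, p (X κ c₀ d i)) (hY : ∀ i, p (Y κ c₀ d i)) (ht : ∀ w, p (t κ c₀ d w))
    (hadd : ∀ a b, p a → p b → p (a + b)) (hmul : ∀ a b, p a → p b → p (a * b))
    (a : Cherednik r n κ c₀ d) : p a := by
  obtain ⟨b, rfl⟩ := RingQuot.mkAlgHom_surjective ℂ (Rel (r := r) (n := n) κ c₀ d) a
  change p (toH κ c₀ d b)
  induction b using FreeAlgebra.induction with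
  | grade0 a => rw [AlgHom.commutes]; exact hc a
  | grade1 g =>
    cases g with
    | x i => exact hX i
    | y i => exact hY i
    | t w => exact ht w
  | mul a b ha hb => rw [map_mul]; exact hmul _ _ ha hb
  | add a b ha hb => rw [map_add]; exact hadd _ _ ha hb

end Relations

/-! ### The Dunkl-Opdam representation on ℂ[x] ⊗ S -/

section Model

variable {S : Type*} [AddCommGroup S] [Module ℂ S] (τ : W r n →* Module.End ℂ S)
  (κ c₀ : ℂ) (d : ZMod r → ℂ)

theorem polyMod_induction {p : PolyMod n S → Prop} (zero : p 0)
    (add : ∀ a b, p a → p b → p (a + b)) (one : ∀ v, p (pt 1 v))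
    (mulX : ∀ k m, p m → p (mulX S k m)) (m : PolyMod n S) : p m := by
  refine TensorProduct.induction_on m zero (fun f v => ?_) add
  change p (pt f v)
  induction f using MvPolynomial.induction_on with
  | C a =>
    have : (MvPolynomial.C a : PolyX n) = a • 1 := by
      rw [MvPolynomial.smul_eq_C_mul, mul_one]
    rw [this, smul_pt, ← map_smul]
    exact one _
  | add f g hf hg => rw [add_pt]; exact add _ _ hf hg
  | mul_X f k hf =>
    rw [mul_comm, ← mulX_pt]
    exact mulX k _ hf

/-- The action of the generators of the Cherednik algebra on `ℂ[x] ⊗ S`. -/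
noncomputable def genOp : Gen r n → Module.End ℂ (PolyMod n S)
  | .x i => mulX S i
  | .y i => dunkl τ c₀ (hcoef κ d) i
  | .t w => diagAct τ w

theorem genOp_rel {a b : FreeAlgebra ℂ (Gen r n)} (h : Rel κ c₀ d a b) :
    FreeAlgebra.lift ℂ (genOp τ κ c₀ d) a = FreeAlgebra.lift ℂ (genOp τ κ c₀ d) b := by
  have hx : ∀ i, FreeAlgebra.lift ℂ (genOp τ κ c₀ d) (FX i) = mulX S i :=
    fun i => FreeAlgebra.lift_ι_apply _ _
  have hy : ∀ i, FreeAlgebra.lift ℂ (genOp τ κ c₀ d) (FY i) = dunkl τ c₀ (hcoef κ d) i :=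
    fun i => FreeAlgebra.lift_ι_apply _ _
  have ht : ∀ w, FreeAlgebra.lift ℂ (genOp τ κ c₀ d) (FT w) = diagAct τ w :=
    fun w => FreeAlgebra.lift_ι_apply _ _
  cases h with
  | x_comm i j =>
    rw [map_mul, map_mul, hx, hx]
    refine polyMod_ext fun f v => ?_
    rw [Module.End.mul_apply, Module.End.mul_apply, mulX_pt, mulX_pt, mulX_pt, mulX_pt,
      mul_left_comm]
  | y_comm i j => rw [map_mul, map_mul, hy, hy, dunkl_comm]
  | t_one => rw [ht, map_one, map_one]
  | t_mul v w => rw [map_mul, ht, ht, ht, map_mul]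
  | t_x w j => rw [map_mul, map_smul, map_mul, ht, hx, hx, diagAct_mul_mulX]; rfl
  | t_y w j => rw [map_mul, map_smul, map_mul, ht, hy, hy, dunkl_isEquivariant]; rfl
  | y_x_ne i j hij => rw [map_rel_ne _ _ κ c₀ d ht hij, map_mul, hx, hy, dunkl_mul_mulX]
  | y_x_self i => rw [map_rel_self _ _ κ c₀ d ht i, map_mul, hx, hy, dunkl_mul_mulX]

/-- The representation of the Cherednik algebra on `ℂ[x] ⊗ S` by Dunkl-Opdam operators. -/
noncomputable def polyRep : Cherednik r n κ c₀ d →ₐ[ℂ] Module.End ℂ (PolyMod n S) :=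
  RingQuot.liftAlgHom ℂ ⟨FreeAlgebra.lift ℂ (genOp τ κ c₀ d), fun _ _ h => genOp_rel τ κ c₀ d h⟩

theorem polyRep_toH (a : FreeAlgebra ℂ (Gen r n)) :
    polyRep τ κ c₀ d (toH κ c₀ d a) = FreeAlgebra.lift ℂ (genOp τ κ c₀ d) a :=
  RingQuot.liftAlgHom_mkAlgHom_apply ..

theorem polyRep_X (i : Fin n) : polyRep τ κ c₀ d (X κ c₀ d i) = mulX S i :=
  (polyRep_toH τ κ c₀ d _).trans (FreeAlgebra.lift_ι_apply _ _)

theorem polyRep_Y (i : Fin n) :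
    polyRep τ κ c₀ d (Y κ c₀ d i) = dunkl τ c₀ (hcoef κ d) i :=
  (polyRep_toH τ κ c₀ d _).trans (FreeAlgebra.lift_ι_apply _ _)

theorem polyRep_t (w : W r n) : polyRep τ κ c₀ d (t κ c₀ d w) = diagAct τ w :=
  (polyRep_toH τ κ c₀ d _).trans (FreeAlgebra.lift_ι_apply _ _)

end Model

/-! ## The standard module as `ℂ[x] ⊗ S^λ` -/

section Verma

variable (κ c₀ : ℂ) (d : ZMod r → ℂ) (lam : MultiPartition r n)

noncomputable instance : Module (Cherednik r n κ c₀ d) (PolyMod n (SMod lam)) :=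
  Module.compHom _ (polyRep (sRep lam) κ c₀ d).toRingHom

theorem smul_polyMod (a : Cherednik r n κ c₀ d) (m : PolyMod n (SMod lam)) :
    a • m = polyRep (sRep lam) κ c₀ d a m := rfl

instance : IsScalarTower ℂ (Cherednik r n κ c₀ d) (PolyMod n (SMod lam)) where
  smul_assoc a b m := by
    rw [smul_polyMod, smul_polyMod, map_smul, LinearMap.smul_apply]

instance : SMulCommClass ℂ (Cherednik r n κ c₀ d) (PolyMod n (SMod lam)) where
  smul_comm a b m := by
    rw [smul_polyMod, smul_polyMod, map_smul]

/-- The embedding `ℂ[x] → ℍ`. -/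
noncomputable def polyH : PolyX n →ₐ[ℂ] Cherednik r n κ c₀ d :=
  -- Evaluation of polynomials needs a commutative target, so it is done in the subalgebra generated
  -- by the x_i.
  letI : CommRing (Algebra.adjoin ℂ (Set.range (X (n := n) κ c₀ d))) :=
    { (inferInstance : Ring (Algebra.adjoin ℂ (Set.range (X (n := n) κ c₀ d)))) with
      mul_comm := by
        have : IsMulCommutative (Algebra.adjoin ℂ (Set.range (X (n := n) κ c₀ d))) :=
          Algebra.isMulCommutative_adjoin ℂ (by rintro _ ⟨i, rfl⟩ _ ⟨j, rfl⟩; exact X_comm κ c₀ d i j)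
        exact this.is_comm.comm }
  (Algebra.adjoin ℂ (Set.range (X (n := n) κ c₀ d))).val.comp
    (MvPolynomial.aeval fun i => ⟨X κ c₀ d i, Algebra.subset_adjoin ⟨i, rfl⟩⟩)

theorem polyH_X (i : Fin n) : polyH κ c₀ d (MvPolynomial.X i) = X κ c₀ d i := by
  rw [polyH]
  simp

theorem polyH_xmon (μ : Fin n → ℕ) : polyH κ c₀ d (xmon μ) = xPow κ c₀ d μ := by
  have : (xmon μ : PolyX n) = (List.ofFn fun i => (MvPolynomial.X i : PolyX n) ^ μ i).prod := by
    rw [List.prod_ofFn]; rfl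
  rw [this, map_list_prod, List.map_ofFn, xPow]
  congr 2
  ext i
  rw [Function.comp_apply, map_pow, polyH_X]

theorem X_mul_xPow (i : Fin n) (μ : Fin n → ℕ) :
    X κ c₀ d i * xPow κ c₀ d μ = xPow κ c₀ d (μ + Pi.single i 1) := by
  rw [← polyH_xmon, ← polyH_xmon, ← polyH_X, ← map_mul, X_mul_xmon]

theorem tH_mul_polyH (w : W r n) (f : PolyX n) :
    t κ c₀ d w * polyH κ c₀ d f = polyH κ c₀ d (polyAct w f) * t κ c₀ d w := by
  induction f using MvPolynomial.induction_on with
  | C a =>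
    rw [MvPolynomial.algHom_C, MvPolynomial.algHom_C, AlgHom.commutes, Algebra.commutes]
  | add f g hf hg => rw [map_add, mul_add, hf, hg, map_add, map_add, add_mul]
  | mul_X f i hf =>
    rw [map_mul, map_mul, map_mul, ← mul_assoc, hf, mul_assoc, polyH_X, ← tH_apply, tH_mul_X,
      polyAct_X, mul_smul_comm, map_smul, polyH_X, mul_smul_comm, smul_mul_assoc, mul_assoc]

noncomputable scoped instance : AddCommGroup (Verma κ c₀ d lam) := inferInstance

noncomputable scoped instance : Module (Cherednik r n κ c₀ d) (Verma κ c₀ d lam) := inferInstance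

noncomputable scoped instance : Module ℂ (Verma κ c₀ d lam) := inferInstance

scoped instance : IsScalarTower ℂ (Cherednik r n κ c₀ d) (Verma κ c₀ d lam) := inferInstance

scoped instance : SMulCommClass (Cherednik r n κ c₀ d) ℂ (Verma κ c₀ d lam) := inferInstance

/-- The image of `h ⊗ v` in the standard module. -/
noncomputable def vmk : Cherednik r n κ c₀ d →ₗ[ℂ] SMod lam →ₗ[ℂ] Verma κ c₀ d lam :=
  (TensorProduct.mk ℂ (Cherednik r n κ c₀ d) (SMod lam)).compr₂
    ((Submodule.mkQ (Submodule.span (Cherednik r n κ c₀ d)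
      {u | IndRel κ c₀ d lam u})).restrictScalars ℂ)

theorem smul_vmk (a b : Cherednik r n κ c₀ d) (v : SMod lam) :
    a • vmk κ c₀ d lam b v = vmk κ c₀ d lam (a * b) v := rfl

theorem vmk_mul_t (a : Cherednik r n κ c₀ d) (w : W r n) (v : SMod lam) :
    vmk κ c₀ d lam (a * t κ c₀ d w) v = vmk κ c₀ d lam a (sRep lam w v) :=
  (Submodule.Quotient.eq _).mpr (Submodule.subset_span (IndRel.group w a v))

theorem vmk_mul_Y (a : Cherednik r n κ c₀ d) (i : Fin n) (v : SMod lam) :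
    vmk κ c₀ d lam (a * Y κ c₀ d i) v = 0 :=
  (Submodule.Quotient.mk_eq_zero _).mpr (Submodule.subset_span (IndRel.y i a v))

/-- The map `ℂ[x] ⊗ S^λ → M(λ)` over `ℂ`. -/
noncomputable def polyToVermaAux : PolyMod n (SMod lam) →ₗ[ℂ] Verma κ c₀ d lam :=
  TensorProduct.lift ((vmk κ c₀ d lam).comp (polyH κ c₀ d).toLinearMap)

theorem polyToVermaAux_pt (f : PolyX n) (v : SMod lam) :
    polyToVermaAux κ c₀ d lam (pt f v) = vmk κ c₀ d lam (polyH κ c₀ d f) v := rfl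

theorem polyToVermaAux_X (i : Fin n) (m : PolyMod n (SMod lam)) :
    polyToVermaAux κ c₀ d lam (mulX _ i m) = X κ c₀ d i • polyToVermaAux κ c₀ d lam m := by
  suffices h : polyToVermaAux κ c₀ d lam ∘ₗ mulX _ i =
      Module.toModuleEnd ℂ (Verma κ c₀ d lam) (X κ c₀ d i) ∘ₗ polyToVermaAux κ c₀ d lam from
    LinearMap.congr_fun h m
  refine polyMod_ext fun f v => ?_
  change polyToVermaAux κ c₀ d lam (mulX _ i (pt f v)) =
    X κ c₀ d i • polyToVermaAux κ c₀ d lam (pt f v)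
  rw [mulX_pt, polyToVermaAux_pt, polyToVermaAux_pt, smul_vmk, map_mul, polyH_X]

theorem polyToVermaAux_t (w : W r n) (m : PolyMod n (SMod lam)) :
    polyToVermaAux κ c₀ d lam (diagAct (sRep lam) w m) =
      t κ c₀ d w • polyToVermaAux κ c₀ d lam m := by
  suffices h : polyToVermaAux κ c₀ d lam ∘ₗ diagAct (sRep lam) w =
      Module.toModuleEnd ℂ (Verma κ c₀ d lam) (t κ c₀ d w) ∘ₗ polyToVermaAux κ c₀ d lam from
    LinearMap.congr_fun h m
  refine polyMod_ext fun f v => ?_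
  change polyToVermaAux κ c₀ d lam (diagAct (sRep lam) w (pt f v)) =
    t κ c₀ d w • polyToVermaAux κ c₀ d lam (pt f v)
  rw [diagAct_pt, polyToVermaAux_pt, polyToVermaAux_pt, smul_vmk, tH_mul_polyH, vmk_mul_t]

theorem polyToVermaAux_commC (i j : Fin n) (m : PolyMod n (SMod lam)) :
    polyToVermaAux κ c₀ d lam (commC (diagAct (sRep lam)) c₀ (hcoef κ d) i j m) =
      commC (tH κ c₀ d) c₀ (hcoef κ d) i j • polyToVermaAux κ c₀ d lam m := by
  rcases eq_or_ne i j with rfl | hij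
  · rw [commC_self, commC_self]
    simp only [LinearMap.sub_apply, LinearMap.smul_apply, LinearMap.sum_apply, map_sub, map_smul,
      map_sum, polyToVermaAux_t, sub_smul, smul_assoc, Finset.sum_smul, tH_apply]
  · rw [commC_ne _ _ _ hij, commC_ne _ _ _ hij]
    simp only [LinearMap.smul_apply, LinearMap.sum_apply, map_smul,
      map_sum, polyToVermaAux_t, smul_assoc, Finset.sum_smul, tH_apply]

theorem Y_smul_vmk_one (i : Fin n) (v : SMod lam) : Y κ c₀ d i • vmk κ c₀ d lam 1 v = 0 := by
  have := vmk_mul_Y κ c₀ d lam 1 i v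
  rw [one_mul] at this
  rw [smul_vmk, mul_one, this]

theorem polyToVermaAux_one (v : SMod lam) :
    polyToVermaAux κ c₀ d lam (pt 1 v) = vmk κ c₀ d lam 1 v := by
  rw [polyToVermaAux_pt, map_one]

theorem polyToVermaAux_Y_mulX (i k : Fin n) {m : PolyMod n (SMod lam)}
    (hm : polyToVermaAux κ c₀ d lam (dunkl (sRep lam) c₀ (hcoef κ d) i m) =
      Y κ c₀ d i • polyToVermaAux κ c₀ d lam m) :
    polyToVermaAux κ c₀ d lam (dunkl (sRep lam) c₀ (hcoef κ d) i (mulX _ k m)) =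
      Y κ c₀ d i • polyToVermaAux κ c₀ d lam (mulX _ k m) := by
  have e := LinearMap.congr_fun (dunkl_mul_mulX (sRep lam) c₀ (hcoef κ d) i k) m
  rw [Module.End.mul_apply, LinearMap.add_apply, Module.End.mul_apply] at e
  rw [e, map_add, polyToVermaAux_X, hm, polyToVermaAux_commC, polyToVermaAux_X,
    ← mul_smul (Y κ c₀ d i) (X κ c₀ d k), Y_mul_X, add_smul, mul_smul (X κ c₀ d k)]

/-- Both sides vanish on 1 ⊗ S^λ, and both change in the same way under multiplication by x_k, since
Dunkl operators and the y_i have matching commutators with the x_k. -/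
theorem polyToVermaAux_Y (i : Fin n) (m : PolyMod n (SMod lam)) :
    polyToVermaAux κ c₀ d lam (dunkl (sRep lam) c₀ (hcoef κ d) i m) =
      Y κ c₀ d i • polyToVermaAux κ c₀ d lam m := by
  induction m using polyMod_induction with
  | zero => rw [map_zero, map_zero, smul_zero]
  | one v => rw [dunkl_one_pt, map_zero, polyToVermaAux_one, Y_smul_vmk_one]
  | add a b ha hb => rw [map_add, map_add, ha, hb, map_add, smul_add]
  | mulX k m hm => exact polyToVermaAux_Y_mulX κ c₀ d lam i k hm

theorem polyToVermaAux_smul (a : Cherednik r n κ c₀ d) (m : PolyMod n (SMod lam)) :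
    polyToVermaAux κ c₀ d lam (a • m) = a • polyToVermaAux κ c₀ d lam m := by
  induction a using cherednik_induction generalizing m with
  | hc a => rw [algebraMap_smul, algebraMap_smul, map_smul]
  | hX i => rw [smul_polyMod, polyRep_X, polyToVermaAux_X]
  | hY i => rw [smul_polyMod, polyRep_Y, polyToVermaAux_Y]
  | ht w => rw [smul_polyMod, polyRep_t, polyToVermaAux_t]
  | hadd a b ha hb => rw [add_smul, map_add, ha, hb, add_smul]
  | hmul a b ha hb => rw [mul_smul, ha, hb, mul_smul]

/-- The map `M(λ) → ℂ[x] ⊗ S^λ`. -/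
noncomputable def vermaToPoly : Verma κ c₀ d lam →ₗ[Cherednik r n κ c₀ d] PolyMod n (SMod lam) :=
  Submodule.liftQ _ (TensorProduct.AlgebraTensorModule.lift
    (LinearMap.toSpanSingleton (Cherednik r n κ c₀ d) (SMod lam →ₗ[ℂ] PolyMod n (SMod lam))
      (pt 1))) (by
    rw [Submodule.span_le]
    rintro u (⟨w, h, v⟩ | ⟨i, h, v⟩) <;> rw [SetLike.mem_coe, LinearMap.mem_ker]
    · rw [map_sub, sub_eq_zero]
      change (h * t κ c₀ d w) • pt (n := n) 1 v = h • pt (n := n) 1 (sRep lam w v)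
      rw [mul_smul, smul_polyMod κ c₀ d lam (t κ c₀ d w), polyRep_t, diagAct_pt, map_one]
    · change (h * Y κ c₀ d i) • pt (n := n) 1 v = 0
      rw [mul_smul, smul_polyMod κ c₀ d lam (Y κ c₀ d i), polyRep_Y, dunkl_one_pt, smul_zero])

theorem vermaToPoly_vmk (a : Cherednik r n κ c₀ d) (v : SMod lam) :
    vermaToPoly κ c₀ d lam (vmk κ c₀ d lam a v) = a • pt 1 v := rfl

theorem polyH_smul (f g : PolyX n) (v : SMod lam) :
    polyH κ c₀ d f • pt g v = pt (f * g) v := by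
  induction f using MvPolynomial.induction_on generalizing g with
  | C a =>
    rw [MvPolynomial.algHom_C, algebraMap_smul, ← MvPolynomial.smul_eq_C_mul, smul_pt]
  | add f f' hf hf' => rw [map_add, add_smul, hf, hf', add_mul, add_pt]
  | mul_X f i hf => rw [map_mul, mul_smul, polyH_X, smul_polyMod κ c₀ d lam (X κ c₀ d i),
      polyRep_X, mulX_pt, hf, mul_assoc]

/-- This carries the injectivity of ℂ[x] ⊗ S^λ → M(λ): the left inverse exists because Dunkl
operators give an ℍ-module in which y_i kills 1 ⊗ S^λ. -/
theorem vermaToPoly_polyToVermaAux (m : PolyMod n (SMod lam)) :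
    vermaToPoly κ c₀ d lam (polyToVermaAux κ c₀ d lam m) = m := by
  suffices h : (vermaToPoly κ c₀ d lam).restrictScalars ℂ ∘ₗ polyToVermaAux κ c₀ d lam =
    LinearMap.id from LinearMap.congr_fun h m
  refine polyMod_ext fun f v => ?_
  change vermaToPoly κ c₀ d lam (polyToVermaAux κ c₀ d lam (pt f v)) = pt f v
  rw [polyToVermaAux_pt, vermaToPoly_vmk, polyH_smul, mul_one]

theorem vmk_one_surj (p : Verma κ c₀ d lam → Prop) (h0 : p 0)
    (hadd : ∀ a b, p a → p b → p (a + b)) (hmk : ∀ a v, p (vmk κ c₀ d lam a v))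
    (m : Verma κ c₀ d lam) : p m := by
  obtain ⟨u, rfl⟩ := Submodule.Quotient.mk_surjective _ m
  induction u using TensorProduct.induction_on with
  | zero => exact h0
  | tmul a v => exact hmk a v
  | add a b ha hb => exact hadd _ _ ha hb

theorem polyToVermaAux_surjective : Function.Surjective (polyToVermaAux κ c₀ d lam) := by
  intro m
  induction m using vmk_one_surj with
  | h0 => exact ⟨0, map_zero _⟩
  | hadd a b ha hb =>
    obtain ⟨x, rfl⟩ := ha
    obtain ⟨y, rfl⟩ := hb
    exact ⟨x + y, map_add _ _ _⟩
  | hmk a v =>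
    refine ⟨a • pt 1 v, ?_⟩
    rw [polyToVermaAux_smul, polyToVermaAux_pt, map_one, smul_vmk, mul_one]

/-- The isomorphism `ℂ[x] ⊗ S^λ ≃ M(λ)`. -/
noncomputable def polyToVerma : PolyMod n (SMod lam) ≃ₗ[Cherednik r n κ c₀ d] Verma κ c₀ d lam :=
  LinearEquiv.ofBijective
    { toFun := polyToVermaAux κ c₀ d lam
      map_add' := map_add _
      map_smul' := polyToVermaAux_smul κ c₀ d lam }
    ⟨Function.LeftInverse.injective (vermaToPoly_polyToVermaAux κ c₀ d lam),
      polyToVermaAux_surjective κ c₀ d lam⟩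

/-- The element `x^μ ⊗ v` of the standard module. -/
noncomputable def mon (μ : Fin n → ℕ) : SMod lam →ₗ[ℂ] Verma κ c₀ d lam :=
  vmk κ c₀ d lam (xPow κ c₀ d μ)

theorem polyToVerma_xmon (μ : Fin n → ℕ) (v : SMod lam) :
    polyToVerma κ c₀ d lam (pt (xmon μ) v) = mon κ c₀ d lam μ v := by
  change polyToVermaAux κ c₀ d lam (pt (xmon μ) v) = _
  rw [polyToVermaAux_pt, polyH_xmon, mon]

theorem X_smul_mon (i : Fin n) (μ : Fin n → ℕ) (v : SMod lam) :
    X κ c₀ d i • mon κ c₀ d lam μ v = mon κ c₀ d lam (μ + Pi.single i 1) v := by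
  rw [mon, mon, smul_vmk, X_mul_xPow]

theorem perm_smul_mon (w : Perm (Fin n)) (μ : Fin n → ℕ) (v : SMod lam) :
    t κ c₀ d (perm w) • mon κ c₀ d lam μ v =
      mon κ c₀ d lam (permComp w μ) (sRep lam (perm w) v) := by
  rw [mon, mon, smul_vmk, ← polyH_xmon, tH_mul_polyH, vmk_mul_t, polyAct_perm_xmon, polyH_xmon]

theorem dg_smul_mon (i : Fin n) (η : rootsOfUnity r ℂ) (μ : Fin n → ℕ) (v : SMod lam) :
    t κ c₀ d (dg i η) • mon κ c₀ d lam μ v =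
      ((uval η)⁻¹ ^ μ i) • mon κ c₀ d lam μ (sRep lam (dg i η) v) := by
  rw [mon, smul_vmk, ← polyH_xmon, tH_mul_polyH, vmk_mul_t, polyAct_dg_xmon, map_smul, map_smul,
    LinearMap.smul_apply]

theorem leading_eq (μ : Fin n → ℕ) (T : SYT lam) : leading κ c₀ d lam μ T =
    mon κ c₀ d lam μ (sRep lam (perm (wPerm μ))⁻¹ (vec T)) := rfl

/-- The decomposition of `ℂ[x] ⊗ S` by monomials. -/
noncomputable def polyModCoef (n : ℕ) (S : Type*) [AddCommGroup S] [Module ℂ S] :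
    PolyMod n S ≃ₗ[ℂ] ((Fin n → ℕ) →₀ S) :=
  TensorProduct.equivFinsuppOfBasisLeft (xmonBasis n)

theorem polyModCoef_symm_single {S : Type*} [AddCommGroup S] [Module ℂ S] (μ : Fin n → ℕ) (v : S) :
    (polyModCoef n S).symm (Finsupp.single μ v) = pt (xmon μ) v := by
  refine (TensorProduct.equivFinsuppOfBasisLeft_symm_apply (xmonBasis n) _).trans ?_
  refine (Finsupp.sum_single_index (h := fun i v => xmonBasis n i ⊗ₜ[ℂ] v)
    (TensorProduct.tmul_zero (R := ℂ) S (xmonBasis n μ))).trans ?_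
  rw [xmonBasis_apply]
  rfl

/-- The decomposition of the standard module by monomials. -/
noncomputable def coef : Verma κ c₀ d lam ≃ₗ[ℂ] ((Fin n → ℕ) →₀ SMod lam) :=
  ((polyToVerma κ c₀ d lam).restrictScalars ℂ).symm ≪≫ₗ polyModCoef n (SMod lam)

theorem coef_symm_single (μ : Fin n → ℕ) (v : SMod lam) :
    (coef κ c₀ d lam).symm (Finsupp.single μ v) = mon κ c₀ d lam μ v := by
  rw [coef, LinearEquiv.trans_symm, LinearEquiv.trans_apply, LinearEquiv.symm_symm,
    polyModCoef_symm_single]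
  exact polyToVerma_xmon κ c₀ d lam μ v

theorem coef_mon (μ : Fin n → ℕ) (v : SMod lam) :
    coef κ c₀ d lam (mon κ c₀ d lam μ v) = Finsupp.single μ v := by
  rw [← coef_symm_single, LinearEquiv.apply_symm_apply]

theorem span_mon : Submodule.span ℂ {m | ∃ μ v, m = mon κ c₀ d lam μ v} = ⊤ := by
  rw [eq_top_iff]
  rintro m -
  rw [← (coef κ c₀ d lam).symm_apply_apply m]
  induction coef κ c₀ d lam m using Finsupp.induction_linear with
  | zero => rw [map_zero]; exact zero_mem _
  | add a b ha hb => rw [map_add]; exact add_mem ha hb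
  | single μ v => rw [coef_symm_single]; exact Submodule.subset_span ⟨μ, v, rfl⟩

/-- The action of a group element on `S^λ`. -/
noncomputable def sRepEquiv (w : W r n) : SMod lam ≃ₗ[ℂ] SMod lam :=
  LinearEquiv.ofLinearMap (sRep lam w) (sRep lam w⁻¹)
    (by rw [← Module.End.mul_eq_comp, ← map_mul, mul_inv_cancel, map_one]; rfl)
    (by rw [← Module.End.mul_eq_comp, ← map_mul, inv_mul_cancel, map_one]; rfl)

/-- The basis of the elements `x^μ v_T^μ`. -/
noncomputable def leadingBasis :
    Module.Basis ((Fin n → ℕ) × SYT lam) ℂ (Verma κ c₀ d lam) :=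
  ((Finsupp.basis fun μ : Fin n → ℕ =>
    (vecBasis lam).map (sRepEquiv lam (perm (wPerm μ))⁻¹)).map (coef κ c₀ d lam).symm).reindex
      (Equiv.sigmaEquivProd _ _)

theorem leadingBasis_apply (p : (Fin n → ℕ) × SYT lam) :
    leadingBasis κ c₀ d lam p = leading κ c₀ d lam p.1 p.2 := by
  rw [leadingBasis, Module.Basis.reindex_apply, Module.Basis.map_apply, leading_eq,
    ← coef_symm_single]
  congr 1
  simp [sRepEquiv, vecBasis_apply]

end Verma

/-! ## Triangularity of the Dunkl-Opdam operators -/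

section Triangular

/-- The span of the monomials that are obtained from `x^μ` by moving the exponents at `i` and `j`
strictly closer to each other. -/
noncomputable def betweenSpan (i j : Fin n) (μ : Fin n → ℕ) : Submodule ℂ (PolyX n) :=
  Submodule.span ℂ (xmon '' {ν | (∀ x, x ≠ i → x ≠ j → ν x = μ x) ∧ ν i + ν j = μ i + μ j ∧
    min (μ i) (μ j) < ν i ∧ ν i < max (μ i) (μ j)})

/-- The span of the monomials below `x^μ`. -/
noncomputable def lowPoly (μ : Fin n → ℕ) : Submodule ℂ (PolyX n) :=
  Submodule.span ℂ (xmon '' {ν | CompLT ν μ})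

theorem betweenSpan_le_lowPoly (i j : Fin n) (μ : Fin n → ℕ) : betweenSpan i j μ ≤ lowPoly μ := by
  refine Submodule.span_mono (Set.image_mono ?_)
  rintro ν ⟨h1, h2, h3, h4⟩
  rcases lt_trichotomy (μ i) (μ j) with h | h | h
  · exact Or.inl (domLT_plus_of_between (i := j) (j := i) (by omega) (by omega) (by omega)
      fun x hx hx' => h1 x hx' hx)
  · omega
  · exact Or.inl (domLT_plus_of_between (i := i) (j := j) (by omega) (by omega) (by omega) h1)

theorem betweenSpan_swap (i j : Fin n) (μ : Fin n → ℕ) :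
    betweenSpan i j (permComp (swap i j) μ) = betweenSpan i j μ := by
  rw [betweenSpan, betweenSpan]
  simp only [permComp_swap_apply, Equiv.swap_apply_left, Equiv.swap_apply_right]
  congr 2
  ext ν
  rw [Set.mem_ofPred_eq, Set.mem_ofPred_eq, add_comm (μ j), min_comm (μ j), max_comm (μ j)]
  refine and_congr_left fun _ => forall_congr' fun x => forall_congr' fun hi => forall_congr' fun hj => ?_
  rw [Equiv.swap_apply_of_ne_of_ne hi hj]

theorem polyAct_refl_xmon (i j : Fin n) (η : rootsOfUnity r ℂ) (μ : Fin n → ℕ) :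
    polyAct (refl i j η) (xmon μ) =
      (uval η ^ μ i * (uval η)⁻¹ ^ μ j) • xmon (permComp (swap i j) μ) := by
  have e : refl i j η = dg i η * dg j η⁻¹ * perm (swap i j) := by
    rw [dg_inv, ← refl_mul_perm_swap, mul_assoc, ← perm_mul, Equiv.swap_mul_self, perm_one, mul_one]
  rw [e, polyAct_mul, polyAct_mul, AlgHom.comp_apply, AlgHom.comp_apply, polyAct_perm_xmon,
    polyAct_dg_xmon, map_smul, polyAct_dg_xmon, smul_smul, permComp_swap_apply, permComp_swap_apply,
    Equiv.swap_apply_left, Equiv.swap_apply_right, uval_inv, inv_inv]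

theorem divDiff_polyAct_refl {i j : Fin n} (hij : i ≠ j) (η : rootsOfUnity r ℂ) (f : PolyX n)
    (hf : polyAct (refl i j η) (polyAct (refl i j η) f) = f) :
    divDiff i j η (polyAct (refl i j η) f) = -divDiff i j η f :=
  divDiff_eq hij (by rw [mul_neg, rootForm_mul_divDiff hij, hf, neg_sub])

/-- The divided difference is a geometric sum (`key`, by telescoping). After multiplication by x_i
its top term is x^μ, and in the others the exponents at i and j are strictly closer together. -/
theorem X_mul_divDiff_xmon_of_lt {i j : Fin n} (hij : i ≠ j) (η : rootsOfUnity r ℂ) {μ : Fin n → ℕ}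
    (h : μ j < μ i) :
    MvPolynomial.X i * divDiff i j η (xmon μ) - xmon μ ∈ betweenSpan i j μ := by
  obtain ⟨m, hm⟩ : ∃ m, μ i = μ j + (m + 1) := ⟨μ i - μ j - 1, by omega⟩
  let ν : ℕ → ℕ → Fin n → ℕ := fun p q => Function.update (Function.update μ i p) j q
  have νi : ∀ p q, ν p q i = p := fun p q => by simp [ν, hij]
  have νj : ∀ p q, ν p q j = q := fun p q => by simp [ν]
  have νx : ∀ p q x, x ≠ i → x ≠ j → ν p q x = μ x := fun p q x h1 h2 => by simp [ν, h1, h2]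
  have ν_ext : ∀ p q (ρ : Fin n → ℕ), ρ i = p → ρ j = q → (∀ x, x ≠ i → x ≠ j → ρ x = μ x) →
      ρ = ν p q := by
    intro p q ρ h1 h2 h3
    ext x
    rcases eq_or_ne x i with rfl | hi
    · rw [h1, νi]
    rcases eq_or_ne x j with rfl | hj
    · rw [h2, νj]
    · rw [h3 x hi hj, νx p q x hi hj]
  have hXi : ∀ p q, MvPolynomial.X i * xmon (ν p q) = xmon (ν (p + 1) q) := fun p q => by
    rw [X_mul_xmon]
    congr 1
    refine ν_ext _ _ _ (by simp [νi]) (by simp [νj, hij.symm]) fun x h1 h2 => ?_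
    simp [νx p q x h1 h2, h1]
  have hXj : ∀ p q, MvPolynomial.X j * xmon (ν p q) = xmon (ν p (q + 1)) := fun p q => by
    rw [X_mul_xmon]
    congr 1
    refine ν_ext _ _ _ (by simp [νi, hij]) (by simp [νj]) fun x h1 h2 => ?_
    simp [νx p q x h1 h2, h2]
  have hμ : μ = ν (μ j + (m + 1)) (μ j) := ν_ext _ _ _ hm rfl fun _ _ _ => rfl
  have key : divDiff i j η (xmon μ) =
      ∑ k ∈ Finset.range (m + 1), uval η ^ (m - k) • xmon (ν (μ j + k) (μ j + (m - k))) := by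
    apply divDiff_eq hij
    have hF : ∀ k ∈ Finset.range (m + 1),
        rootForm i j η * (uval η ^ (m - k) • xmon (ν (μ j + k) (μ j + (m - k)))) =
        uval η ^ (m + 1 - (k + 1)) • xmon (ν (μ j + (k + 1)) (μ j + (m + 1 - (k + 1)))) -
          uval η ^ (m + 1 - k) • xmon (ν (μ j + k) (μ j + (m + 1 - k))) := by
      intro k hk
      have hk' : m + 1 - k = m - k + 1 := by have := Finset.mem_range.mp hk; omega
      rw [rootForm, sub_mul, mul_smul_comm, mul_smul_comm, smul_mul_assoc, hXi, hXj, smul_smul, hk',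
        Nat.add_sub_add_right, ← pow_succ]
      rfl
    rw [Finset.mul_sum, Finset.sum_congr rfl hF, Finset.sum_range_sub
      (fun k => uval η ^ (m + 1 - k) • xmon (ν (μ j + k) (μ j + (m + 1 - k)))),
      polyAct_refl_xmon i j]
    rw [Nat.sub_self, pow_zero, one_smul, add_zero, ← hμ, Nat.sub_zero]
    have e : permComp (swap i j) μ = ν (μ j) (μ j + (m + 1)) := by
      refine ν_ext _ _ _ ?_ ?_ fun x h1 h2 => ?_
      · rw [permComp_swap_apply, Equiv.swap_apply_left]
      · rw [permComp_swap_apply, Equiv.swap_apply_right, hm]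
      · rw [permComp_swap_apply, Equiv.swap_apply_of_ne_of_ne h1 h2]
    rw [e, hm, pow_add (uval η) (μ j), mul_right_comm, ← mul_pow, mul_inv_cancel₀ (uval_ne_zero η), one_pow, one_mul]
  rw [key, Finset.mul_sum, Finset.sum_range_succ, Nat.sub_self, pow_zero, one_smul, hXi, add_zero,
    add_assoc, ← hμ, add_sub_cancel_right]
  refine Submodule.sum_mem _ fun k hk => ?_
  rw [mul_smul_comm, hXi]
  have hk := Finset.mem_range.mp hk
  refine Submodule.smul_mem _ _ (Submodule.subset_span ⟨_, ⟨νx _ _, ?_, ?_, ?_⟩, rfl⟩)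
  · rw [νi, νj]; omega
  · rw [νi]; omega
  · rw [νi]; omega

/-- The divided difference is anti-invariant under s, which reduces to the previous case for s x^μ
and explains the sign. -/
theorem X_mul_divDiff_xmon_of_gt {i j : Fin n} (hij : i ≠ j) (η : rootsOfUnity r ℂ) {μ : Fin n → ℕ}
    (h : μ i < μ j) : MvPolynomial.X i * divDiff i j η (xmon μ) + polyAct (refl i j η) (xmon μ) ∈
      betweenSpan i j μ := by
  set ρ := permComp (swap i j) μ with hρ
  have hρi : ρ i = μ j := by rw [hρ, permComp_swap_apply, Equiv.swap_apply_left]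
  have hρj : ρ j = μ i := by rw [hρ, permComp_swap_apply, Equiv.swap_apply_right]
  have hρρ : permComp (swap i j) ρ = μ := permComp_swap_swap i j μ
  obtain ⟨a, ha0, ha⟩ : ∃ a : ℂ, a ≠ 0 ∧ polyAct (refl i j η) (xmon μ) = a • xmon ρ :=
    ⟨_, mul_ne_zero (pow_ne_zero _ (uval_ne_zero η)) (pow_ne_zero _ (inv_ne_zero (uval_ne_zero η))),
      polyAct_refl_xmon i j η μ⟩
  have h2 : polyAct (refl i j η) (polyAct (refl i j η) (xmon μ)) = xmon μ := by
    rw [polyAct_refl_xmon i j, map_smul, polyAct_refl_xmon i j, smul_smul, permComp_swap_swap,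
      permComp_swap_apply, permComp_swap_apply, Equiv.swap_apply_left, Equiv.swap_apply_right]
    have h0 := uval_ne_zero η
    convert one_smul ℂ (xmon μ) using 2
    rw [inv_pow, inv_pow]
    field_simp
  have e := divDiff_polyAct_refl hij η (xmon μ) h2
  rw [ha, map_smul] at e
  rw [ha, show divDiff i j η (xmon μ) = -(a • divDiff i j η (xmon ρ)) by rw [e, neg_neg], mul_neg,
    mul_smul_comm, neg_add_eq_sub, ← smul_sub, ← betweenSpan_swap]
  have := X_mul_divDiff_xmon_of_lt hij η (μ := ρ) (by rw [hρi, hρj]; exact h)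
  rw [← neg_sub]
  exact Submodule.smul_mem _ _ (Submodule.neg_mem _ this)

theorem divDiff_xmon_of_eq {i j : Fin n} (hij : i ≠ j) (η : rootsOfUnity r ℂ) {μ : Fin n → ℕ}
    (h : μ i = μ j) : divDiff i j η (xmon μ) = 0 ∧ polyAct (refl i j η) (xmon μ) = xmon μ := by
  have h1 : polyAct (refl i j η) (xmon μ) = xmon μ := by
    rw [polyAct_refl_xmon i j, h, ← mul_pow, mul_inv_cancel₀ (uval_ne_zero η), one_pow, one_smul,
      permComp_swap_eq _ _ _ h]
  exact ⟨divDiff_eq hij (by rw [h1, sub_self, mul_zero]), h1⟩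

theorem polyAct_refl_xmon_mem {i j a b : Fin n} (η : rootsOfUnity r ℂ) {μ : Fin n → ℕ}
    (hab : a < b) (hμ : μ b < μ a) (hs : swap i j = swap a b) :
    polyAct (refl i j η) (xmon μ) ∈ lowPoly μ := by
  rw [polyAct_refl_xmon, hs]
  exact Submodule.smul_mem _ _ (Submodule.subset_span ⟨_, compLT_swap hab hμ, rfl⟩)

open Classical in
-- The reflections with j > i in z_i are what makes it triangular. If μ_i < μ_j they cancel the term
-- s x^μ of the divided difference, if μ_i = μ_j they contribute x^μ, and if μ_i > μ_j they
-- contribute a lower term. What survives on the diagonal are the j that precede i in the order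
-- straightened by w_μ.
theorem divDiff_term_mem {i j : Fin n} (hij : i ≠ j) (η : rootsOfUnity r ℂ) (μ : Fin n → ℕ) :
    MvPolynomial.X i * divDiff i j η (xmon μ) +
      (if i < j then polyAct (refl i j η) (xmon μ) else 0) -
      (if PosLT μ j i then xmon μ else 0) ∈ lowPoly μ := by
  have hle := betweenSpan_le_lowPoly i j μ
  rcases lt_trichotomy (μ i) (μ j) with h | h | h
  · have hP : ¬ PosLT μ j i := by unfold PosLT; omega
    have := hle (X_mul_divDiff_xmon_of_gt hij η h)
    rw [if_neg hP, sub_zero]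
    split_ifs with hlt
    · exact this
    · have h2 := polyAct_refl_xmon_mem η (a := j) (b := i) (lt_of_le_of_ne (not_lt.mp hlt) hij.symm) h
        (Equiv.swap_comm _ _)
      rw [add_zero, ← add_sub_cancel_right (MvPolynomial.X i * _) (polyAct (refl i j η) (xmon μ))]
      exact Submodule.sub_mem _ this h2
  · obtain ⟨h1, h2⟩ := divDiff_xmon_of_eq hij η h
    rw [h1, h2, mul_zero, zero_add]
    have : PosLT μ j i ↔ i < j := by unfold PosLT; omega
    simp only [this, sub_self, zero_mem]
  · have hP : PosLT μ j i := by
      unfold PosLT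
      rcases lt_or_gt_of_ne hij with h' | h'
      · exact Or.inr ⟨h', h.le⟩
      · exact Or.inl ⟨h', h⟩
    have := hle (X_mul_divDiff_xmon_of_lt hij η h)
    rw [if_pos hP]
    split_ifs with hlt
    · have h2 := polyAct_refl_xmon_mem η (a := i) (b := j) hlt h rfl
      rw [add_sub_right_comm]
      exact Submodule.add_mem _ this h2
    · rwa [add_zero]

variable {S : Type*} [AddCommGroup S] [Module ℂ S] (τ : W r n →* Module.End ℂ S)
  (c₀ : ℂ) (h : rootsOfUnity r ℂ → ℂ)

/-- The Dunkl-Opdam element `z_i` as an operator on `ℂ[x] ⊗ S`. -/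
noncomputable def zOp (i : Fin n) : Module.End ℂ (PolyMod n S) :=
  mulX S i * dunkl τ c₀ h i + ∑ η, h η • diagAct τ (dg i η)
    - c₀ • ∑ j ∈ Finset.Ioi i, ∑ η, diagAct τ (refl i j η)

/-- The span of the `x^ν ⊗ v` with `ν < μ`. -/
noncomputable def lowPt (S : Type*) [AddCommGroup S] [Module ℂ S] (μ : Fin n → ℕ) :
    Submodule ℂ (PolyMod n S) :=
  Submodule.span ℂ {m | ∃ ν v, CompLT ν μ ∧ m = pt (xmon ν) v}

theorem pt_mem_lowPt {μ : Fin n → ℕ} {f : PolyX n} (hf : f ∈ lowPoly μ) (v : S) :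
    pt f v ∈ lowPt S μ := by
  induction hf using Submodule.span_induction with
  | mem x hx => obtain ⟨ν, hν, rfl⟩ := hx; exact Submodule.subset_span ⟨ν, v, hν, rfl⟩
  | zero => rw [zero_pt]; exact zero_mem _
  | add f g _ _ hf hg => rw [add_pt]; exact add_mem hf hg
  | smul a f _ hf => rw [smul_pt]; exact Submodule.smul_mem _ _ hf

open Classical in
/-- The diagonal part of the operator `z_i` on `x^μ ⊗ S`. -/
noncomputable def zDiag (i : Fin n) (μ : Fin n → ℕ) : Module.End ℂ S :=
  ∑ η, (h η * ∑ m ∈ Finset.range (μ i + 1), (uval η)⁻¹ ^ m) • τ (dg i η)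
    - c₀ • ∑ j ∈ Finset.univ.filter (PosLT μ · i), ∑ η, τ (refl i j η)

theorem zOp_pt (i : Fin n) (μ : Fin n → ℕ) (v : S) :
    zOp τ c₀ h i (pt (xmon μ) v) - pt (xmon μ) (zDiag τ c₀ h i μ v) ∈ lowPt S μ := by
  classical
  have e1 : zOp τ c₀ h i (pt (xmon μ) v) =
      ∑ η, h η • pt (MvPolynomial.X i * qDiff i η (xmon μ) + polyAct (dg i η) (xmon μ)) (τ (dg i η) v)
      - c₀ • ∑ j ∈ Finset.univ.erase i, ∑ η, pt (MvPolynomial.X i * divDiff i j η (xmon μ) +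
          (if i < j then polyAct (refl i j η) (xmon μ) else 0)) (τ (refl i j η) v) := by
    simp only [zOp, LinearMap.sub_apply, LinearMap.add_apply, Module.End.mul_apply, dunkl_pt,
      LinearMap.sum_apply, LinearMap.smul_apply, map_sub, map_sum, map_smul, mulX_pt, diagAct_pt,
      add_pt, smul_add, Finset.sum_add_distrib]
    have e : ∑ j ∈ Finset.univ.erase i, ∑ η, pt (if i < j then polyAct (refl i j η) (xmon μ) else 0)
        (τ (refl i j η) v) = ∑ j ∈ Finset.Ioi i, ∑ η, pt (polyAct (refl i j η) (xmon μ))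
          (τ (refl i j η) v) := by
      rw [show Finset.Ioi i = (Finset.univ.erase i).filter (i < ·) by
        ext j; simp only [Finset.mem_Ioi, Finset.mem_filter, Finset.mem_erase, Finset.mem_univ]
        exact ⟨fun h => ⟨⟨h.ne', trivial⟩, h⟩, fun h => h.2⟩, Finset.sum_filter]
      refine Finset.sum_congr rfl fun j _ => ?_
      split_ifs
      · rfl
      · simp only [zero_pt, Finset.sum_const_zero]
    rw [e]
    abel
  have e2 : pt (xmon μ) (zDiag τ c₀ h i μ v) =
      ∑ η, h η • pt (MvPolynomial.X i * qDiff i η (xmon μ) + polyAct (dg i η) (xmon μ)) (τ (dg i η) v)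
      - c₀ • ∑ j ∈ Finset.univ.erase i, ∑ η, pt (if PosLT μ j i then xmon μ else 0)
          (τ (refl i j η) v) := by
    simp only [zDiag, LinearMap.sub_apply, LinearMap.sum_apply, LinearMap.smul_apply, map_sub,
      map_sum, map_smul]
    congr 1
    · refine Finset.sum_congr rfl fun η _ => ?_
      rw [X_mul_qDiff_xmon, polyAct_dg_xmon, ← add_smul, ← Finset.sum_range_succ, smul_pt, smul_smul]
    · congr 1
      rw [show Finset.univ.filter (PosLT μ · i) = (Finset.univ.erase i).filter (PosLT μ · i) by
        ext j
        simp only [Finset.mem_filter, Finset.mem_erase, Finset.mem_univ]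
        exact ⟨fun h => ⟨⟨by rintro rfl; exact h.2.asymm h.2, trivial⟩, h.2⟩, fun h => ⟨trivial, h.2⟩⟩,
        Finset.sum_filter]
      refine Finset.sum_congr rfl fun j _ => ?_
      split_ifs
      · rfl
      · simp only [zero_pt, Finset.sum_const_zero]
  rw [e1, e2, sub_sub_sub_cancel_left, ← smul_sub, ← Finset.sum_sub_distrib]
  refine Submodule.smul_mem _ _ (Submodule.sum_mem _ fun j hj => ?_)
  rw [← Finset.sum_sub_distrib]
  refine Submodule.sum_mem _ fun η _ => ?_
  rw [← neg_sub]
  refine Submodule.neg_mem _ ?_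
  rw [← LinearMap.sub_apply, ← map_sub]
  exact pt_mem_lowPt (divDiff_term_mem (Finset.ne_of_mem_erase hj).symm η μ) _

end Triangular

/-! ### Eigenvalues of 𝔱 on the leading terms -/

section Weights

variable (κ c₀ : ℂ) (d : ZMod r → ℂ) (lam : MultiPartition r n)

/-- The reflections with j < i in the definition of z_i cancel against those in [y_i, x_i], leaving
the ones with j > i. -/
theorem z_eq (i : Fin n) : z κ c₀ d i = X κ c₀ d i * Y κ c₀ d i +
    ∑ η, hcoef κ d η • tH κ c₀ d (dg i η) - c₀ • ∑ j ∈ Finset.Ioi i, ∑ η, tH κ c₀ d (refl i j η) := by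
  have h1 : jucysMurphy κ c₀ d i = ∑ j ∈ Finset.Iio i, ∑ η, tH κ c₀ d (refl i j η) :=
    Finset.sum_congr rfl fun j _ => sum_reflect (fun w => tH κ c₀ d w) i j
  have h2 : ∑ j ∈ Finset.univ.erase i, ∑ η, tH κ c₀ d (refl i j η) =
      ∑ j ∈ Finset.Iio i, ∑ η, tH κ c₀ d (refl i j η) +
        ∑ j ∈ Finset.Ioi i, ∑ η, tH κ c₀ d (refl i j η) := by
    rw [← Finset.sum_union (Finset.disjoint_left.mpr fun j h1 h2 =>
      absurd (Finset.mem_Iio.mp h1) (Finset.mem_Ioi.mp h2).asymm)]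
    refine Finset.sum_congr ?_ fun _ _ => rfl
    ext j
    simp [lt_or_lt_iff_ne]
  rw [z, Y_mul_X, commC_self, h1, h2, smul_add]
  abel

theorem polyRep_z {S : Type*} [AddCommGroup S] [Module ℂ S] (τ : W r n →* Module.End ℂ S)
    (i : Fin n) : polyRep τ κ c₀ d (z κ c₀ d i) = zOp τ c₀ (hcoef κ d) i := by
  rw [z_eq, zOp, map_sub, map_add, map_mul, map_smul, map_sum, map_sum, polyRep_X, polyRep_Y]
  simp only [map_smul, map_sum, tH_apply, polyRep_t]

/-- The span of the `x^ν ⊗ v` with `ν < μ` in the standard module. -/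
noncomputable def low (μ : Fin n → ℕ) : Submodule ℂ (Verma κ c₀ d lam) :=
  Submodule.span ℂ {m | ∃ ν v, CompLT ν μ ∧ m = mon κ c₀ d lam ν v}

theorem mon_mem_low {ν μ : Fin n → ℕ} (h : CompLT ν μ) (v : SMod lam) :
    mon κ c₀ d lam ν v ∈ low κ c₀ d lam μ :=
  Submodule.subset_span ⟨ν, v, h, rfl⟩

theorem low_mono {ν μ : Fin n → ℕ} (h : CompLT ν μ) : low κ c₀ d lam ν ≤ low κ c₀ d lam μ := by
  refine Submodule.span_mono ?_
  rintro _ ⟨ρ, v, hρ, rfl⟩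
  exact ⟨ρ, v, hρ.trans h, rfl⟩

theorem polyToVerma_mem_low {μ : Fin n → ℕ} {m : PolyMod n (SMod lam)}
    (hm : m ∈ lowPt (SMod lam) μ) : polyToVerma κ c₀ d lam m ∈ low κ c₀ d lam μ := by
  have : lowPt (SMod lam) μ ≤ (low κ c₀ d lam μ).comap
      ((polyToVerma κ c₀ d lam).toLinearMap.restrictScalars ℂ) := by
    rw [lowPt, Submodule.span_le]
    rintro _ ⟨ν, v, hν, rfl⟩
    change polyToVerma κ c₀ d lam (pt (xmon ν) v) ∈ low κ c₀ d lam μ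
    rw [polyToVerma_xmon]
    exact mon_mem_low κ c₀ d lam hν v
  exact this hm

theorem z_smul_mon (i : Fin n) (μ : Fin n → ℕ) (v : SMod lam) :
    z κ c₀ d i • mon κ c₀ d lam μ v - mon κ c₀ d lam μ (zDiag (sRep lam) c₀ (hcoef κ d) i μ v) ∈
      low κ c₀ d lam μ := by
  have e : polyToVerma κ c₀ d lam (zOp (sRep lam) c₀ (hcoef κ d) i (pt (xmon μ) v)) =
      z κ c₀ d i • mon κ c₀ d lam μ v := by
    rw [← polyRep_z, ← polyToVerma_xmon]
    exact (polyToVerma κ c₀ d lam).map_smul (z κ c₀ d i) (pt (xmon μ) v)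
  rw [← e, ← polyToVerma_xmon, ← map_sub (polyToVerma κ c₀ d lam)]
  exact polyToVerma_mem_low κ c₀ d lam (zOp_pt (sRep lam) c₀ (hcoef κ d) i μ v)

/-- The function `b ↦ ∑_η h(η) η^b`. -/
noncomputable def hHat (κ : ℂ) (d : ZMod r → ℂ) (b m : ℕ) : ℂ :=
  ∑ η, hcoef κ d η * (uval η ^ b * (uval η)⁻¹ ^ m)

/-- The eigenvalue of `z_i` on `f_{μ,T}`. -/
noncomputable def wtz (μ : Fin n → ℕ) (T : SYT lam) (i : Fin n) : ℂ :=
  ∑ m ∈ Finset.range (μ i + 1), hHat κ d (T.1 (wPerm μ i)).beta.val m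
    - c₀ * (r * (T.1 (wPerm μ i)).ct)

/-- The eigenvalue of `t_{η_i}` on `f_{μ,T}`. -/
noncomputable def wtd (μ : Fin n → ℕ) (T : SYT lam) (i : Fin n) (η : rootsOfUnity r ℂ) : ℂ :=
  uval η ^ (T.1 (wPerm μ i)).beta.val * (uval η)⁻¹ ^ μ i

variable {lam}

theorem sRep_dg_inv_perm (w : Perm (Fin n)) (i : Fin n) (η : rootsOfUnity r ℂ) (v : SMod lam) :
    sRep lam (dg i η) (sRep lam (perm w)⁻¹ v) = sRep lam (perm w)⁻¹ (sRep lam (dg (w i) η) v) := by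
  rw [← Module.End.mul_apply, ← Module.End.mul_apply, ← map_mul, ← map_mul]
  congr 2
  rw [eq_inv_mul_iff_mul_eq, ← mul_assoc, mul_dg, mul_assoc, mul_inv_cancel, mul_one]
  rfl

/-- This is why v_T is twisted by w_μ⁻¹: the j that precede i correspond under w_μ to the entries
below w_μ(i), so the diagonal reflections become the Jucys-Murphy element at w_μ(i), and its
eigenvalue is r times the content of T(w_μ(i)). -/
theorem zDiag_vec (i : Fin n) (μ : Fin n → ℕ) (T : SYT lam) :
    zDiag (sRep lam) c₀ (hcoef κ d) i μ (sRep lam (perm (wPerm μ))⁻¹ (vec T)) =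
      wtz κ c₀ d lam μ T i • sRep lam (perm (wPerm μ))⁻¹ (vec T) := by
  classical
  set w := wPerm μ with hw
  have h1 : ∀ j, ∑ η, sRep lam (refl i j η) (sRep lam (perm w)⁻¹ (vec T)) =
      sRep lam (perm w)⁻¹ (reflSum lam (w i) (w j) (vec T)) := by
    intro j
    have := LinearMap.congr_fun (perm_mul_reflSum (lam := lam) w⁻¹ (w i) (w j)) (vec T)
    rw [Module.End.mul_apply, Module.End.mul_apply, show w⁻¹ (w i) = i from w.symm_apply_apply i,
      show w⁻¹ (w j) = j from w.symm_apply_apply j, perm_inv] at this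
    rw [this, reflSum, LinearMap.sum_apply]
  have h2 : ∑ j ∈ Finset.univ.filter (PosLT μ · i), reflSum lam (w i) (w j) =
      ∑ j ∈ Finset.Iio (w i), reflSum lam (w i) j := by
    refine Finset.sum_bij (fun j _ => w j) (fun j hj => ?_) (fun a _ b _ e => w.injective e)
      (fun j hj => ⟨w.symm j, ?_, w.apply_symm_apply j⟩) fun _ _ => rfl
    · rw [Finset.mem_Iio]; exact ((Finset.mem_filter.mp hj).2).wPerm_lt
    · rw [Finset.mem_filter, ← wPerm_lt_iff, ← hw, w.apply_symm_apply]
      exact ⟨Finset.mem_univ _, Finset.mem_Iio.mp hj⟩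
  rw [zDiag, LinearMap.sub_apply, LinearMap.smul_apply, LinearMap.sum_apply, LinearMap.sum_apply]
  simp only [LinearMap.smul_apply, LinearMap.sum_apply, h1, sRep_dg_inv_perm, sRep_dg_vec]
  rw [← map_sum, ← LinearMap.sum_apply, h2, sum_reflSum_vec]
  simp only [map_smul, smul_smul]
  rw [← Finset.sum_smul, ← sub_smul, wtz, ← hw]
  congr 2
  simp only [hHat]
  rw [Finset.sum_comm]
  refine Finset.sum_congr rfl fun η _ => ?_
  rw [mul_right_comm, Finset.mul_sum, Finset.sum_congr rfl fun m _ => mul_assoc _ _ _]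

theorem z_smul_leading (μ : Fin n → ℕ) (T : SYT lam) (i : Fin n) :
    z κ c₀ d i • leading κ c₀ d lam μ T - wtz κ c₀ d lam μ T i • leading κ c₀ d lam μ T ∈
      low κ c₀ d lam μ := by
  have := z_smul_mon κ c₀ d lam i μ (sRep lam (perm (wPerm μ))⁻¹ (vec T))
  rwa [zDiag_vec, map_smul, ← leading_eq] at this

theorem dg_smul_leading (μ : Fin n → ℕ) (T : SYT lam) (i : Fin n) (η : rootsOfUnity r ℂ) :
    t κ c₀ d (dg i η) • leading κ c₀ d lam μ T = wtd lam μ T i η • leading κ c₀ d lam μ T := by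
  rw [leading_eq, dg_smul_mon, sRep_dg_inv_perm, sRep_dg_vec, map_smul, map_smul, smul_smul, mul_comm]
  rfl

variable (lam)

theorem low_eq_span_leading (μ : Fin n → ℕ) : low κ c₀ d lam μ =
    Submodule.span ℂ {m | ∃ (ν : Fin n → ℕ) (S : SYT lam), CompLT ν μ ∧
      m = leading κ c₀ d lam ν S} := by
  refine le_antisymm (Submodule.span_le.mpr ?_) (Submodule.span_mono ?_)
  · rintro _ ⟨ν, v, hν, rfl⟩
    have hv : v ∈ Submodule.map (sRep lam (perm (wPerm ν))⁻¹)
        (Submodule.span ℂ (Set.range (vec (lam := lam)))) := by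
      rw [span_range_vec]
      exact ⟨sRep lam (perm (wPerm ν)) v, trivial, by
        rw [← Module.End.mul_apply, ← map_mul, inv_mul_cancel, map_one, Module.End.one_apply]⟩
    obtain ⟨u, hu, rfl⟩ := hv
    induction hu using Submodule.span_induction with
    | mem x hx => obtain ⟨T, rfl⟩ := hx; exact Submodule.subset_span ⟨ν, T, hν, rfl⟩
    | zero => rw [map_zero, map_zero]; exact zero_mem _
    | add a b _ _ ha hb => rw [map_add, map_add]; exact add_mem ha hb
    | smul a x _ hx => rw [map_smul, map_smul]; exact Submodule.smul_mem _ _ hx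
  · rintro _ ⟨ν, S, hν, rfl⟩
    exact ⟨ν, _, hν, leading_eq κ c₀ d lam ν S⟩

end Weights

/-! ## Relations between the Dunkl-Opdam elements and the intertwiners -/

section Intertwine

variable (κ c₀ : ℂ) (d : ZMod r → ℂ)

/-- The element `κ - ∑ (d_j - d_{j-1}) e_{ij}`. -/
noncomputable def eElt (i : Fin n) : Cherednik r n κ c₀ d :=
  ∑ η, hcoef κ d η • tH κ c₀ d (dg i η)

/-- The sum of the reflections `t_{η_i s_{ij} η_i⁻¹}`. -/
noncomputable def rElt (i j : Fin n) : Cherednik r n κ c₀ d := ∑ η, tH κ c₀ d (refl i j η)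

theorem z_eq' (i : Fin n) : z κ c₀ d i = X κ c₀ d i * Y κ c₀ d i + eElt κ c₀ d i
    - c₀ • ∑ j ∈ Finset.Ioi i, rElt κ c₀ d i j := z_eq κ c₀ d i

theorem tH_mul_XY (w : W r n) (i : Fin n) : tH κ c₀ d w * (X κ c₀ d i * Y κ c₀ d i) =
    X κ c₀ d (w.right i) * Y κ c₀ d (w.right i) * tH κ c₀ d w := by
  rw [← mul_assoc, tH_mul_X, smul_mul_assoc, mul_assoc, Y_isEquivariant, mul_smul_comm, smul_smul,
    inv_mul_cancel₀ (uval_ne_zero _), one_smul, mul_assoc]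

theorem tH_mul_eElt (w : W r n) (i : Fin n) :
    tH κ c₀ d w * eElt κ c₀ d i = eElt κ c₀ d (w.right i) * tH κ c₀ d w := by
  rw [eElt, eElt, Finset.mul_sum, Finset.sum_mul]
  refine Finset.sum_congr rfl fun η _ => ?_
  rw [mul_smul_comm, smul_mul_assoc, ← map_mul, ← map_mul, mul_dg]

theorem tH_mul_rElt (w : W r n) {i j : Fin n} (hij : i ≠ j) :
    tH κ c₀ d w * rElt κ c₀ d i j = rElt κ c₀ d (w.right i) (w.right j) * tH κ c₀ d w :=
  mul_sum_refl _ w hij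

theorem tH_mul_sum_rElt (w : W r n) (i : Fin n) (s : Finset (Fin n)) (hs : i ∉ s) :
    tH κ c₀ d w * ∑ j ∈ s, rElt κ c₀ d i j =
      (∑ j ∈ s.image w.right, rElt κ c₀ d (w.right i) j) * tH κ c₀ d w := by
  rw [Finset.sum_image fun a _ b _ e => w.right.injective e, Finset.mul_sum, Finset.sum_mul]
  refine Finset.sum_congr rfl fun j hj => ?_
  rw [tH_mul_rElt]
  rintro rfl
  exact hs hj

theorem tH_mul_z (w : W r n) (i : Fin n) : tH κ c₀ d w * z κ c₀ d i =
    (X κ c₀ d (w.right i) * Y κ c₀ d (w.right i) + eElt κ c₀ d (w.right i)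
      - c₀ • ∑ j ∈ (Finset.Ioi i).image w.right, rElt κ c₀ d (w.right i) j) * tH κ c₀ d w := by
  rw [z_eq', mul_sub, mul_add, tH_mul_XY, tH_mul_eElt, mul_smul_comm, tH_mul_sum_rElt _ _ _ _ _ _
    (by simp), ← smul_mul_assoc, ← add_mul, ← sub_mul]

theorem dg_mul_z (k : Fin n) (η : rootsOfUnity r ℂ) (i : Fin n) :
    tH κ c₀ d (dg k η) * z κ c₀ d i = z κ c₀ d i * tH κ c₀ d (dg k η) := by
  rw [tH_mul_z, z_eq']
  have h : (dg k η : W r n).right = 1 := rfl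
  simp only [h, Equiv.Perm.coe_one, Finset.image_id, id]

theorem piElt_eq (i j : Fin n) :
    piElt κ c₀ d i j = ∑ η, tH κ c₀ d (dg i η * (dg j η)⁻¹) := by
  rw [piElt, ← sum_range_zu]
  refine Finset.sum_congr rfl fun l _ => ?_
  rw [← tH_apply, ← map_pow, zetaAt_eq, zetaAt_eq, dg_pow, dg_pow, ← dg_inv, ← inv_pow]
  rw [Commute.mul_pow (dg_comm _ _ _ _), dg_inv]

theorem piElt_symm (i j : Fin n) : piElt κ c₀ d i j = piElt κ c₀ d j i := by
  rw [piElt_eq, piElt_eq, ← Equiv.sum_comp (Equiv.inv _)]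
  refine Finset.sum_congr rfl fun η _ => ?_
  rw [Equiv.inv_apply, dg_inv, dg_inv, inv_inv, ← dg_inv, dg_comm]

theorem rElt_mul_swap (i j : Fin n) :
    rElt κ c₀ d i j * tH κ c₀ d (perm (swap i j)) = piElt κ c₀ d i j := by
  rw [rElt, Finset.sum_mul, piElt_eq]
  refine Finset.sum_congr rfl fun η _ => ?_
  rw [← map_mul, refl_mul_perm_swap]

theorem swap_mul_swap (i j : Fin n) :
    tH κ c₀ d (perm (swap i j)) * tH κ c₀ d (perm (swap i j)) = 1 := by
  rw [← map_mul, ← perm_mul, Equiv.swap_mul_self, perm_one, map_one]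

theorem swap_mul_piElt (i j : Fin n) : tH κ c₀ d (perm (swap i j)) * piElt κ c₀ d i j =
    piElt κ c₀ d i j * tH κ c₀ d (perm (swap i j)) := by
  conv_rhs => rw [piElt_symm]
  rw [piElt_eq, piElt_eq, Finset.mul_sum, Finset.sum_mul]
  refine Finset.sum_congr rfl fun η _ => ?_
  rw [← map_mul, ← map_mul, ← mul_assoc, mul_dg, mul_assoc, ← dg_inv, mul_dg, perm_right,
    Equiv.swap_apply_left, Equiv.swap_apply_right, dg_inv, mul_assoc]

theorem piElt_mul_z (i j k : Fin n) :
    piElt κ c₀ d i j * z κ c₀ d k = z κ c₀ d k * piElt κ c₀ d i j := by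
  rw [piElt_eq, Finset.mul_sum, Finset.sum_mul]
  refine Finset.sum_congr rfl fun η _ => ?_
  rw [← dg_inv, map_mul, mul_assoc, dg_mul_z, ← mul_assoc, dg_mul_z, mul_assoc]

/-- Conjugation by s_i takes z_i to z_{i+1} except for one additional reflection, between i + 1 and
i; multiplied by s_i that reflection sums to π_i. -/
theorem swap_mul_z_left {i j : Fin n} (hij : (i : ℕ) + 1 = j) :
    tH κ c₀ d (perm (swap i j)) * z κ c₀ d i =
      z κ c₀ d j * tH κ c₀ d (perm (swap i j)) - c₀ • piElt κ c₀ d i j := by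
  have e : (Finset.Ioi i).image (perm (swap i j) : W r n).right = insert i (Finset.Ioi j) := by
    ext k
    rw [perm_right, Finset.mem_image, Finset.mem_insert, Finset.mem_Ioi]
    constructor
    · rintro ⟨m, hm, rfl⟩
      rw [Finset.mem_Ioi] at hm
      rcases eq_or_ne m j with rfl | hmj
      · exact Or.inl (Equiv.swap_apply_right _ _)
      · rw [Equiv.swap_apply_of_ne_of_ne hm.ne' hmj]
        right
        simp only [Fin.lt_def, ne_eq, Fin.ext_iff] at *; omega
    · rintro (rfl | h)
      · exact ⟨j, by simp only [Finset.mem_Ioi, Fin.lt_def]; omega, Equiv.swap_apply_right _ _⟩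
      · refine ⟨k, ?_, ?_⟩
        · simp only [Finset.mem_Ioi, Fin.lt_def] at *; omega
        · refine Equiv.swap_apply_of_ne_of_ne ?_ h.ne'
          simp only [Fin.lt_def, ne_eq, Fin.ext_iff] at *; omega
  have hi : i ∉ Finset.Ioi j := by simp only [Finset.mem_Ioi, Fin.lt_def]; omega
  rw [tH_mul_z, e, Finset.sum_insert hi, perm_right, Equiv.swap_apply_left, z_eq' κ c₀ d j,
    piElt_symm, ← rElt_mul_swap, Equiv.swap_comm j i, ← smul_mul_assoc, ← sub_mul]
  congr 1
  rw [smul_add]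
  abel

theorem swap_mul_z_right {i j : Fin n} (hij : (i : ℕ) + 1 = j) :
    tH κ c₀ d (perm (swap i j)) * z κ c₀ d j =
      z κ c₀ d i * tH κ c₀ d (perm (swap i j)) + c₀ • piElt κ c₀ d i j := by
  have h := congrArg (fun x => tH κ c₀ d (perm (swap i j)) * x * tH κ c₀ d (perm (swap i j)))
    (swap_mul_z_left κ c₀ d hij)
  simp only [mul_sub, sub_mul, mul_smul_comm, smul_mul_assoc] at h
  rw [swap_mul_piElt, mul_assoc (piElt κ c₀ d i j), swap_mul_swap, mul_one, ← mul_assoc,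
    swap_mul_swap, one_mul, ← mul_assoc, mul_assoc _ _ (tH κ c₀ d (perm (swap i j))),
    swap_mul_swap, mul_one] at h
  rw [h]
  abel

theorem swap_mul_z_of_ne {i j k : Fin n} (hij : (i : ℕ) + 1 = j) (hi : k ≠ i) (hj : k ≠ j) :
    tH κ c₀ d (perm (swap i j)) * z κ c₀ d k = z κ c₀ d k * tH κ c₀ d (perm (swap i j)) := by
  have e : (Finset.Ioi k).image (perm (swap i j) : W r n).right = Finset.Ioi k := by
    have hsub : ∀ m, k < m → k < swap i j m := by
      intro m hm
      rw [Equiv.swap_apply_def]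
      split_ifs with h1 h2
      · simp only [Fin.lt_def, ne_eq, Fin.ext_iff] at *; omega
      · simp only [Fin.lt_def, ne_eq, Fin.ext_iff] at *; omega
      · exact hm
    ext m
    rw [perm_right, Finset.mem_image, Finset.mem_Ioi]
    constructor
    · rintro ⟨m, hm, rfl⟩
      exact hsub m (Finset.mem_Ioi.mp hm)
    · intro hm
      exact ⟨swap i j m, Finset.mem_Ioi.mpr (hsub m hm), Equiv.swap_apply_self _ _ _⟩
  rw [tH_mul_z, e, perm_right, Equiv.swap_apply_of_ne_of_ne hi hj, z_eq']

variable [NeZero n]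

/-- The intertwiner `Φ = x_n t_{s_{n-1} ⋯ s_1}`. -/
noncomputable def Phi : Cherednik r n κ c₀ d :=
  X κ c₀ d (lastIdx n) * tH κ c₀ d (perm (finRotate n)⁻¹)

theorem finRotate_lastIdx : finRotate n (lastIdx n) = 0 := by
  obtain ⟨m, rfl⟩ := Nat.exists_eq_succ_of_ne_zero (NeZero.ne n)
  exact finRotate_last

theorem finRotate_val {i : Fin n} (hi : i ≠ lastIdx n) : (finRotate n i : ℕ) = i + 1 := by
  obtain ⟨m, rfl⟩ := Nat.exists_eq_succ_of_ne_zero (NeZero.ne n)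
  exact coe_finRotate_of_ne_last hi

theorem le_lastIdx (i : Fin n) : i ≤ lastIdx n := by
  have := i.2
  simp only [Fin.le_def, lastIdx]; omega

theorem finRotate_inv_apply (i : Fin n) : (finRotate n)⁻¹ (finRotate n i) = i :=
  (finRotate n).symm_apply_apply i

theorem rElt_mul_X_of_ne {i j k : Fin n} (hi : k ≠ i) (hj : k ≠ j) :
    rElt κ c₀ d i j * X κ c₀ d k = X κ c₀ d k * rElt κ c₀ d i j := by
  rw [rElt, Finset.sum_mul, Finset.mul_sum]
  refine Finset.sum_congr rfl fun η _ => ?_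
  rw [tH_mul_X, refl_right, Equiv.swap_apply_of_ne_of_ne hi hj, refl_left, Pi.mulSingle_eq_of_ne hi,
    Pi.mulSingle_eq_of_ne hj, inv_one, mul_one, uval_one, inv_one, one_smul]

theorem rElt_mul_X_right {i j : Fin n} (hij : i ≠ j) : rElt κ c₀ d i j * X κ c₀ d j =
    X κ c₀ d i * ∑ η, (uval η)⁻¹ • tH κ c₀ d (refl i j η) := by
  rw [rElt, Finset.sum_mul, Finset.mul_sum]
  refine Finset.sum_congr rfl fun η _ => ?_
  rw [tH_mul_X, refl_right, Equiv.swap_apply_right, refl_left, Pi.mulSingle_eq_same,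
    Pi.mulSingle_eq_of_ne hij, inv_one, mul_one, mul_smul_comm]

theorem eElt_mul_X_of_ne {i k : Fin n} (hi : k ≠ i) :
    eElt κ c₀ d i * X κ c₀ d k = X κ c₀ d k * eElt κ c₀ d i := by
  rw [eElt, Finset.sum_mul, Finset.mul_sum]
  refine Finset.sum_congr rfl fun η _ => ?_
  have h1 : (dg i η : W r n).right k = k := rfl
  have h2 : (dg i η : W r n).left k = 1 := Pi.mulSingle_eq_of_ne hi _
  rw [smul_mul_assoc, tH_mul_X, mul_smul_comm, h1, h2, uval_one, inv_one, one_smul]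

/-- Conjugated by the cycle, the element lacks only the reflections between i and n to be z_i.
Moving x_n across y_i supplies them. -/
theorem Phi_mul_z {i : Fin n} (hi : i ≠ lastIdx n) :
    Phi κ c₀ d * z κ c₀ d (finRotate n i) = z κ c₀ d i * Phi κ c₀ d := by
  have hlt : i < lastIdx n := lt_of_le_of_ne (le_lastIdx i) hi
  have e : insert (lastIdx n) ((Finset.Ioi (finRotate n i)).image
      (perm (finRotate n)⁻¹ : W r n).right) = Finset.Ioi i := by
    ext k
    rw [perm_right, Finset.mem_insert, Finset.mem_image, Finset.mem_Ioi]
    constructor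
    · rintro (rfl | ⟨m, hm, rfl⟩)
      · exact hlt
      · obtain ⟨m, rfl⟩ := (finRotate n).surjective m
        rw [finRotate_inv_apply]
        rw [Finset.mem_Ioi, Fin.lt_def, finRotate_val hi] at hm
        rcases eq_or_ne m (lastIdx n) with rfl | hm'
        · exact hlt
        · rw [finRotate_val hm'] at hm
          rw [Fin.lt_def]; omega
    · intro hk
      rcases eq_or_ne k (lastIdx n) with h | h
      · exact Or.inl h
      · refine Or.inr ⟨finRotate n k, ?_, finRotate_inv_apply k⟩
        rw [Finset.mem_Ioi, Fin.lt_def, finRotate_val hi, finRotate_val h]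
        rw [Fin.lt_def] at hk; omega
  have hl : lastIdx n ∉ (Finset.Ioi (finRotate n i)).image (perm (finRotate n)⁻¹ : W r n).right := by
    rw [Finset.mem_image]
    rintro ⟨m, hm, h⟩
    obtain ⟨m, rfl⟩ := (finRotate n).surjective m
    rw [perm_right, finRotate_inv_apply] at h
    rw [h, finRotate_lastIdx, Finset.mem_Ioi] at hm
    exact absurd hm (not_lt.mpr (Fin.zero_le _))
  have e2 : X κ c₀ d (lastIdx n) * ∑ j ∈ (Finset.Ioi (finRotate n i)).image
      (perm (finRotate n)⁻¹ : W r n).right, rElt κ c₀ d i j = (∑ j ∈ (Finset.Ioi (finRotate n i)).image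
      (perm (finRotate n)⁻¹ : W r n).right, rElt κ c₀ d i j) * X κ c₀ d (lastIdx n) := by
    rw [Finset.mul_sum, Finset.sum_mul]
    refine Finset.sum_congr rfl fun j hj => (rElt_mul_X_of_ne κ c₀ d hi.symm ?_).symm
    rintro rfl
    exact hl hj
  have e3 : X κ c₀ d i * Y κ c₀ d i * X κ c₀ d (lastIdx n) =
      X κ c₀ d (lastIdx n) * (X κ c₀ d i * Y κ c₀ d i) +
        c₀ • (rElt κ c₀ d i (lastIdx n) * X κ c₀ d (lastIdx n)) := by
    rw [mul_assoc, Y_mul_X, mul_add, commC_ne _ _ _ hi, rElt_mul_X_right _ _ _ hi, ← mul_assoc,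
      X_comm κ c₀ d i, mul_assoc, mul_smul_comm]
  rw [Phi, mul_assoc, tH_mul_z, perm_right, finRotate_inv_apply, ← mul_assoc, ← mul_assoc, z_eq', ← e,
    Finset.sum_insert hl]
  congr 1
  rw [mul_sub, sub_mul, mul_add, add_mul, mul_smul_comm, smul_mul_assoc, add_mul, e3,
    eElt_mul_X_of_ne κ c₀ d hi.symm, smul_add, perm_right] at *
  rw [e2]
  abel

/-- Conjugation by the cycle turns z_1 into y_n x_n, since then every reflection at n occurs. So Φ
z_1 = x_n y_n Φ, and z_n exceeds x_n y_n by the term without reflections in pairs. -/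
theorem Phi_mul_z_zero : z κ c₀ d (lastIdx n) * Phi κ c₀ d =
    Phi κ c₀ d * z κ c₀ d 0 + eElt κ c₀ d (lastIdx n) * Phi κ c₀ d := by
  have hl : (finRotate n)⁻¹ 0 = lastIdx n := by
    rw [← finRotate_lastIdx, finRotate_inv_apply]
  have e : (Finset.Ioi (0 : Fin n)).image (perm (finRotate n)⁻¹ : W r n).right =
      Finset.univ.erase (lastIdx n) := by
    ext k
    rw [perm_right, Finset.mem_image, Finset.mem_erase]
    constructor
    · rintro ⟨m, hm, rfl⟩
      refine ⟨fun h => ?_, Finset.mem_univ _⟩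
      rw [← hl] at h
      rw [(finRotate n)⁻¹.injective h] at hm
      exact absurd (Finset.mem_Ioi.mp hm) (lt_irrefl _)
    · rintro ⟨h, -⟩
      refine ⟨finRotate n k, ?_, finRotate_inv_apply k⟩
      rw [Finset.mem_Ioi, Fin.lt_def, finRotate_val h]
      exact Nat.succ_pos _
  have e2 : z κ c₀ d (lastIdx n) = X κ c₀ d (lastIdx n) * Y κ c₀ d (lastIdx n) +
      eElt κ c₀ d (lastIdx n) := by
    rw [z_eq', show Finset.Ioi (lastIdx n) = ∅ from Finset.eq_empty_of_forall_notMem fun j hj =>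
      absurd (Finset.mem_Ioi.mp hj) (not_lt.mpr (le_lastIdx j)), Finset.sum_empty, smul_zero, sub_zero]
  have e3 : Y κ c₀ d (lastIdx n) * X κ c₀ d (lastIdx n) = X κ c₀ d (lastIdx n) * Y κ c₀ d (lastIdx n) +
      eElt κ c₀ d (lastIdx n) - c₀ • ∑ j ∈ Finset.univ.erase (lastIdx n), rElt κ c₀ d (lastIdx n) j := by
    rw [Y_mul_X, commC_self, add_sub_assoc]; rfl
  rw [e2, add_mul]
  congr 1
  rw [Phi, mul_assoc (X κ c₀ d (lastIdx n)) (tH _ _ _ _), tH_mul_z, e, perm_right, hl, ← e3]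
  simp only [mul_assoc]

theorem dg_mul_Phi (i : Fin n) (η : rootsOfUnity r ℂ) : tH κ c₀ d (dg i η) * Phi κ c₀ d =
    (if i = lastIdx n then (uval η)⁻¹ else 1) • (Phi κ c₀ d * tH κ c₀ d (dg (finRotate n i) η)) := by
  have h1 : (dg i η : W r n).right (lastIdx n) = lastIdx n := rfl
  have h2 : (dg i η : W r n).left (lastIdx n) = if i = lastIdx n then η else 1 := by
    split_ifs with h
    · subst h; exact Pi.mulSingle_eq_same _ _
    · exact Pi.mulSingle_eq_of_ne (Ne.symm h) _
  rw [Phi, ← mul_assoc, tH_mul_X, h1, h2, mul_assoc (X κ c₀ d _) (tH κ c₀ d (perm _)), ← map_mul,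
    mul_dg, perm_right, finRotate_inv_apply, map_mul, ← mul_assoc, smul_mul_assoc]
  congr 1
  split_ifs
  · rfl
  · rw [uval_one, inv_one]

theorem z_zero : z κ c₀ d (0 : Fin n) = Y κ c₀ d 0 * X κ c₀ d 0 := by
  rw [z, jucysMurphy, show Finset.Iio (0 : Fin n) = ∅ from Finset.eq_empty_of_forall_notMem fun j hj =>
    absurd (Finset.mem_Iio.mp hj) (not_lt.mpr (Fin.zero_le j)), Finset.sum_empty, smul_zero, add_zero]

theorem perm_mul_X (w : Perm (Fin n)) (i : Fin n) :
    tH κ c₀ d (perm w) * X κ c₀ d i = X κ c₀ d (w i) * tH κ c₀ d (perm w) := by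
  rw [tH_mul_X, perm_left, perm_right, uval_one, inv_one, one_smul]

theorem perm_mul_Y (w : Perm (Fin n)) (i : Fin n) :
    tH κ c₀ d (perm w) * Y κ c₀ d i = Y κ c₀ d (w i) * tH κ c₀ d (perm w) := by
  rw [Y_isEquivariant, perm_left, perm_right, uval_one, one_smul]

theorem perm_mul_perm_inv (w : Perm (Fin n)) :
    tH κ c₀ d (perm w) * tH κ c₀ d (perm w⁻¹) = 1 := by
  rw [← map_mul, ← perm_mul, mul_inv_cancel, perm_one, map_one]

theorem perm_inv_mul_perm (w : Perm (Fin n)) :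
    tH κ c₀ d (perm w⁻¹) * tH κ c₀ d (perm w) = 1 := by
  rw [← map_mul, ← perm_mul, inv_mul_cancel, perm_one, map_one]

theorem Psi_mul_Phi : Psi κ c₀ d * Phi κ c₀ d = z κ c₀ d (0 : Fin n) := by
  rw [Psi, Phi, ← tH_apply, mul_assoc, ← mul_assoc (tH κ c₀ d (perm (finRotate n))), perm_mul_X,
    mul_assoc (X κ c₀ d _), perm_mul_perm_inv, mul_one, finRotate_lastIdx, z_zero]

theorem Phi_mul_Psi : Phi κ c₀ d * Psi κ c₀ d =
    z κ c₀ d (lastIdx n) - eElt κ c₀ d (lastIdx n) := by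
  have hl : (finRotate n)⁻¹ 0 = lastIdx n := by
    rw [← finRotate_lastIdx, finRotate_inv_apply]
  rw [Psi, Phi, ← tH_apply, mul_assoc, ← mul_assoc (tH κ c₀ d (perm (finRotate n)⁻¹)), perm_mul_Y,
    mul_assoc (Y κ c₀ d _), perm_inv_mul_perm, mul_one, hl, z_eq',
    show Finset.Ioi (lastIdx n) = ∅ from Finset.eq_empty_of_forall_notMem fun j hj =>
      absurd (Finset.mem_Ioi.mp hj) (not_lt.mpr (le_lastIdx j)), Finset.sum_empty, smul_zero, sub_zero,
    add_sub_cancel_right]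

theorem finRotate_inv_mul_swap (i j : Fin n) : (finRotate n)⁻¹ * swap (finRotate n i) (finRotate n j) =
    swap i j * (finRotate n)⁻¹ := by
  rw [Equiv.mul_swap_eq_swap_mul, finRotate_inv_apply, finRotate_inv_apply]

theorem Phi_mul_swap {i j : Fin n} (hi : i ≠ lastIdx n) (hj : j ≠ lastIdx n) :
    Phi κ c₀ d * tH κ c₀ d (perm (swap (finRotate n i) (finRotate n j))) =
      tH κ c₀ d (perm (swap i j)) * Phi κ c₀ d := by
  rw [Phi, mul_assoc, ← map_mul, ← perm_mul, finRotate_inv_mul_swap, perm_mul, map_mul, ← mul_assoc,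
    ← mul_assoc, perm_mul_X, Equiv.swap_apply_of_ne_of_ne hi.symm hj.symm]

/-- Φ² is x_n x_{n-1} times a power of the cycle, and the monomial is symmetric in its two
variables. The statement reads Φ² s_1 = s_{n-1} Φ² and covers the pair of positions that a single Φ
separates. -/
theorem Phi_sq_mul_swap (i : Fin n) (hi : finRotate n i = lastIdx n) :
    Phi κ c₀ d * (Phi κ c₀ d * tH κ c₀ d (perm (swap (finRotate n (finRotate n i))
      (finRotate n (finRotate n (lastIdx n)))))) =
      tH κ c₀ d (perm (swap i (lastIdx n))) * (Phi κ c₀ d * Phi κ c₀ d) := by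
  have e : Phi κ c₀ d * Phi κ c₀ d = X κ c₀ d (lastIdx n) * X κ c₀ d i *
      tH κ c₀ d (perm ((finRotate n)⁻¹ * (finRotate n)⁻¹)) := by
    rw [Phi, mul_assoc, ← mul_assoc (tH κ c₀ d _), perm_mul_X, perm_mul, map_mul, ← hi,
      finRotate_inv_apply]
    simp only [mul_assoc]
  rw [← mul_assoc, e, mul_assoc, ← map_mul, ← perm_mul, mul_assoc (finRotate n)⁻¹,
    finRotate_inv_mul_swap, ← mul_assoc (finRotate n)⁻¹, finRotate_inv_mul_swap, mul_assoc (swap _ _),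
    perm_mul, map_mul, ← mul_assoc, ← mul_assoc, ← mul_assoc, perm_mul_X,
    mul_assoc (X κ c₀ d _) _ (X κ c₀ d i), perm_mul_X, Equiv.swap_apply_left, Equiv.swap_apply_right,
    ← mul_assoc, X_comm κ c₀ d i]

end Intertwine

/-! ## Commutativity of the Dunkl-Opdam elements on the standard module -/

section Commute

variable (κ c₀ : ℂ) (d : ZMod r → ℂ)
variable (M : Type*) [AddCommGroup M] [Module ℂ M] [Module (Cherednik r n κ c₀ d) M]
  [IsScalarTower ℂ (Cherednik r n κ c₀ d) M]

/-- The vectors on which the `z_i` commute. -/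
def zComm : AddSubgroup M where
  carrier := {m | ∀ i j : Fin n, z κ c₀ d i • z κ c₀ d j • m = z κ c₀ d j • z κ c₀ d i • m}
  zero_mem' i j := by simp only [smul_zero]
  add_mem' {a b} ha hb i j := by
    simp only [smul_add]
    rw [ha, hb]
  neg_mem' {a} ha i j := by
    simp only [smul_neg]
    rw [ha]

variable {M}

theorem mem_zComm {m : M} : m ∈ zComm (n := n) κ c₀ d M ↔
    ∀ i j : Fin n, z κ c₀ d i • z κ c₀ d j • m = z κ c₀ d j • z κ c₀ d i • m := Iff.rfl

/-- Pushing two z's through t_s leaves correction terms. Once z_{s(k)} is written as z_k − ε_k (z_j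
− z_i), they are symmetric in the two indices. -/
theorem swap_smul_mem_zComm {m : M} (hm : m ∈ zComm (n := n) κ c₀ d M) {i j : Fin n}
    (hij : (i : ℕ) + 1 = j) : tH κ c₀ d (perm (swap i j)) • m ∈ zComm (n := n) κ c₀ d M := by
  set s := tH κ c₀ d (perm (swap i j)) with hs
  set p := piElt κ c₀ d i j with hp
  -- The sign with which π_i appears when z_k passes t_s.
  let ε : Fin n → ℂ := fun k => if k = i then -1 else if k = j then 1 else 0
  have hij' : j ≠ i := by rintro rfl; omega
  have h1 : ∀ k, z κ c₀ d k * s = s * z κ c₀ d (swap i j k) + (c₀ * ε k) • p := by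
    intro k
    rcases eq_or_ne k i with rfl | hi
    · have := swap_mul_z_right κ c₀ d hij
      rw [Equiv.swap_apply_left, this, show ε k = -1 from if_pos rfl]
      module
    rcases eq_or_ne k j with rfl | hj
    · have := swap_mul_z_left κ c₀ d hij
      rw [Equiv.swap_apply_right, this, show ε k = 1 from (if_neg hi).trans (if_pos rfl)]
      module
    · rw [Equiv.swap_apply_of_ne_of_ne hi hj, show ε k = 0 from (if_neg hi).trans (if_neg hj), hs,
        swap_mul_z_of_ne κ c₀ d hij hi hj, mul_zero, zero_smul, add_zero]
  have h2 : ∀ k, z κ c₀ d (swap i j k) = z κ c₀ d k - ε k • (z κ c₀ d j - z κ c₀ d i) := by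
    intro k
    rcases eq_or_ne k i with rfl | hi
    · rw [Equiv.swap_apply_left, show ε k = -1 from if_pos rfl]; module
    rcases eq_or_ne k j with rfl | hj
    · rw [Equiv.swap_apply_right, show ε k = 1 from (if_neg hi).trans (if_pos rfl)]; module
    · rw [Equiv.swap_apply_of_ne_of_ne hi hj, show ε k = 0 from (if_neg hi).trans (if_neg hj)]
      module
  have h3 : ∀ a b, z κ c₀ d a * (z κ c₀ d b * s) = s * (z κ c₀ d (swap i j a) * z κ c₀ d (swap i j b)) +
      (c₀ * ε a) • (p * z κ c₀ d (swap i j b)) + (c₀ * ε b) • (p * z κ c₀ d a) := by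
    intro a b
    rw [h1 b, mul_add, ← mul_assoc, h1 a, add_mul, mul_assoc, smul_mul_assoc, mul_smul_comm,
      piElt_mul_z κ c₀ d i j a]
  rw [mem_zComm] at hm ⊢
  intro a b
  have e := hm (swap i j a) (swap i j b)
  rw [← mul_smul, ← mul_smul] at e ⊢
  rw [← mul_smul, ← mul_smul, mul_assoc, mul_assoc, h3 a b, h3 b a]
  simp only [add_smul, mul_smul s, e]
  rw [add_assoc, add_assoc]
  congr 1
  rw [← add_smul, ← add_smul]
  congr 1
  rw [h2 a, h2 b]
  simp only [mul_sub, mul_smul_comm]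
  module

/-- As for t_s: the corrections, which involve only the element e at the last index, are symmetric
in the two z's because e commutes with them. -/
theorem Phi_smul_mem_zComm [NeZero n] {m : M} (hm : m ∈ zComm (n := n) κ c₀ d M) :
    (Phi κ c₀ d : Cherednik r n κ c₀ d) • m ∈ zComm (n := n) κ c₀ d M := by
  set e := eElt κ c₀ d (lastIdx n) with he
  have h1 : ∀ k, z κ c₀ d k * Phi κ c₀ d = Phi κ c₀ d * z κ c₀ d (finRotate n k) +
      (if k = lastIdx n then (1 : ℂ) else 0) • (e * Phi κ c₀ d) := by
    intro k
    split_ifs with h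
    · rw [h, Phi_mul_z_zero, one_smul, finRotate_lastIdx]
    · rw [Phi_mul_z κ c₀ d h, zero_smul, add_zero]
  have h2 : ∀ k, z κ c₀ d k * e = e * z κ c₀ d k := by
    intro k
    rw [he, eElt, Finset.mul_sum, Finset.sum_mul]
    refine Finset.sum_congr rfl fun η _ => ?_
    rw [mul_smul_comm, smul_mul_assoc, dg_mul_z]
  have h3 : ∀ a b, z κ c₀ d a * (z κ c₀ d b * Phi κ c₀ d) =
      Phi κ c₀ d * (z κ c₀ d (finRotate n a) * z κ c₀ d (finRotate n b)) +
      (if a = lastIdx n then (1 : ℂ) else 0) • (e * Phi κ c₀ d * z κ c₀ d (finRotate n b)) +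
      (if b = lastIdx n then (1 : ℂ) else 0) • (e * (Phi κ c₀ d * z κ c₀ d (finRotate n a))) +
      ((if a = lastIdx n then (1 : ℂ) else 0) * (if b = lastIdx n then (1 : ℂ) else 0)) •
        (e * (e * Phi κ c₀ d)) := by
    intro a b
    rw [h1 b, mul_add, mul_smul_comm, ← mul_assoc, ← mul_assoc, h1 a, h2 a, mul_assoc e, h1 a, mul_add,
      add_mul, smul_mul_assoc, mul_smul_comm]
    simp only [mul_assoc]
    module
  rw [mem_zComm] at hm ⊢
  intro a b
  have e' := hm (finRotate n a) (finRotate n b)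
  rw [← mul_smul, ← mul_smul] at e' ⊢
  rw [← mul_smul, ← mul_smul, mul_assoc, mul_assoc, h3 a b, h3 b a]
  simp only [add_smul, mul_smul (Phi κ c₀ d), e', mul_assoc]
  rw [mul_comm (if a = lastIdx n then (1 : ℂ) else 0)]
  abel

end Commute

/-! ## Weight vectors with a given leading term -/

section Abstract

variable {A M : Type*} [Ring A] [Algebra ℂ A] [AddCommGroup M] [Module ℂ M] [Module A M]
  [IsScalarTower ℂ A M] [SMulCommClass A ℂ M]

/-- The action of an element that preserves a subspace. -/
def restrictSMul (U : Submodule ℂ M) (a : A) (ha : ∀ u ∈ U, a • u ∈ U) : Module.End ℂ U where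
  toFun u := ⟨a • u, ha u u.2⟩
  map_add' _ _ := Subtype.ext (smul_add _ _ _)
  map_smul' _ _ := Subtype.ext (smul_comm _ _ _)

theorem restrictSMul_sub_pow (U : Submodule ℂ M) (a : A) (ha : ∀ u ∈ U, a • u ∈ U) (e : ℂ) (q : ℕ)
    (u : U) : (((restrictSMul U a ha - e • 1) ^ q) u : M) = (a - algebraMap ℂ A e) ^ q • (u : M) := by
  induction q generalizing u with
  | zero => rw [pow_zero, pow_zero, one_smul, Module.End.one_apply]
  | succ q ih =>
    rw [pow_succ, pow_succ, Module.End.mul_apply, ih, mul_smul, sub_smul, algebraMap_smul]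
    rfl

/-- U is the sum of its joint generalized eigenspaces. A functional that is an eigenfunctional of
weight α vanishes on all of them except the one for α, so the α-component of v has the same value
under l as v itself. -/
theorem exists_weight_vector (B : Subalgebra ℂ A)
    (hcomm : ∀ a ∈ B, ∀ b ∈ B, ∀ m : M, a • b • m = b • a • m) (U : Submodule ℂ M)
    [FiniteDimensional ℂ U] (hU : ∀ a ∈ B, ∀ u ∈ U, a • u ∈ U) (l : M →ₗ[ℂ] ℂ) (α : B → ℂ)
    (hα : ∀ a : B, ∀ u ∈ U, l ((a : A) • u) = α a * l u) {v : M} (hv : v ∈ U) :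
    ∃ f ∈ U, l f = l v ∧ ∃ q, 0 < q ∧ ∀ a : B, ((a : A) - algebraMap ℂ A (α a)) ^ q • f = 0 := by
  let T : B → Module.End ℂ U := fun a => restrictSMul U (a : A) (hU a a.2)
  have hT : Pairwise fun a b => Commute (T a) (T b) := fun a b _ =>
    LinearMap.ext fun u => Subtype.ext (hcomm a a.2 b b.2 u)
  have htop := Module.End.iSup_iInf_maxGenEigenspace_eq_top_of_iSup_maxGenEigenspace_eq_top_of_commute
    T hT fun a => Module.End.iSup_maxGenEigenspace_eq_top _
  -- Generalized eigenspaces stabilise at the exponent `finrank`, which makes it uniform in a; the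
  -- additional 1 keeps it positive, as `weightSpace` demands.
  have key : ∀ u : U, ∃ f : U, l f = l u ∧
      ∀ a, ((T a - α a • 1) ^ (Module.finrank ℂ U + 1)) f = 0 := by
    intro u
    have hu : u ∈ ⨆ χ : B → ℂ, ⨅ a, (T a).maxGenEigenspace (χ a) := htop ▸ Submodule.mem_top
    refine Submodule.iSup_induction _ (motive := fun u : U => ∃ f : U, l f = l u ∧
      ∀ a, ((T a - α a • 1) ^ (Module.finrank ℂ U + 1)) f = 0) hu (fun χ x hx => ?_)
      ⟨0, rfl, fun a => map_zero _⟩ ?_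
    · rw [Submodule.mem_iInf] at hx
      by_cases h : χ = α
      · subst h
        refine ⟨x, rfl, fun a => ?_⟩
        have := hx a
        rw [Module.End.maxGenEigenspace_eq_genEigenspace_finrank, Module.End.mem_genEigenspace_nat,
          LinearMap.mem_ker] at this
        rw [pow_succ', Module.End.mul_apply, this, map_zero]
      · obtain ⟨a, ha⟩ := Function.ne_iff.mp h
        refine ⟨0, ?_, fun a => map_zero _⟩
        obtain ⟨k, hk⟩ := (Module.End.mem_maxGenEigenspace _ _ _).mp (hx a)
        -- For large k the left side vanishes on x, and χ(a) ≠ α(a) then forces l x = 0.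
        have h2 : ∀ (k : ℕ) (y : U), l (((T a - χ a • 1) ^ k) y : U) = (α a - χ a) ^ k * l y := by
          intro k
          induction k with
          | zero => intro y; rw [pow_zero, pow_zero, one_mul, Module.End.one_apply]
          | succ k ih =>
            intro y
            rw [pow_succ, Module.End.mul_apply, ih, pow_succ, mul_assoc]
            congr 1
            change l ((a : A) • (y : M) - χ a • (y : M)) = _
            rw [map_sub, hα a y y.2, map_smul, smul_eq_mul, sub_mul]
        have h3 := h2 k x
        rw [hk, Submodule.coe_zero, map_zero, eq_comm, mul_eq_zero] at h3
        rw [h3.resolve_left (pow_ne_zero _ (sub_ne_zero.mpr (Ne.symm ha))), Submodule.coe_zero, map_zero]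
    · rintro x y ⟨f, hf, hf'⟩ ⟨g, hg, hg'⟩
      refine ⟨f + g, ?_, fun a => ?_⟩
      · rw [Submodule.coe_add, map_add, hf, hg, Submodule.coe_add, map_add]
      · rw [map_add, hf', hg', add_zero]
  obtain ⟨f, hf, hf'⟩ := key ⟨v, hv⟩
  refine ⟨f, f.2, hf, Module.finrank ℂ U + 1, Nat.succ_pos _, fun a => ?_⟩
  rw [← restrictSMul_sub_pow U (a : A) (hU a a.2), hf' a, Submodule.coe_zero]

/-- A submodule contains the components of its elements along eigenvectors with distinct
eigenvalues. -/
theorem smul_mem_of_sum_mem {ι : Type*} {F : ι → M} (N : Submodule A M)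
    (hsep : ∀ p q, p ≠ q → ∃ (a : A) (e : ι → ℂ), (∀ i, a • F i = e i • F i) ∧ e p ≠ e q)
    (s : Finset ι) (c : ι → ℂ) (h : ∑ p ∈ s, c p • F p ∈ N) : ∀ p ∈ s, c p • F p ∈ N := by
  classical
  have hN : ∀ (a : ℂ) {m : M}, m ∈ N → a • m ∈ N := fun a m hm => by
    rw [← algebraMap_smul A a m]; exact N.smul_mem _ hm
  induction s using Finset.induction_on generalizing c with
  | empty => intro p hp; exact absurd hp (Finset.notMem_empty p)
  | insert q s hq ih =>
    have hs : ∀ p ∈ s, c p • F p ∈ N := by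
      intro p hp
      obtain ⟨a, e, ha, hne⟩ := hsep p q (by rintro rfl; exact hq hp)
      -- Acting by a − e(q) removes the q-term and rescales the others, the p-term by the non-zero
      -- number e(p) − e(q).
      have h1 : ∑ p ∈ s, (c p * (e p - e q)) • F p ∈ N := by
        have h2 : a • ∑ p ∈ insert q s, c p • F p - e q • ∑ p ∈ insert q s, c p • F p ∈ N :=
          N.sub_mem (N.smul_mem _ h) (hN _ h)
        rw [Finset.smul_sum, Finset.smul_sum, ← Finset.sum_sub_distrib, Finset.sum_insert hq] at h2
        have h3 : ∀ p, a • c p • F p - e q • c p • F p = (c p * (e p - e q)) • F p := fun p => by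
          rw [smul_comm a, ha]; module
        rw [h3, sub_self, mul_zero, zero_smul, zero_add, Finset.sum_congr rfl fun p _ => h3 p] at h2
        exact h2
      have h4 := hN (e p - e q)⁻¹ (ih _ h1 p hp)
      rwa [smul_smul, mul_comm (c p), inv_mul_cancel_left₀ (sub_ne_zero.mpr hne)] at h4
    intro p hp
    rcases Finset.mem_insert.mp hp with rfl | hp
    · rw [Finset.sum_insert hq] at h
      exact (N.add_mem_iff_left (N.sum_mem hs)).mp h
    · exact hs p hp

theorem smul_smul_comm_of_adjoin {s : Set A}
    (hs : ∀ a ∈ s, ∀ b ∈ s, ∀ m : M, a • b • m = b • a • m) {a b : A} (ha : a ∈ Algebra.adjoin ℂ s)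
    (hb : b ∈ Algebra.adjoin ℂ s) (m : M) : a • b • m = b • a • m := by
  have h1 : ∀ a ∈ s, ∀ b ∈ Algebra.adjoin ℂ s, ∀ m : M, a • b • m = b • a • m := by
    intro a ha b hb
    induction hb using Algebra.adjoin_induction with
    | mem x hx => exact hs a ha x hx
    | algebraMap c => intro m; rw [algebraMap_smul, algebraMap_smul, smul_comm]
    | add x y _ _ hx hy => intro m; rw [add_smul, smul_add, hx, hy, add_smul]
    | mul x y _ _ hx hy => intro m; rw [mul_smul, hx, hy, mul_smul]
  induction ha using Algebra.adjoin_induction generalizing m with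
  | mem x hx => exact h1 x hx b hb m
  | algebraMap c => rw [algebraMap_smul, algebraMap_smul, smul_comm]
  | add x y _ _ hx hy => rw [add_smul, hx, hy, add_smul, smul_add]
  | mul x y _ _ hx hy => rw [mul_smul, hy, hx, mul_smul]

end Abstract

/-! ## The weights of the standard module -/

section Spectrum

variable (κ c₀ : ℂ) (d : ZMod r → ℂ) (lam : MultiPartition r n)

theorem z_mem_tAlg (i : Fin n) : z κ c₀ d i ∈ tAlg (n := n) κ c₀ d :=
  Algebra.subset_adjoin (Or.inl ⟨i, rfl⟩)

theorem zetaAt_mem_tAlg (i : Fin n) : t κ c₀ d (zetaAt i) ∈ tAlg (n := n) κ c₀ d :=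
  Algebra.subset_adjoin (Or.inr ⟨i, rfl⟩)

theorem dg_mem_tAlg (i : Fin n) (η : rootsOfUnity r ℂ) :
    t κ c₀ d (dg i η) ∈ tAlg (n := n) κ c₀ d := by
  obtain ⟨l, -, rfl⟩ := exists_zu_pow η
  rw [dg_pow, ← zetaAt_eq, ← tH_apply, map_pow]
  exact pow_mem (zetaAt_mem_tAlg κ c₀ d i) l

/-- The coefficient of `x^μ v_T^μ`. -/
noncomputable def lcoord (p : (Fin n → ℕ) × SYT lam) : Verma κ c₀ d lam →ₗ[ℂ] ℂ :=
  (leadingBasis κ c₀ d lam).coord p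

open Classical in
theorem lcoord_leading (p : (Fin n → ℕ) × SYT lam) (μ : Fin n → ℕ) (T : SYT lam) :
    lcoord κ c₀ d lam p (leading κ c₀ d lam μ T) = if (μ, T) = p then 1 else 0 := by
  have h := leadingBasis_apply κ c₀ d lam (μ, T)
  rw [← h, lcoord, Module.Basis.coord_apply, Module.Basis.repr_self, Finsupp.single_apply]

theorem lcoord_smul' (p : (Fin n → ℕ) × SYT lam) (c : ℂ) (m : Verma κ c₀ d lam) :
    lcoord κ c₀ d lam p (c • m) = c * lcoord κ c₀ d lam p m :=
  (lcoord κ c₀ d lam p).map_smul c m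

theorem lcoord_leading_self (μ : Fin n → ℕ) (T : SYT lam) :
    lcoord κ c₀ d lam (μ, T) (leading κ c₀ d lam μ T) = 1 := by
  classical
  rw [lcoord_leading, if_pos rfl]

theorem lcoord_low {p : (Fin n → ℕ) × SYT lam} {μ : Fin n → ℕ} (hp : ¬ CompLT p.1 μ)
    {m : Verma κ c₀ d lam} (hm : m ∈ low κ c₀ d lam μ) : lcoord κ c₀ d lam p m = 0 := by
  classical
  rw [low_eq_span_leading] at hm
  induction hm using Submodule.span_induction with
  | mem x hx =>
    obtain ⟨ν, S, hν, rfl⟩ := hx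
    rw [lcoord_leading, if_neg]
    rintro rfl
    exact hp hν
  | zero => exact map_zero _
  | add x y _ _ hx hy => rw [map_add, hx, hy, add_zero]
  | smul a x _ hx => rw [map_smul, hx, smul_zero]

theorem leading_mem_low {ν μ : Fin n → ℕ} (h : CompLT ν μ) (S : SYT lam) :
    leading κ c₀ d lam ν S ∈ low κ c₀ d lam μ :=
  mon_mem_low κ c₀ d lam h _

/-- The elements of `ℍ` that act triangularly on the elements `x^μ v_T^μ`. -/
def IsTriangular (a : Cherednik r n κ c₀ d) : Prop :=
  ∀ (μ : Fin n → ℕ) (T : SYT lam), ∃ e : ℂ,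
    a • leading κ c₀ d lam μ T - e • leading κ c₀ d lam μ T ∈ low κ c₀ d lam μ

variable {κ c₀ d lam}

theorem IsTriangular.smul_mem_low {a : Cherednik r n κ c₀ d} (ha : IsTriangular κ c₀ d lam a)
    {μ : Fin n → ℕ} {m : Verma κ c₀ d lam} (hm : m ∈ low κ c₀ d lam μ) :
    a • m ∈ low κ c₀ d lam μ := by
  rw [low_eq_span_leading] at hm
  induction hm using Submodule.span_induction with
  | mem x hx =>
    obtain ⟨ν, S, hν, rfl⟩ := hx
    obtain ⟨e, he⟩ := ha ν S
    rw [← sub_add_cancel (a • leading κ c₀ d lam ν S) (e • leading κ c₀ d lam ν S)]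
    exact add_mem (low_mono κ c₀ d lam hν he)
      (Submodule.smul_mem _ _ (leading_mem_low κ c₀ d lam hν S))
  | zero => rw [smul_zero]; exact zero_mem _
  | add x y _ _ hx hy => rw [smul_add]; exact add_mem hx hy
  | smul c x _ hx => rw [smul_comm]; exact Submodule.smul_mem _ _ hx

theorem isTriangular_of_mem {a : Cherednik r n κ c₀ d} (ha : a ∈ tAlg κ c₀ d) :
    IsTriangular κ c₀ d lam a := by
  induction ha using Algebra.adjoin_induction with
  | mem x hx =>
    intro μ T
    rcases hx with ⟨i, rfl⟩ | ⟨i, rfl⟩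
    · exact ⟨_, z_smul_leading κ c₀ d μ T i⟩
    · refine ⟨wtd lam μ T i (zu r), ?_⟩
      simp only [zetaAt_eq]
      rw [dg_smul_leading, sub_self]
      exact zero_mem _
  | algebraMap c =>
    intro μ T
    exact ⟨c, by rw [algebraMap_smul, sub_self]; exact zero_mem _⟩
  | add x y _ _ hx hy =>
    intro μ T
    obtain ⟨e, he⟩ := hx μ T
    obtain ⟨e', he'⟩ := hy μ T
    refine ⟨e + e', ?_⟩
    rw [add_smul, add_smul, add_sub_add_comm]
    exact add_mem he he'
  | mul x y _ _ hx hy =>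
    intro μ T
    obtain ⟨e, he⟩ := hx μ T
    obtain ⟨e', he'⟩ := hy μ T
    refine ⟨e' * e, ?_⟩
    have h := add_mem (hx.smul_mem_low he') (Submodule.smul_mem _ e' he)
    rwa [smul_sub, smul_sub, smul_comm x e', ← mul_smul, ← mul_smul, sub_add_sub_cancel] at h

theorem lcoord_smul_low {a : Cherednik r n κ c₀ d} (ha : a ∈ tAlg κ c₀ d) {μ : Fin n → ℕ}
    (T : SYT lam) {m : Verma κ c₀ d lam} (hm : m ∈ low κ c₀ d lam μ) :
    lcoord κ c₀ d lam (μ, T) (a • m) = 0 :=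
  lcoord_low κ c₀ d lam (fun h => h.ne rfl) ((isTriangular_of_mem ha).smul_mem_low hm)

theorem smul_leading_sub_mem {a : Cherednik r n κ c₀ d} (ha : a ∈ tAlg κ c₀ d) (μ : Fin n → ℕ)
    (T : SYT lam) : a • leading κ c₀ d lam μ T - lcoord κ c₀ d lam (μ, T)
      (a • leading κ c₀ d lam μ T) • leading κ c₀ d lam μ T ∈ low κ c₀ d lam μ := by
  obtain ⟨e, he⟩ := isTriangular_of_mem (lam := lam) ha μ T
  have h := lcoord_low κ c₀ d lam (p := (μ, T)) (fun h => h.ne rfl) he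
  rw [map_sub, lcoord_smul', lcoord_leading_self, mul_one, sub_eq_zero] at h
  rwa [h]

/-- The top coordinate is an eigenfunctional of 𝔱, since lower terms stay lower. This makes `weight`
multiplicative and is the hypothesis on l in `exists_weight_vector`. -/
theorem lcoord_smul {a : Cherednik r n κ c₀ d} (ha : a ∈ tAlg κ c₀ d) {μ : Fin n → ℕ}
    {T : SYT lam} {m : Verma κ c₀ d lam} {c : ℂ}
    (hm : m - c • leading κ c₀ d lam μ T ∈ low κ c₀ d lam μ) :
    lcoord κ c₀ d lam (μ, T) (a • m) =
      lcoord κ c₀ d lam (μ, T) (a • leading κ c₀ d lam μ T) * lcoord κ c₀ d lam (μ, T) m := by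
  have h1 := lcoord_smul_low ha T hm
  have h2 := lcoord_low κ c₀ d lam (p := (μ, T)) (fun h => h.ne rfl) hm
  rw [smul_sub, map_sub, smul_comm, lcoord_smul', sub_eq_zero] at h1
  rw [map_sub, lcoord_smul', lcoord_leading_self, sub_eq_zero, mul_one] at h2
  rw [h1, h2, mul_comm]

variable (κ c₀ d lam)

/-- The weight of `x^μ v_T^μ`. -/
noncomputable def weight (μ : Fin n → ℕ) (T : SYT lam) : tAlg (n := n) κ c₀ d →ₐ[ℂ] ℂ where
  toFun a := lcoord κ c₀ d lam (μ, T) ((a : Cherednik r n κ c₀ d) • leading κ c₀ d lam μ T)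
  map_one' := by rw [OneMemClass.coe_one, one_smul, lcoord_leading_self]
  map_zero' := by rw [ZeroMemClass.coe_zero, zero_smul, map_zero]
  map_add' a b := by rw [AddMemClass.coe_add, add_smul, map_add]
  map_mul' a b := by
    rw [MulMemClass.coe_mul, mul_smul, lcoord_smul a.2 (smul_leading_sub_mem b.2 μ T)]
  commutes' c := by
    rw [Subalgebra.coe_algebraMap, algebraMap_smul, lcoord_smul', lcoord_leading_self, mul_one]
    rfl

theorem weight_apply (μ : Fin n → ℕ) (T : SYT lam) (a : tAlg (n := n) κ c₀ d) :
    weight κ c₀ d lam μ T a =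
      lcoord κ c₀ d lam (μ, T) ((a : Cherednik r n κ c₀ d) • leading κ c₀ d lam μ T) := rfl

theorem weight_z (μ : Fin n → ℕ) (T : SYT lam) (i : Fin n) :
    weight κ c₀ d lam μ T ⟨z κ c₀ d i, z_mem_tAlg κ c₀ d i⟩ = wtz κ c₀ d lam μ T i := by
  have h := lcoord_low κ c₀ d lam (p := (μ, T)) (fun h => h.ne rfl) (z_smul_leading κ c₀ d μ T i)
  rwa [map_sub, lcoord_smul', lcoord_leading_self, mul_one, sub_eq_zero] at h

theorem weight_dg (μ : Fin n → ℕ) (T : SYT lam) (i : Fin n) (η : rootsOfUnity r ℂ) :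
    weight κ c₀ d lam μ T ⟨t κ c₀ d (dg i η), dg_mem_tAlg κ c₀ d i η⟩ = wtd lam μ T i η := by
  rw [weight_apply, dg_smul_leading, lcoord_smul', lcoord_leading_self, mul_one]

instance : Finite (SYT lam) := inferInstance

instance (μ : Fin n → ℕ) : FiniteDimensional ℂ (low κ c₀ d lam μ) := by
  rw [low_eq_span_leading]
  apply Module.Finite.span_of_finite
  refine (((finite_compLT μ).prod (Set.finite_univ (α := SYT lam))).image
    (fun p => leading κ c₀ d lam p.1 p.2)).subset ?_
  rintro _ ⟨ν, S, hν, rfl⟩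
  exact ⟨(ν, S), ⟨hν, trivial⟩, rfl⟩

theorem verma_induction (N : Submodule ℂ (Verma κ c₀ d lam))
    (h0 : ∀ T, leading κ c₀ d lam 0 T ∈ N) (hX : ∀ i : Fin n, ∀ m ∈ N, X κ c₀ d i • m ∈ N) : N = ⊤ := by
  have h1 : ∀ v, mon κ c₀ d lam 0 v ∈ N := by
    intro v
    have hw : ∀ T, vec T = sRep lam (perm (wPerm (0 : Fin n → ℕ))) (sRep lam
        (perm (wPerm (0 : Fin n → ℕ)))⁻¹ (vec T)) := fun T => by
      rw [← Module.End.mul_apply, ← map_mul, mul_inv_cancel, map_one, Module.End.one_apply]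
    have hv : v ∈ Submodule.map (sRep lam (perm (wPerm (0 : Fin n → ℕ)))⁻¹)
        (Submodule.span ℂ (Set.range (vec (lam := lam)))) := by
      rw [span_range_vec]
      exact ⟨sRep lam (perm (wPerm (0 : Fin n → ℕ))) v, trivial, by
        rw [← Module.End.mul_apply, ← map_mul, inv_mul_cancel, map_one, Module.End.one_apply]⟩
    obtain ⟨u, hu, rfl⟩ := hv
    induction hu using Submodule.span_induction with
    | mem x hx => obtain ⟨T, rfl⟩ := hx; exact h0 T
    | zero => rw [map_zero, map_zero]; exact zero_mem _
    | add a b _ _ ha hb => rw [map_add, map_add]; exact add_mem ha hb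
    | smul a x _ hx => rw [map_smul, map_smul]; exact Submodule.smul_mem _ _ hx
  have h2 : ∀ (k : ℕ) (μ : Fin n → ℕ), ∑ i, μ i = k → ∀ v, mon κ c₀ d lam μ v ∈ N := by
    intro k
    induction k with
    | zero =>
      intro μ hμ v
      have : μ = 0 := funext fun i => Finset.sum_eq_zero_iff.mp hμ i (Finset.mem_univ i)
      rw [this]
      exact h1 v
    | succ k ih =>
      intro μ hμ v
      obtain ⟨i, -, hi⟩ := Finset.exists_ne_zero_of_sum_ne_zero (hμ.trans_ne (Nat.succ_ne_zero k))
      have e : μ = (μ - Pi.single i 1) + Pi.single i 1 := by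
        ext j
        rcases eq_or_ne j i with rfl | hj
        · simp; omega
        · simp [hj]
      have hs : ∑ j, (μ - Pi.single i 1 : Fin n → ℕ) j = k := by
        have h3 : ∑ j, μ j = ∑ j, ((μ - Pi.single i 1 : Fin n → ℕ) j + (Pi.single i 1 : Fin n → ℕ) j) :=
          Finset.sum_congr rfl fun j _ => congrFun e j
        rw [Finset.sum_add_distrib, hμ, Finset.sum_pi_single', if_pos (Finset.mem_univ i)] at h3
        omega
      rw [e, ← X_smul_mon]
      exact hX i _ (ih _ hs v)
  rw [eq_top_iff, ← span_mon, Submodule.span_le]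
  rintro _ ⟨μ, v, rfl⟩
  exact h2 _ μ rfl v

theorem low_zero : low κ c₀ d lam 0 = ⊥ := by
  rw [low]
  refine Submodule.span_eq_bot.mpr ?_
  rintro _ ⟨ν, v, hν, -⟩
  exact absurd hν (not_compLT_zero ν)

/-- Commutativity is proved on M(λ) only. In degree zero the z_i are diagonal because there is
nothing below μ = 0, and M(λ) is generated from there by permutations and Φ, which preserve the
vectors on which the z_i commute. -/
theorem zComm_eq_top [NeZero n] (m : Verma κ c₀ d lam) :
    m ∈ zComm (n := n) κ c₀ d (Verma κ c₀ d lam) := by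
  let N : Submodule ℂ (Verma κ c₀ d lam) :=
    { zComm (n := n) κ c₀ d (Verma κ c₀ d lam) with
      smul_mem' := fun c x hx i j => by
        have := hx i j
        rw [smul_comm (z κ c₀ d j), smul_comm (z κ c₀ d i), smul_comm (z κ c₀ d i) c,
          smul_comm (z κ c₀ d j) c, this] }
  have hs : ∀ (w : Perm (Fin n)) (x : Verma κ c₀ d lam), x ∈ zComm (n := n) κ c₀ d _ →
      tH κ c₀ d (perm w) • x ∈ zComm (n := n) κ c₀ d _ := by
    intro w
    induction w using adj_induction with
    | one => intro x hx; rw [perm_one, map_one, one_smul]; exact hx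
    | mul w i hi ih =>
      intro x hx
      rw [perm_mul, map_mul, mul_smul, adj_eq hi]
      exact ih _ (swap_smul_mem_zComm κ c₀ d hx rfl)
  suffices h : N = ⊤ from (h ▸ Submodule.mem_top : m ∈ N)
  refine verma_induction κ c₀ d lam N (fun T i j => ?_) fun i x hx => ?_
  · have h0 : ∀ k, z κ c₀ d k • leading κ c₀ d lam 0 T =
        wtz κ c₀ d lam 0 T k • leading κ c₀ d lam 0 T := by
      intro k
      have := z_smul_leading κ c₀ d (0 : Fin n → ℕ) T k
      rwa [low_zero, Submodule.mem_bot, sub_eq_zero] at this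
    rw [h0, h0, smul_comm, h0, smul_comm (z κ c₀ d j), h0, smul_comm]
  -- Up to permutation matrices on either side x_i is Φ, so stability under permutations and Φ
  -- suffices.
  · have e : X κ c₀ d i = tH κ c₀ d (perm (swap (lastIdx n) i)) * (Phi κ c₀ d *
        (tH κ c₀ d (perm (finRotate n)) * tH κ c₀ d (perm (swap (lastIdx n) i)))) := by
      rw [Phi, mul_assoc (X κ c₀ d _), ← mul_assoc (tH κ c₀ d (perm (finRotate n)⁻¹)),
        perm_inv_mul_perm, one_mul, ← mul_assoc, perm_mul_X, mul_assoc, swap_mul_swap, mul_one,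
        Equiv.swap_apply_left]
    rw [e, mul_smul, mul_smul, mul_smul]
    exact hs _ _ (Phi_smul_mem_zComm κ c₀ d (hs _ _ (hs _ _ hx)))

theorem tAlg_smul_comm [NeZero n] {a b : Cherednik r n κ c₀ d} (ha : a ∈ tAlg κ c₀ d)
    (hb : b ∈ tAlg κ c₀ d) (m : Verma κ c₀ d lam) : a • b • m = b • a • m := by
  refine smul_smul_comm_of_adjoin ?_ ha hb m
  rintro _ (⟨i, rfl⟩ | ⟨i, rfl⟩) _ (⟨j, rfl⟩ | ⟨j, rfl⟩) m
  · exact (mem_zComm κ c₀ d).mp (zComm_eq_top κ c₀ d lam m) i j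
  · simp only [zetaAt_eq]
    rw [← mul_smul, ← mul_smul, ← tH_apply, dg_mul_z]
  · simp only [zetaAt_eq]
    rw [← mul_smul, ← mul_smul, ← tH_apply, dg_mul_z]
  · simp only [zetaAt_eq]
    rw [← mul_smul, ← mul_smul, ← tH_apply, ← tH_apply, ← map_mul, ← map_mul, dg_comm]

variable {κ c₀ d lam}

theorem IsF.lcoord_eq_one {μ : Fin n → ℕ} {T : SYT lam} {f : Verma κ c₀ d lam}
    (hf : IsF κ c₀ d lam μ T f) : lcoord κ c₀ d lam (μ, T) f = 1 := by
  have h := hf.2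
  rw [← low_eq_span_leading] at h
  have h := lcoord_low κ c₀ d lam (p := (μ, T)) (fun h => h.ne rfl) h
  rwa [map_sub, lcoord_leading_self, sub_eq_zero] at h

theorem IsF.smul_eq {μ : Fin n → ℕ} {T : SYT lam} {f : Verma κ c₀ d lam}
    (hf : IsF κ c₀ d lam μ T f) (a : tAlg (n := n) κ c₀ d) :
    (a : Cherednik r n κ c₀ d) • f = weight κ c₀ d lam μ T a • f := by
  obtain ⟨e, he⟩ := hf.1.2 a a.2
  have h := hf.2
  rw [← low_eq_span_leading, ← one_smul ℂ (leading κ c₀ d lam μ T)] at h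
  have h2 := lcoord_smul a.2 h
  rw [he, lcoord_smul', hf.lcoord_eq_one, mul_one, mul_one] at h2
  rw [he, h2, weight_apply]

/-- Weight spaces are generalized, so a Jordan block of size two over f is allowed. This is what
rules out coinciding eigenvalues in `wtz_ne_of_sameChar`. -/
theorem mem_weightSpace_of_smul {α : tAlg (n := n) κ c₀ d →ₐ[ℂ] ℂ} {f m : Verma κ c₀ d lam}
    (hf : ∀ a : tAlg (n := n) κ c₀ d, (a : Cherednik r n κ c₀ d) • f = α a • f)
    (hm : ∀ a : tAlg (n := n) κ c₀ d, ∃ b : ℂ,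
      (a : Cherednik r n κ c₀ d) • m = α a • m + b • f) : m ∈ weightSpace κ c₀ d lam α := by
  refine ⟨2, two_pos, fun a => ?_⟩
  obtain ⟨b, hb⟩ := hm a
  rw [pow_two, mul_smul, sub_smul _ _ m, hb, algebraMap_smul, add_sub_cancel_left, smul_comm, sub_smul,
    hf, algebraMap_smul, sub_self, smul_zero]

theorem exists_smul_eq_of_mem_weightSpace (hs : SimpleSpectrum κ c₀ d lam)
    {α : tAlg (n := n) κ c₀ d →ₐ[ℂ] ℂ} {f m : Verma κ c₀ d lam} (hf0 : f ≠ 0)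
    (hf : f ∈ weightSpace κ c₀ d lam α) (hm : m ∈ weightSpace κ c₀ d lam α) :
    ∃ c : ℂ, m = c • f := by
  have h1 := hs α fun h => hf0 (by rw [h] at hf; exact (Submodule.mem_bot ℂ).mp hf)
  obtain ⟨c, hc⟩ := (finrank_eq_one_iff_of_nonzero' (⟨f, hf⟩ : weightSpace κ c₀ d lam α)
    (fun h => hf0 (congrArg Subtype.val h))).mp h1 ⟨m, hm⟩
  exact ⟨c, (congrArg Subtype.val hc).symm⟩

/-! ### Existence and uniqueness of the eigenvectors f_{μ,T} -/

variable (κ c₀ d) in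
/-- The span of `x^μ v_T^μ` and the `x^ν ⊗ v` with `ν < μ`. -/
noncomputable def leadSpan (μ : Fin n → ℕ) (T : SYT lam) : Submodule ℂ (Verma κ c₀ d lam) :=
  Submodule.span ℂ {leading κ c₀ d lam μ T} ⊔ low κ c₀ d lam μ

instance (μ : Fin n → ℕ) (T : SYT lam) : FiniteDimensional ℂ (leadSpan κ c₀ d μ T) :=
  inferInstanceAs (FiniteDimensional ℂ
    (Submodule.span ℂ {leading κ c₀ d lam μ T} ⊔ low κ c₀ d lam μ : Submodule ℂ _))

theorem leading_mem_leadSpan (μ : Fin n → ℕ) (T : SYT lam) :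
    leading κ c₀ d lam μ T ∈ leadSpan κ c₀ d μ T :=
  Submodule.mem_sup_left (Submodule.mem_span_singleton_self _)

theorem low_le_leadSpan (μ : Fin n → ℕ) (T : SYT lam) :
    low κ c₀ d lam μ ≤ leadSpan κ c₀ d μ T := le_sup_right

theorem sub_smul_leading_mem {μ : Fin n → ℕ} {T : SYT lam} {u : Verma κ c₀ d lam}
    (hu : u ∈ leadSpan κ c₀ d μ T) :
    u - lcoord κ c₀ d lam (μ, T) u • leading κ c₀ d lam μ T ∈ low κ c₀ d lam μ := by
  obtain ⟨y, hy, w, hw, rfl⟩ := Submodule.mem_sup.mp hu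
  obtain ⟨c, rfl⟩ := Submodule.mem_span_singleton.mp hy
  have : lcoord κ c₀ d lam (μ, T) (c • leading κ c₀ d lam μ T + w) = c := by
    have h := lcoord_low κ c₀ d lam (p := (μ, T)) (fun h => h.ne rfl) hw
    rw [map_add, lcoord_smul', lcoord_leading_self, h, mul_one, add_zero]
  rw [this, add_sub_cancel_left]
  exact hw

theorem smul_mem_leadSpan {μ : Fin n → ℕ} {T : SYT lam} {a : Cherednik r n κ c₀ d}
    (ha : a ∈ tAlg κ c₀ d) {u : Verma κ c₀ d lam} (hu : u ∈ leadSpan κ c₀ d μ T) :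
    a • u ∈ leadSpan κ c₀ d μ T := by
  have h1 : a • leading κ c₀ d lam μ T ∈ leadSpan κ c₀ d μ T := by
    rw [← sub_add_cancel (a • leading κ c₀ d lam μ T)
      (lcoord κ c₀ d lam (μ, T) (a • leading κ c₀ d lam μ T) • leading κ c₀ d lam μ T)]
    exact add_mem (low_le_leadSpan μ T (smul_leading_sub_mem ha μ T))
      (Submodule.smul_mem _ _ (leading_mem_leadSpan μ T))
  have h2 := add_mem (low_le_leadSpan μ T
    ((isTriangular_of_mem ha).smul_mem_low (sub_smul_leading_mem hu)))
    (Submodule.smul_mem _ (lcoord κ c₀ d lam (μ, T) u) h1)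
  rwa [smul_sub, smul_comm a (lcoord κ c₀ d lam (μ, T) u), sub_add_cancel] at h2

theorem exists_weightSpace_leading [NeZero n] (μ : Fin n → ℕ) (T : SYT lam) :
    ∃ f ∈ weightSpace κ c₀ d lam (weight κ c₀ d lam μ T), lcoord κ c₀ d lam (μ, T) f = 1 ∧
      f - leading κ c₀ d lam μ T ∈ low κ c₀ d lam μ := by
  obtain ⟨f, hfU, hlf, q, hq, hfq⟩ := exists_weight_vector (tAlg κ c₀ d)
    (fun a ha b hb m => tAlg_smul_comm κ c₀ d lam ha hb m) (leadSpan κ c₀ d μ T)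
    (fun a ha u hu => smul_mem_leadSpan ha hu) (lcoord κ c₀ d lam (μ, T))
    (weight κ c₀ d lam μ T) (fun a u hu => lcoord_smul a.2 (sub_smul_leading_mem hu))
    (leading_mem_leadSpan μ T)
  rw [lcoord_leading_self] at hlf
  have := sub_smul_leading_mem hfU
  rw [hlf, one_smul] at this
  exact ⟨f, ⟨q, hq, hfq⟩, hlf, this⟩

theorem smul_mem_weightSpace [NeZero n] {α : tAlg (n := n) κ c₀ d →ₐ[ℂ] ℂ}
    {a : Cherednik r n κ c₀ d} (ha : a ∈ tAlg κ c₀ d) {f : Verma κ c₀ d lam}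
    (hf : f ∈ weightSpace κ c₀ d lam α) : a • f ∈ weightSpace κ c₀ d lam α := by
  obtain ⟨q, hq, hfq⟩ := hf
  refine ⟨q, hq, fun b => ?_⟩
  have h1 : ((b : Cherednik r n κ c₀ d) - algebraMap ℂ _ (α b)) ^ q ∈ tAlg κ c₀ d :=
    pow_mem (sub_mem b.2 (Subalgebra.algebraMap_mem _ _)) q
  rw [tAlg_smul_comm κ c₀ d lam h1 ha, hfq, smul_zero]

/-- The generalized weight vector with the given leading term spans its weight space, which 𝔱
preserves, so it is an eigenvector. Any other candidate lies on the same line with the same leading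
coefficient. -/
theorem existsUnique_isF [NeZero n] (hs : SimpleSpectrum κ c₀ d lam) (μ : Fin n → ℕ)
    (T : SYT lam) : ∃! f, IsF κ c₀ d lam μ T f := by
  obtain ⟨f, hfw, hlf, hfl⟩ := exists_weightSpace_leading (κ := κ) (c₀ := c₀) (d := d) μ T
  have hf0 : f ≠ 0 := by
    rintro rfl
    rw [map_zero] at hlf
    exact zero_ne_one hlf
  refine ⟨f, ⟨⟨hf0, fun a ha => exists_smul_eq_of_mem_weightSpace hs hf0 hfw
    (smul_mem_weightSpace ha hfw)⟩, ?_⟩, fun g hg => ?_⟩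
  · rwa [← low_eq_span_leading]
  have hgw : g ∈ weightSpace κ c₀ d lam (weight κ c₀ d lam μ T) :=
    mem_weightSpace_of_smul hg.smul_eq fun a => ⟨0, by rw [hg.smul_eq, zero_smul, add_zero]⟩
  obtain ⟨c, hc⟩ := exists_smul_eq_of_mem_weightSpace hs hf0 hfw hgw
  have h1 := hg.lcoord_eq_one
  rw [hc, lcoord_smul', hlf, mul_one] at h1
  rw [hc, h1, one_smul]

end Spectrum

/-! ## Intertwiners on eigenvectors -/

section Generic

variable {κ c₀ : ℂ} {d : ZMod r → ℂ}
variable {M : Type*} [AddCommGroup M] [Module ℂ M] [Module (Cherednik r n κ c₀ d) M]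
  [IsScalarTower ℂ (Cherednik r n κ c₀ d) M]

theorem z_smul_swap_left {i j : Fin n} (hij : (i : ℕ) + 1 = j) (m : M) :
    z κ c₀ d i • tH κ c₀ d (perm (swap i j)) • m =
      tH κ c₀ d (perm (swap i j)) • z κ c₀ d j • m - c₀ • piElt κ c₀ d i j • m := by
  rw [← mul_smul, ← mul_smul, ← smul_assoc, ← sub_smul, swap_mul_z_right κ c₀ d hij, add_sub_cancel_right]

theorem z_smul_swap_right {i j : Fin n} (hij : (i : ℕ) + 1 = j) (m : M) :
    z κ c₀ d j • tH κ c₀ d (perm (swap i j)) • m =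
      tH κ c₀ d (perm (swap i j)) • z κ c₀ d i • m + c₀ • piElt κ c₀ d i j • m := by
  rw [← mul_smul, ← mul_smul, ← smul_assoc, ← add_smul, swap_mul_z_left κ c₀ d hij, sub_add_cancel]

theorem z_smul_swap_of_ne {i j k : Fin n} (hij : (i : ℕ) + 1 = j) (hi : k ≠ i) (hj : k ≠ j) (m : M) :
    z κ c₀ d k • tH κ c₀ d (perm (swap i j)) • m =
      tH κ c₀ d (perm (swap i j)) • z κ c₀ d k • m := by
  rw [← mul_smul, ← mul_smul, swap_mul_z_of_ne κ c₀ d hij hi hj]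

theorem dg_smul_swap (i j k : Fin n) (η : rootsOfUnity r ℂ) (m : M) :
    tH κ c₀ d (dg k η) • tH κ c₀ d (perm (swap i j)) • m =
      tH κ c₀ d (perm (swap i j)) • tH κ c₀ d (dg (swap i j k) η) • m := by
  rw [← mul_smul, ← mul_smul, ← map_mul, ← map_mul, mul_dg, perm_right, Equiv.swap_apply_self]

/-- Commuting z_i or z_j with t_s produces ∓c₀e f, and `hb` says that the summand b f absorbs it. In
this form no division is needed. -/
theorem z_smul_sigma {i j : Fin n} (hij : (i : ℕ) + 1 = j) {f : M} {a : Fin n → ℂ} {e b : ℂ}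
    (hz : ∀ k, z κ c₀ d k • f = a k • f) (hp : piElt κ c₀ d i j • f = e • f)
    (hb : b * (a i - a j) = c₀ * e) (k : Fin n) :
    z κ c₀ d k • (tH κ c₀ d (perm (swap i j)) • f + b • f) =
      a (swap i j k) • (tH κ c₀ d (perm (swap i j)) • f + b • f) := by
  rw [smul_add, smul_comm (z κ c₀ d k) b, hz]
  rcases eq_or_ne k i with rfl | hi
  · rw [Equiv.swap_apply_left, z_smul_swap_left hij, hz, hp, smul_comm (tH κ c₀ d _) (a j)]
    generalize tH κ c₀ d (perm (swap _ _) : W r n) • f = g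
    linear_combination (norm := module) hb • f
  rcases eq_or_ne k j with rfl | hj
  · rw [Equiv.swap_apply_right, z_smul_swap_right hij, hz, hp, smul_comm (tH κ c₀ d _) (a i)]
    generalize tH κ c₀ d (perm (swap _ _) : W r n) • f = g
    linear_combination (norm := module) -hb • f
  · rw [Equiv.swap_apply_of_ne_of_ne hi hj, z_smul_swap_of_ne hij hi hj, hz,
      smul_comm (tH κ c₀ d _) (a k), smul_add, smul_comm b]

theorem dg_smul_sigma (i j : Fin n) {f : M} {w : Fin n → rootsOfUnity r ℂ → ℂ} {b : ℂ}
    (hd : ∀ k η, tH κ c₀ d (dg k η) • f = w k η • f) (hb : b ≠ 0 → ∀ η, w i η = w j η) (k : Fin n)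
    (η : rootsOfUnity r ℂ) :
    tH κ c₀ d (dg k η) • (tH κ c₀ d (perm (swap i j)) • f + b • f) =
      w (swap i j k) η • (tH κ c₀ d (perm (swap i j)) • f + b • f) := by
  rw [smul_add, smul_comm (tH κ c₀ d (dg k η)) b, hd, dg_smul_swap, hd, smul_comm (tH κ c₀ d _) (w _ _),
    smul_add, smul_comm b]
  congr 1
  by_cases h : b = 0
  · rw [h, zero_smul, smul_zero, smul_zero]
  · have hw := hb h η
    congr 1
    rw [Equiv.swap_apply_def]
    split_ifs with h1 h2
    · rw [h1, hw]
    · rw [h2, hw]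
    · rfl

theorem mul_smul_of_smul_eq {A : Type*} [Ring A] [Algebra ℂ A] {N : Type*} [AddCommGroup N] [Module ℂ N]
    [Module A N] [IsScalarTower ℂ A N] {x y : A} {m f : N} {a a' b b' : ℂ}
    (hx : x • m = a • m + b • f) (hy : y • m = a' • m + b' • f) (hf : x • f = a • f) :
    (x * y) • m = (a * a') • m + (a' * b + b' * a) • f := by
  rw [mul_smul x y, hy, smul_add, smul_comm x a', smul_comm x b', hx, hf]
  module

/-- Being an eigenvector modulo the line of f passes to products because f itself has the same
weight α. -/
theorem smul_eq_of_mem_adjoin {A : Type*} [Ring A] [Algebra ℂ A] {N : Type*} [AddCommGroup N]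
    [Module ℂ N] [Module A N] [IsScalarTower ℂ A N] {s : Set A} (α : Algebra.adjoin ℂ s →ₐ[ℂ] ℂ)
    {m f : N} (hf : ∀ a : Algebra.adjoin ℂ s, (a : A) • f = α a • f)
    (hm : ∀ x, ∀ hx : x ∈ s, ∃ b : ℂ, x • m = α ⟨x, Algebra.subset_adjoin hx⟩ • m + b • f) :
    ∀ a, ∀ ha : a ∈ Algebra.adjoin ℂ s, ∃ b : ℂ, a • m = α ⟨a, ha⟩ • m + b • f := by
  intro a ha
  induction ha using Algebra.adjoin_induction with
  | mem x hx => exact hm x hx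
  | algebraMap c =>
    refine ⟨0, ?_⟩
    rw [zero_smul, add_zero, algebraMap_smul]
    congr 1
    exact (α.commutes c).symm
  | add x y hx hy ihx ihy =>
    obtain ⟨b, hb⟩ := ihx
    obtain ⟨b', hb'⟩ := ihy
    have e : α ⟨x + y, add_mem hx hy⟩ = α ⟨x, hx⟩ + α ⟨y, hy⟩ := map_add α ⟨x, hx⟩ ⟨y, hy⟩
    refine ⟨b + b', ?_⟩
    rw [e, add_smul x y m, hb, hb']
    module
  | mul x y hx hy ihx ihy =>
    obtain ⟨b, hb⟩ := ihx
    obtain ⟨b', hb'⟩ := ihy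
    have e : α ⟨x * y, mul_mem hx hy⟩ = α ⟨x, hx⟩ * α ⟨y, hy⟩ := map_mul α ⟨x, hx⟩ ⟨y, hy⟩
    rw [e]
    exact ⟨_, mul_smul_of_smul_eq hb hb' (hf ⟨x, hx⟩)⟩

/-- The condition on b and b' turns h into pqf + b′qf + ab′f. The braid relation gives q(pqf) =
a·pqf, and q exchanges qf and f, so a² = 1 finishes. -/
theorem swap_smul_braid {A : Type*} [Ring A] [Algebra ℂ A] {N : Type*} [AddCommGroup N] [Module ℂ N]
    [Module A N] [IsScalarTower ℂ A N] {p q : A} (hpq : q * p * q = p * q * p) (hq : q * q = 1)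
    {f : N} {a b b' : ℂ} (hf : p • f = a • f) (ha : a * a = 1) (hb : a * b + b * b' = a * b')
    {g h : N} (hg : q • f + b • f = g) (hh : p • g + b' • g = h) : q • h = a • h := by
  subst hg hh
  have h1 : q • p • q • f = a • p • q • f := by
    rw [← mul_smul, ← mul_smul, hpq, mul_smul, mul_smul, hf, smul_comm q, smul_comm p]
  have h2 : q • q • f = f := by rw [← mul_smul, hq, one_smul]
  rw [smul_add p, smul_add q, smul_comm p b, hf, smul_add q, h1, smul_comm q b, smul_comm q a,
    smul_comm q b', smul_add q, h2, smul_comm q b]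
  generalize p • q • f = g
  generalize q • f = g'
  linear_combination (norm := module) hb • g' - (a * hb) • f - (b' * ha) • f

end Generic

/-! ### Leading coefficients of the f_{μ,T} and the action of σ_i on them -/

section Eigenvectors

variable {κ c₀ : ℂ} {d : ZMod r → ℂ} {lam : MultiPartition r n}

theorem coef_perm_smul (w : Perm (Fin n)) (m : Verma κ c₀ d lam) (μ : Fin n → ℕ) :
    coef κ c₀ d lam (t κ c₀ d (perm w) • m) (permComp w μ) =
      sRep lam (perm w) (coef κ c₀ d lam m μ) := by
  classical
  have hm : m ∈ Submodule.span ℂ {m | ∃ μ v, m = mon κ c₀ d lam μ v} := by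
    rw [span_mon]; trivial
  induction hm using Submodule.span_induction with
  | mem x hx =>
    obtain ⟨ν, v, rfl⟩ := hx
    rw [perm_smul_mon, coef_mon, coef_mon, Finsupp.single_apply, Finsupp.single_apply]
    have : permComp w ν = permComp w μ ↔ ν = μ := by
      refine ⟨fun h => ?_, fun h => by rw [h]⟩
      have h2 := congrArg (permComp w⁻¹) h
      rw [← permComp_mul, ← permComp_mul, inv_mul_cancel] at h2
      exact h2
    simp only [this]
    split_ifs
    · rfl
    · rw [map_zero]
  | zero => rw [smul_zero, map_zero, Finsupp.zero_apply, Finsupp.zero_apply, map_zero]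
  | add x y _ _ hx hy =>
    rw [smul_add, map_add (coef κ c₀ d lam), map_add (coef κ c₀ d lam), Finsupp.add_apply,
      Finsupp.add_apply, hx, hy, map_add]
  | smul c x _ hx =>
    rw [smul_comm, (coef κ c₀ d lam).map_smul, (coef κ c₀ d lam).map_smul, Finsupp.smul_apply,
      Finsupp.smul_apply, hx, (sRep lam (perm w)).map_smul]

theorem coef_X_smul (i : Fin n) (m : Verma κ c₀ d lam) (μ : Fin n → ℕ) :
    coef κ c₀ d lam (X κ c₀ d i • m) (μ + Pi.single i 1) = coef κ c₀ d lam m μ := by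
  classical
  have hm : m ∈ Submodule.span ℂ {m | ∃ μ v, m = mon κ c₀ d lam μ v} := by
    rw [span_mon]; trivial
  induction hm using Submodule.span_induction with
  | mem x hx =>
    obtain ⟨ν, v, rfl⟩ := hx
    rw [X_smul_mon, coef_mon, coef_mon, Finsupp.single_apply, Finsupp.single_apply]
    simp only [add_left_inj]
  | zero => rw [smul_zero, map_zero, Finsupp.zero_apply, Finsupp.zero_apply]
  | add x y _ _ hx hy =>
    rw [smul_add, map_add (coef κ c₀ d lam), map_add (coef κ c₀ d lam), Finsupp.add_apply,
      Finsupp.add_apply, hx, hy]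
  | smul c x _ hx =>
    rw [smul_comm, (coef κ c₀ d lam).map_smul, (coef κ c₀ d lam).map_smul, Finsupp.smul_apply,
      Finsupp.smul_apply, hx]

theorem X_smul_eq_zero {i : Fin n} {m : Verma κ c₀ d lam} (h : X κ c₀ d i • m = 0) : m = 0 := by
  rw [← (coef κ c₀ d lam).map_eq_zero_iff]
  ext1 μ
  rw [← coef_X_smul i, h, map_zero, Finsupp.zero_apply, Finsupp.zero_apply]

theorem tH_smul_eq_zero {M : Type*} [AddCommGroup M] [Module (Cherednik r n κ c₀ d) M] {w : W r n}
    {m : M} (h : tH κ c₀ d w • m = 0) : m = 0 := by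
  rw [← one_smul (Cherednik r n κ c₀ d) m, ← map_one (tH κ c₀ d), ← inv_mul_cancel w, map_mul, mul_smul,
    h, smul_zero]

theorem Phi_smul_eq_zero [NeZero n] {m : Verma κ c₀ d lam} (h : (Phi κ c₀ d : Cherednik r n κ c₀ d) • m = 0) : m = 0 := by
  rw [Phi, mul_smul] at h
  exact tH_smul_eq_zero (X_smul_eq_zero h)

theorem coef_low {μ ν : Fin n → ℕ} (hν : ¬ CompLT ν μ) {m : Verma κ c₀ d lam}
    (hm : m ∈ low κ c₀ d lam μ) : coef κ c₀ d lam m ν = 0 := by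
  classical
  induction hm using Submodule.span_induction with
  | mem x hx =>
    obtain ⟨ρ, v, hρ, rfl⟩ := hx
    rw [coef_mon, Finsupp.single_apply, if_neg]
    rintro rfl
    exact hν hρ
  | zero => rw [map_zero, Finsupp.zero_apply]
  | add x y _ _ hx hy => rw [map_add, Finsupp.add_apply, hx, hy, add_zero]
  | smul c x _ hx => rw [map_smul, Finsupp.smul_apply, hx, smul_zero]

theorem sRep_eq_zero {w : W r n} {v : SMod lam} (h : sRep lam w v = 0) : v = 0 :=
  (sRepEquiv lam w).map_eq_zero_iff.mp h

theorem sRep_swap_perm_inv (w : Perm (Fin n)) (i j : Fin n) (v : SMod lam) :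
    sRep lam (perm (swap i j)) (sRep lam (perm w)⁻¹ v) =
      sRep lam (perm w)⁻¹ (sRep lam (perm (swap (w j) (w i))) v) := by
  rw [← Module.End.mul_apply, ← Module.End.mul_apply, ← map_mul, ← map_mul]
  congr 2
  rw [eq_inv_mul_iff_mul_eq, ← mul_assoc, ← perm_mul, Equiv.mul_swap_eq_swap_mul, perm_mul, mul_assoc,
    mul_inv_cancel, mul_one, Equiv.swap_comm]

theorem vec_ne_zero (T : SYT lam) : vec T ≠ 0 := linearIndependent_vec.ne_zero T

variable [NeZero n]

theorem isF_fElt (hs : SimpleSpectrum κ c₀ d lam) (μ : Fin n → ℕ) (T : SYT lam) :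
    IsF κ c₀ d lam μ T (fElt κ c₀ d lam (μ, T)) :=
  Classical.epsilon_spec (existsUnique_isF hs μ T).exists

theorem fElt_ne_zero (hs : SimpleSpectrum κ c₀ d lam) (μ : Fin n → ℕ) (T : SYT lam) :
    fElt κ c₀ d lam (μ, T) ≠ 0 := (isF_fElt hs μ T).1.1

theorem tAlg_smul_fElt (hs : SimpleSpectrum κ c₀ d lam) (μ : Fin n → ℕ) (T : SYT lam)
    (a : tAlg (n := n) κ c₀ d) : (a : Cherednik r n κ c₀ d) • fElt κ c₀ d lam (μ, T) =
      weight κ c₀ d lam μ T a • fElt κ c₀ d lam (μ, T) := (isF_fElt hs μ T).smul_eq a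

theorem z_smul_fElt (hs : SimpleSpectrum κ c₀ d lam) (μ : Fin n → ℕ) (T : SYT lam) (i : Fin n) :
    z κ c₀ d i • fElt κ c₀ d lam (μ, T) = wtz κ c₀ d lam μ T i • fElt κ c₀ d lam (μ, T) := by
  have := tAlg_smul_fElt hs μ T ⟨z κ c₀ d i, z_mem_tAlg κ c₀ d i⟩
  rwa [weight_z] at this

theorem dg_smul_fElt (hs : SimpleSpectrum κ c₀ d lam) (μ : Fin n → ℕ) (T : SYT lam) (i : Fin n)
    (η : rootsOfUnity r ℂ) : tH κ c₀ d (dg i η) • fElt κ c₀ d lam (μ, T) =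
      wtd lam μ T i η • fElt κ c₀ d lam (μ, T) := by
  have := tAlg_smul_fElt hs μ T ⟨t κ c₀ d (dg i η), dg_mem_tAlg κ c₀ d i η⟩
  rwa [weight_dg] at this

theorem fElt_sub_leading_mem (hs : SimpleSpectrum κ c₀ d lam) (μ : Fin n → ℕ) (T : SYT lam) :
    fElt κ c₀ d lam (μ, T) - leading κ c₀ d lam μ T ∈ low κ c₀ d lam μ := by
  rw [low_eq_span_leading]
  exact (isF_fElt hs μ T).2

theorem coef_fElt_self (hs : SimpleSpectrum κ c₀ d lam) (μ : Fin n → ℕ) (T : SYT lam) :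
    coef κ c₀ d lam (fElt κ c₀ d lam (μ, T)) μ = sRep lam (perm (wPerm μ))⁻¹ (vec T) := by
  have h := coef_low (ν := μ) (fun h => h.ne rfl) (fElt_sub_leading_mem hs μ T)
  rwa [map_sub, Finsupp.sub_apply, leading_eq, coef_mon, Finsupp.single_eq_same, sub_eq_zero] at h

theorem coef_fElt_of_not (hs : SimpleSpectrum κ c₀ d lam) {μ ν : Fin n → ℕ} (T : SYT lam)
    (hne : ν ≠ μ) (hν : ¬ CompLT ν μ) : coef κ c₀ d lam (fElt κ c₀ d lam (μ, T)) ν = 0 := by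
  have h := coef_low hν (fElt_sub_leading_mem hs μ T)
  rwa [map_sub, Finsupp.sub_apply, leading_eq, coef_mon, Finsupp.single_eq_of_ne hne, sub_zero] at h

theorem exists_eq_smul_fElt_of_gen (hs : SimpleSpectrum κ c₀ d lam) {μ : Fin n → ℕ} {T : SYT lam}
    {m : Verma κ c₀ d lam}
    (hz : ∀ i : Fin n, ∃ b : ℂ, z κ c₀ d i • m =
      wtz κ c₀ d lam μ T i • m + b • fElt κ c₀ d lam (μ, T))
    (hd : ∀ (i : Fin n) η, tH κ c₀ d (dg i η) • m = wtd lam μ T i η • m) :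
    ∃ c : ℂ, m = c • fElt κ c₀ d lam (μ, T) := by
  have h1 : ∀ a, ∀ ha : a ∈ tAlg (n := n) κ c₀ d, ∃ b : ℂ,
      a • m = weight κ c₀ d lam μ T ⟨a, ha⟩ • m + b • fElt κ c₀ d lam (μ, T) := by
    refine smul_eq_of_mem_adjoin (weight κ c₀ d lam μ T) (tAlg_smul_fElt hs μ T) fun x hx => ?_
    rcases hx with ⟨i, rfl⟩ | ⟨i, rfl⟩
    · obtain ⟨b, hb⟩ := hz i
      exact ⟨b, by rw [hb, ← weight_z]; rfl⟩
    · refine ⟨0, ?_⟩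
      rw [zero_smul, add_zero]
      refine (?_ : t κ c₀ d (zetaAt i) • m = _)
      rw [zetaAt_eq, ← tH_apply, hd]
      congr 1
      rw [← weight_dg κ c₀ d]
      congr 1
  exact exists_smul_eq_of_mem_weightSpace hs (fElt_ne_zero hs μ T)
    (mem_weightSpace_of_smul (tAlg_smul_fElt hs μ T) fun a =>
      ⟨0, by rw [tAlg_smul_fElt hs, zero_smul, add_zero]⟩)
    (mem_weightSpace_of_smul (tAlg_smul_fElt hs μ T) fun a => h1 a a.2)

theorem exists_eq_smul_fElt (hs : SimpleSpectrum κ c₀ d lam) {μ : Fin n → ℕ} {T : SYT lam}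
    {m : Verma κ c₀ d lam} (hz : ∀ i : Fin n, z κ c₀ d i • m = wtz κ c₀ d lam μ T i • m)
    (hd : ∀ (i : Fin n) η, tH κ c₀ d (dg i η) • m = wtd lam μ T i η • m) :
    ∃ c : ℂ, m = c • fElt κ c₀ d lam (μ, T) :=
  exists_eq_smul_fElt_of_gen hs (fun i => ⟨0, by rw [hz, zero_smul, add_zero]⟩) hd

/-! ### The intertwiners `σ_i` -/

variable (lam) in
/-- The elements `t_{ζ_i}` and `t_{ζ_j}` act on `f_{μ,T}` by the same scalar. -/
def SameChar (μ : Fin n → ℕ) (T : SYT lam) (i j : Fin n) : Prop :=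
  ∀ η : rootsOfUnity r ℂ, wtd lam μ T i η = wtd lam μ T j η

theorem wtd_mul (μ : Fin n → ℕ) (T : SYT lam) (i : Fin n) (η θ : rootsOfUnity r ℂ) :
    wtd lam μ T i (η * θ) = wtd lam μ T i η * wtd lam μ T i θ := by
  simp only [wtd, uval_mul, mul_inv, mul_pow]
  ring

theorem wtd_ne_zero (μ : Fin n → ℕ) (T : SYT lam) (i : Fin n) (η : rootsOfUnity r ℂ) :
    wtd lam μ T i η ≠ 0 :=
  mul_ne_zero (pow_ne_zero _ (uval_ne_zero η)) (pow_ne_zero _ (inv_ne_zero (uval_ne_zero η)))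

theorem wtd_inv (μ : Fin n → ℕ) (T : SYT lam) (i : Fin n) (η : rootsOfUnity r ℂ) :
    wtd lam μ T i η⁻¹ = (wtd lam μ T i η)⁻¹ := by
  simp only [wtd, uval_inv, mul_inv, inv_pow]

theorem card_rootsOfUnity_complex : Fintype.card (rootsOfUnity r ℂ) = r := by
  have := sum_range_zu (r := r) fun _ => (1 : ℕ)
  simpa using this.symm

open Classical in
theorem piElt_smul_fElt (hs : SimpleSpectrum κ c₀ d lam) (μ : Fin n → ℕ) (T : SYT lam) (i j : Fin n) :
    piElt κ c₀ d i j • fElt κ c₀ d lam (μ, T) =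
      (if SameChar lam μ T i j then (r : ℂ) else 0) • fElt κ c₀ d lam (μ, T) := by
  have h1 : piElt κ c₀ d i j • fElt κ c₀ d lam (μ, T) =
      (∑ η : rootsOfUnity r ℂ, wtd lam μ T i η * (wtd lam μ T j η)⁻¹) • fElt κ c₀ d lam (μ, T) := by
    rw [piElt_eq, Finset.sum_smul, Finset.sum_smul]
    refine Finset.sum_congr rfl fun η _ => ?_
    rw [← dg_inv, map_mul, mul_smul, dg_smul_fElt hs, wtd_inv, smul_comm, dg_smul_fElt hs, smul_smul,
      mul_comm]
  rw [h1]
  congr 1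
  split_ifs with h
  · rw [Finset.sum_congr rfl fun η _ => by rw [h η, mul_inv_cancel₀ (wtd_ne_zero μ T j η)],
      Finset.sum_const, Finset.card_univ, card_rootsOfUnity_complex, nsmul_eq_mul, mul_one]
  · unfold SameChar at h
    push Not at h
    obtain ⟨θ, hθ⟩ := h
    -- Orthogonality: translating by θ multiplies the character sum by a number different from 1, so
    -- the sum is zero.
    have h2 := Equiv.sum_comp (Equiv.mulLeft θ) fun η : rootsOfUnity r ℂ =>
      wtd lam μ T i η * (wtd lam μ T j η)⁻¹
    simp only [Equiv.coe_mulLeft, wtd_mul, mul_inv] at h2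
    rw [Finset.sum_congr rfl fun η _ => mul_mul_mul_comm _ _ _ _, ← Finset.mul_sum] at h2
    by_contra h3
    have h4 := mul_right_cancel₀ h3 (h2.trans (one_mul _).symm)
    rw [← div_eq_mul_inv, div_eq_one_iff_eq (wtd_ne_zero μ T j θ)] at h4
    exact hθ h4

/-- If the eigenvalues agreed, f and t_s f would lie in one generalized weight space, so t_s f = c f
by simplicity. Then z_i acts on t_s f by its eigenvalue, whereas the commutation rule adds −c₀ r f,
which is non-zero. -/
theorem wtz_ne_of_sameChar (hs : SimpleSpectrum κ c₀ d lam) (hc₀ : c₀ ≠ 0) {μ : Fin n → ℕ}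
    {T : SYT lam} {i j : Fin n} (hij : (i : ℕ) + 1 = j) (h : SameChar lam μ T i j) :
    wtz κ c₀ d lam μ T i ≠ wtz κ c₀ d lam μ T j := by
  classical
  intro h0
  have hpi := piElt_smul_fElt hs μ T i j
  rw [if_pos h] at hpi
  have hi : z κ c₀ d i • tH κ c₀ d (perm (swap i j)) • fElt κ c₀ d lam (μ, T) =
      wtz κ c₀ d lam μ T i • tH κ c₀ d (perm (swap i j)) • fElt κ c₀ d lam (μ, T) +
        (-(c₀ * r)) • fElt κ c₀ d lam (μ, T) := by
    rw [z_smul_swap_left hij, z_smul_fElt hs, hpi, h0, smul_comm (tH κ c₀ d _)]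
    generalize tH κ c₀ d (perm (swap _ _) : W r n) • fElt κ c₀ d lam (μ, T) = g
    module
  have hj : z κ c₀ d j • tH κ c₀ d (perm (swap i j)) • fElt κ c₀ d lam (μ, T) =
      wtz κ c₀ d lam μ T j • tH κ c₀ d (perm (swap i j)) • fElt κ c₀ d lam (μ, T) +
        (c₀ * r) • fElt κ c₀ d lam (μ, T) := by
    rw [z_smul_swap_right hij, z_smul_fElt hs, hpi, h0, smul_comm (tH κ c₀ d _)]
    generalize tH κ c₀ d (perm (swap _ _) : W r n) • fElt κ c₀ d lam (μ, T) = g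
    module
  obtain ⟨c, hc⟩ := exists_eq_smul_fElt_of_gen hs (μ := μ) (T := T)
    (m := tH κ c₀ d (perm (swap i j)) • fElt κ c₀ d lam (μ, T)) (fun k => by
      rcases eq_or_ne k i with rfl | hki
      · exact ⟨_, hi⟩
      rcases eq_or_ne k j with rfl | hkj
      · exact ⟨_, hj⟩
      · refine ⟨0, ?_⟩
        rw [z_smul_swap_of_ne hij hki hkj, z_smul_fElt hs, smul_comm (tH κ c₀ d _), zero_smul, add_zero])
    (fun k η => by
      rw [dg_smul_swap, dg_smul_fElt hs, smul_comm (tH κ c₀ d _)]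
      congr 1
      rw [Equiv.swap_apply_def]
      split_ifs with h1 h2
      · rw [h1, h η]
      · rw [h2, h η]
      · rfl)
  rw [hc, smul_comm (z κ c₀ d i), z_smul_fElt hs, smul_comm c, left_eq_add, smul_eq_zero] at hi
  rcases hi with hi | hi
  · exact mul_ne_zero hc₀ (Nat.cast_ne_zero.mpr (NeZero.ne r)) (neg_eq_zero.mp hi)
  · exact fElt_ne_zero hs μ T hi

open Classical in
variable (κ c₀ d lam) in
/-- The coefficient `b` in `σ_i f_{μ,T} = t_{s_i} f_{μ,T} + b f_{μ,T}`. -/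
noncomputable def sigmaCoef (μ : Fin n → ℕ) (T : SYT lam) (i j : Fin n) : ℂ :=
  if SameChar lam μ T i j then c₀ * r / (wtz κ c₀ d lam μ T i - wtz κ c₀ d lam μ T j) else 0

theorem eigenvalue_eq {a : Cherednik r n κ c₀ d} {m : Verma κ c₀ d lam} {e : ℂ} (hm : m ≠ 0)
    (h : a • m = e • m) : eigenvalue κ c₀ d lam a m = e := by
  have h1 : a • m = eigenvalue κ c₀ d lam a m • m :=
    Classical.epsilon_spec (p := fun e : ℂ => a • m = e • m) ⟨e, h⟩
  exact smul_left_injective ℂ hm (h1.symm.trans h)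

/-- If π_i f = 0 the correction term vanishes whatever its denominator is, so the value of a
quotient by zero does not matter. -/
theorem sigma_fElt (hs : SimpleSpectrum κ c₀ d lam) (μ : Fin n → ℕ) (T : SYT lam) (i j : Fin n) :
    sigma κ c₀ d lam i j (fElt κ c₀ d lam (μ, T)) =
      tH κ c₀ d (perm (swap i j)) • fElt κ c₀ d lam (μ, T) +
        sigmaCoef κ c₀ d lam μ T i j • fElt κ c₀ d lam (μ, T) := by
  rw [sigma, piElt_smul_fElt hs, eigenvalue_eq (e := wtz κ c₀ d lam μ T i - wtz κ c₀ d lam μ T j)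
    (fElt_ne_zero hs μ T) (by rw [sub_smul, z_smul_fElt hs, z_smul_fElt hs, sub_smul]), smul_smul,
    tH_apply, sigmaCoef]
  congr 2
  split_ifs
  · ring
  · ring

open Classical in
theorem sigmaCoef_mul (hs : SimpleSpectrum κ c₀ d lam) (hc₀ : c₀ ≠ 0) (μ : Fin n → ℕ) (T : SYT lam)
    {i j : Fin n} (hij : (i : ℕ) + 1 = j) : sigmaCoef κ c₀ d lam μ T i j *
      (wtz κ c₀ d lam μ T i - wtz κ c₀ d lam μ T j) =
        c₀ * (if SameChar lam μ T i j then (r : ℂ) else 0) := by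
  rw [sigmaCoef]
  split_ifs with h
  · exact div_mul_cancel₀ _ (sub_ne_zero.mpr (wtz_ne_of_sameChar hs hc₀ hij h))
  · rw [zero_mul, mul_zero]

theorem exists_sigma_eq (hs : SimpleSpectrum κ c₀ d lam) (hc₀ : c₀ ≠ 0) {μ ν : Fin n → ℕ}
    {T S : SYT lam} {i j : Fin n} (hij : (i : ℕ) + 1 = j)
    (hz : ∀ k, wtz κ c₀ d lam ν S k = wtz κ c₀ d lam μ T (swap i j k))
    (hd : ∀ k (η : rootsOfUnity r ℂ), wtd lam ν S k η = wtd lam μ T (swap i j k) η) :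
    ∃ c : ℂ, sigma κ c₀ d lam i j (fElt κ c₀ d lam (μ, T)) = c • fElt κ c₀ d lam (ν, S) := by
  classical
  rw [sigma_fElt hs]
  refine exists_eq_smul_fElt hs (fun k => ?_) fun k η => ?_
  · rw [hz]
    exact z_smul_sigma hij (z_smul_fElt hs μ T) (piElt_smul_fElt hs μ T i j)
      (sigmaCoef_mul hs hc₀ μ T hij) k
  · rw [hd]
    refine dg_smul_sigma i j (dg_smul_fElt hs μ T) (fun hb => ?_) k η
    by_contra h
    exact hb (if_neg h)

theorem permComp_swap_ne {μ : Fin n → ℕ} {i j : Fin n} (h : μ i ≠ μ j) :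
    permComp (swap i j) μ ≠ μ := fun e => h (by
  have := congrFun e i
  rw [permComp_swap_apply, Equiv.swap_apply_left] at this
  exact this.symm)

theorem wPerm_swap {μ : Fin n → ℕ} {i j : Fin n} (hij : (i : ℕ) + 1 = j) (h : μ i ≠ μ j) (k : Fin n) :
    wPerm (permComp (swap i j) μ) k = wPerm μ (swap i j k) := by
  rw [wPerm_permComp_swap (by rw [Fin.lt_def]; omega) h
    (fun m h1 h2 => by rw [Fin.lt_def] at h1 h2; omega), Perm.mul_apply]

theorem wtz_swap {μ : Fin n → ℕ} {i j : Fin n} (hij : (i : ℕ) + 1 = j) (h : μ i ≠ μ j) (T : SYT lam)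
    (k : Fin n) : wtz κ c₀ d lam (permComp (swap i j) μ) T k =
      wtz κ c₀ d lam μ T (swap i j k) := by
  rw [wtz, wtz, wPerm_swap hij h, permComp_swap_apply]

theorem wtd_swap {μ : Fin n → ℕ} {i j : Fin n} (hij : (i : ℕ) + 1 = j) (h : μ i ≠ μ j) (T : SYT lam)
    (k : Fin n) (η : rootsOfUnity r ℂ) : wtd lam (permComp (swap i j) μ) T k η =
      wtd lam μ T (swap i j k) η := by
  rw [wtd, wtd, wPerm_swap hij h, permComp_swap_apply]

theorem exists_sigma_eq_swap (hs : SimpleSpectrum κ c₀ d lam) (hc₀ : c₀ ≠ 0) {μ : Fin n → ℕ}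
    (T : SYT lam) {i j : Fin n} (hij : (i : ℕ) + 1 = j) (h : μ i ≠ μ j) :
    ∃ c : ℂ, sigma κ c₀ d lam i j (fElt κ c₀ d lam (μ, T)) =
      c • fElt κ c₀ d lam (permComp (swap i j) μ, T) :=
  exists_sigma_eq hs hc₀ hij (wtz_swap hij h T) (wtd_swap hij h T)

/-- Here μ < s_i.μ, so x^{s_i.μ} does not occur in f_{μ,T}, while in t_{s_i} f_{μ,T} it has the
image of the leading coefficient. -/
theorem sigma_ne_zero_of_lt (hs : SimpleSpectrum κ c₀ d lam) {μ : Fin n → ℕ} (T : SYT lam)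
    {i j : Fin n} (hij : (i : ℕ) + 1 = j) (h : μ i < μ j) :
    sigma κ c₀ d lam i j (fElt κ c₀ d lam (μ, T)) ≠ 0 := by
  intro h0
  rw [sigma_fElt hs] at h0
  have h1 := congrArg (fun m => coef κ c₀ d lam m (permComp (swap i j) μ)) h0
  have hlt : CompLT μ (permComp (swap i j) μ) := by
    have := compLT_swap (μ := permComp (swap i j) μ) (a := i) (b := j) (by rw [Fin.lt_def]; omega) (by
      rwa [permComp_swap_apply, permComp_swap_apply, Equiv.swap_apply_left, Equiv.swap_apply_right])
    rwa [permComp_swap_swap] at this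
  simp only [map_add, Finsupp.add_apply, map_smul, Finsupp.smul_apply, map_zero,
    Finsupp.zero_apply] at h1
  rw [coef_fElt_of_not hs T (permComp_swap_ne h.ne) hlt.asymm, smul_zero, add_zero, tH_apply,
    coef_perm_smul, coef_fElt_self hs] at h1
  exact vec_ne_zero T (sRep_eq_zero (sRep_eq_zero h1))

/-- No position lies between two equal neighbouring parts in the order straightened by w_μ, and the
earlier part comes later. Hence the entries exchanged along a tableau edge are w_μ(i+1) and w_μ(i).
-/
theorem wPerm_succ_of_eq {μ : Fin n → ℕ} {i j : Fin n} (hij : (i : ℕ) + 1 = j) (h : μ i = μ j) :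
    (wPerm μ j : ℕ) + 1 = wPerm μ i := by
  have h1 : wPerm μ j < wPerm μ i := (wPerm_lt_iff μ j i).mpr
    (Or.inr ⟨by rw [Fin.lt_def]; omega, h.symm.le⟩)
  by_contra hne
  have h2 : (wPerm μ j : ℕ) + 1 < n := by
    have := (wPerm μ i).2
    rw [Fin.lt_def] at h1; omega
  obtain ⟨k, hk⟩ := (wPerm μ).surjective ⟨(wPerm μ j : ℕ) + 1, h2⟩
  have h3 : PosLT μ j k := (wPerm_lt_iff μ j k).mp (by rw [hk, Fin.lt_def]; exact Nat.lt_succ_self _)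
  have h4 : PosLT μ k i := (wPerm_lt_iff μ k i).mp (by
    rw [hk]; rw [Fin.lt_def] at h1 ⊢; exact lt_of_le_of_ne h1 hne)
  unfold PosLT at h3 h4
  rw [Fin.lt_def, Fin.lt_def] at h3 h4
  omega

/-- Non-vanishing is read off at x^μ: there t_{s_i} acts on v_T through the adjacent transposition
of the entries w_μ(i+1) and w_μ(i), and Young's off-diagonal coefficient is non-zero when the
exchanged tableau is standard. -/
theorem exists_sigma_eq_tableau (hs : SimpleSpectrum κ c₀ d lam) (hc₀ : c₀ ≠ 0) {μ : Fin n → ℕ}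
    (T : SYT lam) {i j : Fin n} (hij : (i : ℕ) + 1 = j) (h : μ i = μ j)
    (hT : IsStandard (swapT (wPerm μ j) (wPerm μ i) T.1)) :
    ∃ c : ℂ, c ≠ 0 ∧ sigma κ c₀ d lam i j (fElt κ c₀ d lam (μ, T)) =
      c • fElt κ c₀ d lam (μ, ⟨swapT (wPerm μ j) (wPerm μ i) T.1, hT⟩) := by
  have hT' : ∀ k, swapT (wPerm μ j) (wPerm μ i) T.1 (wPerm μ k) = T.1 (wPerm μ (swap i j k)) := by
    intro k
    rw [swapT_apply, Equiv.swap_comm, ← Equiv.Perm.mul_apply (wPerm μ), Equiv.mul_swap_eq_swap_mul,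
      Perm.mul_apply]
  have hμ : ∀ k, μ (swap i j k) = μ k := fun k => by
    exact (permComp_swap_apply i j μ k).symm.trans (congrFun (permComp_swap_eq i j μ h) k)
  obtain ⟨c, hc⟩ := exists_sigma_eq hs hc₀ (μ := μ) (ν := μ) (T := T)
    (S := ⟨swapT (wPerm μ j) (wPerm μ i) T.1, hT⟩) hij
    (fun k => by rw [wtz, wtz, hT', hμ]) (fun k η => by rw [wtd, wtd, hT', hμ])
  refine ⟨c, ?_, hc⟩
  rintro rfl
  rw [zero_smul, sigma_fElt hs] at hc
  have h1 := congrArg (fun m => coef κ c₀ d lam m μ) hc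
  have e1 : coef κ c₀ d lam (tH κ c₀ d (perm (swap i j)) • fElt κ c₀ d lam (μ, T)) μ =
      sRep lam (perm (swap i j)) (sRep lam (perm (wPerm μ))⁻¹ (vec T)) := by
    conv_lhs => rw [← permComp_swap_eq i j μ h]
    rw [tH_apply, coef_perm_smul, permComp_swap_eq i j μ h, coef_fElt_self hs]
  simp only [map_add, Finsupp.add_apply, map_smul, Finsupp.smul_apply, map_zero,
    Finsupp.zero_apply] at h1
  rw [e1, sRep_swap_perm_inv, coef_fElt_self hs, ← map_smul, ← map_add] at h1
  have h2 := sRep_eq_zero h1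
  have hk := wPerm_succ_of_eq hij h
  rw [sRep_swap_vec hk, show vecF (swapT (wPerm μ j) (wPerm μ i) T.1) =
    vec ⟨swapT (wPerm μ j) (wPerm μ i) T.1, hT⟩ from rfl, add_right_comm, ← add_smul] at h2
  have hne : T ≠ ⟨swapT (wPerm μ j) (wPerm μ i) T.1, hT⟩ := by
    intro e
    have := congrArg (fun S : SYT lam => S.1 (wPerm μ j)) e
    simp only [swapT_apply, Equiv.swap_apply_left] at this
    have := T.1.injective this
    rw [Fin.ext_iff] at this
    omega
  have h3 := congrArg (fun v => (vecBasis lam).repr v ⟨swapT (wPerm μ j) (wPerm μ i) T.1, hT⟩) h2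
  simp only [map_add, map_smul, ← vecBasis_apply, Module.Basis.repr_self, Finsupp.add_apply,
    Finsupp.smul_apply, Finsupp.single_eq_same, map_zero, Finsupp.zero_apply] at h3
  rw [Finsupp.single_eq_of_ne hne.symm, smul_zero, zero_add, smul_eq_mul, mul_one] at h3
  exact yB_ne_zero T.2 hk hT h3

end Eigenvectors

/-! ### The intertwiners `Φ` and `Ψ` -/

section Affine

variable {κ c₀ : ℂ} {d : ZMod r → ℂ} {lam : MultiPartition r n} [NeZero n]

theorem phi_apply (μ : Fin n → ℕ) (i : Fin n) :
    phi μ i = μ (finRotate n i) + if i = lastIdx n then 1 else 0 := by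
  simp only [phi, permComp, inv_inv]

theorem phi_apply_of_ne (μ : Fin n → ℕ) {i : Fin n} (hi : i ≠ lastIdx n) :
    phi μ i = μ (finRotate n i) := by
  rw [phi_apply, if_neg hi, add_zero]

theorem phi_apply_last (μ : Fin n → ℕ) : phi μ (lastIdx n) = μ 0 + 1 := by
  rw [phi_apply, if_pos rfl, finRotate_lastIdx]

theorem wPerm_phi_apply (μ : Fin n → ℕ) (i : Fin n) :
    wPerm (phi μ) i = wPerm μ (finRotate n i) := by
  rw [wPerm_phi, Perm.mul_apply]

theorem sum_phi (μ : Fin n → ℕ) : ∑ i, phi μ i = ∑ i, μ i + 1 := by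
  simp only [phi_apply, Finset.sum_add_distrib, Finset.sum_ite_eq', Finset.mem_univ, if_true]
  rw [Equiv.sum_comp (finRotate n) μ]

theorem phi_psi {μ : Fin n → ℕ} (h : 0 < μ (lastIdx n)) : phi (psi μ) = μ := by
  funext i
  rw [phi_apply, psi, permComp, finRotate_inv_apply]
  by_cases hi : i = lastIdx n
  · subst hi
    rw [if_pos finRotate_lastIdx, if_pos rfl, Nat.sub_add_cancel h]
  · rw [if_neg hi, if_neg, add_zero, Nat.sub_zero]
    rw [← finRotate_lastIdx]
    exact fun e => hi ((finRotate n).injective e)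

theorem wtd_phi (μ : Fin n → ℕ) (T : SYT lam) (i : Fin n) (η : rootsOfUnity r ℂ) :
    wtd lam (phi μ) T i η =
      (if i = lastIdx n then (uval η)⁻¹ else 1) * wtd lam μ T (finRotate n i) η := by
  rw [wtd, wtd, wPerm_phi_apply, phi_apply]
  split_ifs
  · rw [pow_succ]; ring
  · rw [add_zero, one_mul]

theorem wtz_phi_of_ne (μ : Fin n → ℕ) (T : SYT lam) {i : Fin n} (hi : i ≠ lastIdx n) :
    wtz κ c₀ d lam (phi μ) T i = wtz κ c₀ d lam μ T (finRotate n i) := by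
  rw [wtz, wtz, wPerm_phi_apply, phi_apply_of_ne μ hi]

theorem wtz_phi_last (μ : Fin n → ℕ) (T : SYT lam) :
    wtz κ c₀ d lam (phi μ) T (lastIdx n) =
      wtz κ c₀ d lam μ T 0 + hHat κ d (T.1 (wPerm μ 0)).beta.val (μ 0 + 1) := by
  rw [wtz, wtz, wPerm_phi_apply, phi_apply_last, finRotate_lastIdx, Finset.sum_range_succ]
  ring

theorem eElt_smul {M : Type*} [AddCommGroup M] [Module ℂ M] [Module (Cherednik r n κ c₀ d) M]
    [IsScalarTower ℂ (Cherednik r n κ c₀ d) M] {m : M} {i : Fin n} {μ : Fin n → ℕ} {T : SYT lam}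
    (h : ∀ η, tH κ c₀ d (dg i η) • m = wtd lam μ T i η • m) :
    eElt κ c₀ d i • m = hHat κ d (T.1 (wPerm μ i)).beta.val (μ i) • m := by
  rw [eElt, Finset.sum_smul, hHat, Finset.sum_smul]
  refine Finset.sum_congr rfl fun η _ => ?_
  rw [smul_assoc, h, smul_smul, wtd]

theorem dg_smul_Phi_fElt (hs : SimpleSpectrum κ c₀ d lam) (μ : Fin n → ℕ) (T : SYT lam) (i : Fin n)
    (η : rootsOfUnity r ℂ) :
    tH κ c₀ d (dg i η) • (Phi κ c₀ d : Cherednik r n κ c₀ d) • fElt κ c₀ d lam (μ, T) =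
      wtd lam (phi μ) T i η • (Phi κ c₀ d : Cherednik r n κ c₀ d) • fElt κ c₀ d lam (μ, T) := by
  rw [← mul_smul (tH κ c₀ d (dg i η)), dg_mul_Phi, smul_assoc, mul_smul (Phi κ c₀ d), dg_smul_fElt hs,
    smul_comm (Phi κ c₀ d : Cherednik r n κ c₀ d) (wtd _ _ _ _ _), smul_smul, wtd_phi]

theorem exists_Phi_eq (hs : SimpleSpectrum κ c₀ d lam) (μ : Fin n → ℕ) (T : SYT lam) :
    ∃ c : ℂ, c ≠ 0 ∧ (Phi κ c₀ d : Cherednik r n κ c₀ d) • fElt κ c₀ d lam (μ, T) =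
      c • fElt κ c₀ d lam (phi μ, T) := by
  obtain ⟨c, hc⟩ := exists_eq_smul_fElt hs (μ := phi μ) (T := T)
    (m := (Phi κ c₀ d : Cherednik r n κ c₀ d) • fElt κ c₀ d lam (μ, T)) (fun i => by
      by_cases hi : i = lastIdx n
      · subst hi
        rw [← mul_smul (z κ c₀ d _), Phi_mul_z_zero, add_smul (Phi κ c₀ d * z κ c₀ d 0),
          mul_smul (Phi κ c₀ d), mul_smul (eElt κ c₀ d _), eElt_smul (dg_smul_Phi_fElt hs μ T (lastIdx n)),
          z_smul_fElt hs, smul_comm (Phi κ c₀ d : Cherednik r n κ c₀ d) (wtz _ _ _ _ _ _ _), ← add_smul,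
          wtz_phi_last, wPerm_phi_apply, finRotate_lastIdx, phi_apply_last]
      · rw [← mul_smul (z κ c₀ d _), ← Phi_mul_z κ c₀ d hi, mul_smul (Phi κ c₀ d), z_smul_fElt hs,
          smul_comm (Phi κ c₀ d : Cherednik r n κ c₀ d) (wtz _ _ _ _ _ _ _), wtz_phi_of_ne μ T hi])
    (dg_smul_Phi_fElt hs μ T)
  refine ⟨c, ?_, hc⟩
  rintro rfl
  rw [zero_smul] at hc
  exact fElt_ne_zero hs μ T (Phi_smul_eq_zero hc)

theorem exists_Psi_eq (hs : SimpleSpectrum κ c₀ d lam) {μ : Fin n → ℕ} (T : SYT lam)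
    (h : 0 < μ (lastIdx n)) :
    ∃ c : ℂ, (Psi κ c₀ d : Cherednik r n κ c₀ d) • fElt κ c₀ d lam (μ, T) =
      c • fElt κ c₀ d lam (psi μ, T) := by
  obtain ⟨c, hc, e⟩ := exists_Phi_eq hs (psi μ) T
  rw [phi_psi h] at e
  -- Write f_{μ,T} as c⁻¹ Φ f_{ψ.μ,T} and use ΨΦ = z_1.
  refine ⟨c⁻¹ * wtz κ c₀ d lam (psi μ) T 0, ?_⟩
  rw [mul_smul, ← z_smul_fElt hs, ← Psi_mul_Phi, mul_smul (Psi κ c₀ d), e,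
    smul_comm (Psi κ c₀ d : Cherednik r n κ c₀ d) c, inv_smul_smul₀ hc]

theorem wPerm_last_of_eq_zero {μ : Fin n → ℕ} (h : μ (lastIdx n) = 0) :
    (wPerm μ (lastIdx n) : ℕ) = 0 := by
  refine (?_ : wVal μ (lastIdx n) = 0)
  rw [wVal, h, Finset.filter_false_of_mem, Finset.filter_false_of_mem]
  · rfl
  · exact fun j _ hj => absurd hj.1 (not_lt.mpr (le_lastIdx j))
  · exact fun j _ hj => absurd hj.2 (Nat.not_lt_zero _)

/-- If μ_n = 0 then w_μ(n) is the first entry, which sits in a box of content 0, so z_n and the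
idempotent term of ΦΨ have the same eigenvalue. Hence ΦΨ f = 0, and Φ is injective. -/
theorem Psi_smul_fElt_eq_zero (hs : SimpleSpectrum κ c₀ d lam) {μ : Fin n → ℕ} (T : SYT lam)
    (h : μ (lastIdx n) = 0) :
    (Psi κ c₀ d : Cherednik r n κ c₀ d) • fElt κ c₀ d lam (μ, T) = 0 := by
  refine Phi_smul_eq_zero ?_
  rw [← mul_smul (Phi κ c₀ d), Phi_mul_Psi, sub_smul (z κ c₀ d _), z_smul_fElt hs,
    eElt_smul (dg_smul_fElt hs μ T (lastIdx n)), ← sub_smul, wtz, h,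
    T.2.ct_zero (wPerm_last_of_eq_zero h)]
  simp

end Affine

/-! ### Equal neighbouring parts -/

section Equal

variable {κ c₀ : ℂ} {d : ZMod r → ℂ} {lam : MultiPartition r n}

theorem permComp_zero (w : Perm (Fin n)) : permComp w (0 : Fin n → ℕ) = 0 := rfl

variable [NeZero n]

theorem fElt_zero (hs : SimpleSpectrum κ c₀ d lam) (T : SYT lam) :
    fElt κ c₀ d lam (0, T) = leading κ c₀ d lam 0 T := by
  have h := fElt_sub_leading_mem hs 0 T
  rwa [low_zero, Submodule.mem_bot, sub_eq_zero] at h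

/-- The vertex `(μ,T)` such that exchanging the entries of `T` attached to the equal parts
`μ_i = μ_j`, `j = i + 1`, does not give a standard tableau. -/
structure IsStuck (μ : Fin n → ℕ) (T : SYT lam) (i j : Fin n) : Prop where
  succ : (i : ℕ) + 1 = j
  eq : μ i = μ j
  not_isStandard : ¬ IsStandard (swapT (wPerm μ j) (wPerm μ i) T.1)

theorem IsStuck.yA_sq {μ : Fin n → ℕ} {T : SYT lam} {i j : Fin n} (h : IsStuck μ T i j) :
    yA (T.1 (wPerm μ j)) (T.1 (wPerm μ i)) * yA (T.1 (wPerm μ j)) (T.1 (wPerm μ i)) = 1 :=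
  yA_sq_eq_one T.2 (wPerm_succ_of_eq h.succ h.eq) h.not_isStandard

theorem IsStuck.beta_eq {μ : Fin n → ℕ} {T : SYT lam} {i j : Fin n} (h : IsStuck μ T i j) :
    (T.1 (wPerm μ j)).beta = (T.1 (wPerm μ i)).beta :=
  (T.2.of_not_swap (wPerm_succ_of_eq h.succ h.eq) h.not_isStandard).1

theorem IsStuck.wtd_eq {μ : Fin n → ℕ} {T : SYT lam} {i j : Fin n} (h : IsStuck μ T i j)
    (η : rootsOfUnity r ℂ) : wtd lam μ T i η = wtd lam μ T j η := by
  rw [wtd, wtd, h.eq, h.beta_eq]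

variable (κ c₀ d) in
-- Equal parts and equal components make the h-terms of the two eigenvalues cancel. What remains is
-- c₀ r times the content difference, of which `yA` is the inverse.
theorem IsStuck.yA_mul {μ : Fin n → ℕ} {T : SYT lam} {i j : Fin n} (h : IsStuck μ T i j) :
    yA (T.1 (wPerm μ j)) (T.1 (wPerm μ i)) *
      (wtz κ c₀ d lam μ T j - wtz κ c₀ d lam μ T i) = c₀ * r := by
  have h1 : (((T.1 (wPerm μ i)).ct - (T.1 (wPerm μ j)).ct : ℤ) : ℂ) ≠ 0 :=
    Int.cast_ne_zero.mpr (T.2.ct_ne (wPerm_succ_of_eq h.succ h.eq) h.beta_eq)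
  rw [yA, if_pos h.beta_eq, wtz, wtz, h.eq, h.beta_eq, one_div, inv_mul_eq_iff_eq_mul₀ h1]
  push_cast
  ring

theorem IsStuck.congr {μ ν : Fin n → ℕ} {T : SYT lam} {i j k l : Fin n} (h : IsStuck μ T i j)
    (hkl : (k : ℕ) + 1 = l) (hk : wPerm ν k = wPerm μ i) (hl : wPerm ν l = wPerm μ j)
    (e : ν k = ν l) : IsStuck ν T k l :=
  ⟨hkl, e, by rw [hk, hl]; exact h.not_isStandard⟩

variable (κ c₀ d) in
/-- `t_{s_i}` acts on `f_{μ,T}` by `±1`. -/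
def SwapActs (μ : Fin n → ℕ) (T : SYT lam) (i j : Fin n) : Prop :=
  tH κ c₀ d (perm (swap i j)) • fElt κ c₀ d lam (μ, T) =
    yA (T.1 (wPerm μ j)) (T.1 (wPerm μ i)) • fElt κ c₀ d lam (μ, T)

theorem swapActs_zero (hs : SimpleSpectrum κ c₀ d lam) {T : SYT lam} {i j : Fin n}
    (h : IsStuck 0 T i j) : SwapActs κ c₀ d 0 T i j := by
  have hk := wPerm_succ_of_eq h.succ h.eq
  rw [SwapActs, fElt_zero hs, leading_eq, tH_apply, perm_smul_mon, permComp_zero, sRep_swap_perm_inv,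
    sRep_swap_vec hk, vecF_of_not h.not_isStandard, smul_zero, add_zero, (sRep lam _).map_smul,
    (mon κ c₀ d lam 0).map_smul]

/-- If `m ∈ ℂ^× f_{μ,T}` then both have the same `t_{s_i}`-eigenvalues. -/
theorem swapActs_of_smul_eq {μ : Fin n → ℕ} {T : SYT lam} {i j : Fin n} {m : Verma κ c₀ d lam} {c : ℂ}
    (hc : c ≠ 0) (hm : m = c • fElt κ c₀ d lam (μ, T))
    (h : tH κ c₀ d (perm (swap i j)) • m = yA (T.1 (wPerm μ j)) (T.1 (wPerm μ i)) • m) :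
    SwapActs κ c₀ d μ T i j := by
  have e : fElt κ c₀ d lam (μ, T) = c⁻¹ • m := by rw [hm, inv_smul_smul₀ hc]
  rw [SwapActs, e, smul_comm _ c⁻¹, h, smul_comm c⁻¹]

theorem swapActs_phi (hs : SimpleSpectrum κ c₀ d lam) {ν : Fin n → ℕ} {T : SYT lam} {i j : Fin n}
    (hi : i ≠ lastIdx n) (hj : j ≠ lastIdx n)
    (h : SwapActs κ c₀ d ν T (finRotate n i) (finRotate n j)) : SwapActs κ c₀ d (phi ν) T i j := by
  obtain ⟨c, hc, e⟩ := exists_Phi_eq hs ν T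
  refine swapActs_of_smul_eq hc e ?_
  rw [← mul_smul (tH κ c₀ d _), ← Phi_mul_swap κ c₀ d hi hj, mul_smul (Phi κ c₀ d), h,
    wPerm_phi_apply, wPerm_phi_apply, smul_comm (Phi κ c₀ d : Cherednik r n κ c₀ d) (yA _ _)]

/-- The pair of positions (n−1, n) comes from (1, 2) after two applications of Φ; after one
application it would come from the non-adjacent pair (n, 1). -/
theorem swapActs_phi_phi (hs : SimpleSpectrum κ c₀ d lam) {ν : Fin n → ℕ} {T : SYT lam} {i : Fin n}
    (hi : finRotate n i = lastIdx n)
    (h : SwapActs κ c₀ d ν T (finRotate n (finRotate n i)) (finRotate n (finRotate n (lastIdx n)))) :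
    SwapActs κ c₀ d (phi (phi ν)) T i (lastIdx n) := by
  obtain ⟨c, hc, e⟩ := exists_Phi_eq hs ν T
  obtain ⟨c', hc', e'⟩ := exists_Phi_eq hs (phi ν) T
  refine swapActs_of_smul_eq (m := (Phi κ c₀ d * Phi κ c₀ d : Cherednik r n κ c₀ d) •
    fElt κ c₀ d lam (ν, T)) (mul_ne_zero hc hc') ?_ ?_
  · rw [mul_smul (Phi κ c₀ d), e, smul_comm (Phi κ c₀ d : Cherednik r n κ c₀ d) c, e', smul_smul]
  · rw [← mul_smul (tH κ c₀ d _), ← Phi_sq_mul_swap κ c₀ d i hi, ← mul_assoc,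
      mul_smul (Phi κ c₀ d * Phi κ c₀ d), h]
    simp only [wPerm_phi_apply]
    rw [smul_comm (Phi κ c₀ d * Phi κ c₀ d : Cherednik r n κ c₀ d) (yA _ _)]

theorem swapActs_swap_of_disjoint (hs : SimpleSpectrum κ c₀ d lam) (hc₀ : c₀ ≠ 0) {ν : Fin n → ℕ}
    {T : SYT lam} {i j k l : Fin n} (hkl : (k : ℕ) + 1 = l) (hν : ν k < ν l)
    (hik : i ≠ k) (hil : i ≠ l) (hjk : j ≠ k) (hjl : j ≠ l) (h : SwapActs κ c₀ d ν T i j) :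
    SwapActs κ c₀ d (permComp (swap k l) ν) T i j := by
  obtain ⟨c, e⟩ := exists_sigma_eq_swap hs hc₀ T hkl hν.ne
  have hc : c ≠ 0 := by
    rintro rfl
    exact sigma_ne_zero_of_lt hs T hkl hν (e.trans (zero_smul _ _))
  refine swapActs_of_smul_eq hc e ?_
  have hcomm : swap i j * swap k l = swap k l * swap i j := by
    rw [Equiv.mul_swap_eq_swap_mul, Equiv.swap_apply_of_ne_of_ne hik.symm hjk.symm,
      Equiv.swap_apply_of_ne_of_ne hil.symm hjl.symm]
  rw [wPerm_swap hkl hν.ne, wPerm_swap hkl hν.ne, Equiv.swap_apply_of_ne_of_ne hik hil,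
    Equiv.swap_apply_of_ne_of_ne hjk hjl, sigma_fElt hs, smul_add, ← mul_smul (tH κ c₀ d _),
    ← map_mul, ← perm_mul, hcomm, perm_mul, map_mul, mul_smul (tH κ c₀ d _), h,
    smul_comm (tH κ c₀ d _) (yA _ _), smul_comm (tH κ c₀ d _) (sigmaCoef _ _ _ _ _ _ _ _), h, smul_add,
    smul_comm (sigmaCoef κ c₀ d lam ν T k l)]

/-- With b = c₀r/x and b′ = c₀r/y this is a(x − y) = c₀r divided by xy. If the characters differ,
both coefficients are zero. It supplies the hypothesis on b and b′ in `swap_smul_braid`. -/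
theorem sigmaCoef_relation (hs : SimpleSpectrum κ c₀ d lam) (hc₀ : c₀ ≠ 0) {ν ρ : Fin n → ℕ} {T : SYT lam}
    {i j k l : Fin n} (hij : (i : ℕ) + 1 = j) (hkl : (k : ℕ) + 1 = l) {a : ℂ}
    (hz : a * ((wtz κ c₀ d lam ρ T i - wtz κ c₀ d lam ρ T j) -
      (wtz κ c₀ d lam ν T k - wtz κ c₀ d lam ν T l)) = c₀ * r)
    (hd : SameChar lam ρ T i j ↔ SameChar lam ν T k l) :
    a * sigmaCoef κ c₀ d lam ρ T i j + sigmaCoef κ c₀ d lam ρ T i j * sigmaCoef κ c₀ d lam ν T k l =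
      a * sigmaCoef κ c₀ d lam ν T k l := by
  by_cases h : SameChar lam ν T k l
  · have h1 := sub_ne_zero.mpr (wtz_ne_of_sameChar hs hc₀ hkl h)
    have h2 := sub_ne_zero.mpr (wtz_ne_of_sameChar hs hc₀ hij (hd.mpr h))
    rw [sigmaCoef, sigmaCoef, if_pos h, if_pos (hd.mpr h)]
    generalize wtz κ c₀ d lam ρ T i - wtz κ c₀ d lam ρ T j = x at *
    generalize wtz κ c₀ d lam ν T k - wtz κ c₀ d lam ν T l = y at *
    field_simp
    linear_combination -(r : ℂ) * hz
  · rw [sigmaCoef, sigmaCoef, if_neg h, if_neg (fun h' => h (hd.mp h'))]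
    ring

/-- Up to a non-zero factor f_{μ,T} is obtained from f_{ρ,T} by two intertwiners, first at (i, j)
and then at (k, l). The braid relation carries the known action of s_{kl} on f_{ρ,T} to an action of
s_{ij} on f_{μ,T} by the same sign. -/
theorem swapActs_braid (hs : SimpleSpectrum κ c₀ d lam) (hc₀ : c₀ ≠ 0) {μ ν ρ : Fin n → ℕ} {T : SYT lam}
    {i j k l : Fin n} (h : IsStuck μ T i j) (hkl : (k : ℕ) + 1 = l) (hν : ν k < ν l) (hρ : ρ i < ρ j)
    (hμν : permComp (swap k l) ν = μ) (hνρ : permComp (swap i j) ρ = ν)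
    (hkl' : (swap k l (swap i j k) = i ∧ swap k l (swap i j l) = j))
    (hz : (wtz κ c₀ d lam ρ T i - wtz κ c₀ d lam ρ T j) -
      (wtz κ c₀ d lam ν T k - wtz κ c₀ d lam ν T l) =
        wtz κ c₀ d lam μ T j - wtz κ c₀ d lam μ T i)
    (hd : SameChar lam ρ T i j ↔ SameChar lam ν T k l)
    (hIH : tH κ c₀ d (perm (swap k l)) • fElt κ c₀ d lam (ρ, T) =
      yA (T.1 (wPerm μ j)) (T.1 (wPerm μ i)) • fElt κ c₀ d lam (ρ, T)) :
    SwapActs κ c₀ d μ T i j := by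
  obtain ⟨c, e⟩ := exists_sigma_eq_swap hs hc₀ T h.succ hρ.ne
  obtain ⟨c', e'⟩ := exists_sigma_eq_swap hs hc₀ T hkl hν.ne
  have hc : c ≠ 0 := by
    rintro rfl
    exact sigma_ne_zero_of_lt hs T h.succ hρ (e.trans (zero_smul _ _))
  have hc' : c' ≠ 0 := by
    rintro rfl
    exact sigma_ne_zero_of_lt hs T hkl hν (e'.trans (zero_smul _ _))
  rw [hνρ, sigma_fElt hs] at e
  rw [hμν, sigma_fElt hs] at e'
  refine swapActs_of_smul_eq (mul_ne_zero hc hc') rfl ?_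
  refine swap_smul_braid (p := tH κ c₀ d (perm (swap k l))) (g := c • fElt κ c₀ d lam (ν, T))
    (b := sigmaCoef κ c₀ d lam ρ T i j) (b' := sigmaCoef κ c₀ d lam ν T k l) ?_ (swap_mul_swap κ c₀ d i j)
    hIH h.yA_sq (sigmaCoef_relation hs hc₀ h.succ hkl (by rw [hz]; exact h.yA_mul κ c₀ d) hd) e ?_
  · rw [← map_mul, ← map_mul, ← map_mul, ← map_mul]
    congr 1
    rw [← perm_mul, ← perm_mul, ← perm_mul, ← perm_mul]
    congr 1
    -- Both sides of the braid relation are conjugates of a transposition, and `hkl'` says that they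
    -- are the same one.
    have h1 := Equiv.swap_apply_apply (swap i j) k l
    have h2 := Equiv.swap_apply_apply (swap k l) i j
    rw [Equiv.swap_inv] at h1 h2
    have h3 := congrArg (swap k l) hkl'.1
    have h4 := congrArg (swap k l) hkl'.2
    rw [Equiv.swap_apply_self] at h3 h4
    rw [← h1, ← h2, h3, h4]
  · rw [smul_comm (tH κ c₀ d _) c, smul_comm _ c, ← smul_add, e', smul_smul]

theorem exists_descent {μ : Fin n → ℕ} (h0 : μ ≠ 0) (h : μ (lastIdx n) = 0) :
    ∃ k l : Fin n, (k : ℕ) + 1 = l ∧ μ l < μ k := by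
  by_contra! H
  refine h0 ?_
  have h1 : ∀ m, ∀ k : Fin n, (k : ℕ) + m + 1 = n → μ k = 0 := by
    intro m
    induction m with
    | zero =>
      intro k hk
      have : k = lastIdx n := Fin.ext (by simp only [lastIdx]; omega)
      rw [this, h]
    | succ m ih =>
      intro k hk
      have h2 := H k ⟨k + 1, by omega⟩ rfl
      rw [ih ⟨k + 1, by omega⟩ (by simp only; omega)] at h2
      omega
  funext k
  exact h1 (n - 1 - k) k (by have := k.2; omega)

/-- On the positions i, j, l the parts are (a, a, b) with b < a. Moving b to the front gives the
smaller composition (b, a, a), whose equal parts sit at j and l with the same entries of T attached.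
-/
theorem swapActs_step_left (hs : SimpleSpectrum κ c₀ d lam) (hc₀ : c₀ ≠ 0) {μ : Fin n → ℕ} {T : SYT lam}
    {i j l : Fin n} (h : IsStuck μ T i j) (hl : (j : ℕ) + 1 = l) (hμ : μ l < μ j)
    (hIH : ∀ ρ : Fin n → ℕ, CompLT ρ μ → IsStuck ρ T j l → SwapActs κ c₀ d ρ T j l) :
    SwapActs κ c₀ d μ T i j := by
  have hij := h.succ
  have e1 : i ≠ j := fun e => by rw [e] at hij; omega
  have e2 : j ≠ l := fun e => by rw [e] at hl; omega
  have e3 : i ≠ l := fun e => by rw [e] at hij; omega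
  obtain ⟨ν, hν⟩ : ∃ ν, ν = permComp (swap j l) μ := ⟨_, rfl⟩
  obtain ⟨ρ, hρ⟩ : ∃ ρ, ρ = permComp (swap i j) ν := ⟨_, rfl⟩
  have v1 : ν i = μ i := by rw [hν, permComp_swap_apply, Equiv.swap_apply_of_ne_of_ne e1 e3]
  have v2 : ν j = μ l := by rw [hν, permComp_swap_apply, Equiv.swap_apply_left]
  have v3 : ν l = μ j := by rw [hν, permComp_swap_apply, Equiv.swap_apply_right]
  have w1 : ρ i = μ l := by rw [hρ, permComp_swap_apply, Equiv.swap_apply_left, v2]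
  have w2 : ρ j = μ i := by rw [hρ, permComp_swap_apply, Equiv.swap_apply_right, v1]
  have w3 : ρ l = μ j := by
    rw [hρ, permComp_swap_apply, Equiv.swap_apply_of_ne_of_ne e3.symm e2.symm, v3]
  have hνlt : ν j < ν i := by rw [v1, v2, h.eq]; exact hμ
  have l1 : CompLT ν μ := hν ▸ compLT_swap (by rw [Fin.lt_def]; omega) hμ
  have l2 : CompLT ρ ν := hρ ▸ compLT_swap (by rw [Fin.lt_def]; omega) hνlt
  have p2 : wPerm ρ j = wPerm μ i := by
    rw [hρ, wPerm_swap hij hνlt.ne', Equiv.swap_apply_right, hν, wPerm_swap hl hμ.ne',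
      Equiv.swap_apply_of_ne_of_ne e1 e3]
  have p3 : wPerm ρ l = wPerm μ j := by
    rw [hρ, wPerm_swap hij hνlt.ne', Equiv.swap_apply_of_ne_of_ne e3.symm e2.symm, hν,
      wPerm_swap hl hμ.ne', Equiv.swap_apply_right]
  have hact := hIH ρ (l2.trans l1) (h.congr hl p2 p3 (by rw [w2, w3, h.eq]))
  rw [SwapActs, p2, p3] at hact
  refine swapActs_braid (ν := ν) (ρ := ρ) hs hc₀ h hl (by rw [v2, v3]; exact hμ) (by rw [w1, w2, h.eq]; exact hμ)
    (by rw [hν, permComp_swap_swap]) (by rw [hρ, permComp_swap_swap]) ?_ ?_ ?_ hact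
  · rw [Equiv.swap_apply_right, Equiv.swap_apply_of_ne_of_ne e1 e3,
      Equiv.swap_apply_of_ne_of_ne e3.symm e2.symm, Equiv.swap_apply_right]
    exact ⟨rfl, rfl⟩
  · rw [hρ, wtz_swap hij hνlt.ne', wtz_swap hij hνlt.ne', Equiv.swap_apply_left,
      Equiv.swap_apply_right, hν, wtz_swap hl hμ.ne', wtz_swap hl hμ.ne', wtz_swap hl hμ.ne',
      Equiv.swap_apply_left, Equiv.swap_apply_right, Equiv.swap_apply_of_ne_of_ne e1 e3]
    ring
  · refine forall_congr' fun η => ?_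
    rw [hρ, wtd_swap hij hνlt.ne', wtd_swap hij hνlt.ne', Equiv.swap_apply_left,
      Equiv.swap_apply_right, hν, wtd_swap hl hμ.ne', wtd_swap hl hμ.ne', wtd_swap hl hμ.ne',
      Equiv.swap_apply_left, Equiv.swap_apply_right, Equiv.swap_apply_of_ne_of_ne e1 e3, h.wtd_eq]

/-- The mirror case: (b, a, a) with a < b on the positions k, i, j comes from the smaller
composition (a, a, b). -/
theorem swapActs_step_right (hs : SimpleSpectrum κ c₀ d lam) (hc₀ : c₀ ≠ 0) {μ : Fin n → ℕ}
    {T : SYT lam} {i j k : Fin n} (h : IsStuck μ T i j) (hk : (k : ℕ) + 1 = i) (hμ : μ i < μ k)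
    (hIH : ∀ ρ : Fin n → ℕ, CompLT ρ μ → IsStuck ρ T k i → SwapActs κ c₀ d ρ T k i) :
    SwapActs κ c₀ d μ T i j := by
  have hij := h.succ
  have e1 : i ≠ j := fun e => by rw [e] at hij; omega
  have e2 : k ≠ i := fun e => by rw [e] at hk; omega
  have e3 : k ≠ j := fun e => by rw [e] at hk; omega
  obtain ⟨ν, hν⟩ : ∃ ν, ν = permComp (swap k i) μ := ⟨_, rfl⟩
  obtain ⟨ρ, hρ⟩ : ∃ ρ, ρ = permComp (swap i j) ν := ⟨_, rfl⟩
  have v1 : ν k = μ i := by rw [hν, permComp_swap_apply, Equiv.swap_apply_left]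
  have v2 : ν i = μ k := by rw [hν, permComp_swap_apply, Equiv.swap_apply_right]
  have v3 : ν j = μ j := by
    rw [hν, permComp_swap_apply, Equiv.swap_apply_of_ne_of_ne e3.symm e1.symm]
  have w1 : ρ k = μ i := by rw [hρ, permComp_swap_apply, Equiv.swap_apply_of_ne_of_ne e2 e3, v1]
  have w2 : ρ i = μ j := by rw [hρ, permComp_swap_apply, Equiv.swap_apply_left, v3]
  have w3 : ρ j = μ k := by rw [hρ, permComp_swap_apply, Equiv.swap_apply_right, v2]
  have hνlt : ν j < ν i := by rw [v2, v3, ← h.eq]; exact hμ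
  have l1 : CompLT ν μ := hν ▸ compLT_swap (by rw [Fin.lt_def]; omega) hμ
  have l2 : CompLT ρ ν := hρ ▸ compLT_swap (by rw [Fin.lt_def]; omega) hνlt
  have p1 : wPerm ρ k = wPerm μ i := by
    rw [hρ, wPerm_swap hij hνlt.ne', Equiv.swap_apply_of_ne_of_ne e2 e3, hν,
      wPerm_swap hk hμ.ne', Equiv.swap_apply_left]
  have p2 : wPerm ρ i = wPerm μ j := by
    rw [hρ, wPerm_swap hij hνlt.ne', Equiv.swap_apply_left, hν, wPerm_swap hk hμ.ne',
      Equiv.swap_apply_of_ne_of_ne e3.symm e1.symm]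
  have hact := hIH ρ (l2.trans l1) (h.congr hk p1 p2 (by rw [w1, w2, h.eq]))
  rw [SwapActs, p1, p2] at hact
  refine swapActs_braid (ν := ν) (ρ := ρ) hs hc₀ h hk (by rw [v1, v2]; exact hμ) (by rw [w2, w3, ← h.eq]; exact hμ)
    (by rw [hν, permComp_swap_swap]) (by rw [hρ, permComp_swap_swap]) ?_ ?_ ?_ hact
  · rw [Equiv.swap_apply_of_ne_of_ne e2 e3, Equiv.swap_apply_left, Equiv.swap_apply_left,
      Equiv.swap_apply_of_ne_of_ne e3.symm e1.symm]
    exact ⟨rfl, rfl⟩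
  · rw [hρ, wtz_swap hij hνlt.ne', wtz_swap hij hνlt.ne', Equiv.swap_apply_left,
      Equiv.swap_apply_right, hν, wtz_swap hk hμ.ne', wtz_swap hk hμ.ne', wtz_swap hk hμ.ne',
      Equiv.swap_apply_left, Equiv.swap_apply_right, Equiv.swap_apply_of_ne_of_ne e3.symm e1.symm]
    ring
  · refine forall_congr' fun η => ?_
    rw [hρ, wtd_swap hij hνlt.ne', wtd_swap hij hνlt.ne', Equiv.swap_apply_left,
      Equiv.swap_apply_right, hν, wtd_swap hk hμ.ne', wtd_swap hk hμ.ne', wtd_swap hk hμ.ne',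
      Equiv.swap_apply_left, Equiv.swap_apply_right, Equiv.swap_apply_of_ne_of_ne e3.symm e1.symm,
      h.wtd_eq]

/-- A positive last part means that μ = φ.ν with ν of smaller degree, and Φ carries the statement
from ν to μ. -/
theorem swapActs_of_last_pos (hs : SimpleSpectrum κ c₀ d lam) {μ : Fin n → ℕ} {T : SYT lam}
    {i j : Fin n} (h : IsStuck μ T i j) (hlast : 0 < μ (lastIdx n))
    (hIH : ∀ ν : Fin n → ℕ, ∑ k, ν k < ∑ k, μ k → ∀ k l : Fin n, IsStuck ν T k l →
      SwapActs κ c₀ d ν T k l) : SwapActs κ c₀ d μ T i j := by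
  have hij := h.succ
  have hi : i ≠ lastIdx n := fun e => by
    have := le_lastIdx j
    rw [← e, Fin.le_def] at this
    omega
  obtain ⟨ν, rfl⟩ : ∃ ν, μ = phi ν := ⟨psi μ, (phi_psi hlast).symm⟩
  have hsum := sum_phi ν
  by_cases hj : j = lastIdx n
  -- The pair is (n−1, n), which ν no longer has in adjacent positions. As both parts of μ are
  -- positive, φ can be undone a second time.
  · have hci : finRotate n i = lastIdx n := Fin.ext (by rw [finRotate_val hi, hij, hj])
    have hne : (0 : Fin n) ≠ lastIdx n := fun e => by
      rw [← hj, Fin.ext_iff, Fin.val_zero] at e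
      omega
    subst hj
    have heq := h.eq
    rw [phi_apply_of_ne _ hi, hci, phi_apply_last] at heq
    obtain ⟨ρ, rfl⟩ : ∃ ρ, ν = phi ρ := ⟨psi ν, (phi_psi (by omega)).symm⟩
    have hsum' := sum_phi ρ
    rw [phi_apply_last, phi_apply_of_ne _ hne] at heq
    refine swapActs_phi_phi hs hci (hIH ρ (by omega) _ _ (h.congr ?_ ?_ ?_ ?_))
    · rw [hci, finRotate_lastIdx, finRotate_val hne]
    · rw [wPerm_phi_apply, wPerm_phi_apply]
    · rw [wPerm_phi_apply, wPerm_phi_apply]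
    · rw [hci, finRotate_lastIdx]
      omega
  · have heq := h.eq
    rw [phi_apply_of_ne _ hi, phi_apply_of_ne _ hj] at heq
    refine swapActs_phi hs hi hj (hIH ν (by omega) _ _ (h.congr ?_ ?_ ?_ heq))
    · rw [finRotate_val hi, finRotate_val hj, hij]
    · rw [wPerm_phi_apply]
    · rw [wPerm_phi_apply]

/-- The vertex has no tableau edge at i, so t_{s_i} f must be shown not to leave the line of f.
Outer induction on the degree, inner induction on `compRank`: a positive last part is handled by Φ,
and otherwise μ ≠ 0 has a descent whose removal leads to a smaller composition of the same degree.
-/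
theorem swapActs_of_isStuck (hs : SimpleSpectrum κ c₀ d lam) (hc₀ : c₀ ≠ 0) {μ : Fin n → ℕ} {T : SYT lam}
    {i j : Fin n} (h : IsStuck μ T i j) : SwapActs κ c₀ d μ T i j := by
  induction hN : ∑ k, μ k using Nat.strong_induction_on generalizing μ i j with
  | _ N ihN =>
  induction hR : compRank μ using Nat.strong_induction_on generalizing μ i j with
  | _ R ihR =>
  by_cases h0 : μ = 0
  · subst h0
    exact swapActs_zero hs h
  by_cases hlast : 0 < μ (lastIdx n)
  · exact swapActs_of_last_pos hs h hlast fun ν hν k l hkl => ihN _ (hN ▸ hν) hkl rfl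
  -- The descent meets the pair (i, j) in one position, which calls for the braid argument, or in
  -- none, where the intertwiner commutes with s_i. It is not the pair itself, whose parts are
  -- equal.
  obtain ⟨k, l, hkl, hlt⟩ := exists_descent h0 (by omega)
  have ih : ∀ ρ : Fin n → ℕ, CompLT ρ μ → ∀ {a b : Fin n}, IsStuck ρ T a b →
      SwapActs κ c₀ d ρ T a b := fun ρ hρ a b hab =>
    ihR _ (hR ▸ hρ.compRank_lt) hab (hρ.sum_eq.trans hN) rfl
  have hij := h.succ
  by_cases hkj : k = j
  · subst hkj
    exact swapActs_step_left hs hc₀ h hkl hlt fun ρ hρ => ih ρ hρ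
  by_cases hli : l = i
  · subst hli
    exact swapActs_step_right hs hc₀ h hkl hlt fun ρ hρ => ih ρ hρ
  have hik : i ≠ k := fun e => by
    subst e
    have : j = l := Fin.ext (by omega)
    subst this
    exact absurd h.eq hlt.ne'
  have hjl : j ≠ l := fun e => by
    subst e
    exact hik (Fin.ext (by omega))
  have h1 : CompLT (permComp (swap k l) μ) μ := compLT_swap (by rw [Fin.lt_def]; omega) hlt
  have h2 := swapActs_swap_of_disjoint hs hc₀ (ν := permComp (swap k l) μ) (T := T) (i := i) (j := j) hkl
    (by rw [permComp_swap_apply, permComp_swap_apply, Equiv.swap_apply_left, Equiv.swap_apply_right]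
        exact hlt) hik (Ne.symm hli) (Ne.symm hkj) hjl
    (ih _ h1 (h.congr hij
      (by rw [wPerm_swap hkl hlt.ne', Equiv.swap_apply_of_ne_of_ne hik (Ne.symm hli)])
      (by rw [wPerm_swap hkl hlt.ne', Equiv.swap_apply_of_ne_of_ne (Ne.symm hkj) hjl])
      (by rw [permComp_swap_apply, permComp_swap_apply,
            Equiv.swap_apply_of_ne_of_ne hik (Ne.symm hli),
            Equiv.swap_apply_of_ne_of_ne (Ne.symm hkj) hjl, h.eq])))
  rwa [permComp_swap_swap] at h2

end Equal

/-! ## Submodules and closed sets -/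

section Group

theorem W_induction {p : W r n → Prop} (hdg : ∀ i η, p (dg i η))
    (hswap : ∀ i j : Fin n, (i : ℕ) + 1 = j → p (perm (swap i j))) (one : p 1)
    (hmul : ∀ v w, p v → p w → p (v * w)) (w : W r n) : p w := by
  rw [eq_inl_mul_perm w]
  refine hmul _ _ ?_ ?_
  · let S : Submonoid (Fin n → rootsOfUnity r ℂ) :=
      { carrier := {a | p (SemidirectProduct.inl a)}
        one_mem' := by simpa using one
        mul_mem' := fun {a b} ha hb => by
          simp only [Set.mem_ofPred_eq, map_mul] at *
          exact hmul _ _ ha hb }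
    have h : w.left ∈ S := by
      rw [← Finset.univ_prod_mulSingle w.left]
      exact Submonoid.prod_mem S fun i _ => hdg i _
    exact h
  · induction w.right using adj_induction with
    | one => rw [perm_one]; exact one
    | mul v i hi hv =>
      rw [perm_mul, adj_eq hi]
      exact hmul _ _ hv (hswap _ _ rfl)

end Group

section Main

variable {κ c₀ : ℂ} {d : ZMod r → ℂ} {lam : MultiPartition r n} [NeZero n]

/-- Equal weights make f_{ν,S} a multiple of f_{μ,T}. Its leading coefficient 1 must then come from
a term of f_{μ,T} other than the leading one, hence from a lower term. By symmetry this cannot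
happen for two different vertices. -/
theorem compLT_of_weight_eq (hs : SimpleSpectrum κ c₀ d lam) {μ ν : Fin n → ℕ} {T S : SYT lam}
    (h : weight κ c₀ d lam μ T = weight κ c₀ d lam ν S) (hne : (μ, T) ≠ (ν, S)) : CompLT ν μ := by
  by_contra hlt
  obtain ⟨c, hc⟩ := exists_eq_smul_fElt hs (μ := μ) (T := T) (m := fElt κ c₀ d lam (ν, S))
    (fun i => by rw [z_smul_fElt hs, ← weight_z, ← weight_z, h])
    (fun i η => by rw [dg_smul_fElt hs, ← weight_dg κ c₀ d, ← weight_dg κ c₀ d, h])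
  have h1 := (isF_fElt hs ν S).lcoord_eq_one
  have h2 := lcoord_low κ c₀ d lam (p := (ν, S)) hlt (fElt_sub_leading_mem hs μ T)
  rw [map_sub (lcoord κ c₀ d lam (ν, S)), lcoord_leading, if_neg hne, sub_zero] at h2
  rw [hc, lcoord_smul', h2, mul_zero] at h1
  exact zero_ne_one h1

theorem exists_weight_ne (hs : SimpleSpectrum κ c₀ d lam) {p q : (Fin n → ℕ) × SYT lam} (hne : p ≠ q) :
    ∃ (a : Cherednik r n κ c₀ d) (e : (Fin n → ℕ) × SYT lam → ℂ),
      (∀ i, a • fElt κ c₀ d lam i = e i • fElt κ c₀ d lam i) ∧ e p ≠ e q := by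
  obtain ⟨μ, T⟩ := p
  obtain ⟨ν, S⟩ := q
  by_contra! H
  have h : weight κ c₀ d lam μ T = weight κ c₀ d lam ν S := by
    ext a
    exact H a (fun i => weight κ c₀ d lam i.1 i.2 a) fun i => tAlg_smul_fElt hs i.1 i.2 a
  exact (compLT_of_weight_eq hs h hne).asymm (compLT_of_weight_eq hs h.symm hne.symm)

theorem span_range_fElt (hs : SimpleSpectrum κ c₀ d lam) :
    Submodule.span ℂ (Set.range (fElt κ c₀ d lam)) = ⊤ := by
  have h : ∀ (μ : Fin n → ℕ) (T : SYT lam),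
      leading κ c₀ d lam μ T ∈ Submodule.span ℂ (Set.range (fElt κ c₀ d lam)) := by
    intro μ T
    induction hR : compRank μ using Nat.strong_induction_on generalizing μ T with
    | _ R ih =>
    have h1 := (isF_fElt hs μ T).2
    have h2 : Submodule.span ℂ {m | ∃ (ν : Fin n → ℕ) (S : SYT lam), CompLT ν μ ∧
        m = leading κ c₀ d lam ν S} ≤ Submodule.span ℂ (Set.range (fElt κ c₀ d lam)) := by
      refine Submodule.span_le.mpr ?_
      rintro _ ⟨ν, S, hν, rfl⟩
      exact ih _ (hR ▸ hν.compRank_lt) ν S rfl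
    have h3 := sub_mem (Submodule.subset_span (s := Set.range (fElt κ c₀ d lam)) ⟨(μ, T), rfl⟩) (h2 h1)
    rwa [sub_sub_cancel] at h3
  rw [eq_top_iff, ← (leadingBasis κ c₀ d lam).span_eq, Submodule.span_le]
  rintro _ ⟨p, rfl⟩
  rw [leadingBasis_apply]
  exact h p.1 p.2

theorem linearIndependent_fElt (hs : SimpleSpectrum κ c₀ d lam) :
    LinearIndependent ℂ (fElt κ c₀ d lam) := by
  rw [linearIndependent_iff']
  intro s c h p hp
  have h1 := smul_mem_of_sum_mem (⊥ : Submodule (Cherednik r n κ c₀ d) (Verma κ c₀ d lam))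
    (fun p q => exists_weight_ne hs) s c (by rw [h]; exact zero_mem _) p hp
  rw [Submodule.mem_bot, smul_eq_zero] at h1
  exact h1.resolve_right (fElt_ne_zero hs p.1 p.2)

/-- Distinct weights: a submodule contains the components of its elements along the f_{μ,T}. A
submodule is therefore determined by its set of vertices. -/
theorem mem_span_of_mem (hs : SimpleSpectrum κ c₀ d lam)
    (N : Submodule (Cherednik r n κ c₀ d) (Verma κ c₀ d lam)) {m : Verma κ c₀ d lam} (hm : m ∈ N) :
    m ∈ Submodule.span ℂ (fElt κ c₀ d lam '' {p | fElt κ c₀ d lam p ∈ N}) := by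
  have h : m ∈ Submodule.span ℂ (Set.range (fElt κ c₀ d lam)) := by rw [span_range_fElt hs]; trivial
  obtain ⟨c, rfl⟩ := (Finsupp.mem_span_range_iff_exists_finsupp).mp h
  have h1 := smul_mem_of_sum_mem N (fun p q => exists_weight_ne hs) c.support c hm
  refine sum_mem fun p hp => Submodule.smul_mem _ _ (Submodule.subset_span ⟨p, ?_, rfl⟩)
  have h2 := N.smul_of_tower_mem (c p)⁻¹ (h1 p hp)
  rwa [inv_smul_smul₀ (Finsupp.mem_support_iff.mp hp)] at h2

theorem span_le_of_subset (N : Submodule (Cherednik r n κ c₀ d) (Verma κ c₀ d lam)) {m : Verma κ c₀ d lam}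
    {A : Set ((Fin n → ℕ) × SYT lam)} (hA : ∀ p ∈ A, fElt κ c₀ d lam p ∈ N)
    (hm : m ∈ Submodule.span ℂ (fElt κ c₀ d lam '' A)) : m ∈ N := by
  induction hm using Submodule.span_induction with
  | mem x hx => obtain ⟨p, hp, rfl⟩ := hx; exact hA p hp
  | zero => exact zero_mem _
  | add x y _ _ hx hy => exact add_mem hx hy
  | smul c x _ hx => exact N.smul_of_tower_mem c hx

theorem mem_of_smul_mem {M : Type*} [AddCommGroup M] [Module ℂ M] [Module (Cherednik r n κ c₀ d) M]
    [IsScalarTower ℂ (Cherednik r n κ c₀ d) M]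
    (N : Submodule (Cherednik r n κ c₀ d) M) {c : ℂ} (hc : c ≠ 0) {m : M} (h : c • m ∈ N) : m ∈ N := by
  have h2 := N.smul_of_tower_mem c⁻¹ h
  rwa [inv_smul_smul₀ hc] at h2

/-- Along an edge some element of ℍ, or σ_i, sends f at the source to a non-zero multiple of f at
the target: automatically for φ and tableau edges, by the condition on the edge for the others. -/
theorem isClosedSet_of_submodule (hs : SimpleSpectrum κ c₀ d lam) (hc₀ : c₀ ≠ 0)
    (N : Submodule (Cherednik r n κ c₀ d) (Verma κ c₀ d lam)) :
    IsClosedSet κ c₀ d lam {p | fElt κ c₀ d lam p ∈ N} := by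
  have hσ : ∀ (μ : Fin n → ℕ) (T : SYT lam) (i j : Fin n), fElt κ c₀ d lam (μ, T) ∈ N →
      sigma κ c₀ d lam i j (fElt κ c₀ d lam (μ, T)) ∈ N := fun μ T i j h => by
    rw [sigma_fElt hs]
    exact add_mem (N.smul_mem _ h) (N.smul_of_tower_mem _ h)
  intro p q hp hpq
  simp only [Set.mem_ofPred_eq] at hp ⊢
  cases hpq with
  | swap μ T i j hij hμ h =>
    obtain ⟨c, e⟩ := exists_sigma_eq_swap hs hc₀ T hij hμ
    refine mem_of_smul_mem N (c := c) ?_ (e ▸ hσ μ T i j hp)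
    rintro rfl
    exact h (e.trans (zero_smul _ _))
  | tableau μ T i j k hij hμ hk hT =>
    -- The entry j − 1 in the definition of a tableau edge is w_μ(i+1).
    have hk' : k = wPerm μ j := Fin.ext (by have := wPerm_succ_of_eq hij hμ; omega)
    subst hk'
    obtain ⟨c, hc, e⟩ := exists_sigma_eq_tableau hs hc₀ T hij hμ hT
    exact mem_of_smul_mem N hc (e ▸ hσ μ T i j hp)
  | phi μ T =>
    obtain ⟨c, hc, e⟩ := exists_Phi_eq hs μ T
    exact mem_of_smul_mem N hc (e ▸ N.smul_mem _ hp)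
  | psi μ T hμ h =>
    obtain ⟨c, e⟩ := exists_Psi_eq hs T hμ
    refine mem_of_smul_mem N (c := c) ?_ (e ▸ N.smul_mem _ hp)
    rintro rfl
    exact h (e.trans (zero_smul _ _))

variable (κ c₀ d lam) in
/-- The span of the eigenfunctions attached to a set of vertices. -/
noncomputable def fSpan (A : Set ((Fin n → ℕ) × SYT lam)) : Submodule ℂ (Verma κ c₀ d lam) :=
  Submodule.span ℂ (fElt κ c₀ d lam '' A)

theorem fElt_mem_fSpan {A : Set ((Fin n → ℕ) × SYT lam)} {p : (Fin n → ℕ) × SYT lam} (hp : p ∈ A) :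
    fElt κ c₀ d lam p ∈ fSpan κ c₀ d lam A := Submodule.subset_span ⟨p, hp, rfl⟩

theorem smul_mem_fSpan {A : Set ((Fin n → ℕ) × SYT lam)} {a : Cherednik r n κ c₀ d}
    (h : ∀ (μ : Fin n → ℕ) (T : SYT lam), (μ, T) ∈ A → a • fElt κ c₀ d lam (μ, T) ∈ fSpan κ c₀ d lam A)
    {m : Verma κ c₀ d lam} (hm : m ∈ fSpan κ c₀ d lam A) : a • m ∈ fSpan κ c₀ d lam A := by
  unfold fSpan at hm
  induction hm using Submodule.span_induction with
  | mem x hx => obtain ⟨p, hp, rfl⟩ := hx; exact h p.1 p.2 hp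
  | zero => rw [smul_zero]; exact zero_mem _
  | add x y _ _ hx hy => rw [smul_add]; exact add_mem hx hy
  | smul c x _ hx => rw [smul_comm]; exact Submodule.smul_mem _ _ hx

theorem smul_fElt_mem_fSpan_of_eq {A : Set ((Fin n → ℕ) × SYT lam)} {m : Verma κ c₀ d lam} {c : ℂ}
    {p : (Fin n → ℕ) × SYT lam} (e : m = c • fElt κ c₀ d lam p) (h : m ≠ 0 → p ∈ A) :
    m ∈ fSpan κ c₀ d lam A := by
  by_cases hm : m = 0
  · rw [hm]; exact zero_mem _
  · rw [e]; exact Submodule.smul_mem _ _ (fElt_mem_fSpan (h hm))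

/-- t_{s_i} f differs from σ_i f by a multiple of f, and σ_i f is zero or belongs to the target of
an edge. The exception is a stuck vertex, where t_{s_i} f is itself a multiple of f. -/
theorem swap_smul_mem_fSpan (hs : SimpleSpectrum κ c₀ d lam) (hc₀ : c₀ ≠ 0)
    {A : Set ((Fin n → ℕ) × SYT lam)} (hA : IsClosedSet κ c₀ d lam A) {i j : Fin n} (hij : (i : ℕ) + 1 = j)
    {m : Verma κ c₀ d lam} (hm : m ∈ fSpan κ c₀ d lam A) :
    tH κ c₀ d (perm (swap i j)) • m ∈ fSpan κ c₀ d lam A := by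
  refine smul_mem_fSpan (fun μ T hp => ?_) hm
  suffices h : (∃ c : ℂ, tH κ c₀ d (perm (swap i j)) • fElt κ c₀ d lam (μ, T) =
      c • fElt κ c₀ d lam (μ, T)) ∨
      sigma κ c₀ d lam i j (fElt κ c₀ d lam (μ, T)) ∈ fSpan κ c₀ d lam A by
    rcases h with ⟨c, e⟩ | h
    · rw [e]
      exact Submodule.smul_mem _ _ (fElt_mem_fSpan hp)
    · rw [sigma_fElt hs] at h
      have h2 := sub_mem h (Submodule.smul_mem _ (sigmaCoef κ c₀ d lam μ T i j)
        (fElt_mem_fSpan (κ := κ) (c₀ := c₀) (d := d) hp))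
      rwa [add_sub_cancel_right] at h2
  by_cases hμ : μ i = μ j
  · by_cases hT : IsStandard (swapT (wPerm μ j) (wPerm μ i) T.1)
    · obtain ⟨c, hc, e⟩ := exists_sigma_eq_tableau hs hc₀ T hij hμ hT
      exact Or.inr (smul_fElt_mem_fSpan_of_eq e fun _ =>
        hA _ _ hp (Edge.tableau μ T i j _ hij hμ (wPerm_succ_of_eq hij hμ) hT))
    · exact Or.inl ⟨_, swapActs_of_isStuck hs hc₀ ⟨hij, hμ, hT⟩⟩
  · obtain ⟨c, e⟩ := exists_sigma_eq_swap hs hc₀ T hij hμ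
    exact Or.inr (smul_fElt_mem_fSpan_of_eq e fun h => hA _ _ hp (Edge.swap μ T i j hij hμ h))

theorem tH_smul_mem_fSpan (hs : SimpleSpectrum κ c₀ d lam) (hc₀ : c₀ ≠ 0)
    {A : Set ((Fin n → ℕ) × SYT lam)} (hA : IsClosedSet κ c₀ d lam A) (w : W r n) :
    ∀ m ∈ fSpan κ c₀ d lam A, tH κ c₀ d w • m ∈ fSpan κ c₀ d lam A := by
  induction w using W_induction with
  | hdg i η =>
    intro m hm
    refine smul_mem_fSpan (fun μ T hp => ?_) hm
    rw [dg_smul_fElt hs]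
    exact Submodule.smul_mem _ _ (fElt_mem_fSpan hp)
  | hswap i j hij => exact fun m hm => swap_smul_mem_fSpan hs hc₀ hA hij hm
  | one => intro m hm; rwa [map_one, one_smul]
  | hmul v w hv hw => intro m hm; rw [map_mul, mul_smul]; exact hv _ (hw _ hm)

theorem Phi_smul_mem_fSpan (hs : SimpleSpectrum κ c₀ d lam)
    {A : Set ((Fin n → ℕ) × SYT lam)} (hA : IsClosedSet κ c₀ d lam A) {m : Verma κ c₀ d lam}
    (hm : m ∈ fSpan κ c₀ d lam A) :
    (Phi κ c₀ d : Cherednik r n κ c₀ d) • m ∈ fSpan κ c₀ d lam A := by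
  refine smul_mem_fSpan (fun μ T hp => ?_) hm
  obtain ⟨c, -, e⟩ := exists_Phi_eq hs μ T
  exact smul_fElt_mem_fSpan_of_eq e fun _ => hA _ _ hp (Edge.phi μ T)

theorem Psi_smul_mem_fSpan (hs : SimpleSpectrum κ c₀ d lam)
    {A : Set ((Fin n → ℕ) × SYT lam)} (hA : IsClosedSet κ c₀ d lam A) {m : Verma κ c₀ d lam}
    (hm : m ∈ fSpan κ c₀ d lam A) :
    (Psi κ c₀ d : Cherednik r n κ c₀ d) • m ∈ fSpan κ c₀ d lam A := by
  refine smul_mem_fSpan (fun μ T hp => ?_) hm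
  rcases Nat.eq_zero_or_pos (μ (lastIdx n)) with h0 | h0
  · rw [Psi_smul_fElt_eq_zero hs T h0]
    exact zero_mem _
  · obtain ⟨c, e⟩ := exists_Psi_eq hs T h0
    exact smul_fElt_mem_fSpan_of_eq e fun h => hA _ _ hp (Edge.psi μ T h0 h)

/-- With `Y_eq` this shows that ℍ is generated by the t_w together with Φ and Ψ, so stability of a
span needs to be checked only for these. -/
theorem X_eq (i : Fin n) : X κ c₀ d i = tH κ c₀ d (perm (swap i (lastIdx n))) * (Phi κ c₀ d *
    (tH κ c₀ d (perm (finRotate n)) * tH κ c₀ d (perm (swap i (lastIdx n))))) := by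
  have h1 : Phi κ c₀ d * (tH κ c₀ d (perm (finRotate n)) * tH κ c₀ d (perm (swap i (lastIdx n)))) =
      X κ c₀ d (lastIdx n) * tH κ c₀ d (perm (swap i (lastIdx n))) := by
    rw [Phi, mul_assoc, ← mul_assoc (tH κ c₀ d (perm (finRotate n)⁻¹)), perm_inv_mul_perm, one_mul]
  rw [h1, ← mul_assoc, perm_mul_X, Equiv.swap_apply_right, mul_assoc, swap_mul_swap, mul_one]

theorem Y_eq (i : Fin n) : Y κ c₀ d i = tH κ c₀ d (perm (swap i 0)) * (Psi κ c₀ d *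
    (tH κ c₀ d (perm (finRotate n)⁻¹) * tH κ c₀ d (perm (swap i 0)))) := by
  have h1 : Psi κ c₀ d * (tH κ c₀ d (perm (finRotate n)⁻¹) * tH κ c₀ d (perm (swap i 0))) =
      Y κ c₀ d 0 * tH κ c₀ d (perm (swap i 0)) := by
    rw [Psi, ← tH_apply, mul_assoc, ← mul_assoc (tH κ c₀ d (perm (finRotate n))), perm_mul_perm_inv,
      one_mul]
  rw [h1, ← mul_assoc, perm_mul_Y, Equiv.swap_apply_right, mul_assoc, swap_mul_swap, mul_one]

/-- The `ℍ`-submodule attached to a closed set of vertices. -/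
noncomputable def closedSubmodule (hs : SimpleSpectrum κ c₀ d lam) (hc₀ : c₀ ≠ 0)
    {A : Set ((Fin n → ℕ) × SYT lam)} (hA : IsClosedSet κ c₀ d lam A) :
    Submodule (Cherednik r n κ c₀ d) (Verma κ c₀ d lam) where
  __ := (fSpan κ c₀ d lam A).toAddSubmonoid
  smul_mem' := by
    intro a m hm
    have hm' : m ∈ fSpan κ c₀ d lam A := hm
    suffices h : ∀ m ∈ fSpan κ c₀ d lam A, a • m ∈ fSpan κ c₀ d lam A from h m hm'
    have ht := tH_smul_mem_fSpan hs hc₀ hA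
    induction a using cherednik_induction with
    | hc a => intro m hm; rw [algebraMap_smul]; exact Submodule.smul_mem _ _ hm
    | hX i =>
      intro m hm
      rw [X_eq, mul_smul (tH κ c₀ d _), mul_smul (Phi κ c₀ d), mul_smul (tH κ c₀ d _)]
      exact ht _ _ (Phi_smul_mem_fSpan hs hA (ht _ _ (ht _ _ hm)))
    | hY i =>
      intro m hm
      rw [Y_eq, mul_smul (tH κ c₀ d _), mul_smul (Psi κ c₀ d), mul_smul (tH κ c₀ d _)]
      exact ht _ _ (Psi_smul_mem_fSpan hs hA (ht _ _ (ht _ _ hm)))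
    | ht w => exact ht w
    | hadd a b ha hb => intro m hm; rw [add_smul a b m]; exact add_mem (ha m hm) (hb m hm)
    | hmul a b ha hb => intro m hm; rw [mul_smul a b m]; exact ha _ (hb m hm)

theorem fElt_mem_closedSubmodule (hs : SimpleSpectrum κ c₀ d lam) (hc₀ : c₀ ≠ 0)
    {A : Set ((Fin n → ℕ) × SYT lam)} (hA : IsClosedSet κ c₀ d lam A) (p : (Fin n → ℕ) × SYT lam) :
    fElt κ c₀ d lam p ∈ closedSubmodule hs hc₀ hA ↔ p ∈ A := by
  refine ⟨fun h => ?_, fun h => fElt_mem_fSpan h⟩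
  by_contra hp
  exact (linearIndependent_fElt hs).notMem_span_image hp h

/-- Injectivity holds because a submodule is spanned by its eigenvectors. For surjectivity the span
of a closed set is a submodule, and linear independence keeps any further f_{μ,T} out of it. -/
theorem bijOn_closedSets (hs : SimpleSpectrum κ c₀ d lam) (hc₀ : c₀ ≠ 0) :
    Set.BijOn (fun N : Submodule (Cherednik r n κ c₀ d) (Verma κ c₀ d lam) =>
      {p : (Fin n → ℕ) × SYT lam | fElt κ c₀ d lam p ∈ N})
      Set.univ {A | IsClosedSet κ c₀ d lam A} := by
  refine ⟨fun N _ => isClosedSet_of_submodule hs hc₀ N, fun N _ N' _ h => ?_, fun A hA => ?_⟩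
  · have h' : ∀ p, fElt κ c₀ d lam p ∈ N ↔ fElt κ c₀ d lam p ∈ N' := Set.ext_iff.mp h
    refine le_antisymm (fun m hm => ?_) fun m hm => ?_
    · exact span_le_of_subset N' (fun p hp => (h' p).mp hp) (mem_span_of_mem hs N hm)
    · exact span_le_of_subset N (fun p hp => (h' p).mpr hp) (mem_span_of_mem hs N' hm)
  · exact ⟨closedSubmodule hs hc₀ hA, trivial, Set.ext fun p => fElt_mem_closedSubmodule hs hc₀ hA p⟩

end Main

end

end RCA

theorem mainTheorem6 (r n : ℕ) [NeZero r] [NeZero n] (c₀ : ℂ) (hc₀ : c₀ ≠ 0)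
    (d : ZMod r → ℂ) (hd : ∑ j, d j = 0) (lam : RCA.MultiPartition r n)
    (hsimple : RCA.SimpleSpectrum 1 c₀ d lam) :
    (∀ (μ : Fin n → ℕ) (T : RCA.SYT lam), ∃! f, RCA.IsF 1 c₀ d lam μ T f) ∧
    Set.BijOn
      (fun N : Submodule (RCA.Cherednik r n 1 c₀ d) (RCA.Verma 1 c₀ d lam) =>
        {p : (Fin n → ℕ) × RCA.SYT lam | RCA.fElt 1 c₀ d lam p ∈ N})
      Set.univ {A | RCA.IsClosedSet 1 c₀ d lam A} :=
  ⟨fun μ T => RCA.existsUnique_isF hsimple μ T, RCA.bijOn_closedSets hsimple hc₀⟩
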